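/- Let $n>1$, let $\lambda,\mu\in\mathbb R$, put $\delta=\mu-\lambda$, and assume $\delta\neq\frac{n+3}{n+1},\frac{n+4}{n+1},\frac{n+5}{n+1}$. For a smooth (Hausdorff) $n$-manifold $M$ let $\mathcal F_\lambda(M)$ be the space of smooth $\lambda$-densities (components change by $|\det(\partial y/\partial x)|^{-\lambda}$), $\mathcal D^3_{\lambda,\mu}(M)$ the space of linear differential operators $\mathcal F_\lambda(M)\to\mathcal F_\mu(M)$ of order at most $3$ with smooth coefficients, and $\mathrm{Pol}^3_\delta(T^*M)$ the space of smooth symmetric contravariant tensor fields $P^{ijk}$ of degree $3$ with values in $\delta$-densities. Let $\nabla$ be a smooth affine connection on $M$, with Christoffel symbols $\nabla_{\partial_i}\partial_j=\Gamma^k_{ij}\partial_k$, extended to tensor fields with values in densities (on $w$-densities, $\nabla_i\phi=\partial_i\phi-w\,\Gamma^m_{im}\phi$), and let $$R_{ij}=\partial_i\Gamma^k_{kj}-\partial_k\Gamma^k_{ij}+\Gamma^k_{im}\Gamma^m_{kj}-\Gamma^k_{km}\Gamma^m_{ij}$$ be its Ricci tensor (in this sign convention the Ricci tensor of a round sphere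 is negative definite). Then $$\begin{aligned}P^{ijk}\mapsto{}& P^{ijk}\nabla_i\nabla_j\nabla_k+\alpha\,\nabla_kP^{ijk}\,\nabla_i\nabla_j+\left(\beta_1\nabla_i\nabla_jP^{ijk}+\beta_2P^{ijk}R_{ij}\right)\nabla_k\\&+\left(\eta_1\nabla_i\nabla_j\nabla_kP^{ijk}+\eta_2R_{ij}\nabla_kP^{ijk}+\eta_3\nabla_iR_{jk}\,P^{ijk}\right),\end{aligned}$$ with $$\alpha=\frac{6+3\lambda(1+n)}{4+(1-\delta)(1+n)},\qquad \beta_1=\frac{1+\lambda(n+1)}{3+(1-\delta)(1+n)}\,\alpha,\qquad \beta_2=\frac{2+3\lambda(1+n)-(4+(1-\delta)(1+n))\beta_1}{n-1},$$ $$\eta_1=\frac{\lambda(1+n)}{6+3(1-\delta)(1+n)}\,\beta_1,\qquad \eta_2=\frac{\lambda(1+n)\alpha-(10+3(1-\delta)(1+n))\eta_1}{n-1},\qquad \eta_3=\frac{\lambda(1+n)-\eta_1(4+(1-\delta)(1+n))}{n-1},$$ defines a quantization map $Q^\nabla:\mathrm{Pol}^3_\delta(T^*M)\to\mathcal D^3_{\lambda,\mu}(M)$,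 i.e. a well-defined linear map such that $Q^\nabla(P)$ has principal symbol $P$. Moreover: (i) It depends only on the projective class: if $\nabla,\tilde\nabla$ are smooth torsion-free connections that are projectively equivalent, i.e. $\tilde\Gamma^k_{ij}=\Gamma^k_{ij}+\delta^k_i\omega_j+\delta^k_j\omega_i$ for some 1-form $\omega$, then $Q^{\tilde\nabla}=Q^\nabla$. (ii) Let $M=\mathbb R^n$ carry the flat projective structure given by a global coordinate system $(x^1,\dots,x^n)$ (the projective class of the connection whose Christoffel symbols vanish in these coordinates), and let $\nabla$ be a smooth torsion-free connection in this class. Then $Q^\nabla$ is the unique linear map $T:\mathrm{Pol}^3_\delta(T^*\mathbb R^n)\to\mathcal D^3_{\lambda,\mu}(\mathbb R^n)$ that preserves principal symbols and is equivariant under the Lie algebra $\mathrm{sl}_{n+1}(\mathbb R)\subset\mathrm{Vect}(\mathbb R^n)$ spanned by the fields $\partial_i$, $x^i\partial_j$ and $x^i\sum_jx^j\partial_j$, i.e. $T(L_XP)=L_X\circ T(P)-T(P)\circ L_X$ for all $X$ in it. -/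

import Mathlib

open scoped Manifold ContDiff
open IsManifold

universe u

noncomputable section

namespace ProjQuant

/-! ## Coordinates -/

/-- The model space `ℝⁿ`. -/
abbrev Coord (n : ℕ) : Type := EuclideanSpace ℝ (Fin n)

/-- The `i`-th vector of the standard basis of `ℝⁿ`. -/
def stdVec {n : ℕ} (i : Fin n) : Coord n := EuclideanSpace.single i (1 : ℝ)

/-- The partial derivative `∂_i f`. -/
def pderiv {n : ℕ} (i : Fin n) (f : Coord n → ℝ) (x : Coord n) : ℝ :=
  fderiv ℝ f x (stdVec i)

/-- The local coordinate systems of the smooth manifold `M`: all charts of its maximal smooth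
atlas. -/
abbrev SmoothChart (n : ℕ) (M : Type*) [TopologicalSpace M] [ChartedSpace (Coord n) M] : Type _ :=
  {c : OpenPartialHomeomorph M (Coord n) // c ∈ maximalAtlas (𝓡 n) ∞ M}

/-- The Jacobian matrix `∂y^i/∂x^a` at `x`, where `x` are the coordinates of `c` and `y` those
of `c'`. -/
def jacobian {n : ℕ} {M : Type*} [TopologicalSpace M]
    (c c' : OpenPartialHomeomorph M (Coord n)) (x : Coord n) : Matrix (Fin n) (Fin n) ℝ :=
  Matrix.of fun i a => pderiv a (fun z => c' (c.symm z) i) x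

/-! ## Symbols and densities -/

/-- The law by which the components of a contravariant `k`-tensor field with values in
`δ`-densities change from the coordinates `x` of `c` to the coordinates `y` of `c'`:
`P'^{i₁…i_k} = |det (∂y/∂x)|^{-δ} ∂y^{i₁}/∂x^{a₁} ⋯ ∂y^{i_k}/∂x^{a_k} P^{a₁…a_k}`. -/
def transformed {n k : ℕ} {M : Type*} [TopologicalSpace M] (δ : ℝ)
    (c c' : OpenPartialHomeomorph M (Coord n)) (f : (Fin k → Fin n) → Coord n → ℝ)
    (I : Fin k → Fin n) (x : Coord n) : ℝ :=
  |(jacobian c c' x).det| ^ (-δ) *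
    ∑ K : Fin k → Fin n, (∏ s, jacobian c c' x (I s) (K s)) * f K x

/-- `Pol^k_δ(T*M)`: the smooth symmetric contravariant tensor fields of degree `k` with values in
the `δ`-densities, given by their components `P c I` in every chart `c`. Components are functions
on the range of the chart; they are extended by `0` so that equality means equality of fields. -/
def Pol (n : ℕ) (M : Type*) [TopologicalSpace M] [ChartedSpace (Coord n) M] (k : ℕ) (δ : ℝ) :
    Submodule ℝ (SmoothChart n M → (Fin k → Fin n) → Coord n → ℝ) where
  carrier := {P |
    (∀ c I, ContDiffOn ℝ ∞ (P c I) c.1.target) ∧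
    (∀ c I, ∀ x ∉ c.1.target, P c I x = 0) ∧
    (∀ c I, ∀ σ : Equiv.Perm (Fin k), P c (I ∘ σ) = P c I) ∧
    (∀ c c' : SmoothChart n M, ∀ p ∈ c.1.source ∩ c'.1.source, ∀ I,
      P c' I (c'.1 p) = transformed δ c.1 c'.1 (P c) I (c.1 p))}
  zero_mem' := by
    refine ⟨fun c I => contDiffOn_const, fun c I x _ => rfl, fun c I σ => rfl, ?_⟩
    intro c c' p _ I
    simp [transformed]
  add_mem' := by
    rintro P P' ⟨h1, h2, h3, h4⟩ ⟨h1', h2', h3', h4'⟩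
    refine ⟨fun c I => (h1 c I).add (h1' c I), fun c I x hx => ?_, fun c I σ => ?_, ?_⟩
    · simp [h2 c I x hx, h2' c I x hx]
    · simp [h3 c I σ, h3' c I σ]
    · intro c c' p hp I
      simp only [Pi.add_apply, h4 c c' p hp I, h4' c c' p hp I, transformed]
      rw [← mul_add, ← Finset.sum_add_distrib]
      simp only [mul_add]
  smul_mem' := by
    rintro r P ⟨h1, h2, h3, h4⟩
    refine ⟨fun c I => contDiffOn_const (c := r) |>.mul (h1 c I), fun c I x hx => ?_, fun c I σ => ?_, ?_⟩
    · simp [h2 c I x hx]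
    · simp [h3 c I σ]
    · intro c c' p hp I
      simp only [Pi.smul_apply, smul_eq_mul, h4 c c' p hp I, transformed]
      rw [mul_left_comm, Finset.mul_sum]
      simp only [mul_left_comm]

/-- `𝓕_λ(M)`: the smooth `λ`-densities on `M`, whose component changes by `|det (∂y/∂x)|^{-λ}`. -/
abbrev Density (n : ℕ) (M : Type*) [TopologicalSpace M] [ChartedSpace (Coord n) M] (lam : ℝ) :=
  Pol n M 0 lam

/-- The component of a density in the chart `c`. -/
def densityComp {n : ℕ} {M : Type*} [TopologicalSpace M] [ChartedSpace (Coord n) M] {lam : ℝ}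
    (φ : Density n M lam) (c : SmoothChart n M) : Coord n → ℝ :=
  φ.1 c ![]

/-! ## Differential operators -/

section DiffOp

variable {n : ℕ} {M : Type*} [TopologicalSpace M] [ChartedSpace (Coord n) M] {lam mu : ℝ}

/-- In the chart `c` the operator `A` reads
`φ ↦ ∑_{m ≤ N} ∑_{i₁,…,i_m} a^{i₁…i_m} ∂_{i₁} ⋯ ∂_{i_m} φ` with smooth coefficients. -/
def HasLocalForm (N : ℕ) (A : Density n M lam →ₗ[ℝ] Density n M mu) (c : SmoothChart n M)
    (a : (m : ℕ) → (Fin m → Fin n) → Coord n → ℝ) : Prop :=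
  (∀ m I, ContDiffOn ℝ ∞ (a m I) c.1.target) ∧
  ∀ φ : Density n M lam, ∀ x ∈ c.1.target,
    densityComp (A φ) c x = ∑ m ∈ Finset.range (N + 1), ∑ I : Fin m → Fin n,
      a m I x * iteratedFDeriv ℝ m (densityComp φ c) x (fun s => stdVec (I s))

variable (n M lam mu) in
/-- `𝓓^N_{λ,μ}(M)`: the linear differential operators of order at most `N` from `λ`-densities to
`μ`-densities. -/
def DiffOp (N : ℕ) : Submodule ℝ (Density n M lam →ₗ[ℝ] Density n M mu) where
  carrier := {A | ∀ c, ∃ a, HasLocalForm N A c a}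
  zero_mem' := by
    intro c
    refine ⟨fun _ _ _ => 0, fun m I => contDiffOn_const, fun φ x _ => ?_⟩
    simp [densityComp]
  add_mem' := by
    intro A B hA hB c
    obtain ⟨a, ha, ha'⟩ := hA c
    obtain ⟨b, hb, hb'⟩ := hB c
    refine ⟨fun m I x => a m I x + b m I x, fun m I => (ha m I).add (hb m I), fun φ x hx => ?_⟩
    have h : densityComp ((A + B) φ) c x = densityComp (A φ) c x + densityComp (B φ) c x := rfl
    rw [h, ha' φ x hx, hb' φ x hx]
    simp only [add_mul, Finset.sum_add_distrib]
  smul_mem' := by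
    intro r A hA c
    obtain ⟨a, ha, ha'⟩ := hA c
    refine ⟨fun m I x => r * a m I x, fun m I => contDiffOn_const.mul (ha m I),
      fun φ x hx => ?_⟩
    have h : densityComp ((r • A) φ) c x = r * densityComp (A φ) c x := rfl
    rw [h, ha' φ x hx]
    simp only [Finset.mul_sum, mul_assoc]

/-- The linear map `T` preserves principal symbols: for every `P` the coefficients of the
third-order derivatives in the operator `T P` are the components `P^{ijk}`. -/
def PreservesSymbol {δ : ℝ} (T : Pol n M 3 δ →ₗ[ℝ] DiffOp n M lam mu 3) : Prop :=
  ∀ P : Pol n M 3 δ, ∀ c : SmoothChart n M, ∃ a, HasLocalForm 3 (T P).1 c a ∧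
    ∀ I, ∀ x ∈ c.1.target, a 3 I x = P.1 c I x

end DiffOp

/-! ## Affine connections -/

section Connection

variable {n : ℕ} {M : Type*} [TopologicalSpace M] [ChartedSpace (Coord n) M]

/-- Affine connections on `M` (covariant derivatives on the tangent bundle);
`cov Y p v` is `∇_v Y` at `p`. -/
abbrev AffineConnection (n : ℕ) (M : Type*) [TopologicalSpace M] [ChartedSpace (Coord n) M]
    [IsManifold (𝓡 n) ∞ M] : Type _ :=
  CovariantDerivative (𝓡 n) (Coord n) (TangentSpace (𝓡 n) : M → Type _)

/-- The coordinate vector field `∂/∂x^j` of the chart `c` (relevant only on its domain). -/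
def coordField (c : SmoothChart n M) (j : Fin n) (p : M) : TangentSpace (𝓡 n) p :=
  mfderiv (𝓡 n) (𝓡 n) c.1.symm (c.1 p) (stdVec j)

/-- The component `v^k` of a tangent vector in the chart `c`. -/
def vecComp (c : SmoothChart n M) (k : Fin n) {p : M} (v : TangentSpace (𝓡 n) p) : ℝ :=
  (show Coord n from mfderiv (𝓡 n) (𝓡 n) c.1 p v) k

variable [IsManifold (𝓡 n) ∞ M]

/-- The Christoffel symbols `Γ^k_{ij}` in the chart `c`: `∇_{∂_i} ∂_j = Γ^k_{ij} ∂_k`. -/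
def christoffel (cov : AffineConnection n M) (c : SmoothChart n M) (k i j : Fin n)
    (x : Coord n) : ℝ :=
  vecComp c k (cov (coordField c j) (c.1.symm x) (coordField c i (c.1.symm x)))

/-- Torsion-free connections are projectively equivalent if they differ by
`∇'_v Y = ∇_v Y + θ(v) Y + θ(Y) v` for a 1-form `θ` (which is then smooth if both connections
are), that is `Γ'^k_{ij} = Γ^k_{ij} + δ^k_i θ_j + δ^k_j θ_i`. -/
def ProjEquiv (cov cov' : AffineConnection n M) : Prop :=
  ∃ θ : (p : M) → TangentSpace (𝓡 n) p →L[ℝ] ℝ,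
    ∀ (Y : (p : M) → TangentSpace (𝓡 n) p) (p : M),
      MDifferentiableAt (𝓡 n) ((𝓡 n).prod 𝓘(ℝ, Coord n))
        (fun q => (⟨q, Y q⟩ : TangentBundle (𝓡 n) M)) p →
      ∀ v : TangentSpace (𝓡 n) p, cov' Y p v = cov Y p v + θ p v • Y p + θ p (Y p) • v

end Connection

/-! ## Tensor calculus in a chart -/

section Local

variable {n : ℕ}

/-- The covariant derivative, for the connection with Christoffel symbols `Γ`, of a tensor field
with `p` upper and `q` lower indices and values in the `w`-densities:
`∇_{j₀} T^I_{j₁…j_q} = ∂_{j₀} T^I_J + ∑_s Γ^{i_s}_{j₀ m} T^{…m…}_J - ∑_t Γ^m_{j₀ j_t} T^I_{…m…}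
  - w Γ^m_{j₀ m} T^I_J`.
The new lower index comes first. -/
def covD (Γ : Fin n → Fin n → Fin n → Coord n → ℝ) (w : ℝ) {p q : ℕ}
    (T : (Fin p → Fin n) → (Fin q → Fin n) → Coord n → ℝ) :
    (Fin p → Fin n) → (Fin (q + 1) → Fin n) → Coord n → ℝ :=
  fun I J x =>
    pderiv (J 0) (T I (Fin.tail J)) x
      + ∑ s : Fin p, ∑ m : Fin n,
          Γ (I s) (J 0) m x * T (Function.update I s m) (Fin.tail J) x
      - ∑ t : Fin q, ∑ m : Fin n,
          Γ m (J 0) (J t.succ) x * T I (Function.update (Fin.tail J) t m) x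
      - w * (∑ m : Fin n, Γ m (J 0) m x) * T I (Fin.tail J) x

/-- The Ricci tensor `R_{ij} = ∂_i Γ^k_{kj} - ∂_k Γ^k_{ij} + Γ^k_{im} Γ^m_{kj} - Γ^k_{km} Γ^m_{ij}`,
the trace of `Z ↦ R(∂_i, Z) ∂_j` where `R(X, Y) = [∇_X, ∇_Y] - ∇_{[X, Y]}`. (With this sign
convention the Ricci tensor of a round sphere is negative definite.) -/
def ricci (Γ : Fin n → Fin n → Fin n → Coord n → ℝ) (i j : Fin n) (x : Coord n) : ℝ :=
  ∑ k : Fin n, (pderiv i (Γ k k j) x - pderiv k (Γ k i j) x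
    + ∑ m : Fin n, (Γ k i m x * Γ m k j x - Γ k k m x * Γ m i j x))

/-! ## The quantization formula -/

variable (n) in
/-- The constant `α`. -/
def cα (lam δ : ℝ) : ℝ := (6 + 3 * lam * (1 + n)) / (4 + (1 - δ) * (1 + n))

variable (n) in
/-- The constant `β₁`. -/
def cβ₁ (lam δ : ℝ) : ℝ := (1 + lam * (n + 1)) / (3 + (1 - δ) * (1 + n)) * cα n lam δ

variable (n) in
/-- The constant `β₂`. -/
def cβ₂ (lam δ : ℝ) : ℝ :=
  (2 + 3 * lam * (1 + n) - (4 + (1 - δ) * (1 + n)) * cβ₁ n lam δ) / (n - 1)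

variable (n) in
/-- The constant `η₁`. -/
def cη₁ (lam δ : ℝ) : ℝ := lam * (1 + n) / (6 + 3 * (1 - δ) * (1 + n)) * cβ₁ n lam δ

variable (n) in
/-- The constant `η₂`. -/
def cη₂ (lam δ : ℝ) : ℝ :=
  (lam * (1 + n) * cα n lam δ - (10 + 3 * (1 - δ) * (1 + n)) * cη₁ n lam δ) / (n - 1)

variable (n) in
/-- The constant `η₃`. -/
def cη₃ (lam δ : ℝ) : ℝ :=
  (lam * (1 + n) - cη₁ n lam δ * (4 + (1 - δ) * (1 + n))) / (n - 1)

/-- The right-hand side of the quantization formula in a chart, applied to the density with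
component `φ`; `I = (i, j, k)` runs over all triples of indices. -/
def quantFormula (lam δ : ℝ) (Γ : Fin n → Fin n → Fin n → Coord n → ℝ)
    (P : (Fin 3 → Fin n) → Coord n → ℝ) (φ : Coord n → ℝ) (x : Coord n) : ℝ :=
  let φ₀ : (Fin 0 → Fin n) → (Fin 0 → Fin n) → Coord n → ℝ := fun _ _ => φ
  let φ₁ := covD Γ lam φ₀
  let φ₂ := covD Γ lam φ₁
  let φ₃ := covD Γ lam φ₂
  let P₀ : (Fin 3 → Fin n) → (Fin 0 → Fin n) → Coord n → ℝ := fun I _ => P I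
  let P₁ := covD Γ δ P₀
  let P₂ := covD Γ δ P₁
  let P₃ := covD Γ δ P₂
  let R : (Fin 0 → Fin n) → (Fin 2 → Fin n) → Coord n → ℝ := fun _ J => ricci Γ (J 0) (J 1)
  let R₁ := covD Γ 0 R
  ∑ i : Fin n, ∑ j : Fin n, ∑ k : Fin n,
    (P ![i, j, k] x * φ₃ ![] ![i, j, k] x
      + cα n lam δ * P₁ ![i, j, k] ![k] x * φ₂ ![] ![i, j] x
      + (cβ₁ n lam δ * P₂ ![i, j, k] ![i, j] x
          + cβ₂ n lam δ * P ![i, j, k] x * R ![] ![i, j] x) * φ₁ ![] ![k] x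
      + (cη₁ n lam δ * P₃ ![i, j, k] ![i, j, k] x
          + cη₂ n lam δ * R ![] ![i, j] x * P₁ ![i, j, k] ![k] x
          + cη₃ n lam δ * R₁ ![] ![i, j, k] x * P ![i, j, k] x) * φ x)

end Local

/-- In every chart the map `Q` is given by the quantization formula of the connection. -/
def IsGivenByFormula {n : ℕ} {M : Type*} [TopologicalSpace M] [ChartedSpace (Coord n) M]
    [IsManifold (𝓡 n) ∞ M] {lam mu δ : ℝ} (cov : AffineConnection n M)
    (Q : Pol n M 3 δ →ₗ[ℝ] DiffOp n M lam mu 3) : Prop :=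
  ∀ (P : Pol n M 3 δ) (φ : Density n M lam) (c : SmoothChart n M), ∀ x ∈ c.1.target,
    densityComp ((Q P).1 φ) c x =
      quantFormula lam δ (christoffel cov c) (P.1 c) (densityComp φ c) x

/-! ## Global coordinates, Lie derivatives and `sl_{n+1}(ℝ)` -/

section Global

variable {n k : ℕ} {M : Type*} [TopologicalSpace M] [ChartedSpace (Coord n) M]

theorem contDiffOn_transition (c c' : SmoothChart n M) :
    ContDiffOn ℝ ∞ (fun z => c'.1 (c.1.symm z)) (c.1.symm.trans c'.1).source := by
  have h := contMDiffOn_of_mem_contDiffGroupoid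
    (StructureGroupoid.compatible_of_mem_maximalAtlas c.2 c'.2)
  exact contMDiffOn_iff_contDiffOn.1 h

theorem contDiffAt_transition (c c' : SmoothChart n M) {x : Coord n}
    (hx : x ∈ (c.1.symm.trans c'.1).source) :
    ContDiffAt ℝ ∞ (fun z => c'.1 (c.1.symm z)) x :=
  (contDiffOn_transition c c').contDiffAt ((c.1.symm.trans c'.1).open_source.mem_nhds hx)

theorem mem_transition {c c' : SmoothChart n M} {p : M}
    (hp : p ∈ c.1.source) (hp' : p ∈ c'.1.source) :
    c.1 p ∈ (c.1.symm.trans c'.1).source := by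
  simp [hp, hp']

theorem jacobian_apply (c c' : SmoothChart n M) {x : Coord n}
    (hx : x ∈ (c.1.symm.trans c'.1).source) (i a : Fin n) :
    jacobian c.1 c'.1 x i a = fderiv ℝ (fun z => c'.1 (c.1.symm z)) x (stdVec a) i := by
  have h := ((contDiffAt_transition c c' hx).differentiableAt (by simp)).hasFDerivAt
  have h2 := ((EuclideanSpace.proj (𝕜 := ℝ) i).hasFDerivAt.comp x h).fderiv
  simp only [jacobian, Matrix.of_apply, pderiv]
  change fderiv ℝ ((EuclideanSpace.proj (𝕜 := ℝ) i) ∘ fun z => c'.1 (c.1.symm z)) x (stdVec a) = _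
  rw [h2]
  rfl

theorem jacobian_self (c : SmoothChart n M) {p : M} (hp : p ∈ c.1.source) :
    jacobian c.1 c.1 (c.1 p) = 1 := by
  ext i a
  rw [jacobian_apply c c (mem_transition hp hp)]
  have h : (fun z => c.1 (c.1.symm z)) =ᶠ[nhds (c.1 p)] id := by
    filter_upwards [c.1.open_target.mem_nhds (c.1.map_source hp)] with z hz
    exact c.1.right_inv hz
  rw [h.fderiv_eq, fderiv_id]
  simp [stdVec, Matrix.one_apply]

theorem jacobian_comp (c c' c'' : SmoothChart n M) {p : M}
    (hp : p ∈ c.1.source) (hp' : p ∈ c'.1.source) (hp'' : p ∈ c''.1.source) :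
    jacobian c.1 c''.1 (c.1 p) = jacobian c'.1 c''.1 (c'.1 p) * jacobian c.1 c'.1 (c.1 p) := by
  have h : (fun z => c''.1 (c.1.symm z)) =ᶠ[nhds (c.1 p)]
      (fun z => c''.1 (c'.1.symm z)) ∘ (fun z => c'.1 (c.1.symm z)) := by
    filter_upwards [(c.1.symm.trans c'.1).open_source.mem_nhds (mem_transition hp hp')]
      with z hz
    simp only [OpenPartialHomeomorph.trans_source, Set.mem_inter_iff, Set.mem_preimage] at hz
    simp [c'.1.left_inv hz.2]
  have e : c'.1 (c.1.symm (c.1 p)) = c'.1 p := by rw [c.1.left_inv hp]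
  have d1 : DifferentiableAt ℝ (fun z => c'.1 (c.1.symm z)) (c.1 p) :=
    (contDiffAt_transition c c' (mem_transition hp hp')).differentiableAt (by simp)
  have d2 : DifferentiableAt ℝ (fun z => c''.1 (c'.1.symm z)) (c'.1 (c.1.symm (c.1 p))) := by
    rw [e]
    exact (contDiffAt_transition c' c'' (mem_transition hp' hp'')).differentiableAt (by simp)
  have hc := fderiv_comp (𝕜 := ℝ) (g := fun z => c''.1 (c'.1.symm z))
    (f := fun z => c'.1 (c.1.symm z)) (c.1 p) d2 d1
  rw [e] at hc
  ext i a
  rw [jacobian_apply c c'' (mem_transition hp hp''), h.fderiv_eq, hc, Matrix.mul_apply]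
  simp only [jacobian_apply c c' (mem_transition hp hp'),
    jacobian_apply c' c'' (mem_transition hp' hp'')]
  set L := fderiv ℝ (fun z => c'.1 (c.1.symm z)) (c.1 p) (stdVec a) with hL
  have hv : L = ∑ m, L m • (stdVec m : Coord n) := by
    ext j
    simp [stdVec, Pi.single_apply]
  rw [ContinuousLinearMap.comp_apply, ← hL]
  conv_lhs => rw [hv]
  simp [map_sum, mul_comm]

theorem jacobian_det_ne_zero (c c' : SmoothChart n M) {p : M}
    (hp : p ∈ c.1.source) (hp' : p ∈ c'.1.source) : (jacobian c.1 c'.1 (c.1 p)).det ≠ 0 := by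
  intro h
  have h1 := congrArg Matrix.det (jacobian_comp c c' c hp hp' hp)
  rw [jacobian_self c hp, Matrix.det_mul, h] at h1
  simp at h1

theorem contDiffOn_pderiv {f : Coord n → ℝ} {s : Set (Coord n)} (hs : IsOpen s)
    (hf : ContDiffOn ℝ ∞ f s) (i : Fin n) : ContDiffOn ℝ ∞ (pderiv i f) s :=
  (hf.fderiv_of_isOpen hs (by simp)).clm_apply contDiffOn_const

theorem contDiffOn_jacobian (c c' : SmoothChart n M) (i a : Fin n) :
    ContDiffOn ℝ ∞ (fun x => jacobian c.1 c'.1 x i a) (c.1.symm.trans c'.1).source := by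
  refine contDiffOn_pderiv (c.1.symm.trans c'.1).open_source ?_ a
  exact (EuclideanSpace.proj (𝕜 := ℝ) i).contDiff.comp_contDiffOn (contDiffOn_transition c c')

theorem contDiffOn_transformed (δ : ℝ) (c c' : SmoothChart n M)
    (f : (Fin k → Fin n) → Coord n → ℝ) (hf : ∀ I, ContDiffOn ℝ ∞ (f I) c.1.target)
    (I : Fin k → Fin n) :
    ContDiffOn ℝ ∞ (transformed δ c.1 c'.1 f I) (c.1.symm.trans c'.1).source := by
  have hJ := contDiffOn_jacobian c c'
  have hsub : (c.1.symm.trans c'.1).source ⊆ c.1.target := by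
    intro x hx
    simp only [OpenPartialHomeomorph.trans_source, Set.mem_inter_iff] at hx
    exact hx.1
  have hdet : ContDiffOn ℝ ∞ (fun x => (jacobian c.1 c'.1 x).det)
      (c.1.symm.trans c'.1).source := by
    simp only [Matrix.det_apply]
    refine ContDiffOn.sum fun σ _ => ?_
    exact (contDiffOn_prod fun i _ => hJ _ _).const_smul _
  refine ContDiffOn.mul ?_ (ContDiffOn.sum fun K _ => ?_)
  · intro x hx
    have hx' := hx
    simp only [OpenPartialHomeomorph.trans_source, Set.mem_inter_iff, Set.mem_preimage,
      OpenPartialHomeomorph.symm_source] at hx'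
    have hne : (jacobian c.1 c'.1 x).det ≠ 0 := by
      have := jacobian_det_ne_zero c c' (c.1.map_target hx'.1) hx'.2
      rwa [c.1.right_inv hx'.1] at this
    have h1 := (contDiffAt_abs (n := (⊤ : ℕ∞)) hne).comp_contDiffWithinAt x (hdet x hx)
    exact h1.rpow_const_of_ne (abs_ne_zero.2 hne)
  · exact (contDiffOn_prod fun s _ => hJ _ _).mul ((hf K).mono hsub)

theorem transformed_self (δ : ℝ) (c : SmoothChart n M) (f : (Fin k → Fin n) → Coord n → ℝ)
    (I : Fin k → Fin n) {p : M} (hp : p ∈ c.1.source) :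
    transformed δ c.1 c.1 f I (c.1 p) = f I (c.1 p) := by
  rw [transformed, jacobian_self c hp, Finset.sum_eq_single I]
  · simp
  · intro K _ hK
    obtain ⟨s, hs⟩ := Function.ne_iff.1 hK
    rw [Finset.prod_eq_zero (Finset.mem_univ s), zero_mul]
    exact Matrix.one_apply_ne (Ne.symm hs)
  · simp

theorem transformed_comp (δ : ℝ) (c c' c'' : SmoothChart n M)
    (f g : (Fin k → Fin n) → Coord n → ℝ) (I : Fin k → Fin n) {p : M}
    (hp : p ∈ c.1.source) (hp' : p ∈ c'.1.source) (hp'' : p ∈ c''.1.source)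
    (hg : ∀ K, g K (c'.1 p) = transformed δ c.1 c'.1 f K (c.1 p)) :
    transformed δ c'.1 c''.1 g I (c'.1 p) = transformed δ c.1 c''.1 f I (c.1 p) := by
  simp only [transformed] at hg ⊢
  rw [jacobian_comp c c' c'' hp hp' hp'']
  set A := jacobian c'.1 c''.1 (c'.1 p)
  set B := jacobian c.1 c'.1 (c.1 p)
  rw [Matrix.det_mul, abs_mul, Real.mul_rpow (abs_nonneg _) (abs_nonneg _), mul_assoc]
  congr 1
  simp only [hg, Finset.mul_sum]
  rw [Finset.sum_comm]
  refine Finset.sum_congr rfl fun L _ => ?_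
  simp only [Matrix.mul_apply, Fintype.prod_sum, Finset.prod_mul_distrib, Finset.sum_mul,
    Finset.mul_sum]
  refine Finset.sum_congr rfl fun K _ => ?_
  ring

theorem transformed_perm (δ : ℝ) (c c' : SmoothChart n M)
    (f : (Fin k → Fin n) → Coord n → ℝ) (σ : Equiv.Perm (Fin k))
    (hf : ∀ I, f (I ∘ σ) = f I) (I : Fin k → Fin n) :
    transformed δ c.1 c'.1 f (I ∘ σ) = transformed δ c.1 c'.1 f I := by
  funext x
  simp only [transformed]
  congr 1
  refine (Fintype.sum_equiv (Equiv.arrowCongr σ.symm (Equiv.refl (Fin n))) _ _ fun K => ?_).symm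
  have h : (Equiv.arrowCongr σ.symm (Equiv.refl (Fin n))) K = K ∘ σ := by
    ext; simp [Equiv.arrowCongr]
  rw [h, hf K]
  congr 1
  exact (Equiv.prod_comp σ fun s => jacobian c.1 c'.1 x (I s) (K s)).symm

/-- The symbol whose components in the global coordinate system `c` are `f`. -/
def ofCoords (δ : ℝ) (c : SmoothChart n M) (hc : c.1.source = Set.univ)
    (f : (Fin k → Fin n) → Coord n → ℝ) (hf : ∀ I, ContDiffOn ℝ ∞ (f I) c.1.target)
    (hf' : ∀ I, ∀ σ : Equiv.Perm (Fin k), f (I ∘ σ) = f I) : Pol n M k δ :=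
  ⟨fun c' I => Set.indicator c'.1.target
      fun y => transformed δ c.1 c'.1 f I (c.1 (c'.1.symm y)), by
    have hm : ∀ p, p ∈ c.1.source := fun p => hc ▸ Set.mem_univ p
    refine ⟨fun c' I => ?_, fun c' I x hx => Set.indicator_of_notMem hx _,
      fun c' I σ => ?_, fun c' c'' p hp I => ?_⟩
    · refine ContDiffOn.congr ?_ (fun y hy => Set.indicator_of_mem hy _)
      have hsub : c'.1.target ⊆ (c'.1.symm.trans c.1).source := by
        intro y hy
        simp [hy, hm]
      refine (contDiffOn_transformed δ c c' f hf I).comp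
        ((contDiffOn_transition c' c).mono hsub) ?_
      intro y hy
      exact mem_transition (hm _) (c'.1.map_target hy)
    · dsimp only
      rw [transformed_perm δ c c' f σ (fun I => hf' I σ) I]
    · have e : ∀ d : SmoothChart n M, p ∈ d.1.source → ∀ K,
          Set.indicator d.1.target (fun y => transformed δ c.1 d.1 f K (c.1 (d.1.symm y))) (d.1 p)
            = transformed δ c.1 d.1 f K (c.1 p) := by
        intro d hd K
        rw [Set.indicator_of_mem (d.1.map_source hd), d.1.left_inv hd]
      exact (e c'' hp.2 I).trans (transformed_comp δ c c' c'' f _ I (hm p) hp.1 hp.2 (e c' hp.1)).symm⟩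

theorem ofCoords_apply (δ : ℝ) (c : SmoothChart n M) (hc : c.1.source = Set.univ)
    (f : (Fin k → Fin n) → Coord n → ℝ) (hf : ∀ I, ContDiffOn ℝ ∞ (f I) c.1.target)
    (hf' : ∀ I, ∀ σ : Equiv.Perm (Fin k), f (I ∘ σ) = f I) (I : Fin k → Fin n)
    {x : Coord n} (hx : x ∈ c.1.target) : (ofCoords δ c hc f hf hf').1 c I x = f I x := by
  have h := transformed_self δ c f I (c.1.map_target hx)
  rw [c.1.right_inv hx] at h
  change Set.indicator c.1.target
    (fun y => transformed δ c.1 c.1 f I (c.1 (c.1.symm y))) x = f I x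
  rw [Set.indicator_of_mem hx, c.1.right_inv hx, h]

/-- The components of the Lie derivative along `X = X^i ∂_i` of a symbol with components `f`:
`X^l ∂_l f^I - ∑_s ∂_l X^{i_s} f^{…l…} + δ ∂_l X^l f^I`. -/
def lieComp (δ : ℝ) (X : Fin n → Coord n → ℝ) (f : (Fin k → Fin n) → Coord n → ℝ)
    (I : Fin k → Fin n) (x : Coord n) : ℝ :=
  ∑ l : Fin n, X l x * pderiv l (f I) x
    - ∑ s : Fin k, ∑ l : Fin n, pderiv l (X (I s)) x * f (Function.update I s l) x
    + δ * (∑ l : Fin n, pderiv l (X l) x) * f I x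

theorem lieComp_perm (δ : ℝ) (X : Fin n → Coord n → ℝ) (f : (Fin k → Fin n) → Coord n → ℝ)
    (σ : Equiv.Perm (Fin k)) (hf : ∀ I, f (I ∘ σ) = f I) (I : Fin k → Fin n) :
    lieComp δ X f (I ∘ σ) = lieComp δ X f I := by
  funext x
  simp only [lieComp, hf I]
  congr 2
  refine Fintype.sum_equiv σ _ _ fun s => ?_
  refine Finset.sum_congr rfl fun l _ => ?_
  rw [← hf (Function.update I (σ s) l)]
  congr 2
  funext t
  by_cases h : t = s
  · subst h; simp
  · simp [Function.update_of_ne h, Function.update_of_ne (fun h' => h (σ.injective h'))]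

theorem contDiffOn_lieComp (δ : ℝ) {s : Set (Coord n)} (hs : IsOpen s)
    (X : Fin n → Coord n → ℝ) (hX : ∀ l, ContDiff ℝ ∞ (X l))
    (f : (Fin k → Fin n) → Coord n → ℝ) (hf : ∀ I, ContDiffOn ℝ ∞ (f I) s)
    (I : Fin k → Fin n) : ContDiffOn ℝ ∞ (lieComp δ X f I) s := by
  have hX' := fun i l => contDiffOn_pderiv hs (hX l).contDiffOn i
  refine ContDiffOn.add (ContDiffOn.sub ?_ ?_) ?_
  · exact ContDiffOn.sum fun l _ => (hX l).contDiffOn.mul (contDiffOn_pderiv hs (hf I) l)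
  · exact ContDiffOn.sum fun t _ => ContDiffOn.sum fun l _ => (hX' l _).mul (hf _)
  · exact (contDiffOn_const.mul (ContDiffOn.sum fun l _ => hX' l l)).mul (hf I)

/-- The Lie derivative `L_X P` along the vector field with components `X` in the global
coordinate system `c`. For `k = 0` this is the Lie derivative of densities. -/
def lieDeriv (c : SmoothChart n M) (hc : c.1.source = Set.univ)
    (X : Fin n → Coord n → ℝ) (hX : ∀ l, ContDiff ℝ ∞ (X l)) {δ : ℝ} (P : Pol n M k δ) :
    Pol n M k δ :=
  ofCoords δ c hc (lieComp δ X (P.1 c))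
    (contDiffOn_lieComp δ c.1.open_target X hX _ (P.2.1 c))
    (fun I σ => lieComp_perm δ X _ σ (fun I => P.2.2.2.1 c I σ) I)

variable (n) in
/-- The realization of `sl_{n+1}(ℝ)` by vector fields (in components): the span of the fields
`∂_j`, `x^i ∂_j` and `x^i ∑_j x^j ∂_j`. -/
def slFields : Submodule ℝ (Fin n → Coord n → ℝ) :=
  Submodule.span ℝ
    ({X | ∃ j, X = fun l _ => if l = j then 1 else 0} ∪
      {X | ∃ i j, X = fun l x => if l = j then x i else 0} ∪
      {X | ∃ i, X = fun l x => x i * x l})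

theorem contDiff_of_mem_slFields {X : Fin n → Coord n → ℝ} (hX : X ∈ slFields n) (l : Fin n) :
    ContDiff ℝ ∞ (X l) := by
  have hx : ∀ i : Fin n, ContDiff ℝ ∞ (fun x : Coord n => x i) :=
    fun i => (EuclideanSpace.proj (𝕜 := ℝ) i).contDiff
  induction hX using Submodule.span_induction with
  | mem X h =>
    rcases h with (⟨j, rfl⟩ | ⟨i, j, rfl⟩) | ⟨i, rfl⟩
    · exact contDiff_const
    · by_cases h : l = j
      · simpa [h] using hx i
      · simpa [h] using contDiff_const
    · exact (hx i).mul (hx l)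
  | zero => exact contDiff_const
  | add X Y _ _ h h' => exact h.add h'
  | smul r X _ h => exact contDiff_const.mul h

/-- The linear map `T` is equivariant under `sl_{n+1}(ℝ)` acting by Lie derivatives on symbols
and by commutators with Lie derivatives on operators:
`T (L_X P) = L_X ∘ T P - T P ∘ L_X`. -/
def IsSlEquivariant (c : SmoothChart n M) (hc : c.1.source = Set.univ) {lam mu δ : ℝ}
    (T : Pol n M 3 δ →ₗ[ℝ] DiffOp n M lam mu 3) : Prop :=
  ∀ (X : Fin n → Coord n → ℝ) (hX : X ∈ slFields n) (P : Pol n M 3 δ) (φ : Density n M lam),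
    (T (lieDeriv c hc X (contDiff_of_mem_slFields hX) P)).1 φ =
      lieDeriv c hc X (contDiff_of_mem_slFields hX) ((T P).1 φ) -
        (T P).1 (lieDeriv c hc X (contDiff_of_mem_slFields hX) φ)

/-- The connection belongs to the flat projective structure with coordinates `c`: it is
projectively equivalent to a connection whose Christoffel symbols vanish in `c`. -/
def IsProjFlatIn [IsManifold (𝓡 n) ∞ M] (c : SmoothChart n M) (cov : AffineConnection n M) :
    Prop :=
  ∃ cov₀ : AffineConnection n M,
    (∀ k i j, ∀ x ∈ c.1.target, christoffel cov₀ c k i j x = 0) ∧ ProjEquiv cov₀ cov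

end Global

end ProjQuant

end

open ProjQuant

noncomputable section

namespace ProjQuant

/-! ## The algebra of smooth functions on an open set -/

section SmoothAlgebra

variable {n : ℕ}

/-! All local computations are carried out over a commutative algebra with commuting derivations:
the functions smooth on an open set of coordinates, with the partial derivatives. There the
quantization formula is a polynomial expression `quantA` in the components of the symbol, the
Christoffel symbols and their derivatives, and each claim becomes an identity of such expressions.
`PartialsAlong.quantFormula` translates between the analytic and the algebraic formula.

Existence. Covariant derivatives of tensors and the Ricci tensor are tensorial (`TensorRel.covA`,
`TensorRel.ricciA`), and full contractions depend on the coordinates only through the density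
factors (`TensorRel.contract`). Hence the formula produces a density of weight `λ + δ = μ`
(`quantA_covariant`, `quantFormula_transition`). Its only third order part is `P^{ijk} ∂_i ∂_j ∂_k`
(`quantA_sub_mem_diffOps`), so the principal symbol is `P`.

Projective invariance. When `Γ` is changed by a 1-form `θ`, iterated covariant derivatives of `φ`
and iterated divergences of `P` change by explicit polynomials in `θ`, `∇θ`, `∇∇θ`, and the
symmetrized Ricci tensor changes by `n - 1` times the symmetrization of `∇θ - θ ⊗ θ`. After
contraction with the symmetric `P` the total change is a combination of finitely many scalar
contractions, and the constants of the formula are chosen to make all coefficients vanish. There are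
more conditions than constants; the surplus ones are consequences of the others
(`QuantCoeffs.Balanced`, `quantCoeffs_balanced`). The cancellation itself is `quantE_projChange`.

Equivariance in the flat case. By invariance the connection may be replaced by `Γ = 0`. A field `X`
of `sl_{n+1}` satisfies `∂_a ∂_b X^l = δ^l_a c_b + δ^l_b c_a` with constant `c`: its flow changes
the flat connection projectively. Commuting partial derivatives with `L_X` therefore produces the
corrections linear in `θ` with `θ = -c`, and three of the same relations make them cancel
(`quantE_zero_equivariant`).

Uniqueness. The difference `S` of two equivariant maps with the right symbols has values of order at
most 2. If its values have order at most `k < 3`, their symbols of degree `k` depend equivariantly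
on `P`. The Casimir operator of `sl_{n+1}` acts on symbols of each degree by a scalar (`casimir`),
and the scalars in degrees 3 and `k` differ by `2 (3 - k) (k + 2 + (1 - δ)(n + 1))`. The three
excluded values of `δ` are those at which this vanishes for `k = 2, 1, 0`, so the order drops until
`S = 0`. The argument is made pointwise, for the functionals `φ ↦ (S P φ)(x₀)`
(`IsSlEquivariant.valueAt_eq_zero_of_succ`); nothing but linearity and equivariance is used about
the dependence of `S` on `P`. -/

theorem pderiv_congr {f g : Coord n → ℝ} {x : Coord n} (h : f =ᶠ[nhds x] g) (i : Fin n) :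
    pderiv i f x = pderiv i g x := by
  simp only [pderiv, h.fderiv_eq]

theorem pderiv_congr_of_isOpen {f g : Coord n → ℝ} {s : Set (Coord n)} (hs : IsOpen s)
    (h : Set.EqOn f g s) {x : Coord n} (hx : x ∈ s) (i : Fin n) :
    pderiv i f x = pderiv i g x :=
  pderiv_congr (Filter.eventuallyEq_of_mem (hs.mem_nhds hx) h) i

/-- Chain rule in coordinates. -/
theorem pderiv_comp {g : Coord n → ℝ} {y : Coord n → Coord n} {x : Coord n}
    (hg : DifferentiableAt ℝ g (y x)) (hy : DifferentiableAt ℝ y x) (a : Fin n) :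
    pderiv a (fun z => g (y z)) x =
      ∑ i, pderiv a (fun z => y z i) x * pderiv i g (y x) := by
  have h := (hg.hasFDerivAt.comp x hy.hasFDerivAt).fderiv
  have hi : ∀ i, pderiv a (fun z => y z i) x = fderiv ℝ y x (stdVec a) i := by
    intro i
    have h2 := ((EuclideanSpace.proj (𝕜 := ℝ) i).hasFDerivAt.comp x hy.hasFDerivAt).fderiv
    simp only [pderiv]
    change fderiv ℝ ((EuclideanSpace.proj (𝕜 := ℝ) i) ∘ y) x (stdVec a) = _
    rw [h2]
    rfl
  simp only [hi]
  simp only [pderiv]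
  change fderiv ℝ (g ∘ y) x (stdVec a) = _
  rw [h, ContinuousLinearMap.comp_apply]
  set v := fderiv ℝ y x (stdVec a)
  have hv : v = ∑ m, v m • (stdVec m : Coord n) := by
    ext j
    simp [stdVec, Pi.single_apply]
  conv_lhs => rw [hv]
  simp [map_sum]

theorem pderiv_coord (a b : Fin n) (x : Coord n) :
    pderiv a (fun z : Coord n => z b) x = if a = b then 1 else 0 := by
  simp only [pderiv]
  change fderiv ℝ (EuclideanSpace.proj (𝕜 := ℝ) b) x (stdVec a) = _
  rw [ContinuousLinearMap.fderiv]
  simp [stdVec, eq_comm]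

/-- Functions on `ℝⁿ` that are smooth on the open set `U`. -/
def smoothOn (U : TopologicalSpace.Opens (Coord n)) : Subalgebra ℝ (Coord n → ℝ) where
  carrier := {f | ContDiffOn ℝ ∞ f U}
  mul_mem' := fun h h' => ContDiffOn.mul h h'
  add_mem' := fun h h' => ContDiffOn.add h h'
  algebraMap_mem' := fun _ => contDiffOn_const

variable {U : TopologicalSpace.Opens (Coord n)}

theorem smoothOn.differentiableAt (f : smoothOn U) {x : Coord n} (hx : x ∈ U) :
    DifferentiableAt ℝ f.1 x :=
  (ContDiffOn.contDiffAt f.2 (U.2.mem_nhds hx)).differentiableAt (by simp)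

/-- The partial derivative, set to `0` outside `U`, as a derivation of the smooth functions. -/
def partialD (U : TopologicalSpace.Opens (Coord n)) (i : Fin n) :
    Derivation ℝ (smoothOn U) (smoothOn U) :=
  Derivation.mk'
    { toFun := fun f => ⟨Set.indicator (U : Set (Coord n)) (pderiv i f.1),
        (contDiffOn_pderiv U.2 f.2 i).congr fun _ hx => Set.indicator_of_mem hx _⟩
      map_add' := by
        intro f g
        ext x
        by_cases hx : x ∈ (U : Set (Coord n))
        · have := fderiv_add (smoothOn.differentiableAt f hx) (smoothOn.differentiableAt g hx)
          simp [hx, pderiv, this]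
        · simp [hx]
      map_smul' := by
        intro r f
        ext x
        by_cases hx : x ∈ (U : Set (Coord n))
        · have := fderiv_const_smul (smoothOn.differentiableAt f hx) r
          simp [hx, pderiv, this]
        · simp [hx] }
    (by
      intro f g
      ext x
      by_cases hx : x ∈ (U : Set (Coord n))
      · have := fderiv_mul (smoothOn.differentiableAt f hx) (smoothOn.differentiableAt g hx)
        simp [hx, pderiv, this]
      · simp [hx])

theorem partialD_apply (i : Fin n) (f : smoothOn U) {x : Coord n} (hx : x ∈ U) :
    (partialD U i f).1 x = pderiv i f.1 x :=
  Set.indicator_of_mem (s := (U : Set (Coord n))) hx _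

theorem partialD_apply_of_eqOn (i : Fin n) (f : smoothOn U) {g : Coord n → ℝ}
    (h : Set.EqOn g f.1 U) {x : Coord n} (hx : x ∈ U) :
    pderiv i g x = (partialD U i f).1 x := by
  rw [partialD_apply i f hx, pderiv_congr_of_isOpen U.2 h hx]

theorem two_le_smooth : (2 : WithTop ℕ∞) ≤ ∞ := WithTop.coe_le_coe.2 le_top

theorem pderiv_pderiv_comm {f : Coord n → ℝ} {s : Set (Coord n)} (hs : IsOpen s)
    (hf : ContDiffOn ℝ ∞ f s) {x : Coord n} (hx : x ∈ s) (i j : Fin n) :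
    pderiv i (pderiv j f) x = pderiv j (pderiv i f) x := by
  have hfx := hf.contDiffAt (hs.mem_nhds hx)
  have hd : DifferentiableAt ℝ (fderiv ℝ f) x :=
    (hfx.fderiv_right (m := 1) (by norm_num [two_le_smooth])).differentiableAt (by simp)
  have key : ∀ a b : Fin n,
      pderiv a (pderiv b f) x = fderiv ℝ (fderiv ℝ f) x (stdVec a) (stdVec b) := by
    intro a b
    change fderiv ℝ (fun y => fderiv ℝ f y (stdVec b)) x (stdVec a) = _
    rw [fderiv_clm_apply hd (differentiableAt_const _)]
    simp
  rw [key, key]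
  exact (hfx.isSymmSndFDerivAt (by simp [two_le_smooth])).eq _ _

/-- Elements of `smoothOn U` carry arbitrary values off `U`, and `partialD` is cut off to zero
there. This makes the symmetry of second derivatives an identity in the algebra and not only on `U`.
-/
theorem partialD_comm (i j : Fin n) (f : smoothOn U) :
    partialD U i (partialD U j f) = partialD U j (partialD U i f) := by
  apply Subtype.ext
  funext x
  by_cases hx : x ∈ U
  · rw [partialD_apply i _ hx, partialD_apply j _ hx,
      pderiv_congr_of_isOpen U.2 (fun z hz => partialD_apply j f hz) hx,
      pderiv_congr_of_isOpen U.2 (fun z hz => partialD_apply i f hz) hx]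
    exact pderiv_pderiv_comm U.2 f.2 hx i j
  · have h : ∀ k (g : smoothOn U), (partialD U k g).1 x = 0 := fun k g =>
      Set.indicator_of_notMem (s := (U : Set (Coord n))) hx _
    rw [h, h]

end SmoothAlgebra

/-! ## Tensor calculus over an algebra with derivations -/

section AlgebraicCalculus

variable {n : ℕ} {R : Type*} [CommRing R] [Algebra ℝ R]

/-- The covariant derivative of tensors with entries in an algebra with derivations `D i`. -/
def covA (D : Fin n → Derivation ℝ R R) (Γ : Fin n → Fin n → Fin n → R) (w : R) {p q : ℕ}
    (T : (Fin p → Fin n) → (Fin q → Fin n) → R) :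
    (Fin p → Fin n) → (Fin (q + 1) → Fin n) → R :=
  fun I J =>
    D (J 0) (T I (Fin.tail J))
      + ∑ s : Fin p, ∑ m : Fin n, Γ (I s) (J 0) m * T (Function.update I s m) (Fin.tail J)
      - ∑ t : Fin q, ∑ m : Fin n,
          Γ m (J 0) (J t.succ) * T I (Function.update (Fin.tail J) t m)
      - w * (∑ m : Fin n, Γ m (J 0) m) * T I (Fin.tail J)

/-- The Ricci tensor over an algebra with derivations. -/
def ricciA (D : Fin n → Derivation ℝ R R) (Γ : Fin n → Fin n → Fin n → R) (i j : Fin n) : R :=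
  ∑ k : Fin n, (D i (Γ k k j) - D k (Γ k i j)
    + ∑ m : Fin n, (Γ k i m * Γ m k j - Γ k k m * Γ m i j))

/-- The coefficients of the quantization formula. -/
structure QuantCoeffs (R : Type*) where
  (lam δ α β₁ β₂ η₁ η₂ η₃ : R)

/-- The quantization formula over an algebra with derivations. -/
def quantA (κ : QuantCoeffs R) (D : Fin n → Derivation ℝ R R) (Γ : Fin n → Fin n → Fin n → R)
    (P : (Fin 3 → Fin n) → R) (φ : R) : R :=
  let φ₀ : (Fin 0 → Fin n) → (Fin 0 → Fin n) → R := fun _ _ => φ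
  let φ₁ := covA D Γ κ.lam φ₀
  let φ₂ := covA D Γ κ.lam φ₁
  let φ₃ := covA D Γ κ.lam φ₂
  let P₀ : (Fin 3 → Fin n) → (Fin 0 → Fin n) → R := fun I _ => P I
  let P₁ := covA D Γ κ.δ P₀
  let P₂ := covA D Γ κ.δ P₁
  let P₃ := covA D Γ κ.δ P₂
  let S : (Fin 0 → Fin n) → (Fin 2 → Fin n) → R := fun _ J => ricciA D Γ (J 0) (J 1)
  let S₁ := covA D Γ 0 S
  ∑ i : Fin n, ∑ j : Fin n, ∑ k : Fin n,
    (P ![i, j, k] * φ₃ ![] ![i, j, k]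
      + κ.α * P₁ ![i, j, k] ![k] * φ₂ ![] ![i, j]
      + (κ.β₁ * P₂ ![i, j, k] ![i, j] + κ.β₂ * P ![i, j, k] * S ![] ![i, j]) * φ₁ ![] ![k]
      + (κ.η₁ * P₃ ![i, j, k] ![i, j, k] + κ.η₂ * S ![] ![i, j] * P₁ ![i, j, k] ![k]
          + κ.η₃ * S₁ ![] ![i, j, k] * P ![i, j, k]) * φ)

/-- The coefficients of the quantization formula for densities of weights `lam` and `lam + δ`. -/
def quantCoeffs (n : ℕ) (lam δ : ℝ) : QuantCoeffs ℝ :=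
  ⟨lam, δ, cα n lam δ, cβ₁ n lam δ, cβ₂ n lam δ, cη₁ n lam δ, cη₂ n lam δ, cη₃ n lam δ⟩

/-- Transport of coefficients along a map. -/
def QuantCoeffs.map {A B : Type*} (f : A → B) (κ : QuantCoeffs A) : QuantCoeffs B :=
  ⟨f κ.lam, f κ.δ, f κ.α, f κ.β₁, f κ.β₂, f κ.η₁, f κ.η₂, f κ.η₃⟩

end AlgebraicCalculus

/-! ## Comparison of the analytic with the algebraic tensor calculus -/

section Comparison

variable {n : ℕ} {U : TopologicalSpace.Opens (Coord n)}

theorem smoothOn.sum_apply {ι : Type*} (s : Finset ι) (f : ι → smoothOn U) (x : Coord n) :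
    (∑ i ∈ s, f i).1 x = ∑ i ∈ s, (f i).1 x := by
  rw [← Finset.sum_apply, ← AddSubmonoidClass.coe_finsetSum]

theorem smoothOn.add_apply (f g : smoothOn U) (x : Coord n) : (f + g).1 x = f.1 x + g.1 x := rfl
theorem smoothOn.sub_apply (f g : smoothOn U) (x : Coord n) : (f - g).1 x = f.1 x - g.1 x := rfl
theorem smoothOn.mul_apply (f g : smoothOn U) (x : Coord n) : (f * g).1 x = f.1 x * g.1 x := rfl
theorem smoothOn.algebraMap_apply (r : ℝ) (x : Coord n) :
    (algebraMap ℝ (smoothOn U) r).1 x = r := rfl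

/-- The derivations `D i` of the functions on `U` correspond to the partial derivatives under the
map `y`. -/
def PartialsAlong (y : Coord n → Coord n) (D : Fin n → Derivation ℝ (smoothOn U) (smoothOn U)) :
    Prop :=
  ∀ i (f : smoothOn U) (g : Coord n → ℝ), (∀ x ∈ U, g (y x) = f.1 x) →
    ∀ x ∈ U, pderiv i g (y x) = (D i f).1 x

theorem partialsAlong_id : PartialsAlong id (partialD U) :=
  fun i f _ h _ hx => partialD_apply_of_eqOn i f h hx

variable {y : Coord n → Coord n} {D : Fin n → Derivation ℝ (smoothOn U) (smoothOn U)}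

/-- The map `y` is kept general so that the comparison serves twice: with the identity for the
formula in one chart, and with a change of coordinates for the formula of a second chart pulled back
to the first. -/
theorem PartialsAlong.covD (hD : PartialsAlong y D) {Γ : Fin n → Fin n → Fin n → Coord n → ℝ}
    {γ : Fin n → Fin n → Fin n → smoothOn U} (hΓ : ∀ k i j, ∀ x ∈ U, Γ k i j (y x) = (γ k i j).1 x)
    (w : ℝ) {p q : ℕ} {T : (Fin p → Fin n) → (Fin q → Fin n) → Coord n → ℝ}
    {t : (Fin p → Fin n) → (Fin q → Fin n) → smoothOn U}
    (hT : ∀ I J, ∀ x ∈ U, T I J (y x) = (t I J).1 x) (I : Fin p → Fin n)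
    (J : Fin (q + 1) → Fin n) :
    ∀ x ∈ U, covD Γ w T I J (y x) = (covA D γ (algebraMap ℝ _ w) t I J).1 x := by
  intro x hx
  have hΓ' : ∀ k i j, Γ k i j (y x) = (γ k i j).1 x := fun k i j => hΓ k i j x hx
  have hT' : ∀ I J, T I J (y x) = (t I J).1 x := fun I J => hT I J x hx
  simp only [ProjQuant.covD, covA, smoothOn.add_apply, smoothOn.sub_apply, smoothOn.mul_apply,
    smoothOn.sum_apply, smoothOn.algebraMap_apply, hΓ', hT',
    hD _ (t I (Fin.tail J)) _ (hT I (Fin.tail J)) x hx]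

theorem PartialsAlong.ricci (hD : PartialsAlong y D) {Γ : Fin n → Fin n → Fin n → Coord n → ℝ}
    {γ : Fin n → Fin n → Fin n → smoothOn U} (hΓ : ∀ k i j, ∀ x ∈ U, Γ k i j (y x) = (γ k i j).1 x)
    (i j : Fin n) : ∀ x ∈ U, ricci Γ i j (y x) = (ricciA D γ i j).1 x := by
  intro x hx
  have hΓ' : ∀ k i j, Γ k i j (y x) = (γ k i j).1 x := fun k i j => hΓ k i j x hx
  have hd : ∀ a k i j, pderiv a (Γ k i j) (y x) = (D a (γ k i j)).1 x :=
    fun a k i j => hD a (γ k i j) _ (hΓ k i j) x hx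
  simp only [ProjQuant.ricci, ricciA, smoothOn.add_apply, smoothOn.sub_apply, smoothOn.mul_apply,
    smoothOn.sum_apply, hΓ', hd]

theorem PartialsAlong.quantFormula (hD : PartialsAlong y D) (lam δ : ℝ)
    {Γ : Fin n → Fin n → Fin n → Coord n → ℝ}
    {γ : Fin n → Fin n → Fin n → smoothOn U} (hΓ : ∀ k i j, ∀ x ∈ U, Γ k i j (y x) = (γ k i j).1 x)
    {P : (Fin 3 → Fin n) → Coord n → ℝ} {ρ : (Fin 3 → Fin n) → smoothOn U}
    (hP : ∀ I, ∀ x ∈ U, P I (y x) = (ρ I).1 x) {φ : Coord n → ℝ} {f : smoothOn U}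
    (hφ : ∀ x ∈ U, φ (y x) = f.1 x) :
    ∀ x ∈ U, quantFormula lam δ Γ P φ (y x)
      = (quantA ((quantCoeffs n lam δ).map (algebraMap ℝ (smoothOn U))) D γ ρ f).1 x := by
  intro x hx
  have f1 := hD.covD hΓ lam (p := 0) (q := 0) (T := fun _ _ => φ) (t := fun _ _ => f)
    (fun _ _ => hφ)
  have f2 := hD.covD hΓ lam f1
  have f3 := hD.covD hΓ lam f2
  have p1 := hD.covD hΓ δ (p := 3) (q := 0) (T := fun I _ => P I) (t := fun I _ => ρ I)
    (fun I _ => hP I)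
  have p2 := hD.covD hΓ δ p1
  have p3 := hD.covD hΓ δ p2
  have r1 := hD.covD hΓ 0 (p := 0) (q := 2) (T := fun _ J => ProjQuant.ricci Γ (J 0) (J 1))
    (t := fun _ J => ricciA D γ (J 0) (J 1)) (fun _ J => hD.ricci hΓ _ _)
  rw [map_zero] at r1
  simp only [ProjQuant.quantFormula, quantA, quantCoeffs, QuantCoeffs.map, smoothOn.add_apply,
    smoothOn.mul_apply, smoothOn.sum_apply, smoothOn.algebraMap_apply, f1 _ _ x hx, f2 _ _ x hx,
    f3 _ _ x hx, p1 _ _ x hx, p2 _ _ x hx, p3 _ _ x hx, r1 _ _ x hx, hP _ x hx, hφ x hx,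
    hD.ricci hΓ _ _ x hx]

theorem quantFormula_eq_quantA (lam δ : ℝ) {Γ : Fin n → Fin n → Fin n → Coord n → ℝ}
    {γ : Fin n → Fin n → Fin n → smoothOn U} (hΓ : ∀ k i j, Set.EqOn (Γ k i j) (γ k i j).1 U)
    {P : (Fin 3 → Fin n) → Coord n → ℝ} {ρ : (Fin 3 → Fin n) → smoothOn U}
    (hP : ∀ I, Set.EqOn (P I) (ρ I).1 U) {φ : Coord n → ℝ} {f : smoothOn U}
    (hφ : Set.EqOn φ f.1 U) :
    Set.EqOn (quantFormula lam δ Γ P φ)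
      (quantA ((quantCoeffs n lam δ).map (algebraMap ℝ (smoothOn U))) (partialD U) γ ρ f).1 U :=
  partialsAlong_id.quantFormula lam δ hΓ hP hφ

end Comparison

end ProjQuant

end

noncomputable section

namespace ProjQuant

/-! ## The quantization formula with explicit indices -/

/-- Symmetry of a tensor of degree three. -/
def Symm3 {n : ℕ} {R : Type*} (p : Fin n → Fin n → Fin n → R) : Prop :=
  (∀ i j k, p i j k = p j i k) ∧ (∀ i j k, p i j k = p i k j)

theorem symm3_of_perm {n : ℕ} {R : Type*} {P : (Fin 3 → Fin n) → R}
    (hP : ∀ I, ∀ σ : Equiv.Perm (Fin 3), P (I ∘ σ) = P I) :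
    Symm3 (fun i j k => P ![i, j, k]) := by
  constructor
  · intro i j k
    dsimp only
    rw [← hP ![j, i, k] (Equiv.swap 0 1)]
    congr 1
    funext s
    fin_cases s <;> simp [Equiv.swap_apply_def]
  · intro i j k
    dsimp only
    rw [← hP ![i, k, j] (Equiv.swap 1 2)]
    congr 1
    funext s
    fin_cases s <;> simp [Equiv.swap_apply_def]

theorem update_vec3_zero {α : Type*} (i j k m : α) :
    Function.update ![i, j, k] 0 m = ![m, j, k] := by
  funext s; fin_cases s <;> rfl
theorem update_vec3_one {α : Type*} (i j k m : α) :
    Function.update ![i, j, k] 1 m = ![i, m, k] := by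
  funext s; fin_cases s <;> rfl
theorem update_vec3_two {α : Type*} (i j k m : α) :
    Function.update ![i, j, k] 2 m = ![i, j, m] := by
  funext s; fin_cases s <;> rfl
theorem update_vec2_zero {α : Type*} (i j m : α) :
    Function.update ![i, j] 0 m = ![m, j] := by
  funext s; fin_cases s <;> rfl
theorem update_vec2_one {α : Type*} (i j m : α) :
    Function.update ![i, j] 1 m = ![i, m] := by
  funext s; fin_cases s <;> rfl
theorem update_vec1 {α : Type*} (i m : α) :
    Function.update ![i] 0 m = ![m] := by
  funext s; fin_cases s; rfl


section Explicit

variable {n : ℕ} {R : Type*} [CommRing R] [Algebra ℝ R]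
  (D : Fin n → Derivation ℝ R R) (Γ : Fin n → Fin n → Fin n → R) (w : R)

/-- The trace `Γ^m_{im}`. -/
def traceΓ (Γ : Fin n → Fin n → Fin n → R) (i : Fin n) : R := ∑ m, Γ m i m

/-- Covariant derivative of a density. -/
def cov0 (f : R) (i : Fin n) : R := D i f - w * traceΓ Γ i * f

/-- Covariant derivative of a covector. -/
def cov1 (T : Fin n → R) (i j : Fin n) : R :=
  D i (T j) - ∑ m, Γ m i j * T m - w * traceΓ Γ i * T j

/-- Covariant derivative of a covariant 2-tensor. -/
def cov2 (T : Fin n → Fin n → R) (i j k : Fin n) : R :=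
  D i (T j k) - ∑ m, Γ m i j * T m k - ∑ m, Γ m i k * T j m - w * traceΓ Γ i * T j k

/-- Divergence of a vector. -/
def div1 (V : Fin n → R) : R :=
  ∑ i, (D i (V i) + ∑ m, Γ i i m * V m - w * traceΓ Γ i * V i)

/-- Divergence of a contravariant 2-tensor. -/
def div2 (B : Fin n → Fin n → R) (j : Fin n) : R :=
  ∑ i, (D i (B i j) + ∑ m, Γ i i m * B m j + ∑ m, Γ j i m * B i m - w * traceΓ Γ i * B i j)

/-- Divergence of a contravariant 3-tensor. -/
def div3 (p : Fin n → Fin n → Fin n → R) (j k : Fin n) : R :=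
  ∑ i, (D i (p i j k) + ∑ m, Γ i i m * p m j k + ∑ m, Γ j i m * p i m k + ∑ m, Γ k i m * p i j m
    - w * traceΓ Γ i * p i j k)

/-- Full contraction of vectors with covectors. -/
def ctr1 (V : Fin n → R) (T : Fin n → R) : R := ∑ i, V i * T i

/-- Full contraction of 2-tensors. -/
def ctr2 (B T : Fin n → Fin n → R) : R := ∑ i, ∑ j, B i j * T i j

/-- Full contraction of 3-tensors. -/
def ctr3 (p T : Fin n → Fin n → Fin n → R) : R := ∑ i, ∑ j, ∑ k, p i j k * T i j k

/-- The quantization formula with explicit indices. -/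
def quantE (κ : QuantCoeffs R) (p : Fin n → Fin n → Fin n → R) (f : R) : R :=
  let f₁ := cov0 D Γ κ.lam f
  let f₂ := cov1 D Γ κ.lam f₁
  let f₃ := cov2 D Γ κ.lam f₂
  let p₂ := div3 D Γ κ.δ p
  let p₁ := div2 D Γ κ.δ p₂
  let p₀ := div1 D Γ κ.δ p₁
  let S := ricciA D Γ
  ctr3 p f₃ + κ.α * ctr2 p₂ f₂ + κ.β₁ * ctr1 p₁ f₁ + κ.β₂ * ctr3 p (fun i j k => S i j * f₁ k)
    + (κ.η₁ * p₀ + κ.η₂ * ctr2 p₂ S + κ.η₃ * ctr3 p (cov2 D Γ 0 S)) * f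

variable {D Γ w}

theorem covA_zero_zero (T : (Fin 0 → Fin n) → (Fin 0 → Fin n) → R) (i : Fin n) :
    covA D Γ w T ![] ![i] = cov0 D Γ w (T ![] ![]) i := by
  simp [covA, cov0, traceΓ]

theorem covA_zero_one (T : (Fin 0 → Fin n) → (Fin 1 → Fin n) → R) (i j : Fin n) :
    covA D Γ w T ![] ![i, j] = cov1 D Γ w (fun j => T ![] ![j]) i j := by
  simp [covA, cov1, traceΓ, update_vec1]

theorem covA_zero_two (T : (Fin 0 → Fin n) → (Fin 2 → Fin n) → R) (i j k : Fin n) :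
    covA D Γ w T ![] ![i, j, k] = cov2 D Γ w (fun j k => T ![] ![j, k]) i j k := by
  simp [covA, cov2, traceΓ, update_vec2_zero, update_vec2_one, Fin.sum_univ_two]
  ring

theorem covA_three_zero (T : (Fin 3 → Fin n) → (Fin 0 → Fin n) → R) (i j k a : Fin n) :
    covA D Γ w T ![i, j, k] ![a] = D a (T ![i, j, k] ![])
      + ∑ m, Γ i a m * T ![m, j, k] ![] + ∑ m, Γ j a m * T ![i, m, k] ![]
      + ∑ m, Γ k a m * T ![i, j, m] ![] - w * traceΓ Γ a * T ![i, j, k] ![] := by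
  simp [covA, traceΓ, update_vec3_zero, update_vec3_one, update_vec3_two,
    Fin.sum_univ_three]
  ring

theorem covA_three_one (T : (Fin 3 → Fin n) → (Fin 1 → Fin n) → R) (i j k a b : Fin n) :
    covA D Γ w T ![i, j, k] ![a, b] = D a (T ![i, j, k] ![b])
      + ∑ m, Γ i a m * T ![m, j, k] ![b] + ∑ m, Γ j a m * T ![i, m, k] ![b]
      + ∑ m, Γ k a m * T ![i, j, m] ![b] - ∑ m, Γ m a b * T ![i, j, k] ![m]
      - w * traceΓ Γ a * T ![i, j, k] ![b] := by
  simp [covA, traceΓ, update_vec3_zero, update_vec3_one, update_vec3_two,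
    Fin.sum_univ_three, update_vec1]
  ring

theorem covA_three_two (T : (Fin 3 → Fin n) → (Fin 2 → Fin n) → R) (i j k a b c : Fin n) :
    covA D Γ w T ![i, j, k] ![a, b, c] = D a (T ![i, j, k] ![b, c])
      + ∑ m, Γ i a m * T ![m, j, k] ![b, c] + ∑ m, Γ j a m * T ![i, m, k] ![b, c]
      + ∑ m, Γ k a m * T ![i, j, m] ![b, c] - ∑ m, Γ m a b * T ![i, j, k] ![m, c]
      - ∑ m, Γ m a c * T ![i, j, k] ![b, m]
      - w * traceΓ Γ a * T ![i, j, k] ![b, c] := by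
  simp [covA, traceΓ, update_vec3_zero, update_vec3_one, update_vec3_two,
    Fin.sum_univ_three, Fin.sum_univ_two, update_vec2_zero, update_vec2_one]
  ring

section Contraction

variable (D Γ w) in
/-- Contracting two indices of the covariant derivative of a tensor of type `(3, 1)`. -/
theorem sum_covA_three_one (T : (Fin 3 → Fin n) → (Fin 1 → Fin n) → R) (k : Fin n)
    (B : Fin n → Fin n → R) (hB : ∀ i k, B i k = ∑ j, T ![i, j, k] ![j]) :
    ∑ i, ∑ j, covA D Γ w T ![i, j, k] ![i, j] = div2 D Γ w B k := by
  simp only [div2, covA_three_one]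
  refine Finset.sum_congr rfl fun i _ => ?_
  -- Once `j` is contracted, the Christoffel term of its upper slot equals that of its lower slot.
  -- The two enter with opposite signs, so the contraction commutes with the covariant derivative.
  have e : ∑ j, ∑ m, Γ j i m * T ![i, m, k] ![j] = ∑ j, ∑ m, Γ m i j * T ![i, j, k] ![m] :=
    Finset.sum_comm
  have e1 : ∑ j, ∑ m, Γ i i m * T ![m, j, k] ![j] = ∑ m, Γ i i m * B m k := by
    rw [Finset.sum_comm]
    exact Finset.sum_congr rfl fun m _ => by rw [hB, Finset.mul_sum]
  have e2 : ∑ j, ∑ m, Γ k i m * T ![i, j, m] ![j] = ∑ m, Γ k i m * B i m := by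
    rw [Finset.sum_comm]
    exact Finset.sum_congr rfl fun m _ => by rw [hB, Finset.mul_sum]
  simp only [Finset.sum_add_distrib, Finset.sum_sub_distrib]
  rw [e, e1, e2, hB i k, map_sum, Finset.mul_sum]
  ring

variable (D Γ w) in
/-- Contracting all indices of the covariant derivative of a tensor of type `(3, 2)`. -/
theorem sum_covA_three_two (T : (Fin 3 → Fin n) → (Fin 2 → Fin n) → R)
    (V : Fin n → R) (hV : ∀ i, V i = ∑ j, ∑ k, T ![i, j, k] ![j, k]) :
    ∑ i, ∑ j, ∑ k, covA D Γ w T ![i, j, k] ![i, j, k] = div1 D Γ w V := by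
  simp only [div1, covA_three_two]
  refine Finset.sum_congr rfl fun i _ => ?_
  have e : ∑ j, ∑ k, ∑ m, Γ j i m * T ![i, m, k] ![j, k]
      = ∑ j, ∑ k, ∑ m, Γ m i j * T ![i, j, k] ![m, k] := by
    simp only [Finset.sum_comm (s := (Finset.univ : Finset (Fin n))) (t := Finset.univ)
      (f := fun k m => _ * T ![i, m, k] _)]
    rw [Finset.sum_comm]
    exact Finset.sum_congr rfl fun m _ => Finset.sum_comm
  have e' : ∑ j, ∑ k, ∑ m, Γ k i m * T ![i, j, m] ![j, k]
      = ∑ j, ∑ k, ∑ m, Γ m i k * T ![i, j, k] ![j, m] :=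
    Finset.sum_congr rfl fun j _ => Finset.sum_comm
  have e1 : ∑ j, ∑ k, ∑ m, Γ i i m * T ![m, j, k] ![j, k] = ∑ m, Γ i i m * V m := by
    have : ∀ j, ∑ k, ∑ m, Γ i i m * T ![m, j, k] ![j, k]
        = ∑ m, ∑ k, Γ i i m * T ![m, j, k] ![j, k] := fun j => Finset.sum_comm
    simp only [this]
    rw [Finset.sum_comm]
    exact Finset.sum_congr rfl fun m _ => by simp only [hV, Finset.mul_sum]
  simp only [Finset.sum_add_distrib, Finset.sum_sub_distrib]
  rw [e, e', e1, hV i]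
  simp only [map_sum, Finset.mul_sum]
  ring

end Contraction

/-- The symmetry of `P` passes to its covariant derivatives, so it is immaterial which upper index
meets a given derivative index. All contractions of derivatives of `P` then become iterated
divergences, and tensors with both upper and lower indices disappear from the invariance and
equivariance computations. -/
theorem quantA_eq_quantE (κ : QuantCoeffs R) {P : (Fin 3 → Fin n) → R}
    (hP : Symm3 (fun i j k => P ![i, j, k])) (f : R) :
    quantA κ D Γ P f = quantE D Γ κ (fun i j k => P ![i, j, k]) f := by
  obtain ⟨h12, h23⟩ := hP
  dsimp only at h12 h23
  have hp₂ : ∀ j k, div3 D Γ κ.δ (fun i j k => P ![i, j, k]) j k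
      = ∑ i, covA D Γ κ.δ (fun I (_ : Fin 0 → Fin n) => P I) ![i, j, k] ![i] := by
    intro j k
    simp only [div3, covA_three_zero]
  have hs : ∀ i j k a, covA D Γ κ.δ (fun I (_ : Fin 0 → Fin n) => P I) ![i, j, k] ![a]
      = covA D Γ κ.δ (fun I (_ : Fin 0 → Fin n) => P I) ![j, i, k] ![a] := by
    intro i j k a
    simp only [covA_three_zero]
    rw [h12 i j k]
    simp only [fun m => h12 m j k, fun m => h12 i m k, fun m => h12 i j m]
    ring
  have hs' : ∀ i j k a, covA D Γ κ.δ (fun I (_ : Fin 0 → Fin n) => P I) ![i, j, k] ![a]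
      = covA D Γ κ.δ (fun I (_ : Fin 0 → Fin n) => P I) ![i, k, j] ![a] := by
    intro i j k a
    simp only [covA_three_zero]
    rw [h23 i j k]
    simp only [fun m => h23 m j k, fun m => h23 i m k, fun m => h23 i j m]
    ring
  have hp₂' : ∀ i k, div3 D Γ κ.δ (fun i j k => P ![i, j, k]) i k
      = ∑ j, covA D Γ κ.δ (fun I (_ : Fin 0 → Fin n) => P I) ![i, j, k] ![j] := by
    intro i k
    rw [hp₂]
    exact Finset.sum_congr rfl fun j _ => hs _ _ _ _
  have hp₂'' : ∀ i j, div3 D Γ κ.δ (fun i j k => P ![i, j, k]) i j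
      = ∑ k, covA D Γ κ.δ (fun I (_ : Fin 0 → Fin n) => P I) ![i, j, k] ![k] := by
    intro i k
    rw [hp₂']
    exact Finset.sum_congr rfl fun j _ => hs' _ _ _ _
  have hp₁ := fun k => sum_covA_three_one D Γ κ.δ
    (covA D Γ κ.δ (fun I (_ : Fin 0 → Fin n) => P I)) k _ hp₂'
  have hp₁' : ∀ i, div2 D Γ κ.δ (div3 D Γ κ.δ (fun i j k => P ![i, j, k])) i
      = ∑ j, ∑ k, covA D Γ κ.δ (covA D Γ κ.δ (fun I (_ : Fin 0 → Fin n) => P I))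
          ![i, j, k] ![j, k] := by
    intro i
    rw [← hp₁]
    -- The formula contracts the first two indices of the second derivative, whereas peeling off the
    -- outermost divergence of the third leaves the last two contracted; cyclic symmetry in the
    -- upper indices reconciles them.
    have hperm : ∀ a b : Fin n, ∀ i j k,
        covA D Γ κ.δ (covA D Γ κ.δ (fun I (_ : Fin 0 → Fin n) => P I)) ![j, k, i] ![a, b]
        = covA D Γ κ.δ (covA D Γ κ.δ (fun I (_ : Fin 0 → Fin n) => P I)) ![i, j, k] ![a, b] := by
      intro a b i j k
      have hc : ∀ i j k a, covA D Γ κ.δ (fun I (_ : Fin 0 → Fin n) => P I) ![j, k, i] ![a]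
          = covA D Γ κ.δ (fun I (_ : Fin 0 → Fin n) => P I) ![i, j, k] ![a] := by
        intro i j k a
        rw [hs i j k, hs' j i k]
      simp only [covA_three_one, fun m => hc m j k, fun m => hc i m k, fun m => hc i j m]
      ring
    exact Finset.sum_congr rfl fun j _ => Finset.sum_congr rfl fun k _ => hperm _ _ _ _ _
  have hp₀ := sum_covA_three_two D Γ κ.δ
    (covA D Γ κ.δ (covA D Γ κ.δ (fun I (_ : Fin 0 → Fin n) => P I))) _ hp₁'
  have c1 : ∀ F : Fin n → Fin n → R, ∑ i, ∑ j, ∑ k,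
      κ.α * covA D Γ κ.δ (fun I (_ : Fin 0 → Fin n) => P I) ![i, j, k] ![k] * F i j
      = κ.α * ctr2 (div3 D Γ κ.δ (fun i j k => P ![i, j, k])) F := by
    intro F
    simp only [ctr2, hp₂'', Finset.mul_sum, Finset.sum_mul, mul_assoc]
  have c2 : ∀ F : Fin n → R, ∑ i, ∑ j, ∑ k,
      κ.β₁ * covA D Γ κ.δ (covA D Γ κ.δ (fun I (_ : Fin 0 → Fin n) => P I))
        ![i, j, k] ![i, j] * F k
      = κ.β₁ * ctr1 (div2 D Γ κ.δ (div3 D Γ κ.δ (fun i j k => P ![i, j, k]))) F := by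
    intro F
    have : ∀ i, ∑ j, ∑ k, κ.β₁ * covA D Γ κ.δ (covA D Γ κ.δ (fun I (_ : Fin 0 → Fin n) => P I))
        ![i, j, k] ![i, j] * F k = ∑ k, ∑ j, κ.β₁ * covA D Γ κ.δ
          (covA D Γ κ.δ (fun I (_ : Fin 0 → Fin n) => P I)) ![i, j, k] ![i, j] * F k :=
      fun i => Finset.sum_comm
    simp only [this]
    rw [Finset.sum_comm]
    simp only [ctr1, ← hp₁, Finset.mul_sum, Finset.sum_mul, mul_assoc]
  have c3 : ∑ i, ∑ j, ∑ k,
      κ.η₁ * covA D Γ κ.δ (covA D Γ κ.δ (covA D Γ κ.δ (fun I (_ : Fin 0 → Fin n) => P I)))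
        ![i, j, k] ![i, j, k] * f
      = κ.η₁ * div1 D Γ κ.δ (div2 D Γ κ.δ (div3 D Γ κ.δ (fun i j k => P ![i, j, k]))) * f := by
    simp only [← hp₀, Finset.mul_sum, Finset.sum_mul]
  have c4 : ∑ i, ∑ j, ∑ k, κ.η₂ * ricciA D Γ i j *
      covA D Γ κ.δ (fun I (_ : Fin 0 → Fin n) => P I) ![i, j, k] ![k] * f
      = κ.η₂ * ctr2 (div3 D Γ κ.δ (fun i j k => P ![i, j, k])) (ricciA D Γ) * f := by
    simp only [ctr2, hp₂'', Finset.mul_sum, Finset.sum_mul]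
    refine Finset.sum_congr rfl fun i _ => Finset.sum_congr rfl fun j _ =>
      Finset.sum_congr rfl fun k _ => by ring
  have c5 : ∑ i, ∑ j, ∑ k, κ.β₂ * P ![i, j, k] * ricciA D Γ i j * cov0 D Γ κ.lam f k
      = κ.β₂ * ctr3 (fun i j k => P ![i, j, k])
        (fun i j k => ricciA D Γ i j * cov0 D Γ κ.lam f k) := by
    simp only [ctr3, Finset.mul_sum, mul_assoc]
  have c6 : ∑ i, ∑ j, ∑ k, κ.η₃ * cov2 D Γ 0 (ricciA D Γ) i j k * P ![i, j, k] * f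
      = κ.η₃ * ctr3 (fun i j k => P ![i, j, k]) (cov2 D Γ 0 (ricciA D Γ)) * f := by
    simp only [ctr3, Finset.mul_sum, Finset.sum_mul]
    refine Finset.sum_congr rfl fun i _ => Finset.sum_congr rfl fun j _ =>
      Finset.sum_congr rfl fun k _ => by ring
  simp only [quantA, quantE, covA_zero_two, covA_zero_one, covA_zero_zero, Matrix.cons_val_zero,
    Matrix.cons_val_one, add_mul, Finset.sum_add_distrib]
  rw [c1, c2, c3, c4, c5, c6]
  simp only [ctr3]
  ring

end Explicit

end ProjQuant

end

noncomputable section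

namespace ProjQuant

/-! ## Product rules -/

section ProductRules

variable {n : ℕ} {R : Type*} [CommRing R] [Algebra ℝ R]
  {D : Fin n → Derivation ℝ R R} {Γ : Fin n → Fin n → Fin n → R} {w : R}

theorem cov1_sub (S T : Fin n → R) (i j : Fin n) :
    cov1 D Γ w (fun j => S j - T j) i j = cov1 D Γ w S i j - cov1 D Γ w T i j := by
  simp only [cov1, map_sub, mul_sub, Finset.sum_sub_distrib]
  ring

theorem cov1_const_mul {c : R} (hc : ∀ i, D i c = 0) (T : Fin n → R) (i j : Fin n) :
    cov1 D Γ w (fun j => c * T j) i j = c * cov1 D Γ w T i j := by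
  simp only [cov1, Derivation.leibniz, hc, smul_eq_mul, mul_sub, Finset.mul_sum]
  simp only [mul_left_comm _ c]
  ring

theorem cov1_mul (θ : Fin n → R) (f : R) (i j : Fin n) :
    cov1 D Γ w (fun j => θ j * f) i j = cov1 D Γ 0 θ i j * f + θ j * cov0 D Γ w f i := by
  simp only [cov1, cov0, Derivation.leibniz, smul_eq_mul, ← mul_assoc, ← Finset.sum_mul]
  ring

theorem cov2_add (S T : Fin n → Fin n → R) (i j k : Fin n) :
    cov2 D Γ w (fun j k => S j k + T j k) i j k = cov2 D Γ w S i j k + cov2 D Γ w T i j k := by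
  simp only [cov2, map_add, mul_add, Finset.sum_add_distrib]
  ring

theorem cov2_sub (S T : Fin n → Fin n → R) (i j k : Fin n) :
    cov2 D Γ w (fun j k => S j k - T j k) i j k = cov2 D Γ w S i j k - cov2 D Γ w T i j k := by
  simp only [cov2, map_sub, mul_sub, Finset.sum_sub_distrib]
  ring

theorem cov2_const_mul {c : R} (hc : ∀ i, D i c = 0) (T : Fin n → Fin n → R) (i j k : Fin n) :
    cov2 D Γ w (fun j k => c * T j k) i j k = c * cov2 D Γ w T i j k := by
  simp only [cov2, Derivation.leibniz, hc, smul_eq_mul, mul_sub, Finset.mul_sum]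
  simp only [mul_left_comm _ c]
  ring

theorem cov2_mul (S : Fin n → Fin n → R) (f : R) (i j k : Fin n) :
    cov2 D Γ w (fun j k => S j k * f) i j k
      = cov2 D Γ 0 S i j k * f + S j k * cov0 D Γ w f i := by
  simp only [cov2, cov0, Derivation.leibniz, smul_eq_mul, ← mul_assoc, ← Finset.sum_mul]
  ring

theorem cov2_outer (θ T : Fin n → R) (i j k : Fin n) :
    cov2 D Γ w (fun j k => θ j * T k) i j k
      = cov1 D Γ 0 θ i j * T k + θ j * cov1 D Γ w T i k := by
  simp only [cov2, cov1, Derivation.leibniz, smul_eq_mul, ← mul_assoc, ← Finset.sum_mul]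
  have : ∑ m, Γ m i k * θ j * T m = θ j * ∑ m, Γ m i k * T m := by
    rw [Finset.mul_sum]; exact Finset.sum_congr rfl fun m _ => by ring
  rw [this]
  ring

theorem cov2_swap (T : Fin n → Fin n → R) (i j k : Fin n) :
    cov2 D Γ w (fun j k => T k j) i j k = cov2 D Γ w T i k j := by
  simp only [cov2]
  ring

theorem div1_add (V V' : Fin n → R) :
    div1 D Γ w (fun i => V i + V' i) = div1 D Γ w V + div1 D Γ w V' := by
  simp only [div1, ← Finset.sum_add_distrib, map_add, mul_add]
  refine Finset.sum_congr rfl fun i _ => ?_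
  simp only [Finset.sum_add_distrib]
  ring

theorem div1_const_mul {c : R} (hc : ∀ i, D i c = 0) (V : Fin n → R) :
    div1 D Γ w (fun i => c * V i) = c * div1 D Γ w V := by
  simp only [div1, Finset.mul_sum, Derivation.leibniz, hc, smul_eq_mul]
  refine Finset.sum_congr rfl fun i _ => ?_
  simp only [mul_left_comm _ c, ← Finset.mul_sum]
  ring

theorem div2_add (B B' : Fin n → Fin n → R) (j : Fin n) :
    div2 D Γ w (fun i j => B i j + B' i j) j = div2 D Γ w B j + div2 D Γ w B' j := by
  simp only [div2, ← Finset.sum_add_distrib, map_add, mul_add]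
  refine Finset.sum_congr rfl fun i _ => ?_
  simp only [Finset.sum_add_distrib]
  ring

theorem div2_const_mul {c : R} (hc : ∀ i, D i c = 0) (B : Fin n → Fin n → R) (j : Fin n) :
    div2 D Γ w (fun i j => c * B i j) j = c * div2 D Γ w B j := by
  simp only [div2, Finset.mul_sum, Derivation.leibniz, hc, smul_eq_mul]
  refine Finset.sum_congr rfl fun i _ => ?_
  simp only [mul_left_comm _ c, ← Finset.mul_sum]
  ring

/-- Product rule for the divergence of a contraction of a covector with a 2-tensor. -/
theorem div1_contract (θ : Fin n → R) (B : Fin n → Fin n → R) :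
    div1 D Γ w (fun j => ∑ i, θ i * B i j)
      = (∑ j, ∑ i, cov1 D Γ 0 θ j i * B i j)
        + ∑ i, θ i * div2 D Γ w (fun a b => B b a) i := by
  have h2 : ∑ i, θ i * div2 D Γ w (fun a b => B b a) i
      = ∑ j, ∑ i, θ i * (D j (B i j) + ∑ m, Γ j j m * B i m + ∑ m, Γ i j m * B m j
        - w * traceΓ Γ j * B i j) := by
    simp only [div2, Finset.mul_sum]
    exact Finset.sum_comm
  rw [h2, div1, ← Finset.sum_add_distrib]
  refine Finset.sum_congr rfl fun j _ => ?_
  have e1 : ∑ m, Γ j j m * ∑ i, θ i * B i m = ∑ i, θ i * ∑ m, Γ j j m * B i m := by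
    simp only [Finset.mul_sum]
    rw [Finset.sum_comm]
    exact Finset.sum_congr rfl fun i _ => Finset.sum_congr rfl fun m _ => by ring
  have e2 : ∑ i, (∑ m, Γ m j i * θ m) * B i j = ∑ i, θ i * ∑ m, Γ i j m * B m j := by
    simp only [Finset.mul_sum, Finset.sum_mul]
    rw [Finset.sum_comm]
    exact Finset.sum_congr rfl fun i _ => Finset.sum_congr rfl fun m _ => by ring
  have e3 : ∀ i, cov1 D Γ 0 θ j i * B i j
      = D j (θ i) * B i j - (∑ m, Γ m j i * θ m) * B i j := by
    intro i; simp only [cov1]; ring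
  simp only [e3, Finset.sum_sub_distrib, e2, mul_add, mul_sub, Finset.sum_add_distrib]
  rw [e1, map_sum, Finset.mul_sum]
  simp only [Derivation.leibniz, smul_eq_mul, Finset.sum_add_distrib]
  have e4 : ∑ i, θ i * (w * traceΓ Γ j * B i j) = ∑ i, w * traceΓ Γ j * (θ i * B i j) :=
    Finset.sum_congr rfl fun i _ => by ring
  have e5 : ∑ i, D j (θ i) * B i j = ∑ i, B i j * D j (θ i) :=
    Finset.sum_congr rfl fun i _ => by ring
  rw [e4, e5]
  ring

/-- Product rule for the divergence of a contraction of a covector with a 3-tensor. -/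
theorem div2_contract (θ : Fin n → R) {p : Fin n → Fin n → Fin n → R} (hp : Symm3 p)
    (k : Fin n) :
    div2 D Γ w (fun j k => ∑ i, θ i * p i j k) k
      = (∑ j, ∑ i, cov1 D Γ 0 θ j i * p i j k) + ∑ i, θ i * div3 D Γ w p i k := by
  have h2 : ∑ i, θ i * div3 D Γ w p i k
      = ∑ j, ∑ i, θ i * (D j (p i j k) + ∑ m, Γ j j m * p i m k + ∑ m, Γ i j m * p m j k
        + ∑ m, Γ k j m * p i j m - w * traceΓ Γ j * p i j k) := by
    simp only [div3, Finset.mul_sum]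
    rw [Finset.sum_comm]
    refine Finset.sum_congr rfl fun j _ => Finset.sum_congr rfl fun i _ => ?_
    rw [hp.1 j i k]
    simp only [fun m => hp.1 m i k, fun m => hp.1 j m k, fun m => hp.1 j i m]
  rw [h2, div2, ← Finset.sum_add_distrib]
  refine Finset.sum_congr rfl fun j _ => ?_
  have e1 : ∑ m, Γ j j m * ∑ i, θ i * p i m k = ∑ i, θ i * ∑ m, Γ j j m * p i m k := by
    simp only [Finset.mul_sum]
    rw [Finset.sum_comm]
    exact Finset.sum_congr rfl fun i _ => Finset.sum_congr rfl fun m _ => by ring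
  have e1' : ∑ m, Γ k j m * ∑ i, θ i * p i j m = ∑ i, θ i * ∑ m, Γ k j m * p i j m := by
    simp only [Finset.mul_sum]
    rw [Finset.sum_comm]
    exact Finset.sum_congr rfl fun i _ => Finset.sum_congr rfl fun m _ => by ring
  have e2 : ∑ i, (∑ m, Γ m j i * θ m) * p i j k = ∑ i, θ i * ∑ m, Γ i j m * p m j k := by
    simp only [Finset.mul_sum, Finset.sum_mul]
    rw [Finset.sum_comm]
    exact Finset.sum_congr rfl fun i _ => Finset.sum_congr rfl fun m _ => by ring
  have e3 : ∀ i, cov1 D Γ 0 θ j i * p i j k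
      = D j (θ i) * p i j k - (∑ m, Γ m j i * θ m) * p i j k := by
    intro i; simp only [cov1]; ring
  simp only [e3, Finset.sum_sub_distrib, e2, mul_add, mul_sub, Finset.sum_add_distrib]
  rw [e1, e1', map_sum, Finset.mul_sum]
  simp only [Derivation.leibniz, smul_eq_mul, Finset.sum_add_distrib]
  have e4 : ∑ i, θ i * (w * traceΓ Γ j * p i j k) = ∑ i, w * traceΓ Γ j * (θ i * p i j k) :=
    Finset.sum_congr rfl fun i _ => by ring
  have e5 : ∑ i, D j (θ i) * p i j k = ∑ i, p i j k * D j (θ i) :=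
    Finset.sum_congr rfl fun i _ => by ring
  rw [e4, e5]
  ring

/-- Product rule for the divergence of a contraction of a 2-tensor with a 3-tensor. -/
theorem div1_contract₂ (S : Fin n → Fin n → R) (p : Fin n → Fin n → Fin n → R) :
    div1 D Γ w (fun k => ∑ i, ∑ j, S i j * p k i j)
      = (∑ k, ∑ i, ∑ j, cov2 D Γ 0 S k i j * p k i j)
        + ∑ i, ∑ j, S i j * div3 D Γ w p i j := by
  have h2 : ∑ i, ∑ j, S i j * div3 D Γ w p i j
      = ∑ k, ∑ i, ∑ j, S i j * (D k (p k i j) + ∑ m, Γ k k m * p m i j + ∑ m, Γ i k m * p k m j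
        + ∑ m, Γ j k m * p k i m - w * traceΓ Γ k * p k i j) := by
    simp only [div3, Finset.mul_sum]
    rw [Finset.sum_comm (s := Finset.univ (α := Fin n)) (t := Finset.univ (α := Fin n))]
    rw [← Finset.sum_comm]
    have : ∀ i, ∑ j, ∑ k, S i j * (D k (p k i j) + ∑ m, Γ k k m * p m i j
        + ∑ m, Γ i k m * p k m j + ∑ m, Γ j k m * p k i m - w * traceΓ Γ k * p k i j)
        = ∑ k, ∑ j, S i j * (D k (p k i j) + ∑ m, Γ k k m * p m i j
        + ∑ m, Γ i k m * p k m j + ∑ m, Γ j k m * p k i m - w * traceΓ Γ k * p k i j) :=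
      fun i => Finset.sum_comm
    simp only [this]
    exact Finset.sum_comm
  rw [h2, div1, ← Finset.sum_add_distrib]
  refine Finset.sum_congr rfl fun k _ => ?_
  have e1 : ∑ m, Γ k k m * ∑ i, ∑ j, S i j * p m i j
      = ∑ i, ∑ j, S i j * ∑ m, Γ k k m * p m i j := by
    simp only [Finset.mul_sum]
    rw [Finset.sum_comm]
    refine Finset.sum_congr rfl fun i _ => ?_
    rw [Finset.sum_comm]
    exact Finset.sum_congr rfl fun i _ => Finset.sum_congr rfl fun m _ => by ring
  have e2 : ∑ i, ∑ j, (∑ m, Γ m k i * S m j) * p k i j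
      = ∑ i, ∑ j, S i j * ∑ m, Γ i k m * p k m j := by
    rw [Finset.sum_comm]
    conv_rhs => rw [Finset.sum_comm]
    refine Finset.sum_congr rfl fun j _ => ?_
    simp only [Finset.mul_sum, Finset.sum_mul]
    rw [Finset.sum_comm]
    exact Finset.sum_congr rfl fun i _ => Finset.sum_congr rfl fun m _ => by ring
  have e2' : ∑ i, ∑ j, (∑ m, Γ m k j * S i m) * p k i j
      = ∑ i, ∑ j, S i j * ∑ m, Γ j k m * p k i m := by
    refine Finset.sum_congr rfl fun j _ => ?_
    simp only [Finset.mul_sum, Finset.sum_mul]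
    rw [Finset.sum_comm]
    exact Finset.sum_congr rfl fun i _ => Finset.sum_congr rfl fun m _ => by ring
  have e3 : ∀ i j, cov2 D Γ 0 S k i j * p k i j
      = D k (S i j) * p k i j - (∑ m, Γ m k i * S m j) * p k i j
        - (∑ m, Γ m k j * S i m) * p k i j := by
    intro i j; simp only [cov2]; ring
  simp only [e3, Finset.sum_sub_distrib, e2, e2', mul_add, mul_sub, Finset.sum_add_distrib]
  rw [e1]
  simp only [map_sum, Finset.mul_sum, Derivation.leibniz, smul_eq_mul, Finset.sum_add_distrib]
  have e4 : ∑ i, ∑ j, S i j * (w * traceΓ Γ k * p k i j)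
      = ∑ i, ∑ j, w * traceΓ Γ k * (S i j * p k i j) :=
    Finset.sum_congr rfl fun i _ => Finset.sum_congr rfl fun i _ => by ring
  have e5 : ∑ i, ∑ j, D k (S i j) * p k i j = ∑ i, ∑ j, p k i j * D k (S i j) :=
    Finset.sum_congr rfl fun i _ => Finset.sum_congr rfl fun i _ => by ring
  rw [e4, e5]
  ring

end ProductRules

end ProjQuant

end

noncomputable section

namespace ProjQuant

/-! ## Projective change of the connection -/

section ProjectiveChange

/-- The Christoffel symbols after the projective change by `θ`. -/
def projChange {n : ℕ} {R : Type*} [CommRing R] (Γ : Fin n → Fin n → Fin n → R) (θ : Fin n → R) : Fin n → Fin n → Fin n → R :=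
  fun k i j => Γ k i j + (if k = i then θ j else 0) + (if k = j then θ i else 0)

/-- The term `δ^m_m θ_i` contributes `n θ_i` and the term `δ^m_i θ_m` one more. This is the origin
of every factor `w (n + 1)` below. -/
theorem traceΓ_projChange {n : ℕ} {R : Type*} [CommRing R] (Γ : Fin n → Fin n → Fin n → R)
    (θ : Fin n → R) (i : Fin n) :
    traceΓ (projChange Γ θ) i = traceΓ Γ i + (n + 1) * θ i := by
  simp [traceΓ, projChange, Finset.sum_add_distrib]
  ring

variable {n : ℕ} {R : Type*} [CommRing R] [Algebra ℝ R]
  {D : Fin n → Derivation ℝ R R} {Γ : Fin n → Fin n → Fin n → R} {θ : Fin n → R} {w : R}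

theorem cov0_projChange (f : R) (i : Fin n) :
    cov0 D (projChange Γ θ) w f i = cov0 D Γ w f i - w * (n + 1) * (θ i * f) := by
  simp only [cov0, traceΓ_projChange]
  ring

theorem cov1_projChange (T : Fin n → R) (i j : Fin n) :
    cov1 D (projChange Γ θ) w T i j
      = cov1 D Γ w T i j - θ j * T i - (1 + w * (n + 1)) * (θ i * T j) := by
  simp only [cov1, traceΓ_projChange]
  simp [projChange, add_mul, Finset.sum_add_distrib]
  ring

theorem cov2_projChange (T : Fin n → Fin n → R) (i j k : Fin n) :
    cov2 D (projChange Γ θ) w T i j k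
      = cov2 D Γ w T i j k - θ j * T i k - θ k * T j i
        - (2 + w * (n + 1)) * (θ i * T j k) := by
  simp only [cov2, traceΓ_projChange]
  simp [projChange, add_mul, Finset.sum_add_distrib]
  ring

/-- The trace over the contracted index yields `n + 1` copies of `θ` and the weight removes `w (n +
1)` of them. In `div2_projChange` and `div3_projChange` every free index of the symmetric tensor
adds two more copies, one from each of the two terms of the projective change. -/
theorem div1_projChange (V : Fin n → R) :
    div1 D (projChange Γ θ) w V = div1 D Γ w V + (1 - w) * (n + 1) * ∑ i, θ i * V i := by
  have h : ∀ i, ∑ m, projChange Γ θ i i m * V m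
      = ∑ m, Γ i i m * V m + ∑ m, θ m * V m + θ i * V i := by
    intro i
    simp [projChange, add_mul, Finset.sum_add_distrib]
  simp only [div1, traceΓ_projChange, h, Finset.sum_add_distrib, Finset.sum_sub_distrib]
  simp only [Finset.sum_const, Finset.card_univ, Fintype.card_fin, nsmul_eq_mul, mul_add, add_mul,
    Finset.sum_add_distrib, Finset.mul_sum]
  simp only [← Finset.mul_sum, mul_assoc]
  ring

theorem div2_projChange {B : Fin n → Fin n → R} (hB : ∀ i j, B i j = B j i) (j : Fin n) :
    div2 D (projChange Γ θ) w B j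
      = div2 D Γ w B j + (2 + (1 - w) * (n + 1)) * ∑ i, θ i * B i j := by
  have h : ∀ i, ∑ m, projChange Γ θ i i m * B m j
      = ∑ m, Γ i i m * B m j + ∑ m, θ m * B m j + θ i * B i j := by
    intro i
    simp [projChange, add_mul, Finset.sum_add_distrib]
  have h' : ∀ i, ∑ m, projChange Γ θ j i m * B i m
      = ∑ m, Γ j i m * B i m + (if j = i then ∑ m, θ m * B i m else 0) + θ i * B i j := by
    intro i
    by_cases e : j = i <;> simp [projChange, add_mul, Finset.sum_add_distrib, e]
  have h'' : ∑ m, θ m * B j m = ∑ m, θ m * B m j :=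
    Finset.sum_congr rfl fun m _ => by rw [hB]
  simp only [div2, traceΓ_projChange, h, h', Finset.sum_add_distrib, Finset.sum_sub_distrib,
    Finset.sum_ite_eq, Finset.mem_univ, if_true, h'']
  simp only [Finset.sum_const, Finset.card_univ, Fintype.card_fin, nsmul_eq_mul, mul_add, add_mul,
    Finset.sum_add_distrib, Finset.mul_sum]
  simp only [← Finset.mul_sum, mul_assoc]
  ring

theorem div3_projChange {p : Fin n → Fin n → Fin n → R} (hp : Symm3 p) (j k : Fin n) :
    div3 D (projChange Γ θ) w p j k
      = div3 D Γ w p j k + (4 + (1 - w) * (n + 1)) * ∑ i, θ i * p i j k := by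
  have h : ∀ i, ∑ m, projChange Γ θ i i m * p m j k
      = ∑ m, Γ i i m * p m j k + ∑ m, θ m * p m j k + θ i * p i j k := by
    intro i
    simp [projChange, add_mul, Finset.sum_add_distrib]
  have h1 : ∀ i, ∑ m, projChange Γ θ j i m * p i m k
      = ∑ m, Γ j i m * p i m k + (if j = i then ∑ m, θ m * p i m k else 0) + θ i * p i j k := by
    intro i
    by_cases e : j = i <;> simp [projChange, add_mul, Finset.sum_add_distrib, e]
  have h2 : ∀ i, ∑ m, projChange Γ θ k i m * p i j m
      = ∑ m, Γ k i m * p i j m + (if k = i then ∑ m, θ m * p i j m else 0) + θ i * p i j k := by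
    intro i
    by_cases e : k = i <;> simp [projChange, add_mul, Finset.sum_add_distrib, e]
  have h1' : ∑ m, θ m * p j m k = ∑ m, θ m * p m j k :=
    Finset.sum_congr rfl fun m _ => by rw [hp.1]
  have h2' : ∑ m, θ m * p k j m = ∑ m, θ m * p m j k :=
    Finset.sum_congr rfl fun m _ => by rw [hp.1 m j k, hp.2 j m k, hp.1 j k m]
  simp only [div3, traceΓ_projChange, h, h1, h2, Finset.sum_add_distrib, Finset.sum_sub_distrib,
    Finset.sum_ite_eq, Finset.mem_univ, if_true, h1', h2']
  simp only [Finset.sum_const, Finset.card_univ, Fintype.card_fin, nsmul_eq_mul, mul_add, add_mul,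
    Finset.sum_add_distrib, Finset.mul_sum]
  simp only [← Finset.mul_sum, mul_assoc]
  ring

/-- Symmetry of `Γ` lets the mixed terms in `Γ` and `θ` combine into covariant derivatives of `θ`.
Since `∇θ` need not be symmetric, its two transposes occur with the coefficients `n` and `-1`;
against a symmetric tensor they merge into `n - 1`, which is the denominator in `β₂`, `η₂` and `η₃`.
-/
theorem ricciA_projChange (hΓ : ∀ k i j, Γ k i j = Γ k j i) (i j : Fin n) :
    ricciA D (projChange Γ θ) i j
      = ricciA D Γ i j + n * cov1 D Γ 0 θ i j - cov1 D Γ 0 θ j i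
        - (n - 1) * (θ i * θ j) := by
  have expand : ∀ G : Fin n → Fin n → Fin n → R, ricciA D G i j
      = D i (∑ k, G k k j) - ∑ k, D k (G k i j) + ∑ k, ∑ m, G k i m * G m k j
        - ∑ m, (∑ k, G k k m) * G m i j := by
    intro G
    have : ∑ m, (∑ k, G k k m) * G m i j = ∑ k, ∑ m, G k k m * G m i j := by
      simp only [Finset.sum_mul]; exact Finset.sum_comm
    rw [this]
    simp only [ricciA, Finset.sum_add_distrib, Finset.sum_sub_distrib, map_sum]
    ring
  have t : ∀ j, ∑ k, projChange Γ θ k k j = ∑ k, Γ k k j + (n + 1) * θ j := by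
    intro j
    simp [projChange, Finset.sum_add_distrib]
    ring
  have d : ∑ k, D k (projChange Γ θ k i j) = ∑ k, D k (Γ k i j) + D i (θ j) + D j (θ i) := by
    have : ∀ k, D k (projChange Γ θ k i j) = D k (Γ k i j) + (if k = i then D k (θ j) else 0)
        + (if k = j then D k (θ i) else 0) := by
      intro k
      simp only [projChange, map_add]
      congr 1
      · congr 1
        split_ifs <;> simp
      · split_ifs <;> simp
    simp [this, Finset.sum_add_distrib]
  have q1 : ∀ k, ∑ m, projChange Γ θ k i m * projChange Γ θ m k j
      = ∑ m, Γ k i m * Γ m k j + Γ k i k * θ j + Γ k i j * θ k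
        + (if k = i then ∑ m, θ m * Γ m k j + θ k * θ j + θ j * θ k else 0)
        + θ i * Γ k k j + θ i * θ j + (if k = j then θ i * θ k else 0) := by
    intro k
    simp only [projChange]
    rcases eq_or_ne k i with rfl | e <;> rcases eq_or_ne k j with rfl | e' <;>
      simp [*, add_mul, mul_add, Finset.sum_add_distrib] <;> ring
  have q2 : ∑ m, (∑ k, projChange Γ θ k k m) * projChange Γ θ m i j
      = ∑ m, (∑ k, Γ k k m) * Γ m i j + (∑ k, Γ k k i) * θ j + (∑ k, Γ k k j) * θ i
        + (n + 1) * ∑ m, Γ m i j * θ m + (n + 1) * θ i * θ j + (n + 1) * θ j * θ i := by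
    simp only [t]
    simp only [projChange, add_mul, mul_add, Finset.sum_add_distrib, Finset.mul_sum]
    simp [mul_comm, mul_left_comm, mul_assoc]
    ring
  have s1 : ∑ k, Γ k i k = ∑ k, Γ k k i := Finset.sum_congr rfl fun k _ => hΓ _ _ _
  have s2 : ∑ m, Γ m j i * θ m = ∑ m, Γ m i j * θ m :=
    Finset.sum_congr rfl fun m _ => by rw [hΓ]
  have s3 : ∑ m, θ m * Γ m i j = ∑ m, Γ m i j * θ m :=
    Finset.sum_congr rfl fun m _ => mul_comm _ _
  rw [expand, expand, d, q2, t]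
  simp only [q1, Finset.sum_add_distrib, ← Finset.sum_mul, ← Finset.mul_sum, s1,
    Finset.sum_ite_eq', Finset.mem_univ, if_true, s3, cov1, s2]
  simp only [map_add, Derivation.leibniz, smul_eq_mul, Finset.sum_const, Finset.card_univ,
    Fintype.card_fin, nsmul_eq_mul, Derivation.map_natCast, Derivation.map_one_eq_zero]
  ring

end ProjectiveChange

end ProjQuant

end

noncomputable section

namespace ProjQuant

/-! ## Projective invariance of the quantization formula -/

section Contractions

variable {n : ℕ} {R : Type*} [CommRing R]

theorem ctr1_add (V T S : Fin n → R) : ctr1 V (fun i => T i + S i) = ctr1 V T + ctr1 V S := by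
  simp [ctr1, mul_add, Finset.sum_add_distrib]

theorem ctr1_sub (V T S : Fin n → R) : ctr1 V (fun i => T i - S i) = ctr1 V T - ctr1 V S := by
  simp [ctr1, mul_sub, Finset.sum_sub_distrib]

theorem ctr1_const_mul (V T : Fin n → R) (c : R) :
    ctr1 V (fun i => c * T i) = c * ctr1 V T := by
  simp [ctr1, Finset.mul_sum, mul_left_comm]

theorem ctr1_mul_const (V T : Fin n → R) (c : R) :
    ctr1 V (fun i => T i * c) = c * ctr1 V T := by
  simp only [mul_comm _ c, ctr1_const_mul]

theorem ctr1_add_left (V V' T : Fin n → R) :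
    ctr1 (fun i => V i + V' i) T = ctr1 V T + ctr1 V' T := by
  simp [ctr1, add_mul, Finset.sum_add_distrib]

theorem ctr1_const_mul_left (V T : Fin n → R) (c : R) :
    ctr1 (fun i => c * V i) T = c * ctr1 V T := by
  simp [ctr1, Finset.mul_sum, mul_assoc]

theorem ctr2_add (B T S : Fin n → Fin n → R) :
    ctr2 B (fun i j => T i j + S i j) = ctr2 B T + ctr2 B S := by
  simp [ctr2, mul_add, Finset.sum_add_distrib]

theorem ctr2_sub (B T S : Fin n → Fin n → R) :
    ctr2 B (fun i j => T i j - S i j) = ctr2 B T - ctr2 B S := by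
  simp [ctr2, mul_sub, Finset.sum_sub_distrib]

theorem ctr2_const_mul (B T : Fin n → Fin n → R) (c : R) :
    ctr2 B (fun i j => c * T i j) = c * ctr2 B T := by
  simp [ctr2, Finset.mul_sum, mul_left_comm]

theorem ctr2_mul_const (B T : Fin n → Fin n → R) (c : R) :
    ctr2 B (fun i j => T i j * c) = c * ctr2 B T := by
  simp only [mul_comm _ c, ctr2_const_mul]

theorem ctr2_add_left (B B' T : Fin n → Fin n → R) :
    ctr2 (fun i j => B i j + B' i j) T = ctr2 B T + ctr2 B' T := by
  simp [ctr2, add_mul, Finset.sum_add_distrib]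

theorem ctr2_const_mul_left (B T : Fin n → Fin n → R) (c : R) :
    ctr2 (fun i j => c * B i j) T = c * ctr2 B T := by
  simp [ctr2, Finset.mul_sum, mul_assoc]

theorem ctr2_swap {B : Fin n → Fin n → R} (hB : ∀ i j, B i j = B j i) (T : Fin n → Fin n → R) :
    ctr2 B (fun i j => T j i) = ctr2 B T := by
  rw [ctr2, Finset.sum_comm]
  exact Finset.sum_congr rfl fun i _ => Finset.sum_congr rfl fun j _ => by rw [hB]

theorem ctr3_add (p T S : Fin n → Fin n → Fin n → R) :
    ctr3 p (fun i j k => T i j k + S i j k) = ctr3 p T + ctr3 p S := by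
  simp [ctr3, mul_add, Finset.sum_add_distrib]

theorem ctr3_sub (p T S : Fin n → Fin n → Fin n → R) :
    ctr3 p (fun i j k => T i j k - S i j k) = ctr3 p T - ctr3 p S := by
  simp [ctr3, mul_sub, Finset.sum_sub_distrib]

theorem ctr3_const_mul (p T : Fin n → Fin n → Fin n → R) (c : R) :
    ctr3 p (fun i j k => c * T i j k) = c * ctr3 p T := by
  simp [ctr3, Finset.mul_sum, mul_left_comm]

theorem ctr3_mul_const (p T : Fin n → Fin n → Fin n → R) (c : R) :
    ctr3 p (fun i j k => T i j k * c) = c * ctr3 p T := by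
  simp only [mul_comm _ c, ctr3_const_mul]

variable {p : Fin n → Fin n → Fin n → R}

theorem ctr3_swap₁₂ (hp : Symm3 p) (T : Fin n → Fin n → Fin n → R) :
    ctr3 p (fun i j k => T j i k) = ctr3 p T := by
  rw [ctr3, Finset.sum_comm]
  exact Finset.sum_congr rfl fun i _ => Finset.sum_congr rfl fun j _ =>
    Finset.sum_congr rfl fun k _ => by rw [hp.1]

theorem ctr3_swap₂₃ (hp : Symm3 p) (T : Fin n → Fin n → Fin n → R) :
    ctr3 p (fun i j k => T i k j) = ctr3 p T := by
  refine Finset.sum_congr rfl fun i _ => ?_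
  rw [Finset.sum_comm]
  exact Finset.sum_congr rfl fun j _ => Finset.sum_congr rfl fun k _ => by rw [hp.2]

theorem ctr3_rot (hp : Symm3 p) (T : Fin n → Fin n → Fin n → R) :
    ctr3 p (fun i j k => T j k i) = ctr3 p T := by
  rw [ctr3_swap₁₂ hp (fun i j k => T i k j), ctr3_swap₂₃ hp]

theorem ctr3_rot' (hp : Symm3 p) (T : Fin n → Fin n → Fin n → R) :
    ctr3 p (fun i j k => T k i j) = ctr3 p T := by
  rw [ctr3_swap₂₃ hp (fun i j k => T j i k), ctr3_swap₁₂ hp]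

theorem ctr3_swap₁₃ (hp : Symm3 p) (T : Fin n → Fin n → Fin n → R) :
    ctr3 p (fun i j k => T k j i) = ctr3 p T := by
  rw [ctr3_rot hp (fun i j k => T j i k), ctr3_swap₁₂ hp]

theorem ctr2_contract (p : Fin n → Fin n → Fin n → R) (θ : Fin n → R)
    (T : Fin n → Fin n → R) :
    ctr2 (fun j k => ∑ i, θ i * p i j k) T = ctr3 p (fun i j k => θ i * T j k) := by
  simp only [ctr2, ctr3, Finset.sum_mul]
  have h : ∀ j, ∑ k, ∑ i, θ i * p i j k * T j k = ∑ i, ∑ k, θ i * p i j k * T j k :=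
    fun j => Finset.sum_comm
  simp only [h]
  rw [Finset.sum_comm]
  exact Finset.sum_congr rfl fun i _ => Finset.sum_congr rfl fun j _ =>
    Finset.sum_congr rfl fun k _ => by ring

theorem ctr1_contract (B : Fin n → Fin n → R) (θ T : Fin n → R) :
    ctr1 (fun k => ∑ i, θ i * B i k) T = ctr2 B (fun i k => θ i * T k) := by
  simp only [ctr2, ctr1, Finset.sum_mul]
  rw [Finset.sum_comm]
  exact Finset.sum_congr rfl fun j _ => Finset.sum_congr rfl fun k _ => by ring

theorem ctr1_contract₂ (hp : Symm3 p) (S : Fin n → Fin n → R) (T : Fin n → R) :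
    ctr1 (fun k => ∑ i, ∑ j, S i j * p k i j) T = ctr3 p (fun i j k => S i j * T k) := by
  rw [← ctr3_rot hp]
  simp only [ctr3, ctr1, Finset.sum_mul]
  exact Finset.sum_congr rfl fun j _ => Finset.sum_congr rfl fun k _ =>
    Finset.sum_congr rfl fun k _ => by ring

end Contractions

/-! ### The effect of a projective change on every term of the formula. -/

section Invariance

variable {n : ℕ} {R : Type*} [CommRing R] [Algebra ℝ R]
  {D : Fin n → Derivation ℝ R R} {Γ : Fin n → Fin n → Fin n → R} {θ : Fin n → R} {w : R}

/-- The algebraic relations between the coefficients of the quantization formula. -/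
structure QuantCoeffs.Balanced {R : Type*} [CommRing R] (n : ℕ) (κ : QuantCoeffs R) : Prop where
  alpha : κ.α * (4 + (1 - κ.δ) * (n + 1)) = 6 + 3 * (κ.lam * (n + 1))
  beta₁ : κ.β₁ * (3 + (1 - κ.δ) * (n + 1)) = κ.α * (1 + κ.lam * (n + 1))
  beta₂ : κ.β₂ * (n - 1) = 2 + 3 * (κ.lam * (n + 1)) - (4 + (1 - κ.δ) * (n + 1)) * κ.β₁
  eta₁ : κ.η₁ * (6 + 3 * ((1 - κ.δ) * (n + 1))) = κ.lam * (n + 1) * κ.β₁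
  eta₂ : κ.η₂ * (n - 1)
    = κ.lam * (n + 1) * κ.α - (10 + 3 * ((1 - κ.δ) * (n + 1))) * κ.η₁
  eta₃ : κ.η₃ * (n - 1) = κ.lam * (n + 1) - κ.η₁ * (4 + (1 - κ.δ) * (n + 1))
  curvature : κ.η₂ * (4 + (1 - κ.δ) * (n + 1)) = κ.lam * (n + 1) * κ.β₂ + 4 * κ.η₃
  cubic : κ.η₁ * (4 + (1 - κ.δ) * (n + 1)) * (2 + (1 - κ.δ) * (n + 1))
      * (3 + (1 - κ.δ) * (n + 1))
    = κ.lam * (n + 1) * (1 + κ.lam * (n + 1)) * (2 + κ.lam * (n + 1))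

theorem cov1_cov0_projChange (hw : ∀ i, D i w = 0) (f : R) :
    cov1 D (projChange Γ θ) w (cov0 D (projChange Γ θ) w f) = fun j k =>
      cov1 D Γ w (cov0 D Γ w f) j k - w * (n + 1) * (cov1 D Γ 0 θ j k * f)
        - (1 + w * (n + 1)) * (θ k * cov0 D Γ w f j)
        - (1 + w * (n + 1)) * (θ j * cov0 D Γ w f k)
        + w * (n + 1) * (2 + w * (n + 1)) * (θ j * θ k * f) := by
  have hc : ∀ i, D i (w * (n + 1)) = 0 := by
    intro i
    simp [Derivation.leibniz, hw]
  funext j k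
  rw [cov1_projChange]
  have h : cov0 D (projChange Γ θ) w f = fun k => cov0 D Γ w f k - w * (n + 1) * (θ k * f) :=
    funext fun k => cov0_projChange f k
  rw [h, cov1_sub, cov1_const_mul hc, cov1_mul]
  ring

/-- The expansion is left unsymmetrized. Only its contraction with a symmetric tensor is needed, and
there the many terms collapse to seven types. -/
theorem cov2_cov1_cov0_projChange (hw : ∀ i, D i w = 0) (f : R) (i j k : Fin n) :
    let f₁ := cov0 D Γ w f
    let f₂ := cov1 D Γ w f₁
    let W := cov1 D Γ 0 θ
    let L := w * (n + 1)
    cov2 D (projChange Γ θ) w (cov1 D (projChange Γ θ) w (cov0 D (projChange Γ θ) w f)) i j k =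
      cov2 D Γ w f₂ i j k - L * (cov2 D Γ 0 W i j k * f) - L * (W j k * f₁ i)
        - (1 + L) * (W i k * f₁ j) - (1 + L) * (θ k * f₂ i j)
        - (1 + L) * (W i j * f₁ k) - (1 + L) * (θ j * f₂ i k)
        + L * (2 + L) * (W i j * θ k * f) + L * (2 + L) * (θ j * W i k * f)
        + L * (2 + L) * (θ j * θ k * f₁ i)
        - θ j * (f₂ i k - L * (W i k * f) - (1 + L) * (θ k * f₁ i)
          - (1 + L) * (θ i * f₁ k) + L * (2 + L) * (θ i * θ k * f))
        - θ k * (f₂ j i - L * (W j i * f) - (1 + L) * (θ i * f₁ j)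
          - (1 + L) * (θ j * f₁ i) + L * (2 + L) * (θ j * θ i * f))
        - (2 + L) * (θ i * (f₂ j k - L * (W j k * f) - (1 + L) * (θ k * f₁ j)
          - (1 + L) * (θ j * f₁ k) + L * (2 + L) * (θ j * θ k * f))) := by
  intro f₁ f₂ W L
  have hc : ∀ i, D i (w * (n + 1)) = 0 := by
    intro i
    simp [Derivation.leibniz, hw]
  have hc1 : ∀ i, D i (1 + w * (n + 1)) = 0 := by
    intro i
    simp [map_add, hc]
  have h2 : ∀ i, D i (2 : R) = 0 := fun i => by
    have := (D i).map_natCast 2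
    exact_mod_cast this
  have hc2 : ∀ i, D i (w * (n + 1) * (2 + w * (n + 1))) = 0 := by
    intro i
    rw [Derivation.leibniz, map_add, hc, h2]
    simp
  rw [cov2_projChange, cov1_cov0_projChange hw]
  have hsw : cov2 D Γ w (fun j k => θ k * cov0 D Γ w f j) i j k
      = cov1 D Γ 0 θ i k * cov0 D Γ w f j + θ k * cov1 D Γ w (cov0 D Γ w f) i j := by
    rw [cov2_swap (fun j k => θ j * cov0 D Γ w f k), cov2_outer]
  simp only [cov2_add, cov2_sub, cov2_const_mul hc, cov2_const_mul hc1, cov2_const_mul hc2,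
    cov2_mul, cov2_outer, hsw]
  simp only [f₁, f₂, W, L]
  ring

theorem div3_symm {p : Fin n → Fin n → Fin n → R} (hp : Symm3 p) (j k : Fin n) :
    div3 D Γ w p j k = div3 D Γ w p k j := by
  refine Finset.sum_congr rfl fun i _ => ?_
  simp only [fun i => hp.2 i j k, fun i m => hp.2 i m k, fun i m => hp.2 i j m]
  ring

/-- With `W = ∇θ` and `V = ∇∇θ`, each summand of the formula is expanded into scalar contractions of
`p`, `p₂`, `p₁` with `f`, `f₁`, `f₂`, `θ`, `W`, `V` and the Ricci tensor. The terms free of `θ`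
reproduce the old formula, and the coefficient of every other contraction vanishes by the balance
relations. -/
theorem quantE_projChange (κ : QuantCoeffs R) (hκ : κ.Balanced n) (hlam : ∀ i, D i κ.lam = 0)
    (hδ : ∀ i, D i κ.δ = 0) (hΓ : ∀ k i j, Γ k i j = Γ k j i)
    {p : Fin n → Fin n → Fin n → R} (hp : Symm3 p) (f : R) :
    quantE D (projChange Γ θ) κ p f = quantE D Γ κ p f := by
  set f₁ := cov0 D Γ κ.lam f with hf₁
  set f₂ := cov1 D Γ κ.lam f₁ with hf₂
  set f₃ := cov2 D Γ κ.lam f₂ with hf₃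
  set p₂ := div3 D Γ κ.δ p with hp₂
  set p₁ := div2 D Γ κ.δ p₂ with hp₁
  set p₀ := div1 D Γ κ.δ p₁ with hp₀
  set S := ricciA D Γ with hS
  set W := cov1 D Γ 0 θ with hW
  set V := cov2 D Γ 0 W with hV
  set L := κ.lam * ((n : R) + 1) with hL
  set s := (1 - κ.δ) * ((n : R) + 1) with hs
  have hp₂s : ∀ i j, p₂ i j = p₂ j i := div3_symm hp
  have hcδ : ∀ i, D i s = 0 := by
    intro i
    simp [hs, Derivation.leibniz, hδ]
  have hnum : ∀ (m : ℕ) i, D i (m : R) = 0 := fun m i => (D i).map_natCast m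
  have hd3 : ∀ i, D i (4 + s) = 0 := by
    intro i
    have := hnum 4 i
    rw [map_add, hcδ, add_zero]
    exact_mod_cast this
  have hd2 : ∀ i, D i (2 + s) = 0 := by
    intro i
    have := hnum 2 i
    rw [map_add, hcδ, add_zero]
    exact_mod_cast this
  have hd23 : ∀ i, D i ((2 + s) * (4 + s)) = 0 := by
    intro i
    simp [Derivation.leibniz, hd3, hd2]
  have hd2' : ∀ i, D i (6 + 2 * s) = 0 := by
    intro i
    have : (6 + 2 * s : R) = (4 + s) + (2 + s) := by ring
    rw [this, map_add, hd3, hd2, add_zero]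
  -- the covariant side
  have g₁ : cov0 D (projChange Γ θ) κ.lam f = fun i => f₁ i - L * (θ i * f) :=
    funext fun i => cov0_projChange f i
  have g₂ : cov1 D (projChange Γ θ) κ.lam (cov0 D (projChange Γ θ) κ.lam f) = fun j k =>
      f₂ j k - L * (W j k * f) - (1 + L) * (θ k * f₁ j)
        - (1 + L) * (θ j * f₁ k) + L * (2 + L) * (θ j * θ k * f) :=
    cov1_cov0_projChange hlam f
  -- The polynomials in `L` are the sums of the coefficients of all placements of the indices that
  -- the symmetry of `p` identifies.
  have g₃ : ctr3 p (cov2 D (projChange Γ θ) κ.lam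
      (cov1 D (projChange Γ θ) κ.lam (cov0 D (projChange Γ θ) κ.lam f)))
      = ctr3 p f₃ - (6 + 3 * L) * ctr3 p (fun i j k => θ i * f₂ j k)
        - (2 + 3 * L) * ctr3 p (fun i j k => W i j * f₁ k) - L * (f * ctr3 p V)
        + (8 + 12 * L + 3 * L ^ 2) * ctr3 p (fun i j k => θ i * θ j * f₁ k)
        + (8 * L + 3 * L ^ 2) * (f * ctr3 p (fun i j k => θ i * W j k))
        - L * (2 + L) * (4 + L) * (f * ctr3 p (fun i j k => θ i * θ j * θ k)) := by
    have e : cov2 D (projChange Γ θ) κ.lam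
        (cov1 D (projChange Γ θ) κ.lam (cov0 D (projChange Γ θ) κ.lam f))
        = fun i j k => f₃ i j k - L * (V i j k * f) - L * (W j k * f₁ i)
        - (1 + L) * (W i k * f₁ j) - (1 + L) * (θ k * f₂ i j)
        - (1 + L) * (W i j * f₁ k) - (2 + L) * (θ j * f₂ i k)
        + L * (2 + L) * (θ k * W i j * f) + L * (3 + L) * (θ j * W i k * f)
        + (2 + 4 * L + L ^ 2) * (θ j * θ k * f₁ i) + (1 + L) * (3 + L) * (θ i * θ j * f₁ k)
        - θ k * f₂ j i + L * (θ k * W j i * f) - (2 + L) * (θ i * f₂ j k)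
        + (2 + L) * L * (θ i * W j k * f) + (3 + L) * (1 + L) * (θ i * θ k * f₁ j)
        - L * (2 + L) * (4 + L) * (θ i * θ j * θ k * f) := by
      funext i j k
      rw [cov2_cov1_cov0_projChange hlam]
      simp only [← hf₁, ← hf₂, ← hf₃, ← hW, ← hV, ← hL]
      ring
    rw [e]
    simp only [ctr3_add, ctr3_sub, ctr3_const_mul, ctr3_mul_const]
    rw [ctr3_rot hp (fun i j k => W i j * f₁ k), ctr3_swap₂₃ hp (fun i j k => W i j * f₁ k),
      ctr3_rot' hp (fun i j k => θ i * f₂ j k), ctr3_swap₁₂ hp (fun i j k => θ i * f₂ j k),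
      ctr3_swap₁₃ hp (fun i j k => θ i * f₂ j k), ctr3_rot' hp (fun i j k => θ i * W j k),
      ctr3_swap₁₂ hp (fun i j k => θ i * W j k), ctr3_swap₁₃ hp (fun i j k => θ i * W j k),
      ctr3_rot hp (fun i j k => θ i * θ j * f₁ k),
      ctr3_swap₂₃ hp (fun i j k => θ i * θ j * f₁ k)]
    ring
  -- the contravariant side
  have q₂ : div3 D (projChange Γ θ) κ.δ p
      = fun j k => p₂ j k + (4 + s) * ∑ i, θ i * p i j k := by
    funext j k
    exact div3_projChange hp j k
  have q₂s : ∀ j k, div3 D (projChange Γ θ) κ.δ p j k = div3 D (projChange Γ θ) κ.δ p k j :=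
    div3_symm hp
  have q₁ : div2 D (projChange Γ θ) κ.δ (div3 D (projChange Γ θ) κ.δ p) = fun k =>
      p₁ k + (4 + s) * (∑ i, ∑ j, W i j * p k i j) + (6 + 2 * s) * (∑ i, θ i * p₂ i k)
        + (2 + s) * (4 + s) * ∑ i, ∑ j, θ i * θ j * p k i j := by
    funext k
    rw [div2_projChange q₂s, q₂, div2_add, div2_const_mul hd3, div2_contract θ hp]
    have e1 : ∑ j, ∑ i, W j i * p i j k = ∑ i, ∑ j, W i j * p k i j :=
      Finset.sum_congr rfl fun j _ => Finset.sum_congr rfl fun i _ => by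
        rw [hp.1, hp.2, hp.1]
    have e2 : ∑ i, θ i * ∑ j, θ j * p j i k = ∑ i, ∑ j, θ i * θ j * p k i j := by
      simp only [Finset.mul_sum]
      exact Finset.sum_congr rfl fun j _ => Finset.sum_congr rfl fun i _ => by
        rw [hp.1, hp.2, hp.1, mul_assoc]
    simp only [← hp₁, ← hp₂, ← hW, ← hs, mul_add, mul_left_comm (θ _) (4 + s),
      Finset.sum_add_distrib]
    rw [← Finset.mul_sum, e1, e2]
    ring
  have q₀ : div1 D (projChange Γ θ) κ.δ
      (div2 D (projChange Γ θ) κ.δ (div3 D (projChange Γ θ) κ.δ p))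
      = p₀ + (4 + s) * ctr3 p V + (10 + 3 * s) * ctr2 p₂ W + (6 + 3 * s) * ctr1 p₁ θ
        + (s * (4 + s) + 2 * ((2 + s) * (4 + s))) * ctr3 p (fun i j k => θ i * W j k)
        + ((2 + s) * (4 + s) + s * (6 + 2 * s)) * ctr2 p₂ (fun i j => θ i * θ j)
        + s * (2 + s) * (4 + s) * ctr3 p (fun i j k => θ i * θ j * θ k) := by
    rw [div1_projChange, q₁, div1_add, div1_add, div1_add, div1_const_mul hd3,
      div1_const_mul hd2', div1_const_mul hd23, div1_contract₂ W, div1_contract₂, div1_contract]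
    have e0 : ∀ F : Fin n → R, ∑ i, θ i * F i = ctr1 F θ := fun F =>
      Finset.sum_congr rfl fun i _ => mul_comm _ _
    have e1 : ∑ k, ∑ i, ∑ j, cov2 D Γ 0 W k i j * p k i j = ctr3 p V :=
      Finset.sum_congr rfl fun i _ => Finset.sum_congr rfl fun j _ =>
        Finset.sum_congr rfl fun k _ => mul_comm _ _
    have e2 : ∀ T : Fin n → Fin n → R, ∑ i, ∑ j, T i j * div3 D Γ κ.δ p i j = ctr2 p₂ T :=
      fun T => Finset.sum_congr rfl fun i _ => Finset.sum_congr rfl fun j _ => mul_comm _ _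
    have e3 : ∑ j, ∑ i, W j i * p₂ i j = ctr2 p₂ W :=
      Finset.sum_congr rfl fun i _ => Finset.sum_congr rfl fun j _ => by rw [hp₂s, mul_comm]
    have e4 : (fun a b => p₂ b a) = p₂ := by
      funext a b
      rw [hp₂s]
    have e5 : ∑ k, ∑ i, ∑ j, cov2 D Γ 0 (fun i j => θ i * θ j) k i j * p k i j
        = 2 * ctr3 p (fun i j k => θ i * W j k) := by
      have : ctr3 p (fun i j k => W i j * θ k + θ j * W i k)
          = 2 * ctr3 p (fun i j k => θ i * W j k) := by
        simp only [mul_comm (W _ _) (θ _)]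
        rw [ctr3_add, ctr3_rot' hp (fun i j k => θ i * W j k),
          ctr3_swap₁₂ hp (fun i j k => θ i * W j k)]
        ring
      rw [← this]
      exact Finset.sum_congr rfl fun i _ => Finset.sum_congr rfl fun j _ =>
        Finset.sum_congr rfl fun k _ => by rw [cov2_outer, mul_comm]
    rw [e0, e1, e2, e2, e3, e4, e5, e0, ctr1_add_left, ctr1_add_left, ctr1_add_left,
      ctr1_const_mul_left, ctr1_const_mul_left, ctr1_const_mul_left, ctr1_contract₂ hp,
      ctr1_contract₂ hp, ctr1_contract]
    simp only [← hp₁, ← hp₀, ← hs]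
    have e6 : ctr3 p (fun i j k => W i j * θ k) = ctr3 p (fun i j k => θ i * W j k) := by
      simp only [mul_comm (W _ _) (θ _)]
      rw [ctr3_rot' hp (fun i j k => θ i * W j k)]
    rw [e6]
    ring
  -- the Ricci tensor
  have r₀ : ricciA D (projChange Γ θ) = fun i j =>
      S i j + n * W i j - W j i - (n - 1) * (θ i * θ j) := by
    funext i j
    exact ricciA_projChange hΓ i j
  -- The Ricci tensor need not be symmetric, but `p` sees only symmetric parts, so `n V i j k - V i
  -- k j` becomes `(n - 1) V`. The coefficient 4 counts `θ_j S_{ik}` and `θ_k S_{ji}` once each and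
  -- `θ_i S_{jk}` twice. The 6 is 4 for the change of the Ricci tensor inside these terms, plus 2
  -- from the derivative of `θ_j θ_k`.
  have r₁ : ctr3 p (cov2 D (projChange Γ θ) 0 (ricciA D (projChange Γ θ)))
      = ctr3 p (cov2 D Γ 0 S) + (n - 1) * ctr3 p V - 4 * ctr3 p (fun i j k => θ i * S j k)
        - 6 * (n - 1) * ctr3 p (fun i j k => θ i * W j k)
        + 4 * (n - 1) * ctr3 p (fun i j k => θ i * θ j * θ k) := by
    have hcn : ∀ i, D i ((n : R) - 1) = 0 := by
      intro i
      simp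
    have e : cov2 D (projChange Γ θ) 0 (ricciA D (projChange Γ θ)) = fun i j k =>
        cov2 D Γ 0 S i j k + n * V i j k - V i k j - (n - 1) * (W i j * θ k)
        - (n - 1) * (θ j * W i k)
        - (θ j * S i k + n * (θ j * W i k) - θ j * W k i - (n - 1) * (θ j * θ i * θ k))
        - (θ k * S j i + n * (θ k * W j i) - θ k * W i j - (n - 1) * (θ k * θ j * θ i))
        - 2 * (θ i * S j k + n * (θ i * W j k) - θ i * W k j - (n - 1) * (θ i * θ j * θ k)) := by
      funext i j k
      rw [cov2_projChange, r₀]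
      simp only [cov2_add, cov2_sub, cov2_const_mul (hnum n), cov2_const_mul hcn,
        cov2_swap W, cov2_outer]
      simp only [← hW, ← hV]
      ring
    have t1 : ctr3 p (fun i j k => θ j * θ i * θ k) = ctr3 p (fun i j k => θ i * θ j * θ k) :=
      ctr3_swap₁₂ hp (fun i j k => θ i * θ j * θ k)
    have t2 : ctr3 p (fun i j k => θ k * θ j * θ i) = ctr3 p (fun i j k => θ i * θ j * θ k) :=
      ctr3_swap₁₃ hp (fun i j k => θ i * θ j * θ k)
    rw [e]
    simp only [mul_comm (W _ _) (θ _)]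
    simp only [ctr3_add, ctr3_sub, ctr3_const_mul]
    rw [t1, t2, ctr3_swap₂₃ hp V, ctr3_rot' hp (fun i j k => θ i * W j k),
      ctr3_swap₁₂ hp (fun i j k => θ i * W j k), ctr3_swap₁₃ hp (fun i j k => θ i * W j k),
      ctr3_swap₂₃ hp (fun i j k => θ i * W j k), ctr3_rot hp (fun i j k => θ i * W j k),
      ctr3_swap₁₂ hp (fun i j k => θ i * S j k), ctr3_swap₁₃ hp (fun i j k => θ i * S j k)]
    ring
  have r₂ : ctr3 p (fun i j k =>
      ricciA D (projChange Γ θ) i j * cov0 D (projChange Γ θ) κ.lam f k)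
      = ctr3 p (fun i j k => S i j * f₁ k) + (n - 1) * ctr3 p (fun i j k => W i j * f₁ k)
        - (n - 1) * ctr3 p (fun i j k => θ i * θ j * f₁ k)
        - L * (f * (ctr3 p (fun i j k => θ i * S j k)
          + (n - 1) * ctr3 p (fun i j k => θ i * W j k)
          - (n - 1) * ctr3 p (fun i j k => θ i * θ j * θ k))) := by
    have e : (fun i j k => ricciA D (projChange Γ θ) i j * cov0 D (projChange Γ θ) κ.lam f k)
        = fun i j k => S i j * f₁ k + n * (W i j * f₁ k) - W j i * f₁ k
          - (n - 1) * (θ i * θ j * f₁ k) - L * ((θ k * S i j + n * (θ k * W i j) - θ k * W j i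
          - (n - 1) * (θ i * θ j * θ k)) * f) := by
      funext i j k
      rw [r₀, g₁]
      ring
    rw [e]
    simp only [ctr3_add, ctr3_sub, ctr3_const_mul, ctr3_mul_const]
    rw [ctr3_swap₁₂ hp (fun i j k => W i j * f₁ k), ctr3_rot' hp (fun i j k => θ i * S j k),
      ctr3_rot' hp (fun i j k => θ i * W j k), ctr3_swap₁₃ hp (fun i j k => θ i * W j k)]
    ring
  have r₃ : ctr2 (div3 D (projChange Γ θ) κ.δ p) (ricciA D (projChange Γ θ))
      = ctr2 p₂ S + (n - 1) * ctr2 p₂ W - (n - 1) * ctr2 p₂ (fun i j => θ i * θ j)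
        + (4 + s) * (ctr3 p (fun i j k => θ i * S j k)
          + (n - 1) * ctr3 p (fun i j k => θ i * W j k)
          - (n - 1) * ctr3 p (fun i j k => θ i * θ j * θ k)) := by
    rw [q₂, ctr2_add_left, ctr2_const_mul_left, ctr2_contract, r₀]
    have e : (fun i j k => θ i * (S j k + n * W j k - W k j - (n - 1) * (θ j * θ k)))
        = fun i j k => θ i * S j k + n * (θ i * W j k) - θ i * W k j
          - (n - 1) * (θ i * θ j * θ k) := by
      funext i j k
      ring
    rw [e]
    simp only [ctr3_add, ctr3_sub, ctr3_const_mul, ctr2_add, ctr2_sub, ctr2_const_mul]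
    rw [ctr2_swap hp₂s W, ctr3_swap₂₃ hp (fun i j k => θ i * W j k)]
    ring
  -- the remaining contractions
  have m₁ : ctr2 (div3 D (projChange Γ θ) κ.δ p)
      (cov1 D (projChange Γ θ) κ.lam (cov0 D (projChange Γ θ) κ.lam f))
      = ctr2 p₂ f₂ - L * (f * ctr2 p₂ W) - (2 + 2 * L) * ctr2 p₂ (fun i j => θ i * f₁ j)
        + L * (2 + L) * (f * ctr2 p₂ (fun i j => θ i * θ j))
        + (4 + s) * (ctr3 p (fun i j k => θ i * f₂ j k)
          - L * (f * ctr3 p (fun i j k => θ i * W j k))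
          - (2 + 2 * L) * ctr3 p (fun i j k => θ i * θ j * f₁ k)
          + L * (2 + L) * (f * ctr3 p (fun i j k => θ i * θ j * θ k))) := by
    rw [q₂, ctr2_add_left, ctr2_const_mul_left, ctr2_contract, g₂]
    have e : (fun i j k => θ i * (f₂ j k - L * (W j k * f) - (1 + L) * (θ k * f₁ j)
        - (1 + L) * (θ j * f₁ k) + L * (2 + L) * (θ j * θ k * f)))
        = fun i j k => θ i * f₂ j k - L * (θ i * W j k * f) - (1 + L) * (θ i * θ k * f₁ j)
          - (1 + L) * (θ i * θ j * f₁ k) + L * (2 + L) * (θ i * θ j * θ k * f) := by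
      funext i j k
      ring
    rw [e]
    simp only [ctr3_add, ctr3_sub, ctr3_const_mul, ctr3_mul_const, ctr2_add, ctr2_sub,
      ctr2_const_mul, ctr2_mul_const]
    rw [ctr2_swap hp₂s (fun i j => θ i * f₁ j), ctr3_swap₂₃ hp (fun i j k => θ i * θ j * f₁ k)]
    ring
  have m₂ : ctr1 (div2 D (projChange Γ θ) κ.δ (div3 D (projChange Γ θ) κ.δ p))
      (cov0 D (projChange Γ θ) κ.lam f)
      = ctr1 p₁ f₁ - L * (f * ctr1 p₁ θ)
        + (4 + s) * (ctr3 p (fun i j k => W i j * f₁ k)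
          - L * (f * ctr3 p (fun i j k => θ i * W j k)))
        + (6 + 2 * s) * (ctr2 p₂ (fun i j => θ i * f₁ j)
          - L * (f * ctr2 p₂ (fun i j => θ i * θ j)))
        + (2 + s) * (4 + s) * (ctr3 p (fun i j k => θ i * θ j * f₁ k)
          - L * (f * ctr3 p (fun i j k => θ i * θ j * θ k))) := by
    rw [q₁, g₁]
    simp only [ctr1_add_left, ctr1_const_mul_left, ctr1_contract₂ hp, ctr1_contract]
    have e1 : (fun i j k => W i j * (f₁ k - L * (θ k * f)))
        = fun i j k => W i j * f₁ k - L * (θ k * W i j * f) := by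
      funext i j k
      ring
    have e2 : (fun i j => θ i * (f₁ j - L * (θ j * f)))
        = fun i j => θ i * f₁ j - L * (θ i * θ j * f) := by
      funext i j
      ring
    have e3 : (fun i j k => θ i * θ j * (f₁ k - L * (θ k * f)))
        = fun i j k => θ i * θ j * f₁ k - L * (θ i * θ j * θ k * f) := by
      funext i j k
      ring
    rw [e1, e2, e3]
    simp only [ctr3_sub, ctr3_const_mul, ctr3_mul_const, ctr2_sub, ctr2_const_mul,
      ctr2_mul_const, ctr1_sub, ctr1_const_mul, ctr1_mul_const]
    rw [ctr3_rot' hp (fun i j k => θ i * W j k)]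
  obtain ⟨h1, h2, h3, h4, h5, h6, h7, h8⟩ := hκ
  simp only [← hL, ← hs] at h1 h2 h3 h4 h5 h6 h7 h8
  simp only [quantE]
  rw [g₃, m₁, m₂, r₂, q₀, r₃, r₁]
  simp only [← hf₁, ← hf₂, ← hf₃, ← hp₀, ← hp₁, ← hp₂, ← hS]
  -- Each relation is the coefficient of one contraction: `h1` of `p(θ, f₂)`, `h2` of `p₂(θ, f₁)`,
  -- `h3` of `p(W, f₁)`, and, with a factor `f`, `h4` of `p₁(θ)`, `h5` of `p₂(W)`, `h6` of `p(V)`,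
  -- `h7` of `p(θ, S)`. The coefficients of `p(θ, θ, f₁)`, `p₂(θ, θ)` and `p(θ, W)` are combinations
  -- of these, and that of `p(θ, θ, θ)` needs `h8` in addition.
  linear_combination
    (ctr3 p (fun i j k => θ i * f₂ j k) - (1 + L) * ctr3 p (fun i j k => θ i * θ j * f₁ k)) * h1
    + (2 * ctr2 p₂ (fun i j => θ i * f₁ j)
      + (4 + s) * ctr3 p (fun i j k => θ i * θ j * f₁ k)
      - L * f * ctr2 p₂ (fun i j => θ i * θ j)
      - L * (4 + s) * f * ctr3 p (fun i j k => θ i * θ j * θ k)) * h2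
    + (ctr3 p (fun i j k => W i j * f₁ k) - ctr3 p (fun i j k => θ i * θ j * f₁ k)
      - L * f * ctr3 p (fun i j k => θ i * W j k)
      + L * f * ctr3 p (fun i j k => θ i * θ j * θ k)) * h3
    + (f * ctr1 p₁ θ + (3 + s) * f * ctr2 p₂ (fun i j => θ i * θ j)) * h4
    + (f * ctr2 p₂ W - f * ctr2 p₂ (fun i j => θ i * θ j)
      + (4 + s) * f * ctr3 p (fun i j k => θ i * W j k)
      - (4 + s) * f * ctr3 p (fun i j k => θ i * θ j * θ k)) * h5
    + (f * ctr3 p V - 6 * f * ctr3 p (fun i j k => θ i * W j k)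
      + 4 * f * ctr3 p (fun i j k => θ i * θ j * θ k)) * h6
    + f * ctr3 p (fun i j k => θ i * S j k) * h7
    + f * ctr3 p (fun i j k => θ i * θ j * θ k) * h8

/-- With `s = (1 - δ)(n + 1)` the excluded values of `δ` are the zeros of `2 + s`, `3 + s` and `4 +
s`, the denominators of `η₁`, `β₁` and `α`. Six relations are then the definitions of the constants;
the last two are the overdetermined part of the system. -/
theorem quantCoeffs_balanced {n : ℕ} (hn : 1 < n) {lam δ : ℝ} (h₃ : δ ≠ (n + 3) / (n + 1))
    (h₄ : δ ≠ (n + 4) / (n + 1)) (h₅ : δ ≠ (n + 5) / (n + 1)) :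
    (quantCoeffs n lam δ).Balanced n := by
  have hN : (n : ℝ) + 1 ≠ 0 := by positivity
  have hn1 : (n : ℝ) - 1 ≠ 0 := by
    have : (1 : ℝ) < n := by exact_mod_cast hn
    linarith
  rw [Ne, eq_div_iff hN] at h₃ h₄ h₅
  have d4 : 4 + (1 - δ) * (1 + (n : ℝ)) ≠ 0 := fun h => h₅ (by linear_combination -h)
  have d3 : 3 + (1 - δ) * (1 + (n : ℝ)) ≠ 0 := fun h => h₄ (by linear_combination -h)
  have d6 : 6 + 3 * (1 - δ) * (1 + (n : ℝ)) ≠ 0 := fun h => h₃ (by linear_combination -h / 3)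
  have h1 : cα n lam δ * (4 + (1 - δ) * (n + 1)) = 6 + 3 * (lam * (n + 1)) := by
    rw [cα, add_comm (n : ℝ) 1, div_mul_cancel₀ _ d4]
    ring
  have h2 : cβ₁ n lam δ * (3 + (1 - δ) * (n + 1)) = cα n lam δ * (1 + lam * (n + 1)) := by
    rw [cβ₁, add_comm (n : ℝ) 1, mul_right_comm, div_mul_cancel₀ _ d3]
    ring
  have h3 : cβ₂ n lam δ * (n - 1)
      = 2 + 3 * (lam * (n + 1)) - (4 + (1 - δ) * (n + 1)) * cβ₁ n lam δ := by
    rw [cβ₂, div_mul_cancel₀ _ hn1]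
    ring
  have h4 : cη₁ n lam δ * (6 + 3 * ((1 - δ) * (n + 1))) = lam * (n + 1) * cβ₁ n lam δ := by
    have : 6 + 3 * ((1 - δ) * ((n : ℝ) + 1)) = 6 + 3 * (1 - δ) * (1 + (n : ℝ)) := by ring
    rw [cη₁, this, mul_right_comm, div_mul_cancel₀ _ d6]
    ring
  have h5 : cη₂ n lam δ * (n - 1)
      = lam * (n + 1) * cα n lam δ - (10 + 3 * ((1 - δ) * (n + 1))) * cη₁ n lam δ := by
    rw [cη₂, div_mul_cancel₀ _ hn1]
    ring
  have h6 : cη₃ n lam δ * (n - 1)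
      = lam * (n + 1) - cη₁ n lam δ * (4 + (1 - δ) * (n + 1)) := by
    rw [cη₃, div_mul_cancel₀ _ hn1]
    ring
  refine ⟨h1, h2, h3, h4, h5, h6, ?_, ?_⟩
  -- After multiplication by `n - 1` the definitions of `η₂`, `β₂` and `η₃` can be inserted; what
  -- remains is `4 + s` times the relation for `η₁`, once `α (4 + s)` has been replaced.
  · refine mul_right_cancel₀ hn1 ?_
    simp only [quantCoeffs]
    linear_combination (4 + (1 - δ) * (n + 1)) * h5 - lam * (n + 1) * h3 - 4 * h6
      + lam * (n + 1) * h1 - (4 + (1 - δ) * (n + 1)) * h4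
  -- The relations for `η₁`, `β₁` and `α` are chained, and the common factor 3 of `6 + 3 s` and `6 +
  -- 3 L`, with `L = λ (n + 1)`, is divided out.
  · simp only [quantCoeffs]
    linear_combination (4 + (1 - δ) * (n + 1)) * (3 + (1 - δ) * (n + 1)) / 3 * h4
      + lam * (n + 1) * (4 + (1 - δ) * (n + 1)) / 3 * h2
      + lam * (n + 1) * (1 + lam * (n + 1)) / 3 * h1

theorem QuantCoeffs.Balanced.map {A B : Type*} [CommRing A] [CommRing B] (f : A →+* B) {n : ℕ}
    {κ : QuantCoeffs A} (h : κ.Balanced n) : (κ.map f).Balanced n := by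
  obtain ⟨h1, h2, h3, h4, h5, h6, h7, h8⟩ := h
  constructor <;> simp only [QuantCoeffs.map]
  · simpa [map_ofNat] using congrArg f h1
  · simpa [map_ofNat] using congrArg f h2
  · simpa [map_ofNat] using congrArg f h3
  · simpa [map_ofNat] using congrArg f h4
  · simpa [map_ofNat] using congrArg f h5
  · simpa [map_ofNat] using congrArg f h6
  · simpa [map_ofNat] using congrArg f h7
  · simpa [map_ofNat] using congrArg f h8

end Invariance

end ProjQuant

end

noncomputable section

namespace ProjQuant

/-! ## Lie derivatives and equivariance of the flat formula -/

section LieDerivative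

variable {n k : ℕ} {R : Type*} [CommRing R] [Algebra ℝ R]
  (D : Fin n → Derivation ℝ R R) (X : Fin n → R) (w : R)

/-- The Lie derivative of contravariant tensors over an algebra with derivations. -/
def lieA (f : (Fin k → Fin n) → R) (I : Fin k → Fin n) : R :=
  ∑ l, X l * D l (f I) - ∑ s, ∑ l, D l (X (I s)) * f (Function.update I s l)
    + w * (∑ l, D l (X l)) * f I

/-- The Lie derivative of a scalar density. -/
def lieS (f : R) : R := ∑ l, X l * D l f + w * (∑ l, D l (X l)) * f

/-- The Lie derivative of a vector density. -/
def lieV₁ (V : Fin n → R) (i : Fin n) : R :=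
  ∑ l, X l * D l (V i) - ∑ l, D l (X i) * V l + w * (∑ l, D l (X l)) * V i

/-- The Lie derivative of a contravariant 2-tensor. -/
def lieV₂ (B : Fin n → Fin n → R) (i j : Fin n) : R :=
  ∑ l, X l * D l (B i j) - ∑ l, D l (X i) * B l j - ∑ l, D l (X j) * B i l
    + w * (∑ l, D l (X l)) * B i j

/-- The Lie derivative of a contravariant 3-tensor. -/
def lieV₃ (p : Fin n → Fin n → Fin n → R) (i j k : Fin n) : R :=
  ∑ l, X l * D l (p i j k) - ∑ l, D l (X i) * p l j k - ∑ l, D l (X j) * p i l k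
    - ∑ l, D l (X k) * p i j l + w * (∑ l, D l (X l)) * p i j k

/-- The Lie derivative of a covector. -/
def lieC₁ (T : Fin n → R) (i : Fin n) : R :=
  ∑ l, X l * D l (T i) + ∑ l, D i (X l) * T l + w * (∑ l, D l (X l)) * T i

/-- The Lie derivative of a covariant 2-tensor. -/
def lieC₂ (T : Fin n → Fin n → R) (i j : Fin n) : R :=
  ∑ l, X l * D l (T i j) + ∑ l, D i (X l) * T l j + ∑ l, D j (X l) * T i l
    + w * (∑ l, D l (X l)) * T i j

/-- The Lie derivative of a covariant 3-tensor. -/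
def lieC₃ (T : Fin n → Fin n → Fin n → R) (i j k : Fin n) : R :=
  ∑ l, X l * D l (T i j k) + ∑ l, D i (X l) * T l j k + ∑ l, D j (X l) * T i l k
    + ∑ l, D k (X l) * T i j l + w * (∑ l, D l (X l)) * T i j k

theorem lieA_zero (f : (Fin 0 → Fin n) → R) (I : Fin 0 → Fin n) :
    lieA D X w f I = lieS D X w (f I) := by
  simp [lieA, lieS]

theorem lieA_three (f : (Fin 3 → Fin n) → R) (i j k : Fin n) :
    lieA D X w f ![i, j, k] = lieV₃ D X w (fun i j k => f ![i, j, k]) i j k := by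
  simp [lieA, lieV₃, Fin.sum_univ_three, update_vec3_zero, update_vec3_one, update_vec3_two]
  ring

/-! ### Contractions -/

variable {w} {w' : R}

/-- The Lie derivative is compatible with contractions: the terms in `∂X` coming from an upper and
from a lower index cancel, and the divergence terms add up the weights. The versions for two and
three indices treat the first index as a parameter and cancel its two `∂X` terms separately. -/
theorem lieS_ctr1 (V T : Fin n → R) :
    lieS D X (w + w') (ctr1 V T) = ctr1 (lieV₁ D X w V) T + ctr1 V (lieC₁ D X w' T) := by
  have e0 : ∑ l, X l * D l (∑ i, V i * T i)
      = ∑ i, ((∑ l, X l * D l (V i)) * T i + V i * ∑ l, X l * D l (T i)) := by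
    simp only [map_sum, Finset.mul_sum, Finset.sum_mul, ← Finset.sum_add_distrib]
    rw [Finset.sum_comm]
    refine Finset.sum_congr rfl fun i _ => Finset.sum_congr rfl fun l _ => ?_
    rw [Derivation.leibniz, smul_eq_mul, smul_eq_mul]
    ring
  have e1 : ∑ i, V i * ∑ l, D i (X l) * T l = ∑ i, (∑ l, D l (X i) * V l) * T i := by
    simp only [Finset.mul_sum, Finset.sum_mul]
    rw [Finset.sum_comm]
    exact Finset.sum_congr rfl fun i _ => Finset.sum_congr rfl fun l _ => by ring
  have e2 : ∀ i, lieV₁ D X w V i * T i + V i * lieC₁ D X w' T i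
      = ((∑ l, X l * D l (V i)) * T i + V i * ∑ l, X l * D l (T i))
        + (w + w') * (∑ l, D l (X l)) * (V i * T i)
        + (V i * (∑ l, D i (X l) * T l) - (∑ l, D l (X i) * V l) * T i) := by
    intro i
    simp only [lieV₁, lieC₁]
    ring
  simp only [lieS, ctr1, ← Finset.sum_add_distrib, e2, e0]
  simp only [Finset.sum_add_distrib, Finset.sum_sub_distrib, e1]
  rw [← Finset.mul_sum (f := fun i => V i * T i)]
  ring

theorem lieV₁_curry (B : Fin n → Fin n → R) (T : Fin n → Fin n → R) :
    ctr2 (lieV₂ D X w B) T + ctr2 B (lieC₂ D X w' T)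
      = ∑ i, lieS D X (w + w') (ctr1 (B i) (T i)) := by
  have e1 : ∑ i, ∑ j, B i j * ∑ l, D i (X l) * T l j
      = ∑ i, ∑ j, (∑ l, D l (X i) * B l j) * T i j := by
    rw [Finset.sum_comm]
    conv_rhs => rw [Finset.sum_comm]
    refine Finset.sum_congr rfl fun j _ => ?_
    simp only [Finset.mul_sum, Finset.sum_mul]
    rw [Finset.sum_comm]
    exact Finset.sum_congr rfl fun i _ => Finset.sum_congr rfl fun l _ => by ring
  have e2 : ∀ i j, lieV₂ D X w B i j * T i j + B i j * lieC₂ D X w' T i j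
      = lieV₁ D X w (B i) j * T i j + B i j * lieC₁ D X w' (T i) j
        + (B i j * (∑ l, D i (X l) * T l j) - (∑ l, D l (X i) * B l j) * T i j) := by
    intro i j
    simp only [lieV₂, lieC₂, lieV₁, lieC₁]
    ring
  simp only [lieS_ctr1]
  simp only [ctr2, ctr1, ← Finset.sum_add_distrib, e2]
  simp only [Finset.sum_add_distrib, Finset.sum_sub_distrib]
  rw [e1]
  ring

theorem lieS_sum {ι : Type*} (s : Finset ι) (f : ι → R) :
    lieS D X w (∑ i ∈ s, f i) = ∑ i ∈ s, lieS D X w (f i) := by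
  simp only [lieS, map_sum, Finset.mul_sum, Finset.sum_add_distrib]
  rw [Finset.sum_comm]

theorem lieS_ctr2 (B T : Fin n → Fin n → R) :
    lieS D X (w + w') (ctr2 B T) = ctr2 (lieV₂ D X w B) T + ctr2 B (lieC₂ D X w' T) := by
  rw [lieV₁_curry, ctr2, lieS_sum]
  rfl

theorem lieS_ctr3 (p T : Fin n → Fin n → Fin n → R) :
    lieS D X (w + w') (ctr3 p T) = ctr3 (lieV₃ D X w p) T + ctr3 p (lieC₃ D X w' T) := by
  have e1 : ∑ i, ∑ j, ∑ k, p i j k * ∑ l, D i (X l) * T l j k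
      = ∑ i, ∑ j, ∑ k, (∑ l, D l (X i) * p l j k) * T i j k := by
    have h1 : ∑ i, ∑ j, ∑ k, p i j k * ∑ l, D i (X l) * T l j k
        = ∑ i, ∑ l, ∑ j, ∑ k, p i j k * (D i (X l) * T l j k) := by
      refine Finset.sum_congr rfl fun i _ => ?_
      conv_rhs => rw [Finset.sum_comm]
      refine Finset.sum_congr rfl fun j _ => ?_
      conv_rhs => rw [Finset.sum_comm]
      simp only [Finset.mul_sum]
    have h2 : ∑ i, ∑ j, ∑ k, (∑ l, D l (X i) * p l j k) * T i j k
        = ∑ i, ∑ l, ∑ j, ∑ k, D l (X i) * p l j k * T i j k := by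
      refine Finset.sum_congr rfl fun i _ => ?_
      conv_rhs => rw [Finset.sum_comm]
      refine Finset.sum_congr rfl fun j _ => ?_
      conv_rhs => rw [Finset.sum_comm]
      simp only [Finset.sum_mul]
    rw [h1, h2, Finset.sum_comm]
    exact Finset.sum_congr rfl fun i _ => Finset.sum_congr rfl fun l _ =>
      Finset.sum_congr rfl fun j _ => Finset.sum_congr rfl fun k _ => by ring
  have e2 : ∀ i j k, lieV₃ D X w p i j k * T i j k + p i j k * lieC₃ D X w' T i j k
      = lieV₂ D X w (p i) j k * T i j k + p i j k * lieC₂ D X w' (T i) j k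
        + (p i j k * (∑ l, D i (X l) * T l j k) - (∑ l, D l (X i) * p l j k) * T i j k) := by
    intro i j k
    simp only [lieV₂, lieC₂, lieV₃, lieC₃]
    ring
  have e3 : ctr3 p T = ∑ i, ctr2 (p i) (T i) := rfl
  rw [e3, lieS_sum]
  simp only [lieS_ctr2]
  simp only [ctr3, ctr2, ← Finset.sum_add_distrib, e2]
  simp only [Finset.sum_add_distrib, Finset.sum_sub_distrib]
  rw [e1]
  ring

/-! ### Commutation with partial derivatives -/

variable {D X} {c : Fin n → R}

/-- The second derivatives of the components of the fields in `sl_{n+1}`. -/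
def IsProjField (D : Fin n → Derivation ℝ R R) (X c : Fin n → R) : Prop :=
  ∀ a b l, D a (D b (X l)) = (if l = a then c b else 0) + (if l = b then c a else 0)

theorem derivation_sum_mul (d : Derivation ℝ R R) (A B : Fin n → R) :
    d (∑ l, A l * B l) = ∑ l, A l * d (B l) + ∑ l, d (A l) * B l := by
  simp only [map_sum, Derivation.leibniz, smul_eq_mul, Finset.sum_add_distrib, mul_comm]

theorem IsProjField.sum_mul (hX : IsProjField D X c) (a b : Fin n) (T : Fin n → R) :
    ∑ l, D a (D b (X l)) * T l = c b * T a + c a * T b := by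
  simp [hX a b, add_mul, Finset.sum_add_distrib]

theorem IsProjField.div (hX : IsProjField D X c)
    (i : Fin n) : D i (∑ l, D l (X l)) = (n + 1) * c i := by
  simp only [map_sum, hX i, Finset.sum_add_distrib]
  simp
  ring

/-- A partial derivative fails to commute with `L_X` only through the second derivatives of `X`. For
a projective field the defect is algebraic in `c`, and it is the correction of `cov0_projChange`
with `θ = -c`. The formulas for `lieC₁` and `lieC₂` correspond in the same way to `cov1_projChange`
and `cov2_projChange`. -/
theorem lieS_deriv (hD : ∀ i j f, D i (D j f) = D j (D i f)) (hX : IsProjField D X c)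
    (hw : ∀ i, D i w = 0) (f : R) (i : Fin n) :
    D i (lieS D X w f) = lieC₁ D X w (fun i => D i f) i + w * (n + 1) * (c i * f) := by
  simp only [lieS, lieC₁, map_add, derivation_sum_mul, Derivation.leibniz, smul_eq_mul, hw,
    hX.div, hD i _ f]
  ring

theorem lieC₁_deriv (hD : ∀ i j f, D i (D j f) = D j (D i f)) (hX : IsProjField D X c)
    (hw : ∀ i, D i w = 0) (T : Fin n → R) (i j : Fin n) :
    D i (lieC₁ D X w T j) = lieC₂ D X w (fun i j => D i (T j)) i j
      + c j * T i + (1 + w * (n + 1)) * (c i * T j) := by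
  have e0 := hX.sum_mul i j T
  simp only [lieC₁, lieC₂, map_add, derivation_sum_mul, Derivation.leibniz, smul_eq_mul, hw,
    hX.div, hD i _ (T _)]
  rw [e0]
  ring

theorem lieC₂_deriv (hD : ∀ i j f, D i (D j f) = D j (D i f)) (hX : IsProjField D X c)
    (hw : ∀ i, D i w = 0) (T : Fin n → Fin n → R) (i j k : Fin n) :
    D i (lieC₂ D X w T j k) = lieC₃ D X w (fun i j k => D i (T j k)) i j k
      + c j * T i k + c k * T j i + (2 + w * (n + 1)) * (c i * T j k) := by
  have e0 := hX.sum_mul i j (fun l => T l k)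
  have e1 := hX.sum_mul i k (fun l => T j l)
  simp only [lieC₂, lieC₃, map_add, derivation_sum_mul, Derivation.leibniz, smul_eq_mul, hw,
    hX.div, hD i _ (T _ _)]
  rw [e0, e1]
  ring

theorem cov0_zero (f : R) : cov0 D 0 w f = fun i => D i f := by
  funext i; simp [cov0, traceΓ]

theorem cov1_zero (T : Fin n → R) : cov1 D 0 w T = fun i j => D i (T j) := by
  funext i j; simp [cov1, traceΓ]

theorem cov2_zero (T : Fin n → Fin n → R) : cov2 D 0 w T = fun i j k => D i (T j k) := by
  funext i j k; simp [cov2, traceΓ]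

theorem div1_zero (V : Fin n → R) : div1 D 0 w V = ∑ i, D i (V i) := by
  simp [div1, traceΓ]

theorem div2_zero (B : Fin n → Fin n → R) : div2 D 0 w B = fun j => ∑ i, D i (B i j) := by
  funext j; simp [div2, traceΓ]

theorem div3_zero (p : Fin n → Fin n → Fin n → R) :
    div3 D 0 w p = fun j k => ∑ i, D i (p i j k) := by
  funext j k; simp [div3, traceΓ]

theorem ricciA_zero : ricciA D (0 : Fin n → Fin n → Fin n → R) = 0 := by
  funext i j; simp [ricciA]

/-- The terms with one derivative on `X` and one on `V` cancel by exchanging the summation indices.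
The second derivatives of `X` give `n + 1` copies of `c`, reduced by the weight, in parallel with
`div1_projChange`. -/
theorem div1_lie (hD : ∀ i j f, D i (D j f) = D j (D i f)) (hX : IsProjField D X c)
    (hw : ∀ i, D i w = 0) (V : Fin n → R) :
    ∑ i, D i (lieV₁ D X w V i)
      = lieS D X w (∑ i, D i (V i)) - (1 - w) * (n + 1) * ∑ i, c i * V i := by
  have h : ∀ i, D i (lieV₁ D X w V i) = ∑ l, X l * D l (D i (V i))
      + w * (∑ l, D l (X l)) * D i (V i)
      + (∑ l, D i (X l) * D l (V i) - ∑ l, D l (X i) * D i (V l))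
      - ∑ l, D l (D i (X i)) * V l + w * (n + 1) * (c i * V i) := by
    intro i
    simp only [lieV₁, map_add, map_sub, derivation_sum_mul, Derivation.leibniz, smul_eq_mul, hw,
      hX.div, hD i _ (V i), hD i _ (X i)]
    ring
  have e1 : ∑ i, ∑ l, D i (X l) * D l (V i) = ∑ i, ∑ l, D l (X i) * D i (V l) :=
    Finset.sum_comm
  have e2 : ∑ i, ∑ l, D l (D i (X i)) * V l = (n + 1) * ∑ l, c l * V l := by
    rw [Finset.sum_comm]
    simp only [← Finset.sum_mul, ← map_sum, hX.div, Finset.mul_sum, mul_assoc]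
  have e3 : ∑ i, ∑ l, X l * D l (D i (V i)) = ∑ l, X l * D l (∑ i, D i (V i)) := by
    rw [Finset.sum_comm]
    simp only [map_sum, Finset.mul_sum]
  simp only [h, Finset.sum_add_distrib, Finset.sum_sub_distrib, lieS, e1, e2, e3]
  simp only [Finset.mul_sum]
  simp only [mul_assoc, ← Finset.mul_sum]
  ring

theorem div2_lie (hD : ∀ i j f, D i (D j f) = D j (D i f)) (hX : IsProjField D X c)
    (hw : ∀ i, D i w = 0) {B : Fin n → Fin n → R} (hB : ∀ i j, B i j = B j i) (j : Fin n) :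
    ∑ i, D i (lieV₂ D X w B i j)
      = lieV₁ D X w (fun j => ∑ i, D i (B i j)) j
        - (2 + (1 - w) * (n + 1)) * ∑ i, c i * B i j := by
  have h : ∀ i, D i (lieV₂ D X w B i j) = D i (lieV₁ D X w (fun i => B i j) i)
      - ∑ l, D l (X j) * D i (B i l) - ∑ l, D i (D l (X j)) * B i l := by
    intro i
    simp only [lieV₁, lieV₂, map_add, map_sub, derivation_sum_mul]
    ring
  have e1 : ∑ i, ∑ l, D l (X j) * D i (B i l) = ∑ l, D l (X j) * ∑ i, D i (B i l) := by
    rw [Finset.sum_comm]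
    simp only [Finset.mul_sum]
  have e2 : ∑ i, ∑ l, D i (D l (X j)) * B i l = 2 * ∑ i, c i * B i j := by
    simp only [hX _ _ j, add_mul, Finset.sum_add_distrib, ite_mul, zero_mul]
    simp [hB j, two_mul]
  simp only [h, Finset.sum_sub_distrib, div1_lie hD hX hw, e1, e2]
  simp only [lieS, lieV₁]
  ring

theorem div3_lie (hD : ∀ i j f, D i (D j f) = D j (D i f)) (hX : IsProjField D X c)
    (hw : ∀ i, D i w = 0) {p : Fin n → Fin n → Fin n → R} (hp : Symm3 p) (j k : Fin n) :
    ∑ i, D i (lieV₃ D X w p i j k)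
      = lieV₂ D X w (fun j k => ∑ i, D i (p i j k)) j k
        - (4 + (1 - w) * (n + 1)) * ∑ i, c i * p i j k := by
  have h : ∀ i, D i (lieV₃ D X w p i j k) = D i (lieV₁ D X w (fun i => p i j k) i)
      - ∑ l, D l (X j) * D i (p i l k) - ∑ l, D i (D l (X j)) * p i l k
      - ∑ l, D l (X k) * D i (p i j l) - ∑ l, D i (D l (X k)) * p i j l := by
    intro i
    simp only [lieV₁, lieV₃, map_add, map_sub, derivation_sum_mul]
    ring
  have e1 : ∑ i, ∑ l, D l (X j) * D i (p i l k) = ∑ l, D l (X j) * ∑ i, D i (p i l k) := by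
    rw [Finset.sum_comm]
    simp only [Finset.mul_sum]
  have e1' : ∑ i, ∑ l, D l (X k) * D i (p i j l) = ∑ l, D l (X k) * ∑ i, D i (p i j l) := by
    rw [Finset.sum_comm]
    simp only [Finset.mul_sum]
  have e2 : ∑ i, ∑ l, D i (D l (X j)) * p i l k = 2 * ∑ i, c i * p i j k := by
    simp only [hX _ _ j, add_mul, Finset.sum_add_distrib, ite_mul, zero_mul]
    simp [hp.1 j, two_mul]
  have e2' : ∑ i, ∑ l, D i (D l (X k)) * p i j l = 2 * ∑ i, c i * p i j k := by
    have e3 : ∀ l, p k j l = p l j k := fun l => by rw [hp.1, hp.2, hp.1]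
    simp only [hX _ _ k, add_mul, Finset.sum_add_distrib, ite_mul, zero_mul]
    simp [e3, two_mul]
  simp only [h, Finset.sum_sub_distrib, div1_lie hD hX hw, e1, e2, e1', e2']
  simp only [lieS, lieV₂]
  ring

theorem lieS_add (f g : R) : lieS D X w (f + g) = lieS D X w f + lieS D X w g := by
  simp only [lieS, map_add, mul_add, Finset.sum_add_distrib]
  ring

theorem lieS_mul (f g : R) :
    lieS D X (w + w') (f * g) = lieS D X w f * g + f * lieS D X w' g := by
  simp only [lieS, Derivation.leibniz, smul_eq_mul, mul_add, Finset.sum_add_distrib,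
    mul_left_comm (X _), ← Finset.mul_sum]
  ring

theorem lieS_const_mul {a : R} (ha : ∀ i, D i a = 0) (f : R) :
    lieS D X w (a * f) = a * lieS D X w f := by
  simp only [lieS, Derivation.leibniz, smul_eq_mul, ha, mul_zero, add_zero,
    mul_left_comm (X _), ← Finset.mul_sum]
  ring

/-- The flat quantization formula is equivariant under the fields of `sl_{n+1}`. -/
theorem quantE_zero_equivariant (κ : QuantCoeffs R) (hκ : κ.Balanced n)
    (hD : ∀ i j f, D i (D j f) = D j (D i f)) (hX : IsProjField D X c)
    (hc : ∀ i j, D i (c j) = 0)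
    (hlam : ∀ i, D i κ.lam = 0) (hδ : ∀ i, D i κ.δ = 0) (hα : ∀ i, D i κ.α = 0)
    (hβ₁ : ∀ i, D i κ.β₁ = 0) (hη₁ : ∀ i, D i κ.η₁ = 0)
    {p : Fin n → Fin n → Fin n → R} (hp : Symm3 p) (f : R) :
    quantE D 0 κ (lieV₃ D X κ.δ p) f
      = lieS D X (κ.δ + κ.lam) (quantE D 0 κ p f) - quantE D 0 κ p (lieS D X κ.lam f) := by
  set L := κ.lam * ((n : R) + 1) with hL
  set s := (1 - κ.δ) * ((n : R) + 1) with hs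
  have hcL : ∀ i, D i L = 0 := by
    intro i
    simp [hL, Derivation.leibniz, hlam]
  have hcs : ∀ i, D i s = 0 := by
    intro i
    simp [hs, Derivation.leibniz, hδ]
  have hnum : ∀ (m : ℕ) i, D i (m : R) = 0 := fun m i => (D i).map_natCast m
  have hd3 : ∀ i, D i (4 + s) = 0 := by
    intro i
    have := hnum 4 i
    rw [map_add, hcs, add_zero]
    exact_mod_cast this
  have hd2 : ∀ i, D i (6 + 2 * s) = 0 := by
    intro i
    have h6 := hnum 6 i
    have h2 := hnum 2 i
    push_cast at h6 h2
    rw [map_add, Derivation.leibniz, hcs, h6, h2]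
    simp
  have hL1 : ∀ i, D i (1 + L) = 0 := by
    intro i
    simp [hcL]
  -- covariant side
  have g₁ : (fun i => D i (lieS D X κ.lam f))
      = fun i => lieC₁ D X κ.lam (fun i => D i f) i + L * (c i * f) :=
    funext fun i => lieS_deriv hD hX hlam f i
  have g₂ : (fun i j => D i (D j (lieS D X κ.lam f)))
      = fun i j => lieC₂ D X κ.lam (fun i j => D i (D j f)) i j
        + (1 + L) * (c i * D j f) + (1 + L) * (c j * D i f) := by
    funext i j
    rw [congrFun g₁ j, map_add, lieC₁_deriv hD hX hlam]
    simp only [Derivation.leibniz, hcL, hc, smul_eq_mul, ← hL]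
    ring
  have g₃ : (fun i j k => D i (D j (D k (lieS D X κ.lam f))))
      = fun i j k => lieC₃ D X κ.lam (fun i j k => D i (D j (D k f))) i j k
        + (2 + L) * (c i * D j (D k f)) + (2 + L) * (c j * D i (D k f))
        + c k * D j (D i f) + (1 + L) * (c k * D i (D j f)) := by
    funext i j k
    rw [congrFun (congrFun g₂ j) k, map_add, map_add, lieC₂_deriv hD hX hlam]
    simp only [Derivation.leibniz, hL1, hc, smul_eq_mul, ← hL]
    ring
  -- contravariant side
  have q₂ : (fun j k => ∑ i, D i (lieV₃ D X κ.δ p i j k))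
      = fun j k => lieV₂ D X κ.δ (fun j k => ∑ i, D i (p i j k)) j k
        - (4 + s) * ∑ i, c i * p i j k :=
    funext fun j => funext fun k => div3_lie hD hX hδ hp j k
  have hB : ∀ i j, ∑ l, D l (p l i j) = ∑ l, D l (p l j i) := fun i j =>
    Finset.sum_congr rfl fun l _ => by rw [hp.2]
  have q₁ : (fun j => ∑ i, D i (∑ l, D l (lieV₃ D X κ.δ p l i j)))
      = fun j => lieV₁ D X κ.δ (fun j => ∑ i, D i (∑ l, D l (p l i j))) j
        - (6 + 2 * s) * ∑ i, c i * ∑ l, D l (p l i j) := by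
    funext j
    have e : ∑ i, D i ((4 + s) * ∑ l, c l * p l i j)
        = (4 + s) * ∑ i, c i * ∑ l, D l (p l i j) := by
      simp only [Derivation.leibniz, hd3, smul_eq_mul, derivation_sum_mul, hc]
      simp only [zero_mul, Finset.sum_const_zero, mul_zero, add_zero, ← Finset.mul_sum]
      rw [Finset.sum_comm]
      congr 1
      refine Finset.sum_congr rfl fun i _ => ?_
      rw [← Finset.mul_sum]
      congr 1
      exact Finset.sum_congr rfl fun l _ => by rw [hp.1]
    have e' : ∀ i, D i (∑ l, D l (lieV₃ D X κ.δ p l i j))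
        = D i (lieV₂ D X κ.δ (fun j k => ∑ i, D i (p i j k)) i j)
          - D i ((4 + s) * ∑ l, c l * p l i j) := by
      intro i
      rw [congrFun (congrFun q₂ i) j, map_sub]
    simp only [e', Finset.sum_sub_distrib, e, div2_lie hD hX hδ hB j, ← hs]
    ring
  have q₀ : ∑ j, D j (∑ i, D i (∑ l, D l (lieV₃ D X κ.δ p l i j)))
      = lieS D X κ.δ (∑ j, D j (∑ i, D i (∑ l, D l (p l i j))))
        - (6 + 3 * s) * ∑ i, c i * ∑ j, D j (∑ l, D l (p l j i)) := by
    have e : ∑ j, D j ((6 + 2 * s) * ∑ i, c i * ∑ l, D l (p l i j))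
        = (6 + 2 * s) * ∑ i, c i * ∑ j, D j (∑ l, D l (p l j i)) := by
      simp only [Derivation.leibniz, hd2, smul_eq_mul, derivation_sum_mul, hc]
      simp only [zero_mul, Finset.sum_const_zero, mul_zero, add_zero, ← Finset.mul_sum]
      rw [Finset.sum_comm]
      congr 1
      refine Finset.sum_congr rfl fun i _ => ?_
      rw [← Finset.mul_sum]
      congr 1
      exact Finset.sum_congr rfl fun l _ => by rw [hB]
    have e' : ∀ j, D j (∑ i, D i (∑ l, D l (lieV₃ D X κ.δ p l i j)))
        = D j (lieV₁ D X κ.δ (fun j => ∑ i, D i (∑ l, D l (p l i j))) j)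
          - D j ((6 + 2 * s) * ∑ i, c i * ∑ l, D l (p l i j)) := by
      intro j
      rw [congrFun q₁ j, map_sub]
    simp only [e', Finset.sum_sub_distrib, e, div1_lie hD hX hδ, ← hs]
    ring
  obtain ⟨h1, h2, h3, h4, h5, h6, h7, h8⟩ := hκ
  simp only [← hL, ← hs] at h1 h2 h3 h4 h5 h6 h7 h8
  have z2 : ∀ B : Fin n → Fin n → R, ctr2 B (0 : Fin n → Fin n → R) = 0 := by
    intro B; simp [ctr2]
  have z3 : ∀ F : Fin n → R,
      ctr3 p (fun i j k => (0 : Fin n → Fin n → R) i j * F k) = 0 := by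
    intro F; simp [ctr3]
  have z3' : ∀ F : Fin n → R,
      ctr3 (lieV₃ D X κ.δ p) (fun i j k => (0 : Fin n → Fin n → R) i j * F k) = 0 := by
    intro F; simp [ctr3]
  have z4 : ∀ p : Fin n → Fin n → Fin n → R,
      ctr3 p (fun i j k => D i ((0 : Fin n → Fin n → R) j k)) = 0 := by
    intro p; simp [ctr3]
  -- The Ricci tensor of the flat connection is zero, so the terms with `β₂`, `η₂` and `η₃` drop
  -- out.
  simp only [quantE, cov0_zero, cov1_zero, cov2_zero, div1_zero, div2_zero, div3_zero, ricciA_zero,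
    z2, z3, z3', z4, mul_zero, add_zero]
  rw [q₀, q₁, q₂, g₁, g₂, g₃]
  set f₁ := fun i => D i f
  set f₂ := fun i j => D i (D j f)
  set f₃ := fun i j k => D i (D j (D k f))
  set p₂ := fun j k => ∑ i, D i (p i j k)
  set p₁ := fun j => ∑ i, D i (∑ l, D l (p l i j))
  set p₀ := ∑ j, D j (∑ i, D i (∑ l, D l (p l i j)))
  rw [lieS_add, lieS_add, lieS_add, lieS_const_mul hα, lieS_const_mul hβ₁, lieS_mul,
    lieS_const_mul hη₁, lieS_ctr3, lieS_ctr2, lieS_ctr1]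
  have k₁ : ctr2 (fun j k => lieV₂ D X κ.δ p₂ j k - (4 + s) * ∑ i, c i * p i j k) f₂
      = ctr2 (lieV₂ D X κ.δ p₂) f₂ - (4 + s) * ctr3 p (fun i j k => c i * f₂ j k) := by
    rw [← ctr2_contract, ← ctr2_const_mul_left]
    simp only [ctr2, sub_mul, Finset.sum_sub_distrib]
  have k₂ : ctr1 (fun j => lieV₁ D X κ.δ p₁ j - (6 + 2 * s) * ∑ i, c i * p₂ i j) f₁
      = ctr1 (lieV₁ D X κ.δ p₁) f₁ - (6 + 2 * s) * ctr2 p₂ (fun i j => c i * f₁ j) := by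
    rw [← ctr1_contract, ← ctr1_const_mul_left]
    simp only [ctr1, sub_mul, Finset.sum_sub_distrib]
  have k₃ : ctr3 p (fun i j k => lieC₃ D X κ.lam f₃ i j k
        + (2 + L) * (c i * D j (D k f)) + (2 + L) * (c j * D i (D k f))
        + c k * D j (D i f) + (1 + L) * (c k * D i (D j f)))
      = ctr3 p (lieC₃ D X κ.lam f₃) + (6 + 3 * L) * ctr3 p (fun i j k => c i * f₂ j k) := by
    simp only [ctr3_add, ctr3_const_mul]
    rw [ctr3_swap₁₂ hp (fun i j k => c i * D j (D k f)),
      ctr3_swap₁₃ hp (fun i j k => c i * D j (D k f)),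
      ctr3_rot' hp (fun i j k => c i * D j (D k f))]
    simp only [f₂]
    ring
  have k₄ : ctr2 p₂ (fun i j => lieC₂ D X κ.lam f₂ i j
        + (1 + L) * (c i * D j f) + (1 + L) * (c j * D i f))
      = ctr2 p₂ (lieC₂ D X κ.lam f₂) + (2 + 2 * L) * ctr2 p₂ (fun i j => c i * f₁ j) := by
    simp only [ctr2_add, ctr2_const_mul]
    rw [ctr2_swap hB (fun i j => c i * D j f)]
    simp only [f₁]
    ring
  have k₅ : ctr1 p₁ (fun i => lieC₁ D X κ.lam f₁ i + L * (c i * f))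
      = ctr1 p₁ (lieC₁ D X κ.lam f₁) + L * (f * ctr1 p₁ c) := by
    simp only [ctr1_add, ctr1_const_mul, ctr1_mul_const]
  have k₆ : ∑ i, c i * ∑ j, D j (∑ l, D l (p l j i)) = ctr1 p₁ c :=
    Finset.sum_congr rfl fun i _ => mul_comm _ _
  have k₂' : (fun j => lieV₁ D X κ.δ p₁ j - (6 + 2 * s) * ∑ i, c i * ∑ l, D l (p l i j))
      = fun j => lieV₁ D X κ.δ p₁ j - (6 + 2 * s) * ∑ i, c i * p₂ i j := rfl
  rw [k₁, k₂', k₂, k₃, k₄, k₅, k₆]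
  -- Three defects remain, contractions of `p`, `p₂`, `p₁` with `c` and with `f₂`, `f₁`, `f`. Each
  -- combines what the divergence of `P` loses with what the next higher derivative of `f` gains,
  -- and the relations for `α`, `β₁`, `η₁` say that these agree.
  linear_combination -ctr3 p (fun i j k => c i * f₂ j k) * h1
    - 2 * ctr2 p₂ (fun i j => c i * f₁ j) * h2 - f * ctr1 p₁ c * h4

end LieDerivative

end ProjQuant

end

noncomputable section

namespace ProjQuant

/-! ## Change of coordinates over an algebra with derivations -/

section MultiIndex

variable {n : ℕ} {R : Type*} [CommRing R]

/-- The product of matrix entries over two multi-indices. -/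
def multiProd (A : Fin n → Fin n → R) {q : ℕ} (I J : Fin q → Fin n) : R := ∏ t, A (I t) (J t)

theorem multiProd_update_left (A : Fin n → Fin n → R) {q : ℕ} (I J : Fin q → Fin n) (t : Fin q)
    (m : Fin n) : multiProd A (Function.update I t m) J
      = A m (J t) * ∏ s ∈ Finset.univ.erase t, A (I s) (J s) := by
  rw [multiProd, ← Finset.mul_prod_erase _ _ (Finset.mem_univ t), Function.update_self]
  congr 1
  refine Finset.prod_congr rfl fun s hs => ?_
  rw [Function.update_of_ne (Finset.ne_of_mem_erase hs)]

theorem multiProd_update_right (A : Fin n → Fin n → R) {q : ℕ} (I J : Fin q → Fin n) (t : Fin q)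
    (m : Fin n) : multiProd A I (Function.update J t m)
      = A (I t) m * ∏ s ∈ Finset.univ.erase t, A (I s) (J s) := by
  rw [multiProd, ← Finset.mul_prod_erase _ _ (Finset.mem_univ t), Function.update_self]
  congr 1
  refine Finset.prod_congr rfl fun s hs => ?_
  rw [Function.update_of_ne (Finset.ne_of_mem_erase hs)]

theorem multiProd_cons (A : Fin n → Fin n → R) {q : ℕ} (i a : Fin n) (I J : Fin q → Fin n) :
    multiProd A (Fin.cons i I : Fin (q + 1) → Fin n) (Fin.cons a J : Fin (q + 1) → Fin n)
      = A i a * multiProd A I J := by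
  simp [multiProd, Fin.prod_univ_succ]

theorem sum_multiIndex_succ {q : ℕ} (F : (Fin (q + 1) → Fin n) → R) :
    ∑ J, F J = ∑ J : Fin q → Fin n, ∑ i, F (Fin.cons i J : Fin (q + 1) → Fin n) := by
  rw [← (Fin.consEquiv (fun _ : Fin (q + 1) => Fin n)).sum_comp, Fintype.sum_prod_type_right]
  rfl

/-- Exchanging the entry `J t` with the free index `m` is an involution of the pairs `(J, m)`. It
moves a Christoffel symbol from one factor of a contraction to the other. -/
theorem sum_update_swap {q : ℕ} (t : Fin q) (Φ : (Fin q → Fin n) → (Fin q → Fin n) → R) :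
    ∑ J, ∑ m, Φ J (Function.update J t m) = ∑ J, ∑ m, Φ (Function.update J t m) J := by
  rw [← Fintype.sum_prod_type', ← Fintype.sum_prod_type']
  refine Finset.sum_nbij' (fun x => (Function.update x.1 t x.2, x.1 t))
    (fun x => (Function.update x.1 t x.2, x.1 t)) ?_ ?_ ?_ ?_ ?_
  all_goals simp

/-- Tensor powers of mutually inverse matrices are inverse to each other, since a sum over
multi-indices of a product factors into a product of sums. -/
theorem multiProd_mul (A B : Fin n → Fin n → R) (hAB : ∀ i k, ∑ j, B i j * A j k = if i = k then 1 else 0)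
    {q : ℕ} (J K : Fin q → Fin n) :
    ∑ I, multiProd B J I * multiProd A I K = if J = K then 1 else 0 := by
  simp only [multiProd, ← Finset.prod_mul_distrib]
  rw [← Fintype.prod_sum (fun t i => B (J t) i * A i (K t))]
  simp only [hAB]
  split_ifs with h
  · subst h; simp
  · obtain ⟨s, hs⟩ := Function.ne_iff.1 h
    exact Finset.prod_eq_zero (Finset.mem_univ s) (if_neg hs)

end MultiIndex

/-! ### Tensoriality of the covariant derivative. -/

section ChangeOfCoordinates

variable {n : ℕ} {R : Type*} [CommRing R]

/-- Two arrays are components, in two coordinate systems with Jacobian `A`, of the same tensor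
with values in densities, where `r` is the density factor. -/
def TensorRel (r : R) (A : Fin n → Fin n → R) {p q : ℕ}
    (T T' : (Fin p → Fin n) → (Fin q → Fin n) → R) : Prop :=
  ∀ I J, ∑ J', multiProd A J' J * T' I J' = r * ∑ K, multiProd A I K * T K J

variable [Algebra ℝ R]

/-- The change of the Christoffel symbols and of the partial derivatives under a change of
coordinates with Jacobian `A`. -/
structure ConnectionRel (A : Fin n → Fin n → R) (D D' : Fin n → Derivation ℝ R R)
    (Γ Γ' : Fin n → Fin n → Fin n → R) : Prop where
  deriv : ∀ a f, D a f = ∑ i, A i a * D' i f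
  christoffel : ∀ a k b, D a (A k b)
    = ∑ c, A k c * Γ c a b - ∑ i, ∑ j, A i a * (Γ' k i j * A j b)

variable {A : Fin n → Fin n → R} {D D' : Fin n → Derivation ℝ R R}
  {Γ Γ' : Fin n → Fin n → Fin n → R}

theorem derivation_prod {ι : Type*} [DecidableEq ι] (d : Derivation ℝ R R) (s : Finset ι)
    (F : ι → R) : d (∏ t ∈ s, F t) = ∑ t ∈ s, d (F t) * ∏ u ∈ s.erase t, F u := by
  induction s using Finset.induction_on with
  | empty => simp
  | insert a s ha ih =>
    rw [Finset.prod_insert ha, Derivation.leibniz, ih, Finset.sum_insert ha,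
      Finset.erase_insert ha, smul_eq_mul, smul_eq_mul, Finset.mul_sum, add_comm, mul_comm]
    congr 1
    refine Finset.sum_congr rfl fun t ht => ?_
    rw [Finset.erase_insert_of_ne (by rintro rfl; exact ha ht),
      Finset.prod_insert (fun h => ha (Finset.mem_of_mem_erase h))]
    ring

/-- The product rule applied to a tensor power of the Jacobian, with each differentiated factor
replaced by the Christoffel law. The result has the shape of the connection terms of `covA` in the
two coordinate systems. -/
theorem ConnectionRel.multiProd_deriv (h : ConnectionRel A D D' Γ Γ') {q : ℕ} (a : Fin n)
    (I J : Fin q → Fin n) : D a (multiProd A I J)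
      = ∑ t, ∑ c, Γ c a (J t) * multiProd A I (Function.update J t c)
        - ∑ i, A i a * ∑ t, ∑ j, Γ' (I t) i j * multiProd A (Function.update I t j) J := by
  have e : ∑ i, A i a * ∑ t, ∑ j, Γ' (I t) i j * multiProd A (Function.update I t j) J
      = ∑ t, ∑ i, ∑ j, A i a * (Γ' (I t) i j * multiProd A (Function.update I t j) J) := by
    simp only [Finset.mul_sum]
    exact Finset.sum_comm
  rw [e, ← Finset.sum_sub_distrib, multiProd, derivation_prod]
  refine Finset.sum_congr rfl fun t _ => ?_
  rw [h.christoffel]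
  simp only [multiProd_update_left, multiProd_update_right, sub_mul, Finset.sum_mul]
  congr 1
  · exact Finset.sum_congr rfl fun c _ => by ring
  · exact Finset.sum_congr rfl fun i _ => Finset.sum_congr rfl fun j _ => by ring

/-- The covariant derivative of a tensor is a tensor. -/
theorem TensorRel.covA (h : ConnectionRel A D D' Γ Γ') {r w : R}
    (hr : ∀ a, D a r = - w * r * (traceΓ Γ a - ∑ i, A i a * traceΓ Γ' i)) {p q : ℕ}
    {T T' : (Fin p → Fin n) → (Fin q → Fin n) → R} (hT : TensorRel r A T T') :
    TensorRel r A (covA D Γ w T) (covA D' Γ' w T') := by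
  intro I J
  obtain ⟨a, J, rfl⟩ : ∃ a J₀, J = (Fin.cons a J₀ : Fin (q + 1) → Fin n) :=
    ⟨J 0, Fin.tail J, (Fin.cons_self_tail J).symm⟩
  rw [sum_multiIndex_succ]
  simp only [multiProd_cons, ProjQuant.covA, Fin.cons_zero, Fin.tail_cons, Fin.cons_succ]
  -- Differentiating the transformation law of `T` gives the partial derivatives of both arrays, the
  -- derivatives of the Jacobian products, and that of the density factor. Sorted as in `x1` to
  -- `x6`, these are the remaining terms of the two covariant derivatives. The law is stated with
  -- the Jacobian only, lower indices being pulled back, so no inverse matrix has to be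
  -- differentiated.
  have E := congrArg (D a) (hT I J)
  simp only [map_sum, Derivation.leibniz, smul_eq_mul, h.multiProd_deriv, h.deriv a (T' _ _), hr,
    Finset.sum_add_distrib] at E
  set Γa := ∑ m, Γ m a m with hΓa
  have hΓa' : traceΓ Γ a = Γa := rfl
  -- terms on the side of `T'`
  have x1 : ∑ J', T' I J' * (∑ t, ∑ c, Γ c a (J t) * multiProd A J' (Function.update J t c)
        - ∑ i, A i a * ∑ t, ∑ j, Γ' (J' t) i j * multiProd A (Function.update J' t j) J)
      = r * (∑ K, multiProd A I K * ∑ t, ∑ m, Γ m a (J t) * T K (Function.update J t m))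
        - ∑ J', ∑ i, A i a * multiProd A J' J *
          ∑ t, ∑ m, Γ' m i (J' t) * T' I (Function.update J' t m) := by
    have y1 : ∑ J', T' I J' * (∑ t, ∑ c, Γ c a (J t) * multiProd A J' (Function.update J t c))
        = r * (∑ K, multiProd A I K * ∑ t, ∑ m, Γ m a (J t) * T K (Function.update J t m)) := by
      have z1 : ∀ t c, ∑ J', T' I J' * (Γ c a (J t) * multiProd A J' (Function.update J t c))
          = r * ∑ K, multiProd A I K * (Γ c a (J t) * T K (Function.update J t c)) := by
        intro t c
        have := congrArg (fun z => Γ c a (J t) * z) (hT I (Function.update J t c))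
        simp only [Finset.mul_sum] at this ⊢
        refine Eq.trans ?_ (this.trans ?_) <;>
          exact Finset.sum_congr rfl fun _ _ => by ring
      simp only [Finset.mul_sum] at z1 ⊢
      rw [Finset.sum_comm, Finset.sum_comm (s := (Finset.univ : Finset (Fin p → Fin n)))]
      refine Finset.sum_congr rfl fun t _ => ?_
      rw [Finset.sum_comm, Finset.sum_comm (s := (Finset.univ : Finset (Fin p → Fin n)))]
      exact Finset.sum_congr rfl fun c _ => z1 t c
    have y2 : ∑ J', T' I J' * (∑ i, A i a * ∑ t, ∑ j, Γ' (J' t) i j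
          * multiProd A (Function.update J' t j) J)
        = ∑ J', ∑ i, A i a * multiProd A J' J *
          ∑ t, ∑ m, Γ' m i (J' t) * T' I (Function.update J' t m) := by
      simp only [Finset.mul_sum]
      rw [Finset.sum_comm, Finset.sum_comm (s := (Finset.univ : Finset (Fin q → Fin n)))]
      refine Finset.sum_congr rfl fun i _ => ?_
      rw [Finset.sum_comm, Finset.sum_comm (s := (Finset.univ : Finset (Fin q → Fin n)))]
      refine Finset.sum_congr rfl fun t _ => ?_
      have := sum_update_swap t (fun X Y => T' I X * (A i a * (Γ' (X t) i (Y t) * multiProd A Y J)))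
      simp only [Function.update_self] at this
      rw [this]
      exact Finset.sum_congr rfl fun X _ => Finset.sum_congr rfl fun m _ => by ring
    simp only [mul_sub, Finset.sum_sub_distrib]
    rw [y1, y2]
  have x2 : ∑ K, T K J * (∑ s, ∑ c, Γ c a (K s) * multiProd A I (Function.update K s c)
        - ∑ i, A i a * ∑ s, ∑ j, Γ' (I s) i j * multiProd A (Function.update I s j) K)
      = (∑ K, multiProd A I K * ∑ s, ∑ m, Γ (K s) a m * T (Function.update K s m) J)
        - ∑ i, A i a * ∑ s, ∑ j, Γ' (I s) i j *
          ∑ K, multiProd A (Function.update I s j) K * T K J := by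
    have y1 : ∑ K, T K J * (∑ s, ∑ c, Γ c a (K s) * multiProd A I (Function.update K s c))
        = ∑ K, multiProd A I K * ∑ s, ∑ m, Γ (K s) a m * T (Function.update K s m) J := by
      simp only [Finset.mul_sum]
      rw [Finset.sum_comm, Finset.sum_comm (s := (Finset.univ : Finset (Fin p → Fin n)))]
      refine Finset.sum_congr rfl fun t _ => ?_
      have := sum_update_swap t (fun X Y => T X J * (Γ (Y t) a (X t) * multiProd A I Y))
      simp only [Function.update_self] at this
      rw [this]
      exact Finset.sum_congr rfl fun X _ => Finset.sum_congr rfl fun m _ => by ring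
    have y2 : ∑ K, T K J * (∑ i, A i a * ∑ s, ∑ j, Γ' (I s) i j
          * multiProd A (Function.update I s j) K)
        = ∑ i, A i a * ∑ s, ∑ j, Γ' (I s) i j *
          ∑ K, multiProd A (Function.update I s j) K * T K J := by
      simp only [Finset.mul_sum]
      rw [Finset.sum_comm]
      refine Finset.sum_congr rfl fun i _ => ?_
      rw [Finset.sum_comm]
      refine Finset.sum_congr rfl fun t _ => ?_
      rw [Finset.sum_comm]
      exact Finset.sum_congr rfl fun X _ => Finset.sum_congr rfl fun m _ => by ring
    simp only [mul_sub, Finset.sum_sub_distrib]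
    rw [y1, y2]
  have x3 : r * ∑ i, A i a * ∑ s, ∑ j, Γ' (I s) i j *
        ∑ K, multiProd A (Function.update I s j) K * T K J
      = ∑ J', ∑ i, A i a * multiProd A J' J *
          ∑ s, ∑ m, Γ' (I s) i m * T' (Function.update I s m) J' := by
    have z : ∀ s j i, r * (A i a * (Γ' (I s) i j *
          ∑ K, multiProd A (Function.update I s j) K * T K J))
        = ∑ J', A i a * multiProd A J' J * (Γ' (I s) i j * T' (Function.update I s j) J') := by
      intro s j i
      have := congrArg (fun z => A i a * Γ' (I s) i j * z) (hT (Function.update I s j) J)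
      rw [show r * (A i a * (Γ' (I s) i j *
        ∑ K, multiProd A (Function.update I s j) K * T K J)) = A i a * Γ' (I s) i j * (r *
        ∑ K, multiProd A (Function.update I s j) K * T K J) by ring, ← this, Finset.mul_sum]
      exact Finset.sum_congr rfl fun _ _ => by ring
    rw [Finset.sum_comm, Finset.mul_sum]
    refine Finset.sum_congr rfl fun i _ => ?_
    simp only [Finset.mul_sum (s := (Finset.univ : Finset (Fin p)))]
    rw [Finset.sum_comm]
    refine Finset.sum_congr rfl fun s _ => ?_
    simp only [Finset.mul_sum (s := (Finset.univ : Finset (Fin n)))]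
    rw [Finset.sum_comm]
    exact Finset.sum_congr rfl fun j _ => z s j i
  have x4 : ∑ J', ∑ i, A i a * multiProd A J' J * (w * (∑ m, Γ' m i m) * T' I J')
      = w * (∑ i, A i a * traceΓ Γ' i) * (r * ∑ K, multiProd A I K * T K J) := by
    rw [← hT I J, Finset.mul_sum]
    refine Finset.sum_congr rfl fun J' _ => ?_
    rw [Finset.mul_sum, Finset.sum_mul]
    refine Finset.sum_congr rfl fun i _ => ?_
    simp only [traceΓ]
    ring
  have x5 : ∑ J', ∑ i, A i a * multiProd A J' J * D' i (T' I J')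
      = ∑ J', multiProd A J' J * ∑ i, A i a * D' i (T' I J') := by
    refine Finset.sum_congr rfl fun J' _ => ?_
    rw [Finset.mul_sum]
    exact Finset.sum_congr rfl fun i _ => by ring
  have x6 : ∑ K, multiProd A I K * (w * Γa * T K J)
      = w * Γa * ∑ K, multiProd A I K * T K J := by
    rw [Finset.mul_sum (s := (Finset.univ : Finset (Fin p → Fin n)))]
    exact Finset.sum_congr rfl fun i _ => by ring
  rw [x1, x2] at E
  simp only [mul_add, mul_sub, Finset.sum_add_distrib, Finset.sum_sub_distrib]
  rw [x4, x5, x6]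
  linear_combination E - x3 - w * (r * ∑ K, multiProd A I K * T K J) * hΓa'

end ChangeOfCoordinates

end ProjQuant

end

noncomputable section

namespace ProjQuant

/-! ### Curvature under gauge transformations and tensoriality of the Ricci tensor. -/

section Curvature

variable {n : ℕ} {R : Type*} [CommRing R] [Algebra ℝ R]

/-- A derivation applied to the entries of a matrix. -/
def matrixDeriv (d : Derivation ℝ R R) (M : Matrix (Fin n) (Fin n) R) :
    Matrix (Fin n) (Fin n) R := Matrix.of fun i j => d (M i j)

theorem matrixDeriv_mul (d : Derivation ℝ R R) (M N : Matrix (Fin n) (Fin n) R) :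
    matrixDeriv d (M * N) = matrixDeriv d M * N + M * matrixDeriv d N := by
  ext i j
  simp only [matrixDeriv, Matrix.of_apply, Matrix.mul_apply, Matrix.add_apply, map_sum,
    Derivation.leibniz, smul_eq_mul, ← Finset.sum_add_distrib]
  exact Finset.sum_congr rfl fun _ _ => by ring

theorem matrixDeriv_sub (d : Derivation ℝ R R) (M N : Matrix (Fin n) (Fin n) R) :
    matrixDeriv d (M - N) = matrixDeriv d M - matrixDeriv d N := by
  ext i j
  simp [matrixDeriv]

/-- The curvature of a matrix-valued connection form. -/
def curvatureA (D : Fin n → Derivation ℝ R R) (G : Fin n → Matrix (Fin n) (Fin n) R)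
    (e a : Fin n) : Matrix (Fin n) (Fin n) R :=
  matrixDeriv (D e) (G a) - matrixDeriv (D a) (G e) + G e * G a - G a * G e

/-- This is the integrability condition of `dA = A G - H A`: differentiating once more and
antisymmetrizing removes the second derivatives of `A`, and substituting the equation for the first
derivatives leaves the two curvatures. -/
theorem curvatureA_gauge {D : Fin n → Derivation ℝ R R}
    {G H : Fin n → Matrix (Fin n) (Fin n) R} {A : Matrix (Fin n) (Fin n) R} (e a : Fin n)
    (hD : ∀ f, D e (D a f) = D a (D e f))
    (h : ∀ a, matrixDeriv (D a) A = A * G a - H a * A) :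
    A * curvatureA D G e a = curvatureA D H e a * A := by
  have h1 : matrixDeriv (D e) (matrixDeriv (D a) A) = matrixDeriv (D a) (matrixDeriv (D e) A) := by
    ext i j
    exact hD _
  simp only [h, matrixDeriv_sub, matrixDeriv_mul] at h1
  rw [← sub_eq_zero] at h1 ⊢
  rw [← h1]
  simp only [curvatureA]
  noncomm_ring

theorem ricciA_eq_curvatureA (D : Fin n → Derivation ℝ R R) (Γ : Fin n → Fin n → Fin n → R)
    (i j : Fin n) : ricciA D Γ i j
      = ∑ k, curvatureA D (fun a => Matrix.of fun c b => Γ c a b) i k k j := by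
  refine Finset.sum_congr rfl fun k _ => ?_
  simp only [curvatureA, matrixDeriv, Matrix.sub_apply, Matrix.add_apply, Matrix.mul_apply,
    Matrix.of_apply, Finset.sum_sub_distrib]
  ring

variable {A B : Fin n → Fin n → R} {D D' : Fin n → Derivation ℝ R R}
  {Γ Γ' : Fin n → Fin n → Fin n → R}

/-- The derivatives of `A` in the two antisymmetrized terms cancel because `A` is closed, that is
`D_a A_{ib} = D_b A_{ia}`, as holds for a Jacobian. -/
theorem curvatureA_pullback (hd : ∀ a f, D a f = ∑ i, A i a * D' i f)
    (hA : ∀ i a b, D a (A i b) = D b (A i a)) (G : Fin n → Matrix (Fin n) (Fin n) R)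
    (e a : Fin n) : curvatureA D (fun a => ∑ i, A i a • G i) e a
      = ∑ i, ∑ j, (A i e * A j a) • curvatureA D' G i j := by
  ext l m
  have h1 : ∀ e a, ∑ j, A j a * D e (G j l m)
      = ∑ i, ∑ j, A i e * A j a * D' i (G j l m) := by
    intro e a
    rw [Finset.sum_comm]
    refine Finset.sum_congr rfl fun j _ => ?_
    rw [hd, Finset.mul_sum]
    exact Finset.sum_congr rfl fun _ _ => by ring
  have h2 : ∀ e a, ∑ x, (∑ i, A i e * G i l x) * (∑ j, A j a * G j x m)
      = ∑ i, ∑ j, A i e * A j a * ∑ x, G i l x * G j x m := by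
    intro e a
    simp only [Finset.sum_mul_sum]
    simp only [Finset.mul_sum]
    rw [Finset.sum_comm]
    refine Finset.sum_congr rfl fun i _ => ?_
    rw [Finset.sum_comm]
    exact Finset.sum_congr rfl fun j _ => Finset.sum_congr rfl fun x _ => by ring
  have h3 : ∀ F : Fin n → Fin n → R, ∑ i, ∑ j, A i a * A j e * F i j
      = ∑ i, ∑ j, A i e * A j a * F j i := by
    intro F
    rw [Finset.sum_comm]
    exact Finset.sum_congr rfl fun j _ => Finset.sum_congr rfl fun x _ => by ring
  have h4 : ∑ i, G i l m * D e (A i a) = ∑ i, G i l m * D a (A i e) :=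
    Finset.sum_congr rfl fun i _ => by rw [hA]
  simp only [curvatureA, matrixDeriv, Matrix.sub_apply, Matrix.add_apply, Matrix.mul_apply,
    Matrix.of_apply, Matrix.sum_apply, Matrix.smul_apply, smul_eq_mul, map_sum,
    Derivation.leibniz, Finset.sum_add_distrib, mul_sub, mul_add, Finset.sum_sub_distrib]
  rw [h1, h1, h2, h2, h3, h3, h4]
  ring

/-- The Ricci tensor is a tensor. -/
theorem TensorRel.ricciA (h : ConnectionRel A D D' Γ Γ')
    (hD : ∀ a b f, D a (D b f) = D b (D a f)) (hA : ∀ i a b, D a (A i b) = D b (A i a))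
    (hBA : ∀ i k, ∑ j, B i j * A j k = if i = k then 1 else 0)
    (hAB : ∀ i k, ∑ j, A i j * B j k = if i = k then 1 else 0) :
    TensorRel 1 A (p := 0) (q := 2) (fun _ J => ricciA D Γ (J 0) (J 1))
      (fun _ J => ricciA D' Γ' (J 0) (J 1)) := by
  set G : Fin n → Matrix (Fin n) (Fin n) R := fun a => Matrix.of fun c b => Γ c a b with hG
  set H : Fin n → Matrix (Fin n) (Fin n) R := fun a => Matrix.of fun c b => Γ' c a b with hH
  -- The Christoffel law says that the Jacobian is a gauge transformation between the connection
  -- matrices `G` and the pullback of `H`, so it intertwines their curvatures.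
  have g : ∀ e a, Matrix.of A * curvatureA D G e a
      = (∑ i, ∑ j, (A i e * A j a) • curvatureA D' H i j) * Matrix.of A := by
    intro e a
    rw [← curvatureA_pullback h.deriv hA]
    refine curvatureA_gauge e a (hD e a) fun a => ?_
    ext k b
    simp only [matrixDeriv, Matrix.of_apply, h.christoffel, Matrix.sub_apply, Matrix.mul_apply,
      hG, hH, Matrix.sum_apply, Matrix.smul_apply, smul_eq_mul, Finset.sum_mul]
    congr 1
    refine Finset.sum_congr rfl fun j _ => Finset.sum_congr rfl fun x _ => ?_
    ring
  have hBA' : Matrix.of B * Matrix.of A = 1 := by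
    ext i k
    simp [Matrix.mul_apply, hBA, Matrix.one_apply]
  -- Solving for the curvature of `G` by means of the inverse `B` and taking the trace, the factor
  -- `B` meets the Jacobian of the traced form index and disappears.
  have key : ∀ e b, ProjQuant.ricciA D Γ e b
      = ∑ i, ∑ m, A i e * A m b * ProjQuant.ricciA D' Γ' i m := by
    intro e b
    simp only [ricciA_eq_curvatureA]
    have e1 : ∀ a, curvatureA D G e a a b
        = ∑ i, ∑ m, ∑ j, ∑ l, (A j a * B a l) * (A i e * A m b * curvatureA D' H i j l m) := by
      intro a
      have : curvatureA D G e a = Matrix.of B *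
          ((∑ i, ∑ j, (A i e * A j a) • curvatureA D' H i j) * Matrix.of A) := by
        rw [← g, ← Matrix.mul_assoc, hBA', Matrix.one_mul]
      rw [this]
      simp only [Matrix.mul_apply, Matrix.of_apply, Matrix.sum_apply, Matrix.smul_apply,
        smul_eq_mul, Finset.sum_mul, Finset.mul_sum]
      have e2 : ∀ F : Fin n → Fin n → Fin n → Fin n → R,
          ∑ l, ∑ i, ∑ j, ∑ m, F l m i j = ∑ i, ∑ m, ∑ j, ∑ l, F l m i j := by
        intro F
        refine Finset.sum_comm.trans (Finset.sum_congr rfl fun i _ => ?_)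
        refine (Finset.sum_congr rfl fun _ _ => Finset.sum_comm).trans ?_
        exact Finset.sum_comm.trans (Finset.sum_congr rfl fun m _ => Finset.sum_comm)
      rw [e2]
      refine Finset.sum_congr rfl fun i _ => Finset.sum_congr rfl fun m _ =>
        Finset.sum_congr rfl fun j _ => Finset.sum_congr rfl fun l _ => by ring
    change ∑ a, curvatureA D G e a a b = _
    simp only [e1]
    rw [Finset.sum_comm]
    refine Finset.sum_congr rfl fun i _ => ?_
    rw [Finset.sum_comm]
    refine Finset.sum_congr rfl fun m _ => ?_
    rw [Finset.sum_comm, Finset.mul_sum]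
    refine Finset.sum_congr rfl fun j _ => ?_
    rw [Finset.sum_comm]
    simp only [← Finset.sum_mul, hAB, ite_mul, one_mul, zero_mul, Finset.sum_ite_eq,
      Finset.mem_univ, if_true]
    rfl
  intro I J
  have : ∀ K : Fin 0 → Fin n, K = I := fun K => Subsingleton.elim _ _
  rw [Fintype.sum_unique (fun K : Fin 0 → Fin n => _)]
  simp only [multiProd, Fin.prod_univ_zero, one_mul, Fin.prod_univ_two]
  rw [key, sum_multiIndex_succ, Finset.sum_comm]
  refine Finset.sum_congr rfl fun i _ => ?_
  rw [sum_multiIndex_succ, Fintype.sum_unique (fun K : Fin 0 → Fin n => _)]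
  refine Finset.sum_congr rfl fun m _ => ?_
  simp

end Curvature

/-! ### Invariance of full contractions and of the quantization formula. -/

section Contraction

variable {n : ℕ} {R : Type*} [CommRing R] {A B : Fin n → Fin n → R}

theorem sum_multiIndex_three (F : (Fin 3 → Fin n) → R) :
    ∑ I, F I = ∑ i, ∑ j, ∑ k, F ![i, j, k] := by
  rw [sum_multiIndex_succ, Finset.sum_comm]
  refine Finset.sum_congr rfl fun i _ => ?_
  rw [sum_multiIndex_succ, Finset.sum_comm]
  refine Finset.sum_congr rfl fun j _ => ?_
  rw [sum_multiIndex_succ, Fintype.sum_unique (fun K : Fin 0 → Fin n => _)]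
  refine Finset.sum_congr rfl fun k _ => ?_
  congr 1

theorem sum_multiIndex_one (F : (Fin 1 → Fin n) → R) : ∑ I, F I = ∑ i, F ![i] := by
  rw [sum_multiIndex_succ, Fintype.sum_unique (fun K : Fin 0 → Fin n => _)]
  exact Finset.sum_congr rfl fun k _ => by congr 1

theorem sum_multiIndex_two (F : (Fin 2 → Fin n) → R) : ∑ I, F I = ∑ i, ∑ j, F ![i, j] := by
  rw [sum_multiIndex_succ, Finset.sum_comm]
  refine Finset.sum_congr rfl fun i _ => ?_
  rw [sum_multiIndex_one]
  exact Finset.sum_congr rfl fun k _ => by congr 1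

/-- The usual form of the transformation law, with the lower indices moved to the other side by the
inverse matrix. It is needed only for contractions, where nothing has to be differentiated. -/
theorem TensorRel.apply_right (hAB : ∀ i k, ∑ j, A i j * B j k = if i = k then 1 else 0)
    {r : R} {p q : ℕ} {T T' : (Fin p → Fin n) → (Fin q → Fin n) → R} (h : TensorRel r A T T')
    (I : Fin p → Fin n) (L : Fin q → Fin n) :
    T' I L = r * ∑ K, ∑ J, multiProd A I K * T K J * multiProd B J L := by
  have h1 : ∑ J, (∑ J', multiProd A J' J * T' I J') * multiProd B J L
      = ∑ J, (r * ∑ K, multiProd A I K * T K J) * multiProd B J L :=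
    Finset.sum_congr rfl fun J _ => by rw [h I J]
  have h2 : ∑ J, (∑ J', multiProd A J' J * T' I J') * multiProd B J L = T' I L := by
    simp only [Finset.sum_mul]
    rw [Finset.sum_comm]
    have : ∀ J', ∑ J, multiProd A J' J * T' I J' * multiProd B J L
        = T' I J' * if J' = L then 1 else 0 := by
      intro J'
      rw [← multiProd_mul B A hAB J' L, Finset.mul_sum]
      exact Finset.sum_congr rfl fun _ _ => by ring
    simp [this]
  rw [← h2, h1, Finset.sum_comm, Finset.mul_sum]
  refine Finset.sum_congr rfl fun J _ => ?_
  rw [Finset.mul_sum, Finset.mul_sum, Finset.sum_mul]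
  exact Finset.sum_congr rfl fun _ _ => by ring

/-- The full contraction of a contravariant tensor of which some indices are already lowered. -/
theorem TensorRel.contract (hBA : ∀ i k, ∑ j, B i j * A j k = if i = k then 1 else 0)
    (hAB : ∀ i k, ∑ j, A i j * B j k = if i = k then 1 else 0)
    {r s : R} {p q q' : ℕ} {X X' : (Fin p → Fin n) → (Fin q → Fin n) → R}
    {Y Y' : (Fin 0 → Fin n) → (Fin q' → Fin n) → R} (hX : TensorRel r A X X')
    (hY : TensorRel s A Y Y') (e : Fin q ⊕ Fin q' ≃ Fin p) :
    ∑ I, X' I (fun t => I (e (Sum.inl t))) * Y' ![] (fun t => I (e (Sum.inr t)))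
      = r * s * ∑ I, X I (fun t => I (e (Sum.inl t))) * Y ![] (fun t => I (e (Sum.inr t))) := by
  have hY' : ∀ J, ∑ J', multiProd A J' J * Y' ![] J' = s * Y ![] J := by
    intro J
    rw [hY ![] J, Fintype.sum_unique (fun K : Fin 0 → Fin n => _)]
    simp only [multiProd, Fin.prod_univ_zero, one_mul]
    congr 2
  -- The equivalence `e` divides the upper indices of `X` into those contracted with its own lower
  -- indices and those contracted with `Y`; `E` divides the summation accordingly.
  let E : (Fin q → Fin n) × (Fin q' → Fin n) ≃ (Fin p → Fin n) :=
    (Equiv.sumArrowEquivProdArrow (Fin q) (Fin q') (Fin n)).symm.trans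
      (Equiv.arrowCongr e (Equiv.refl (Fin n)))
  have hE1 : ∀ a b t, E (a, b) (e (Sum.inl t)) = a t := by
    intro a b t
    simp [E, Equiv.arrowCongr, Equiv.sumArrowEquivProdArrow]
  have hE2 : ∀ a b t, E (a, b) (e (Sum.inr t)) = b t := by
    intro a b t
    simp [E, Equiv.arrowCongr, Equiv.sumArrowEquivProdArrow]
  have hm : ∀ I K : Fin p → Fin n, multiProd A I K
      = multiProd A (fun t => I (e (Sum.inl t))) (fun t => K (e (Sum.inl t)))
        * multiProd A (fun t => I (e (Sum.inr t))) (fun t => K (e (Sum.inr t))) := by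
    intro I K
    simp only [multiProd]
    rw [← e.prod_comp, Fintype.prod_sum_type]
  -- In the first group of indices `B` meets `A` and gives a Kronecker delta, while the second group
  -- is absorbed by the transformation law of `Y`.
  have key : ∀ K J, ∑ I, multiProd A I K * multiProd B J (fun t => I (e (Sum.inl t)))
        * Y' ![] (fun t => I (e (Sum.inr t)))
      = (if J = (fun t => K (e (Sum.inl t))) then 1 else 0)
        * (s * Y ![] (fun t => K (e (Sum.inr t)))) := by
    intro K J
    rw [← E.sum_comp, Fintype.sum_prod_type]
    simp only [hm, hE1, hE2]
    rw [← hY', ← multiProd_mul A B hBA, Finset.sum_mul_sum]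
    exact Finset.sum_congr rfl fun a _ => Finset.sum_congr rfl fun b _ => by ring
  have : ∀ I, X' I (fun t => I (e (Sum.inl t))) * Y' ![] (fun t => I (e (Sum.inr t)))
      = ∑ K, ∑ J, r * X K J * (multiProd A I K * multiProd B J (fun t => I (e (Sum.inl t)))
        * Y' ![] (fun t => I (e (Sum.inr t)))) := by
    intro I
    rw [hX.apply_right hAB, Finset.mul_sum, Finset.sum_mul]
    refine Finset.sum_congr rfl fun K _ => ?_
    rw [Finset.mul_sum, Finset.sum_mul]
    exact Finset.sum_congr rfl fun J _ => by ring
  simp only [this]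
  rw [Finset.sum_comm, Finset.mul_sum]
  refine Finset.sum_congr rfl fun K _ => ?_
  rw [Finset.sum_comm]
  simp only [← Finset.mul_sum, key, ite_mul, one_mul, zero_mul, mul_ite, mul_zero,
    Finset.sum_ite_eq', Finset.mem_univ, if_true]
  ring

variable [Algebra ℝ R] {D D' : Fin n → Derivation ℝ R R} {Γ Γ' : Fin n → Fin n → Fin n → R}

theorem quantA_eq_sum (κ : QuantCoeffs R) (P : (Fin 3 → Fin n) → R) (φ : R) :
    quantA κ D Γ P φ =
      (∑ i, ∑ j, ∑ k, P ![i, j, k] * covA D Γ κ.lam (covA D Γ κ.lam (covA D Γ κ.lam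
          (p := 0) (q := 0) fun _ _ => φ)) ![] ![i, j, k])
      + κ.α * (∑ i, ∑ j, ∑ k, covA D Γ κ.δ (p := 3) (q := 0) (fun I _ => P I) ![i, j, k] ![k] *
          covA D Γ κ.lam (covA D Γ κ.lam (p := 0) (q := 0) fun _ _ => φ) ![] ![i, j])
      + κ.β₁ * (∑ i, ∑ j, ∑ k, covA D Γ κ.δ (covA D Γ κ.δ (p := 3) (q := 0) (fun I _ => P I))
          ![i, j, k] ![i, j] * covA D Γ κ.lam (p := 0) (q := 0) (fun _ _ => φ) ![] ![k])
      + κ.β₂ * (∑ i, ∑ j, ∑ k, P ![i, j, k] * (ricciA D Γ i j *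
          covA D Γ κ.lam (p := 0) (q := 0) (fun _ _ => φ) ![] ![k]))
      + κ.η₁ * (∑ i, ∑ j, ∑ k, covA D Γ κ.δ (covA D Γ κ.δ (covA D Γ κ.δ
          (p := 3) (q := 0) (fun I _ => P I))) ![i, j, k] ![i, j, k] * φ)
      + κ.η₂ * (∑ i, ∑ j, ∑ k, covA D Γ κ.δ (p := 3) (q := 0) (fun I _ => P I) ![i, j, k] ![k] *
          (ricciA D Γ i j * φ))
      + κ.η₃ * (∑ i, ∑ j, ∑ k, P ![i, j, k] * (covA D Γ 0 (p := 0) (q := 2)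
          (fun _ J => ricciA D Γ (J 0) (J 1)) ![] ![i, j, k] * φ)) := by
  simp only [quantA, Finset.mul_sum, ← Finset.sum_add_distrib]
  refine Finset.sum_congr rfl fun i _ => Finset.sum_congr rfl fun j _ =>
    Finset.sum_congr rfl fun k _ => ?_
  simp only [Matrix.cons_val_zero, Matrix.cons_val_one]
  ring

/-- The quantization formula does not depend on the coordinates. -/
theorem quantA_covariant (κ : QuantCoeffs R) (h : ConnectionRel A D D' Γ Γ')
    (hD : ∀ a b f, D a (D b f) = D b (D a f)) (hA : ∀ i a b, D a (A i b) = D b (A i a))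
    (hBA : ∀ i k, ∑ j, B i j * A j k = if i = k then 1 else 0)
    (hAB : ∀ i k, ∑ j, A i j * B j k = if i = k then 1 else 0) {r s : R}
    (hr : ∀ a, D a r = - κ.δ * r * (traceΓ Γ a - ∑ i, A i a * traceΓ Γ' i))
    (hs : ∀ a, D a s = - κ.lam * s * (traceΓ Γ a - ∑ i, A i a * traceΓ Γ' i))
    {P P' : (Fin 3 → Fin n) → R} (hP : ∀ I, P' I = r * ∑ K, multiProd A I K * P K)
    {φ φ' : R} (hφ : φ' = s * φ) :
    quantA κ D' Γ' P' φ' = r * s * quantA κ D Γ P φ := by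
  have f0 : TensorRel s A (p := 0) (q := 0) (fun _ _ => φ) (fun _ _ => φ') := by
    intro I J
    simp [multiProd, hφ]
  have f1 := f0.covA h hs
  have f2 := f1.covA h hs
  have f3 := f2.covA h hs
  have p0 : TensorRel r A (p := 3) (q := 0) (fun I _ => P I) (fun I _ => P' I) := by
    intro I J
    simp [multiProd, hP]
  have p1 := p0.covA h hr
  have p2 := p1.covA h hr
  have p3 := p2.covA h hr
  have R0 := TensorRel.ricciA h hD hA hBA hAB
  have R1 := R0.covA h (w := 0) (by intro a; simp)
  have mulR : ∀ {q : ℕ} {T T' : (Fin 0 → Fin n) → (Fin q → Fin n) → R} (g g' : R),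
      g' = s * g → TensorRel 1 A T T' →
      TensorRel s A (fun I J => T I J * g) (fun I J => T' I J * g') := by
    intro q T T' g g' hg hT I J
    have := congrArg (fun z => z * g') (hT I J)
    simp only [Finset.sum_mul, one_mul, hg, Finset.mul_sum] at this ⊢
    refine Eq.trans ?_ (this.trans ?_) <;> exact Finset.sum_congr rfl fun _ _ => by ring
  have R0f : TensorRel s A (p := 0) (q := 3)
      (fun I J => ricciA D Γ (J 0) (J 1) * covA D Γ κ.lam (p := 0) (q := 0) (fun _ _ => φ) I ![J 2])
      (fun I J => ricciA D' Γ' (J 0) (J 1) *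
        covA D' Γ' κ.lam (p := 0) (q := 0) (fun _ _ => φ') I ![J 2]) := by
    intro I J
    have t1 := R0 ![] ![J 0, J 1]
    have t2 := f1 I ![J 2]
    rw [sum_multiIndex_two, Fintype.sum_unique (fun K : Fin 0 → Fin n => _)] at t1
    rw [sum_multiIndex_one, Fintype.sum_unique (fun K : Fin 0 → Fin n => _)] at t2
    rw [sum_multiIndex_three, Fintype.sum_unique (fun K : Fin 0 → Fin n => _)]
    have m1 : ∀ i j : Fin n, multiProd A (q := 0 + 1) ![i] ![j] = A i j :=
      fun i j => Fin.prod_univ_one _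
    simp only [m1] at t2
    simp only [multiProd, Fin.prod_univ_three, Fin.prod_univ_two,
      Fin.prod_univ_zero, Matrix.cons_val_zero, Matrix.cons_val_one, Matrix.cons_val, one_mul]
      at t1 t2 ⊢
    rw [show s * (ricciA D Γ (J 0) (J 1) * covA D Γ κ.lam (p := 0) (q := 0) (fun _ _ => φ)
      default ![J 2]) = ricciA D Γ (J 0) (J 1) * (s * covA D Γ κ.lam (p := 0) (q := 0)
        (fun _ _ => φ) default ![J 2]) by ring, ← t1, ← t2]
    rw [Finset.sum_mul]
    refine Finset.sum_congr rfl fun i _ => ?_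
    rw [Finset.sum_mul_sum]
    exact Finset.sum_congr rfl fun j _ => Finset.sum_congr rfl fun k _ => by ring
  -- In each equivalence the left list names the positions among `i, j, k` contracted with the
  -- derivative indices of `P`, and the right list those contracted with the covariant factor built
  -- from `φ` and the Ricci tensor.
  have e0 := p0.contract hBA hAB f3
    (Equiv.ofBijective (Sum.elim ![] ![0, 1, 2] : Fin 0 ⊕ Fin 3 → Fin 3) (by decide))
  have e1 := p1.contract hBA hAB f2
    (Equiv.ofBijective (Sum.elim ![2] ![0, 1] : Fin 1 ⊕ Fin 2 → Fin 3) (by decide))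
  have e2 := p2.contract hBA hAB f1
    (Equiv.ofBijective (Sum.elim ![0, 1] ![2] : Fin 2 ⊕ Fin 1 → Fin 3) (by decide))
  have e3 := p0.contract hBA hAB R0f
    (Equiv.ofBijective (Sum.elim ![] ![0, 1, 2] : Fin 0 ⊕ Fin 3 → Fin 3) (by decide))
  have e4 := p3.contract hBA hAB f0
    (Equiv.ofBijective (Sum.elim ![0, 1, 2] ![] : Fin 3 ⊕ Fin 0 → Fin 3) (by decide))
  have e5 := p1.contract hBA hAB (mulR φ φ' hφ R0)
    (Equiv.ofBijective (Sum.elim ![2] ![0, 1] : Fin 1 ⊕ Fin 2 → Fin 3) (by decide))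
  have e6 := p0.contract hBA hAB (mulR φ φ' hφ R1)
    (Equiv.ofBijective (Sum.elim ![] ![0, 1, 2] : Fin 0 ⊕ Fin 3 → Fin 3) (by decide))
  rw [sum_multiIndex_three, sum_multiIndex_three] at e0 e1 e2 e3 e4 e5 e6
  have v1 : ∀ i j k : Fin n, (fun t => ![i, j, k] ((![2] : Fin 1 → Fin 3) t)) = ![k] := by
    intro i j k; funext t; fin_cases t; rfl
  have v2 : ∀ i j k : Fin n, (fun t => ![i, j, k] ((![0, 1] : Fin 2 → Fin 3) t)) = ![i, j] := by
    intro i j k; funext t; fin_cases t <;> rfl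
  have v3 : ∀ i j k : Fin n,
      (fun t => ![i, j, k] ((![0, 1, 2] : Fin 3 → Fin 3) t)) = ![i, j, k] := by
    intro i j k; funext t; fin_cases t <;> rfl
  simp only [Equiv.ofBijective_apply, Sum.elim_inl, Sum.elim_inr, v1, v2, v3,
    Matrix.cons_val_zero, Matrix.cons_val_one, Matrix.cons_val]
    at e0 e1 e2 e3 e4 e5 e6
  rw [quantA_eq_sum, quantA_eq_sum, e0, e1, e2, e3, e4, e5, e6]
  ring

end Contraction

end ProjQuant

end

noncomputable section

namespace ProjQuant

/-! ## Invariance of the quantization formula under changes of charts -/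

section Jacobi

variable {n : ℕ} {R : Type*} [CommRing R] [Algebra ℝ R]

/-- Jacobi's formula for the derivative of a determinant. -/
theorem derivation_det (d : Derivation ℝ R R) (A B : Matrix (Fin n) (Fin n) R) (hAB : A * B = 1) :
    d A.det = A.det * ∑ i, ∑ k, B i k * d (A k i) := by
  -- The determinant is differentiated one column at a time.
  have h1 : d A.det = ∑ i, (A.updateCol i fun k => d (A k i)).det := by
    simp only [Matrix.det_apply', map_sum, Derivation.leibniz, derivation_prod, smul_eq_mul]
    rw [Finset.sum_comm]
    refine Finset.sum_congr rfl fun σ _ => ?_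
    have : d ((Equiv.Perm.sign σ : ℤ) : R) = 0 := by
      rcases Int.units_eq_one_or (Equiv.Perm.sign σ) with h | h <;> simp [h]
    rw [this, mul_zero, add_zero, Finset.mul_sum]
    refine Finset.sum_congr rfl fun i _ => ?_
    rw [← Finset.mul_prod_erase _ _ (Finset.mem_univ i), Matrix.updateCol_self]
    congr 2
    refine Finset.prod_congr rfl fun u hu => ?_
    rw [Matrix.updateCol_ne (Finset.ne_of_mem_erase hu)]
  -- The adjugate is obtained from the given right inverse, so no division by the determinant is
  -- needed in the ring.
  have h2 : A.adjugate = A.det • B := by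
    rw [← Matrix.mul_one A.adjugate, ← hAB, ← Matrix.mul_assoc, Matrix.adjugate_mul,
      Matrix.smul_mul, Matrix.one_mul]
  rw [h1, Finset.mul_sum]
  refine Finset.sum_congr rfl fun i _ => ?_
  rw [← Matrix.cramer_apply, Matrix.cramer_eq_adjugate_mulVec, h2]
  simp [Matrix.mulVec, dotProduct, Finset.mul_sum, mul_assoc]

/-- Tracing the Christoffel law against the inverse Jacobian gives, by Jacobi's formula, the
logarithmic derivative of the determinant. This is what makes `|det|^{-w}` satisfy the differential
equation required of the factor `r` in `TensorRel.covA`. -/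
theorem ConnectionRel.trace {A B : Fin n → Fin n → R} {D D' : Fin n → Derivation ℝ R R}
    {Γ Γ' : Fin n → Fin n → Fin n → R} (h : ConnectionRel A D D' Γ Γ')
    (hBA : ∀ i k, ∑ j, B i j * A j k = if i = k then 1 else 0)
    (hAB : ∀ i k, ∑ j, A i j * B j k = if i = k then 1 else 0) (a : Fin n) :
    ∑ i, ∑ k, B i k * D a (A k i) = traceΓ Γ a - ∑ i, A i a * traceΓ Γ' i := by
  simp only [h.christoffel, mul_sub, Finset.sum_sub_distrib]
  congr 1
  · have : ∀ i, ∑ k, B i k * ∑ c, A k c * Γ c a i = Γ i a i := by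
      intro i
      simp only [Finset.mul_sum]
      rw [Finset.sum_comm]
      have : ∀ c, ∑ k, B i k * (A k c * Γ c a i) = (if i = c then 1 else 0) * Γ c a i := by
        intro c
        rw [← hBA, Finset.sum_mul]
        exact Finset.sum_congr rfl fun _ _ => by ring
      simp [this]
    simp [this, traceΓ]
  · have : ∀ k j i, ∑ m, B m k * (A i a * (Γ' k i j * A j m))
        = A i a * Γ' k i j * if j = k then 1 else 0 := by
      intro k j i
      rw [← hAB, Finset.mul_sum]
      exact Finset.sum_congr rfl fun _ _ => by ring
    simp only [Finset.mul_sum, traceΓ]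
    rw [Finset.sum_comm]
    refine Eq.trans (Finset.sum_congr rfl fun k _ => Finset.sum_comm) ?_
    rw [Finset.sum_comm]
    refine Finset.sum_congr rfl fun i _ => Finset.sum_congr rfl fun k _ => ?_
    rw [Finset.sum_comm]
    simp [this]

end Jacobi

/-! ### Transition maps over the algebra of smooth functions on their domain. -/

section Transition

variable {n : ℕ} {U : TopologicalSpace.Opens (Coord n)}

open Classical in
/-- The function equal to `f` on `U` and to the constant `v` elsewhere. -/
def smoothOn.extend (U : TopologicalSpace.Opens (Coord n)) (f : Coord n → ℝ)
    (hf : ContDiffOn ℝ ∞ f U) (v : ℝ) : smoothOn U :=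
  ⟨fun x => if x ∈ U then f x else v, hf.congr fun _ hx => if_pos hx⟩

theorem smoothOn.extend_mem {f : Coord n → ℝ} (hf : ContDiffOn ℝ ∞ f U) (v : ℝ) {x : Coord n}
    (hx : x ∈ U) : (smoothOn.extend U f hf v).1 x = f x := if_pos hx

theorem smoothOn.extend_notMem {f : Coord n → ℝ} (hf : ContDiffOn ℝ ∞ f U) (v : ℝ) {x : Coord n}
    (hx : x ∉ U) : (smoothOn.extend U f hf v).1 x = v := if_neg hx

theorem smoothOn.ext {f g : smoothOn U} (h : ∀ x ∈ U, f.1 x = g.1 x)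
    (h' : ∀ x ∉ U, f.1 x = g.1 x) : f = g := by
  apply Subtype.ext
  funext x
  by_cases hx : x ∈ U
  · exact h x hx
  · exact h' x hx

theorem partialD_notMem (i : Fin n) (f : smoothOn U) {x : Coord n} (hx : x ∉ U) :
    (partialD U i f).1 x = 0 :=
  Set.indicator_of_notMem (s := (U : Set (Coord n))) hx _

theorem partialD_extend (i : Fin n) {f : Coord n → ℝ} (hf : ContDiffOn ℝ ∞ f U) (v : ℝ)
    {x : Coord n} (hx : x ∈ U) : (partialD U i (smoothOn.extend U f hf v)).1 x = pderiv i f x :=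
  (partialD_apply_of_eqOn i _ (fun _ hz => (smoothOn.extend_mem hf v hz).symm) hx).symm

/-- Evaluation at a point. -/
def smoothOn.eval (x : Coord n) : smoothOn U →+* ℝ :=
  (Pi.evalRingHom (fun _ : Coord n => ℝ) x).comp (smoothOn U).val.toRingHom

theorem smoothOn.eval_apply (x : Coord n) (f : smoothOn U) : smoothOn.eval x f = f.1 x := rfl

variable {M : Type*} [TopologicalSpace M] [ChartedSpace (Coord n) M]

/-- The domain in the coordinates of `c` of the change of coordinates to `c'`. -/
def transitionDomain (c c' : SmoothChart n M) : TopologicalSpace.Opens (Coord n) :=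
  ⟨(c.1.symm.trans c'.1).source, (c.1.symm.trans c'.1).open_source⟩

theorem mem_transitionDomain {c c' : SmoothChart n M} {x : Coord n} :
    x ∈ transitionDomain c c' ↔ x ∈ c.1.target ∧ c.1.symm x ∈ c'.1.source := by
  change x ∈ (c.1.symm.trans c'.1).source ↔ _
  simp

/-- The change of coordinates. -/
def transition (c c' : SmoothChart n M) (x : Coord n) : Coord n := c'.1 (c.1.symm x)

theorem transition_mem {c c' : SmoothChart n M} {x : Coord n} (hx : x ∈ transitionDomain c c') :
    transition c c' x ∈ transitionDomain c' c := by
  rw [mem_transitionDomain] at hx ⊢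
  refine ⟨c'.1.map_source hx.2, ?_⟩
  rw [transition, c'.1.left_inv hx.2]
  exact c.1.map_target hx.1

theorem transition_transition {c c' : SmoothChart n M} {x : Coord n}
    (hx : x ∈ transitionDomain c c') : transition c' c (transition c c' x) = x := by
  rw [mem_transitionDomain] at hx
  rw [transition, transition, c'.1.left_inv hx.2, c.1.right_inv hx.1]

theorem jacobian_mul_jacobian (c c' : SmoothChart n M) {x : Coord n}
    (hx : x ∈ transitionDomain c c') :
    jacobian c'.1 c.1 (transition c c' x) * jacobian c.1 c'.1 x = 1 := by
  have hx' := mem_transitionDomain.1 hx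
  have hp := c.1.map_target hx'.1
  have := jacobian_comp c c' c hp hx'.2 hp
  rw [jacobian_self c hp, c.1.right_inv hx'.1] at this
  exact this.symm

theorem contDiffOn_inverse_jacobian (c c' : SmoothChart n M) (i a : Fin n) :
    ContDiffOn ℝ ∞ (fun x => jacobian c'.1 c.1 (transition c c' x) i a) (transitionDomain c c') :=
  (contDiffOn_jacobian c' c i a).comp (contDiffOn_transition c c') fun _ hx => transition_mem hx

theorem contDiffOn_comp_transition {c c' : SmoothChart n M} {f : Coord n → ℝ}
    (hf : ContDiffOn ℝ ∞ f c'.1.target) :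
    ContDiffOn ℝ ∞ (fun x => f (transition c c' x)) (transitionDomain c c') :=
  hf.comp (contDiffOn_transition c c') fun _ hx => (mem_transitionDomain.1 (transition_mem hx)).1

theorem transitionDomain_subset (c c' : SmoothChart n M) :
    (transitionDomain c c' : Set (Coord n)) ⊆ c.1.target :=
  fun _ hx => (mem_transitionDomain.1 hx).1

/-- The Jacobian matrix of the change of coordinates over the algebra of smooth functions. -/
def jacobianA (c c' : SmoothChart n M) (i a : Fin n) : smoothOn (transitionDomain c c') :=
  smoothOn.extend _ (fun x => jacobian c.1 c'.1 x i a) (contDiffOn_jacobian c c' i a)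
    (if i = a then 1 else 0)

/-- The inverse of the Jacobian matrix. -/
def inverseJacobianA (c c' : SmoothChart n M) (i a : Fin n) : smoothOn (transitionDomain c c') :=
  smoothOn.extend _ (fun x => jacobian c'.1 c.1 (transition c c' x) i a)
    (contDiffOn_inverse_jacobian c c' i a) (if i = a then 1 else 0)

section

variable {c c' : SmoothChart n M} {x : Coord n}

theorem jacobianA_mem (i a : Fin n) (hx : x ∈ transitionDomain c c') :
    (jacobianA c c' i a).1 x = jacobian c.1 c'.1 x i a := if_pos hx

theorem jacobianA_notMem (i a : Fin n) (hx : x ∉ transitionDomain c c') :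
    (jacobianA c c' i a).1 x = if i = a then 1 else 0 := if_neg hx

theorem inverseJacobianA_mem (i a : Fin n) (hx : x ∈ transitionDomain c c') :
    (inverseJacobianA c c' i a).1 x = jacobian c'.1 c.1 (transition c c' x) i a := if_pos hx

theorem inverseJacobianA_notMem (i a : Fin n) (hx : x ∉ transitionDomain c c') :
    (inverseJacobianA c c' i a).1 x = if i = a then 1 else 0 := if_neg hx

theorem partialD_jacobianA (b i a : Fin n) (hx : x ∈ transitionDomain c c') :
    (partialD _ b (jacobianA c c' i a)).1 x
      = pderiv b (fun z => jacobian c.1 c'.1 z i a) x :=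
  (partialD_apply_of_eqOn b _ (fun _ hz => (jacobianA_mem i a hz).symm) hx).symm

end

theorem smoothOn.one_apply (x : Coord n) : (1 : smoothOn U).1 x = 1 := rfl

/-- Off the domain both matrices are extended by the identity matrix, so that they are inverse to
each other in the algebra and not merely on the domain. -/
theorem inverseJacobianA_mul (c c' : SmoothChart n M) (i k : Fin n) :
    ∑ j, inverseJacobianA c c' i j * jacobianA c c' j k = if i = k then 1 else 0 := by
  refine smoothOn.ext (fun x hx => ?_) fun x hx => ?_
  · have := congrFun (congrFun (jacobian_mul_jacobian c c' hx) i) k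
    simp only [Matrix.mul_apply, Matrix.one_apply] at this
    simp only [smoothOn.sum_apply, smoothOn.mul_apply, jacobianA_mem _ _ hx,
      inverseJacobianA_mem _ _ hx, this]
    split_ifs <;> rfl
  · simp only [smoothOn.sum_apply, smoothOn.mul_apply, jacobianA_notMem _ _ hx,
      inverseJacobianA_notMem _ _ hx]
    split_ifs with h <;> simp [h, smoothOn.one_apply]

/-- A left inverse of a square matrix over a commutative ring is also a right inverse. -/
theorem jacobianA_mul (c c' : SmoothChart n M) (i k : Fin n) :
    ∑ j, jacobianA c c' i j * inverseJacobianA c c' j k = if i = k then 1 else 0 := by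
  have h : Matrix.of (inverseJacobianA c c') * Matrix.of (jacobianA c c') = 1 := by
    refine Matrix.ext fun i k => ?_
    simp only [Matrix.mul_apply, Matrix.of_apply, inverseJacobianA_mul, Matrix.one_apply]
  have := congrArg (fun N => N i k) (mul_eq_one_comm.1 h)
  simpa only [Matrix.mul_apply, Matrix.of_apply, Matrix.one_apply] using this

/-- The partial derivatives with respect to the new coordinates, in the old coordinates. -/
def transitionD (c c' : SmoothChart n M) (i : Fin n) :
    Derivation ℝ (smoothOn (transitionDomain c c')) (smoothOn (transitionDomain c c')) :=
  ∑ a, inverseJacobianA c c' a i • partialD (transitionDomain c c') a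

theorem transitionD_apply (c c' : SmoothChart n M) (i : Fin n)
    (f : smoothOn (transitionDomain c c')) :
    transitionD c c' i f = ∑ a, inverseJacobianA c c' a i * partialD _ a f := by
  rw [transitionD, ← Derivation.coeFnAddMonoidHom_apply, map_sum, Finset.sum_apply]
  rfl

/-- A function `g` of the new coordinates is `f` composed with the inverse transition, and the chain
rule for that composition yields the entries of the inverse Jacobian. -/
theorem partialsAlong_transition (c c' : SmoothChart n M) :
    PartialsAlong (transition c c') (transitionD c c') := by
  intro i f g h x hx
  have hg : ∀ z ∈ transitionDomain c' c, g z = f.1 (transition c' c z) := by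
    intro z hz
    rw [← h _ (transition_mem hz), transition_transition hz]
  have hx' := transition_mem hx
  rw [pderiv_congr_of_isOpen (transitionDomain c' c).2 hg hx',
    pderiv_comp (y := transition c' c) (smoothOn.differentiableAt f (by rwa [transition_transition hx]))
      ((contDiffAt_transition c' c hx').differentiableAt (by simp)),
    transition_transition hx, transitionD_apply, smoothOn.sum_apply]
  refine Finset.sum_congr rfl fun a _ => ?_
  rw [smoothOn.mul_apply, inverseJacobianA_mem _ _ hx, partialD_apply _ _ hx]
  rfl

theorem jacobianA_symm (c c' : SmoothChart n M) (i a b : Fin n) :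
    partialD _ a (jacobianA c c' i b) = partialD _ b (jacobianA c c' i a) := by
  refine smoothOn.ext (fun x hx => ?_) fun x hx => ?_
  · rw [partialD_jacobianA _ _ _ hx, partialD_jacobianA _ _ _ hx]
    refine pderiv_pderiv_comm (f := fun z => c'.1 (c.1.symm z) i) (transitionDomain c c').2
      ?_ hx a b
    exact (EuclideanSpace.proj (𝕜 := ℝ) i).contDiff.comp_contDiffOn (contDiffOn_transition c c')
  · rw [partialD_notMem _ _ hx, partialD_notMem _ _ hx]

theorem det_jacobianA (c c' : SmoothChart n M) {x : Coord n} (hx : x ∈ transitionDomain c c') :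
    (Matrix.of (jacobianA c c')).det.1 x = (jacobian c.1 c'.1 x).det := by
  rw [← smoothOn.eval_apply, RingHom.map_det]
  congr 1
  ext i a
  exact jacobianA_mem i a hx

theorem det_jacobian_ne_zero (c c' : SmoothChart n M) {x : Coord n}
    (hx : x ∈ transitionDomain c c') : (jacobian c.1 c'.1 x).det ≠ 0 := by
  have := congrArg Matrix.det (jacobian_mul_jacobian c c' hx)
  rw [Matrix.det_mul, Matrix.det_one] at this
  exact right_ne_zero_of_mul_eq_one this

theorem contDiffOn_densityFactor (c c' : SmoothChart n M) (w : ℝ) :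
    ContDiffOn ℝ ∞ (fun x => |(jacobian c.1 c'.1 x).det| ^ (-w)) (transitionDomain c c') := by
  intro x hx
  have hd : ContDiffOn ℝ ∞ (fun x => (jacobian c.1 c'.1 x).det) (transitionDomain c c') :=
    ContDiffOn.congr (Matrix.of (jacobianA c c')).det.2 fun z hz => (det_jacobianA c c' hz).symm
  have hne := det_jacobian_ne_zero c c' hx
  have h1 := (contDiffAt_abs (n := (⊤ : ℕ∞)) hne).comp_contDiffWithinAt x (hd x hx)
  exact h1.rpow_const_of_ne (abs_ne_zero.2 hne)

/-- The factor `|det ∂y/∂x|^{-w}` by which `w`-densities change. -/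
def densityFactorA (c c' : SmoothChart n M) (w : ℝ) : smoothOn (transitionDomain c c') :=
  smoothOn.extend _ _ (contDiffOn_densityFactor c c' w) 1

/-- Jacobi's formula is applied to `|det|^{-w} = exp (-w log |det|)`. As `Real.log` ignores the sign
of its argument, the absolute value needs no case distinction. Off the domain all derivatives are
zero. -/
theorem partialD_densityFactorA (c c' : SmoothChart n M) (w : ℝ) (a : Fin n) :
    partialD _ a (densityFactorA c c' w) = - algebraMap ℝ _ w * densityFactorA c c' w *
      ∑ i, ∑ k, inverseJacobianA c c' i k * partialD _ a (jacobianA c c' k i) := by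
  refine smoothOn.ext (fun x hx => ?_) fun x hx => ?_
  · have hdet := derivation_det (partialD _ a) (Matrix.of (jacobianA c c'))
      (Matrix.of (inverseJacobianA c c'))
      (by refine Matrix.ext fun i k => ?_; simp only [Matrix.mul_apply, Matrix.of_apply, jacobianA_mul, Matrix.one_apply])
    set S := ∑ i, ∑ k, inverseJacobianA c c' i k * partialD _ a (jacobianA c c' k i)
    have hdet' := congrArg (fun f : smoothOn (transitionDomain c c') => f.1 x) hdet
    simp only [smoothOn.mul_apply, det_jacobianA c c' hx, Matrix.of_apply] at hdet'
    change _ = _ * S.1 x at hdet'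
    rw [← partialD_apply_of_eqOn a _ (fun z hz => (det_jacobianA c c' hz).symm) hx] at hdet'
    have hne := det_jacobian_ne_zero c c' hx
    have hd : DifferentiableAt ℝ (fun x => (jacobian c.1 c'.1 x).det) x := by
      refine (smoothOn.differentiableAt (Matrix.of (jacobianA c c')).det hx).congr_of_eventuallyEq ?_
      filter_upwards [(transitionDomain c c').2.mem_nhds hx] with z hz
      exact (det_jacobianA c c' hz).symm
    have he : Set.EqOn (fun x => |(jacobian c.1 c'.1 x).det| ^ (-w))
        (fun x => Real.exp (Real.log (jacobian c.1 c'.1 x).det * (-w))) (transitionDomain c c') := by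
      intro z hz
      simp only
      rw [Real.rpow_def_of_pos (abs_pos.2 (det_jacobian_ne_zero c c' hz)), Real.log_abs]
    rw [densityFactorA, partialD_extend _ _ _ hx,
      pderiv_congr_of_isOpen (transitionDomain c c').2 he hx]
    have hD : pderiv a (fun x => Real.exp (Real.log (jacobian c.1 c'.1 x).det * (-w))) x
        = Real.exp (Real.log (jacobian c.1 c'.1 x).det * (-w)) *
          (-w * ((jacobian c.1 c'.1 x).det⁻¹ * pderiv a (fun x => (jacobian c.1 c'.1 x).det) x)) := by
      have := (((hd.hasFDerivAt.log hne).mul_const (-w)).exp).fderiv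
      simp only [pderiv]
      rw [this]
      simp
    rw [hD, hdet']
    have : (densityFactorA c c' w).1 x
        = Real.exp (Real.log (jacobian c.1 c'.1 x).det * (-w)) := by
      rw [densityFactorA, smoothOn.extend_mem _ _ hx]
      exact he hx
    change _ = -w * (densityFactorA c c' w).1 x * S.1 x
    rw [this]
    field_simp
  · have : ∀ k i, (partialD (transitionDomain c c') a (jacobianA c c' k i)).1 x = 0 :=
      fun k i => partialD_notMem _ _ hx
    rw [partialD_notMem _ _ hx]
    simp only [smoothOn.mul_apply, smoothOn.sum_apply, this, mul_zero, Finset.sum_const_zero]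

/-- The law of transformation of Christoffel symbols. -/
def ChristoffelRel (c c' : SmoothChart n M) (Γ Γ' : Fin n → Fin n → Fin n → Coord n → ℝ) : Prop :=
  ∀ x ∈ transitionDomain c c', ∀ a k b, pderiv a (fun z => jacobian c.1 c'.1 z k b) x
    = ∑ d, jacobian c.1 c'.1 x k d * Γ d a b x
      - ∑ i, ∑ j, jacobian c.1 c'.1 x i a *
        (Γ' k i j (transition c c' x) * jacobian c.1 c'.1 x j b)

/-- The quantization formula defines a `(λ + δ)`-density. -/
theorem quantFormula_transition (lam δ : ℝ) (c c' : SmoothChart n M)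
    {Γ Γ' : Fin n → Fin n → Fin n → Coord n → ℝ}
    (hΓ : ∀ k i j, ContDiffOn ℝ ∞ (Γ k i j) c.1.target)
    (hΓ' : ∀ k i j, ContDiffOn ℝ ∞ (Γ' k i j) c'.1.target) (h : ChristoffelRel c c' Γ Γ')
    {P P' : (Fin 3 → Fin n) → Coord n → ℝ} (hP : ∀ I, ContDiffOn ℝ ∞ (P I) c.1.target)
    (hPP' : ∀ I, ∀ x ∈ transitionDomain c c', P' I (transition c c' x)
      = transformed δ c.1 c'.1 P I x)
    {φ φ' : Coord n → ℝ} (hφ : ContDiffOn ℝ ∞ φ c.1.target)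
    (hφφ' : ∀ x ∈ transitionDomain c c', φ' (transition c c' x)
      = |(jacobian c.1 c'.1 x).det| ^ (-lam) * φ x)
    {x : Coord n} (hx : x ∈ transitionDomain c c') :
    quantFormula lam δ Γ' P' φ' (transition c c' x)
      = |(jacobian c.1 c'.1 x).det| ^ (-(lam + δ)) * quantFormula lam δ Γ P φ x := by
  have hs := transitionDomain_subset c c'
  let γ : Fin n → Fin n → Fin n → smoothOn (transitionDomain c c') := fun k i j =>
    smoothOn.extend _ (Γ k i j) ((hΓ k i j).mono hs) 0
  let γ' : Fin n → Fin n → Fin n → smoothOn (transitionDomain c c') := fun k i j =>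
    smoothOn.extend _ _ (contDiffOn_comp_transition (c := c) (hΓ' k i j)) 0
  let p : (Fin 3 → Fin n) → smoothOn (transitionDomain c c') := fun I =>
    smoothOn.extend _ (P I) ((hP I).mono hs) 0
  let f : smoothOn (transitionDomain c c') := smoothOn.extend _ φ (hφ.mono hs) 0
  -- The components in the new coordinates are defined by the transformation law, like `f'` below,
  -- so that the law holds off the domain too. On the domain they agree with the pullbacks of `P'`
  -- and `φ'`.
  let p' : (Fin 3 → Fin n) → smoothOn (transitionDomain c c') := fun I =>
    densityFactorA c c' δ * ∑ K, multiProd (jacobianA c c') I K * p K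
  let f' : smoothOn (transitionDomain c c') := densityFactorA c c' lam * f
  have hrel : ConnectionRel (jacobianA c c') (partialD _) (transitionD c c') γ γ' := by
    constructor
    · intro a g
      simp only [transitionD_apply, Finset.mul_sum]
      rw [Finset.sum_comm]
      have : ∀ b, ∑ i, jacobianA c c' i a * (inverseJacobianA c c' b i * partialD _ b g)
          = (if b = a then 1 else 0) * partialD _ b g := by
        intro b
        rw [← inverseJacobianA_mul, Finset.sum_mul]
        exact Finset.sum_congr rfl fun _ _ => by ring
      simp [this]
    · intro a k b
      refine smoothOn.ext (fun x hx => ?_) fun x hx => ?_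
      · simp only [smoothOn.sub_apply, smoothOn.sum_apply, smoothOn.mul_apply, jacobianA_mem _ _ hx,
          γ, γ', partialD_jacobianA _ _ _ hx, smoothOn.extend_mem _ _ hx]
        exact h x hx a k b
      -- Off the domain the Christoffel symbols are extended by zero, and the derivations vanish as
      -- well.
      · simp only [smoothOn.sub_apply, smoothOn.sum_apply, smoothOn.mul_apply, γ, γ',
          partialD_notMem _ _ hx, smoothOn.extend_notMem _ _ hx, mul_zero, zero_mul,
          Finset.sum_const_zero, sub_zero]
  have htr := hrel.trace (inverseJacobianA_mul c c') (jacobianA_mul c c')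
  have cov := quantA_covariant ((quantCoeffs n lam δ).map (algebraMap ℝ _)) hrel
    (fun a b f => partialD_comm a b f) (fun i a b => jacobianA_symm c c' i a b)
    (inverseJacobianA_mul c c') (jacobianA_mul c c') (r := densityFactorA c c' δ)
    (s := densityFactorA c c' lam)
    (fun a => by rw [← htr]; exact partialD_densityFactorA c c' δ a)
    (fun a => by rw [← htr]; exact partialD_densityFactorA c c' lam a)
    (P := p) (P' := p') (fun I => rfl) (φ := f) (φ' := f') rfl
  have e1 := quantFormula_eq_quantA lam δ (U := transitionDomain c c') (Γ := Γ) (γ := γ)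
    (fun k i j z hz => (smoothOn.extend_mem _ _ hz).symm) (P := P) (ρ := p)
    (fun I z hz => (smoothOn.extend_mem _ _ hz).symm) (φ := φ) (f := f)
    (fun z hz => (smoothOn.extend_mem _ _ hz).symm) hx
  have e2 := (partialsAlong_transition c c').quantFormula lam δ (Γ := Γ') (γ := γ')
    (fun k i j z hz => (if_pos hz).symm) (P := P') (ρ := p')
    (fun I z hz => by
      rw [hPP' I z hz]
      simp only [transformed, p', smoothOn.mul_apply, smoothOn.sum_apply, densityFactorA,
        smoothOn.extend_mem _ _ hz, p, multiProd]
      congr 1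
      refine Finset.sum_congr rfl fun K _ => ?_
      congr 1
      rw [← smoothOn.eval_apply, map_prod]
      exact Finset.prod_congr rfl fun s _ => (jacobianA_mem _ _ hz).symm) (φ := φ') (f := f')
    (fun z hz => by
      rw [hφφ' z hz]
      simp only [f', f, smoothOn.mul_apply, densityFactorA, smoothOn.extend_mem _ _ hz]) x hx
  rw [e2, cov, e1]
  simp only [smoothOn.mul_apply, densityFactorA, smoothOn.extend_mem _ _ hx]
  rw [← Real.rpow_add (abs_pos.2 (det_jacobian_ne_zero c c' hx))]
  congr 2
  ring

end Transition

end ProjQuant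

end

noncomputable section

namespace ProjQuant

/-! ## Coordinate vector fields -/

section CoordFields

variable {n : ℕ} {M : Type*} [TopologicalSpace M] [ChartedSpace (Coord n) M]

theorem sum_smul_stdVec (v : Coord n) : ∑ k, v k • (stdVec k : Coord n) = v := by
  ext j
  simp [stdVec, Pi.single_apply]

theorem apply_eq_sum_smul {E : Type*} [AddCommGroup E] [Module ℝ E] [TopologicalSpace E]
    (L : Coord n →L[ℝ] E) (v : Coord n) : L v = ∑ k, v k • L (stdVec k) := by
  conv_lhs => rw [← sum_smul_stdVec v]
  simp [map_sum]

theorem vecComp_add (c : SmoothChart n M) (k : Fin n) {p : M} (v w : TangentSpace (𝓡 n) p) :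
    vecComp c k (v + w) = vecComp c k v + vecComp c k w := by
  simp only [vecComp, map_add]
  rfl

theorem vecComp_smul (c : SmoothChart n M) (k : Fin n) {p : M} (r : ℝ)
    (v : TangentSpace (𝓡 n) p) : vecComp c k (r • v) = r * vecComp c k v := by
  simp only [vecComp, map_smul]
  rfl

/-- The component of a tangent vector as a linear form. -/
def vecCompHom (c : SmoothChart n M) (k : Fin n) (p : M) : TangentSpace (𝓡 n) p →ₗ[ℝ] ℝ where
  toFun := vecComp c k
  map_add' := vecComp_add c k
  map_smul' := vecComp_smul c k

theorem vecComp_sum (c : SmoothChart n M) (k : Fin n) {p : M} {ι : Type*} (s : Finset ι)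
    (v : ι → TangentSpace (𝓡 n) p) : vecComp c k (∑ i ∈ s, v i) = ∑ i ∈ s, vecComp c k (v i) :=
  map_sum (vecCompHom c k p) v s

theorem SmoothChart.mdifferentiable (c : SmoothChart n M) :
    c.1.MDifferentiable (𝓡 n) (𝓡 n) :=
  ⟨(contMDiffOn_of_mem_maximalAtlas c.2).mdifferentiableOn (by simp),
    (contMDiffOn_symm_of_mem_maximalAtlas c.2).mdifferentiableOn (by simp)⟩

theorem sum_vecComp_smul_coordField (c : SmoothChart n M) {p : M} (hp : p ∈ c.1.source)
    (v : TangentSpace (𝓡 n) p) : ∑ k, vecComp c k v • coordField c k p = v := by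
  have h := congrArg (fun L => L v) (c.mdifferentiable.symm_comp_deriv hp)
  refine Eq.trans ?_ h
  exact (apply_eq_sum_smul (E := Coord n) (mfderiv (𝓡 n) (𝓡 n) c.1.symm (c.1 p)) _).symm

theorem vecComp_coordField' (c c' : SmoothChart n M) {p : M} (hp : p ∈ c.1.source)
    (hp' : p ∈ c'.1.source) (k b : Fin n) :
    vecComp c' k (coordField c b p) = jacobian c.1 c'.1 (c.1 p) k b := by
  rw [jacobian_apply c c' (mem_transition hp hp')]
  have hq : c.1.symm (c.1 p) = p := c.1.left_inv hp
  have h := mfderiv_comp (I := 𝓡 n) (I' := 𝓡 n) (I'' := 𝓡 n) (g := c'.1) (f := c.1.symm) (c.1 p)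
    (c'.mdifferentiable.mdifferentiableAt (by rwa [hq]))
    (c.mdifferentiable.mdifferentiableAt_symm (c.1.map_source hp))
  rw [mfderiv_eq_fderiv] at h
  have h' := congrArg (fun L : Coord n →L[ℝ] Coord n => L (stdVec b) k) h
  refine Eq.trans ?_ h'.symm
  -- The base points `c.1.symm (c.1 p)` and `p` are equal only propositionally; with a variable
  -- point the equality can be eliminated.
  have : ∀ q, q = p → ∀ v : Coord n, (show Coord n from mfderiv (𝓡 n) (𝓡 n) c'.1 p v) k
      = (show Coord n from mfderiv (𝓡 n) (𝓡 n) c'.1 q v) k := by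
    rintro q rfl v; rfl
  exact this _ hq _

theorem vecComp_coordField (c : SmoothChart n M) {p : M} (hp : p ∈ c.1.source) (k b : Fin n) :
    vecComp c k (coordField c b p) = if k = b then 1 else 0 := by
  rw [vecComp_coordField' c c hp hp, jacobian_self c hp, Matrix.one_apply]

theorem coordField_eq_sum (c c' : SmoothChart n M) {p : M} (hp : p ∈ c.1.source)
    (hp' : p ∈ c'.1.source) (b : Fin n) :
    coordField c b p = ∑ k, jacobian c.1 c'.1 (c.1 p) k b • coordField c' k p := by
  simp only [← vecComp_coordField' c c' hp hp']
  exact (sum_vecComp_smul_coordField c' hp' _).symm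

theorem vecComp_eq_sum (c c' : SmoothChart n M) {p : M} (hp : p ∈ c.1.source)
    (hp' : p ∈ c'.1.source) (k : Fin n) (v : TangentSpace (𝓡 n) p) :
    vecComp c' k v = ∑ d, jacobian c.1 c'.1 (c.1 p) k d * vecComp c d v := by
  conv_lhs => rw [← sum_vecComp_smul_coordField c hp v]
  rw [vecComp_sum]
  refine Finset.sum_congr rfl fun d _ => ?_
  rw [vecComp_smul, vecComp_coordField' c c' hp hp', mul_comm]

variable [IsManifold (𝓡 n) ∞ M]

/-- The section `∂_j` is the tangent map of the inverse chart applied, along the chart, to a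
constant section of the tangent bundle of the model space. -/
theorem contMDiffOn_coordField (c : SmoothChart n M) (j : Fin n) :
    ContMDiffOn (𝓡 n) ((𝓡 n).prod 𝓘(ℝ, Coord n)) ∞
      (fun p => (⟨p, coordField c j p⟩ : TangentBundle (𝓡 n) M)) c.1.source := by
  have h1 : ContMDiff (𝓡 n) ((𝓡 n).prod 𝓘(ℝ, Coord n)) ∞
      (fun x => (⟨x, stdVec j⟩ : TangentBundle (𝓡 n) (Coord n))) :=
    contMDiff_vectorSpace_iff_contDiff.2 contDiff_const
  have h2 := (contMDiffOn_symm_of_mem_maximalAtlas c.2).contMDiffOn_tangentMapWithin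
    (m := ∞) (by simp) c.1.open_target.uniqueMDiffOn
  have h3 := h1.comp_contMDiffOn (contMDiffOn_of_mem_maximalAtlas c.2)
  refine (h2.comp h3 fun p hp => c.1.map_source hp).congr fun p hp => ?_
  have hq : c.1.symm (c.1 p) = p := c.1.left_inv hp
  have : ∀ q : M, q = p → ∀ v : Coord n, (⟨p, v⟩ : TangentBundle (𝓡 n) M) = ⟨q, v⟩ := by
    rintro q rfl v; rfl
  refine (this _ hq _).trans ?_
  simp only [Function.comp, tangentMapWithin]
  congr 1
  rw [mfderivWithin_of_isOpen c.1.open_target (c.1.map_source hp)]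
  rfl

theorem contDiffOn_vecComp (c : SmoothChart n M) (k : Fin n)
    {Y : (p : M) → TangentSpace (𝓡 n) p} {s : Set M} (hs : IsOpen s) (hsc : s ⊆ c.1.source)
    (hY : ContMDiffOn (𝓡 n) ((𝓡 n).prod 𝓘(ℝ, Coord n)) ∞
      (fun p => (⟨p, Y p⟩ : TangentBundle (𝓡 n) M)) s) :
    ContDiffOn ℝ ∞ (fun x => vecComp c k (Y (c.1.symm x))) (c.1.target ∩ c.1.symm ⁻¹' s) := by
  have h2 := ((contMDiffOn_of_mem_maximalAtlas c.2).mono hsc).contMDiffOn_tangentMapWithin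
    (m := ∞) (by simp) hs.uniqueMDiffOn
  have h3 := (h2.comp hY fun p hp => hp).comp
    ((contMDiffOn_symm_of_mem_maximalAtlas c.2).mono Set.inter_subset_left) fun x hx => hx.2
  have h4 : ContMDiffOn (𝓡 n) ((𝓡 n).prod 𝓘(ℝ, Coord n)) ∞
      (fun x => (⟨x, mfderiv (𝓡 n) (𝓡 n) c.1 (c.1.symm x) (Y (c.1.symm x))⟩ :
        TangentBundle (𝓡 n) (Coord n))) (c.1.target ∩ c.1.symm ⁻¹' s) := by
    refine h3.congr fun x hx => ?_
    have hq : c.1 (c.1.symm x) = x := c.1.right_inv hx.1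
    have : ∀ q : Coord n, q = x → ∀ v : Coord n,
        (⟨x, v⟩ : TangentBundle (𝓡 n) (Coord n)) = ⟨q, v⟩ := by
      rintro q rfl v; rfl
    refine (this _ hq _).trans ?_
    simp only [Function.comp, tangentMapWithin]
    congr 1
    rw [mfderivWithin_of_isOpen hs hx.2]
  have h5 := contMDiffOn_vectorSpace_iff_contDiffOn.1 h4
  exact (EuclideanSpace.proj (𝕜 := ℝ) k).contDiff.comp_contDiffOn h5

end CoordFields

end ProjQuant

end

noncomputable section

namespace ProjQuant

/-! ## Christoffel symbols -/

section Christoffel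

variable {n : ℕ} {M : Type*} [TopologicalSpace M] [ChartedSpace (Coord n) M]

theorem mfderiv_coordField (c : SmoothChart n M) (j : Fin n) {p : M} (hp : p ∈ c.1.source) :
    mfderiv (𝓡 n) (𝓡 n) c.1 p (coordField c j p) = stdVec j := by
  have : ∀ k, vecComp c k (coordField c j p) = (stdVec j : Coord n) k := by
    intro k
    rw [vecComp_coordField c hp]
    simp [stdVec]
  exact PiLp.ext this

theorem mvfderiv_comp_chart (c : SmoothChart n M) {f : Coord n → ℝ} {p : M}
    (hp : p ∈ c.1.source) (hf : DifferentiableAt ℝ f (c.1 p)) (a : Fin n) :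
    MDifferentiableAt (𝓡 n) 𝓘(ℝ, ℝ) (fun q => f (c.1 q)) p ∧
    mvfderiv (𝓡 n) (fun q => f (c.1 q)) p (coordField c a p) = pderiv a f (c.1 p) := by
  have hc := c.mdifferentiable.mdifferentiableAt hp
  have hf' := hf.mdifferentiableAt
  refine ⟨hf'.comp p hc, ?_⟩
  have h := mfderiv_comp (I := 𝓡 n) (I' := 𝓡 n) (I'' := 𝓘(ℝ, ℝ)) (g := f) (f := c.1) p hf' hc
  change (mfderiv (𝓡 n) 𝓘(ℝ, ℝ) (f ∘ c.1) p (coordField c a p) : ℝ) = _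
  rw [h]
  change (mfderiv (𝓡 n) 𝓘(ℝ, ℝ) f (c.1 p)) (mfderiv (𝓡 n) (𝓡 n) c.1 p (coordField c a p)) = _
  rw [mfderiv_coordField c a hp, mfderiv_eq_fderiv]
  rfl

variable [IsManifold (𝓡 n) ∞ M]

theorem mdifferentiableAt_coordField (c : SmoothChart n M) (j : Fin n) {p : M}
    (hp : p ∈ c.1.source) :
    MDifferentiableAt (𝓡 n) ((𝓡 n).prod 𝓘(ℝ, Coord n))
      (fun q => (⟨q, coordField c j q⟩ : TangentBundle (𝓡 n) M)) p :=
  ((contMDiffOn_coordField c j).contMDiffAt (c.1.open_source.mem_nhds hp)).mdifferentiableAt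
    (by simp)

theorem christoffel_symm_apply (cov : AffineConnection n M) (c : SmoothChart n M) (k i j : Fin n)
    {p : M} (hp : p ∈ c.1.source) : christoffel cov c k i j (c.1 p)
      = vecComp c k (cov (coordField c j) p (coordField c i p)) := by
  have h : ∀ q, q = p → vecComp c k (cov (coordField c j) q (coordField c i q))
      = vecComp c k (cov (coordField c j) p (coordField c i p)) := by
    rintro q rfl; rfl
  exact h _ (c.1.left_inv hp)

/-- The smoothness hypothesis on the connection concerns sections on all of `M`, while coordinate
fields are smooth only on the chart domain. They are multiplied by a bump function equal to 1 near
the point in question, which does not affect the covariant derivative there. The Hausdorff property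
makes the bump function smooth on all of `M`. -/
theorem contDiffOn_christoffel [T2Space M] (cov : AffineConnection n M)
    (hcov : CovariantDerivative.ContMDiffCovariantDerivative cov ∞) (c : SmoothChart n M)
    (k i j : Fin n) : ContDiffOn ℝ ∞ (christoffel cov c k i j) c.1.target := by
  intro x hx
  have hp := c.1.map_target hx
  obtain ⟨ψ, hψ, -⟩ := (SmoothBumpFunction.nhds_basis_support (I := 𝓡 n)
    (c.1.open_source.mem_nhds hp)).mem_iff.1 (c.1.open_source.mem_nhds hp)
  have hσ : ∀ j, ContMDiff (𝓡 n) ((𝓡 n).prod 𝓘(ℝ, Coord n)) ∞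
      (fun p => (⟨p, ((ψ : M → ℝ) • coordField c j) p⟩ : TangentBundle (𝓡 n) M)) := fun j =>
    ContMDiffOn.smul_section_of_tsupport ψ.contMDiff.contMDiffOn c.1.open_source hψ
      (contMDiffOn_coordField c j)
  have h1 := hcov.contMDiff.contMDiff (σ := (ψ : M → ℝ) • coordField c j) (by
    exact (hσ j).contMDiffOn)
  have h2 := ContMDiffOn.clm_bundle_apply h1 (hσ i).contMDiffOn
  have h3 := contDiffOn_vecComp c k c.1.open_source subset_rfl (h2.mono (Set.subset_univ _))
  have hmem : c.1.target ∩ c.1.symm ⁻¹' c.1.source ∈ nhds x := by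
    filter_upwards [c.1.open_target.mem_nhds hx] with z hz
    exact ⟨hz, c.1.map_target hz⟩
  refine ((h3.contDiffAt hmem).congr_of_eventuallyEq ?_).contDiffWithinAt
  have hone : ∀ᶠ p in nhds (c.1.symm x), (ψ : M → ℝ) =ᶠ[nhds p] 1 :=
    ψ.eventuallyEq_one.eventuallyEq_nhds
  filter_upwards [(c.1.continuousAt_symm hx).eventually hone, c.1.open_target.mem_nhds hx]
    with z hz hz'
  have hzp := c.1.map_target hz'
  have e1 : ∀ i, ((ψ : M → ℝ) • coordField c i) (c.1.symm z) = coordField c i (c.1.symm z) := by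
    intro i
    have : ψ (c.1.symm z) = 1 := hz.eq_of_nhds
    simp [this]
  have e2 : cov ((ψ : M → ℝ) • coordField c j) (c.1.symm z) = cov (coordField c j) (c.1.symm z) := by
    refine cov.isCovariantDerivativeOnUniv.congr_of_eventuallyEq
      ((hσ j).contMDiffAt.mdifferentiableAt (by simp)) (mdifferentiableAt_coordField c j hzp)
      Filter.univ_mem ?_
    filter_upwards [hz] with q hq
    have : ψ q = 1 := hq
    simp [this]
  change vecComp c k _ = vecComp c k _
  rw [e2, e1]

theorem cov_sum_smul (cov : AffineConnection n M) {ι : Type*} (s : Finset ι) (g : ι → M → ℝ)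
    (σ : ι → (p : M) → TangentSpace (𝓡 n) p) {p : M}
    (hg : ∀ i, MDifferentiableAt (𝓡 n) 𝓘(ℝ, ℝ) (g i) p)
    (hσ : ∀ i, MDifferentiableAt (𝓡 n) ((𝓡 n).prod 𝓘(ℝ, Coord n))
      (fun q => (⟨q, σ i q⟩ : TangentBundle (𝓡 n) M)) p) :
    MDifferentiableAt (𝓡 n) ((𝓡 n).prod 𝓘(ℝ, Coord n))
      (fun q => (⟨q, (∑ i ∈ s, g i • σ i) q⟩ : TangentBundle (𝓡 n) M)) p ∧
    ∀ v, cov (∑ i ∈ s, g i • σ i) p v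
      = ∑ i ∈ s, (g i p • cov (σ i) p v + mvfderiv (𝓡 n) (g i) p v • σ i p) := by
  classical
  induction s using Finset.induction_on with
  | empty =>
    refine ⟨?_, fun v => ?_⟩
    · exact Bundle.mdifferentiableAt_zeroSection ..
    · simp
  | insert a s ha ih =>
    have h1 := (hg a).smul_section (hσ a)
    rw [Finset.sum_insert ha]
    refine ⟨mdifferentiableAt_add_section h1 ih.1, fun v => ?_⟩
    rw [cov.isCovariantDerivativeOnUniv.add h1 ih.1,
      cov.isCovariantDerivativeOnUniv.leibniz (hσ a) (hg a), Finset.sum_insert ha, ← ih.2 v]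
    simp

/-- The field `∂_b` of `c` is written in the coordinate fields of `c'` with Jacobian coefficients
and differentiated along `∂_a`. The Leibniz rule produces the derivative of the Jacobian, and
comparing components in `c'` gives the law. -/
theorem christoffelRel (cov : AffineConnection n M) (c c' : SmoothChart n M) :
    ChristoffelRel c c' (christoffel cov c) (christoffel cov c') := by
  intro x hx a l b
  obtain ⟨p, hp, hp', rfl⟩ : ∃ p, p ∈ c.1.source ∧ p ∈ c'.1.source ∧ c.1 p = x := by
    have := mem_transitionDomain.1 hx
    exact ⟨c.1.symm x, c.1.map_target this.1, this.2, c.1.right_inv this.1⟩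
  have ht : transition c c' (c.1 p) = c'.1 p := by rw [transition, c.1.left_inv hp]
  have hJ : ∀ k, DifferentiableAt ℝ (fun z => jacobian c.1 c'.1 z k b) (c.1 p) := fun k =>
    ((contDiffOn_jacobian c c' k b).contDiffAt
      ((transitionDomain c c').2.mem_nhds hx)).differentiableAt (by simp)
  have hg := fun k => mvfderiv_comp_chart c hp (hJ k) a
  have hs := cov_sum_smul cov Finset.univ (fun k q => jacobian c.1 c'.1 (c.1 q) k b)
    (fun k => coordField c' k) (fun k => (hg k).1)
    (fun k => mdifferentiableAt_coordField c' k hp')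
  have e : cov (coordField c b) p
      = cov (∑ k, (fun q => jacobian c.1 c'.1 (c.1 q) k b) • coordField c' k) p := by
    refine cov.isCovariantDerivativeOnUniv.congr_of_eventuallyEq
      (mdifferentiableAt_coordField c b hp) hs.1 Filter.univ_mem ?_
    filter_upwards [(c.1.open_source.inter c'.1.open_source).mem_nhds ⟨hp, hp'⟩] with q hq
    rw [coordField_eq_sum c c' hq.1 hq.2, Finset.sum_apply]
    rfl
  have h1 : vecComp c' l (cov (coordField c b) p (coordField c a p))
      = ∑ k, jacobian c.1 c'.1 (c.1 p) k b * vecComp c' l (cov (coordField c' k) p (coordField c a p))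
        + pderiv a (fun z => jacobian c.1 c'.1 z l b) (c.1 p) := by
    rw [e, hs.2]
    simp only [vecComp_sum, vecComp_add, vecComp_smul, (hg _).2, vecComp_coordField c' hp',
      mul_ite, mul_one, mul_zero, Finset.sum_add_distrib, Finset.sum_ite_eq, Finset.mem_univ,
      if_true]
  rw [vecComp_eq_sum c c' hp hp'] at h1
  simp only [← christoffel_symm_apply cov c _ _ _ hp] at h1
  have h2 : ∀ k, vecComp c' l (cov (coordField c' k) p (coordField c a p))
      = ∑ i, jacobian c.1 c'.1 (c.1 p) i a * christoffel cov c' l i k (c'.1 p) := by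
    intro k
    rw [coordField_eq_sum c c' hp hp' a, map_sum, vecComp_sum]
    refine Finset.sum_congr rfl fun i _ => ?_
    rw [map_smul, vecComp_smul, christoffel_symm_apply cov c' _ _ _ hp']
  simp only [ht, h1, h2, Finset.mul_sum]
  rw [Finset.sum_comm]
  have : ∀ j i, jacobian c.1 c'.1 (c.1 p) j b *
      (jacobian c.1 c'.1 (c.1 p) i a * christoffel cov c' l i j (c'.1 p))
      = jacobian c.1 c'.1 (c.1 p) i a *
      (christoffel cov c' l i j (c'.1 p) * jacobian c.1 c'.1 (c.1 p) j b) := by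
    intro j i
    ring
  simp only [this]
  exact (add_sub_cancel_left _ _).symm

theorem christoffel_of_projEquiv {cov cov' : AffineConnection n M} (h : ProjEquiv cov cov')
    (c : SmoothChart n M) : ∃ θ : Fin n → Coord n → ℝ, ∀ k i j, ∀ x ∈ c.1.target,
      christoffel cov' c k i j x = projChange (fun k i j => christoffel cov c k i j x)
        (fun i => θ i x) k i j := by
  obtain ⟨θ, hθ⟩ := h
  refine ⟨fun i x => θ (c.1.symm x) (coordField c i (c.1.symm x)), fun k i j x hx => ?_⟩
  have hp := c.1.map_target hx
  simp only [christoffel, projChange]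
  rw [hθ _ _ (mdifferentiableAt_coordField c j hp), vecComp_add, vecComp_add, vecComp_smul,
    vecComp_smul, vecComp_coordField c hp, vecComp_coordField c hp]
  split_ifs <;> ring

/-- The constant vector field on `ℝⁿ`. -/
def constField (v : Coord n) (x : Coord n) : TangentSpace (𝓡 n) x := v

theorem contMDiff_constField (v : Coord n) :
    ContMDiff (𝓡 n) ((𝓡 n).prod 𝓘(ℝ, Coord n)) ∞
      (fun x => (⟨x, constField v x⟩ : TangentBundle (𝓡 n) (Coord n))) :=
  contMDiff_vectorSpace_iff_contDiff.2 contDiff_const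

theorem mlieBracket_constField (v w : Coord n) :
    VectorField.mlieBracket (𝓡 n) (constField v) (constField w) = 0 := by
  rw [← VectorField.mlieBracketWithin_univ]
  refine VectorField.mlieBracketWithin_eq_lieBracketWithin.trans ?_
  funext x
  change fderivWithin ℝ (fun _ => w) Set.univ x v - fderivWithin ℝ (fun _ => v) Set.univ x w = 0
  simp

set_option linter.unusedSectionVars false in
theorem coordField_eventuallyEq_mpullback (c : SmoothChart n M) (j : Fin n) {p : M}
    (hp : p ∈ c.1.source) : coordField c j =ᶠ[nhds p]
      VectorField.mpullback (𝓡 n) (𝓡 n) c.1 (constField (stdVec j)) := by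
  filter_upwards [c.1.open_source.mem_nhds hp] with q hq
  have hinv : (mfderiv (𝓡 n) (𝓡 n) c.1 q).IsInvertible := ⟨c.mdifferentiable.mfderiv hq, rfl⟩
  refine c.mdifferentiable.mfderiv_injective hq ((mfderiv_coordField c j hq).trans ?_)
  exact (hinv.self_apply_inverse _).symm

/-- Coordinate fields are pullbacks of constant fields, the bracket is natural under pullback, and
constant fields commute. -/
theorem mlieBracket_coordField (c : SmoothChart n M) (i j : Fin n) {p : M}
    (hp : p ∈ c.1.source) :
    VectorField.mlieBracket (𝓡 n) (coordField c i) (coordField c j) p = 0 := by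
  have : IsManifold (𝓡 n) (minSmoothness ℝ 2) M := by
    rw [minSmoothness_of_isRCLikeNormedField]; infer_instance
  have : IsManifold (𝓡 n) (minSmoothness ℝ 2) (Coord n) := by
    rw [minSmoothness_of_isRCLikeNormedField]; infer_instance
  rw [(coordField_eventuallyEq_mpullback c i hp).mlieBracket_vectorField_eq
      (coordField_eventuallyEq_mpullback c j hp),
    ← VectorField.mpullback_mlieBracket (n := ∞)
      ((contMDiff_constField (stdVec i)).contMDiffAt.mdifferentiableAt (by simp))
      ((contMDiff_constField (stdVec j)).contMDiffAt.mdifferentiableAt (by simp))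
      ((contMDiffOn_of_mem_maximalAtlas c.2).contMDiffAt (c.1.open_source.mem_nhds hp))
      (by rw [minSmoothness_of_isRCLikeNormedField]; exact two_le_smooth),
    mlieBracket_constField, VectorField.mpullback_zero]
  rfl

theorem christoffel_symm {cov : AffineConnection n M} (h : cov.torsion = 0)
    (c : SmoothChart n M) (k i j : Fin n) {x : Coord n} (hx : x ∈ c.1.target) :
    christoffel cov c k i j x = christoffel cov c k j i x := by
  have hp := c.1.map_target hx
  have := cov.torsion_eq_zero_iff.1 h (mdifferentiableAt_coordField c i hp)
    (mdifferentiableAt_coordField c j hp)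
  rw [mlieBracket_coordField c i j hp, sub_eq_zero] at this
  simp only [christoffel, this]

end Christoffel

end ProjQuant

end

noncomputable section

namespace ProjQuant

/-! ## The quantization formula as a differential operator -/

section Linearity

variable {n : ℕ} {R : Type*} [CommRing R] [Algebra ℝ R] (D : Fin n → Derivation ℝ R R)
  (Γ : Fin n → Fin n → Fin n → R) (w : R)

theorem covA_add {p q : ℕ} (T T' : (Fin p → Fin n) → (Fin q → Fin n) → R) :
    covA D Γ w (fun I J => T I J + T' I J) = fun I J => covA D Γ w T I J + covA D Γ w T' I J := by
  funext I J
  simp only [covA, map_add, mul_add, Finset.sum_add_distrib]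
  ring

theorem covA_smul {p q : ℕ} (r : ℝ) (T : (Fin p → Fin n) → (Fin q → Fin n) → R) :
    covA D Γ w (fun I J => r • T I J) = fun I J => r • covA D Γ w T I J := by
  funext I J
  simp only [covA, Derivation.map_smul, mul_smul_comm, ← Finset.smul_sum, smul_sub, smul_add]

variable (κ : QuantCoeffs R)

theorem quantA_add_right (P : (Fin 3 → Fin n) → R) (φ φ' : R) :
    quantA κ D Γ P (φ + φ') = quantA κ D Γ P φ + quantA κ D Γ P φ' := by
  simp only [quantA, covA_add D Γ κ.lam, ← Finset.sum_add_distrib]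
  refine Finset.sum_congr rfl fun i _ => Finset.sum_congr rfl fun j _ =>
    Finset.sum_congr rfl fun k _ => ?_
  ring

theorem quantA_smul_right (P : (Fin 3 → Fin n) → R) (r : ℝ) (φ : R) :
    quantA κ D Γ P (r • φ) = r • quantA κ D Γ P φ := by
  simp only [quantA, covA_smul D Γ κ.lam, Finset.smul_sum, smul_add, mul_smul_comm]

theorem quantA_add_left (P P' : (Fin 3 → Fin n) → R) (φ : R) :
    quantA κ D Γ (fun I => P I + P' I) φ = quantA κ D Γ P φ + quantA κ D Γ P' φ := by
  simp only [quantA, covA_add D Γ κ.δ, ← Finset.sum_add_distrib]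
  refine Finset.sum_congr rfl fun i _ => Finset.sum_congr rfl fun j _ =>
    Finset.sum_congr rfl fun k _ => ?_
  ring

theorem quantA_smul_left (r : ℝ) (P : (Fin 3 → Fin n) → R) (φ : R) :
    quantA κ D Γ (fun I => r • P I) φ = r • quantA κ D Γ P φ := by
  simp only [quantA, covA_smul D Γ κ.δ, Finset.smul_sum, smul_add, mul_smul_comm, smul_mul_assoc,
    add_mul]

end Linearity

/-! ### Differential operators over an algebra with derivations. -/

section DiffOps

variable {n : ℕ} {R : Type*} [CommRing R] [Algebra ℝ R]

/-- The iterated derivative `D_{I 0} ⋯ D_{I (m - 1)}`. -/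
def iterD (D : Fin n → Derivation ℝ R R) : (m : ℕ) → (Fin m → Fin n) → R → R
  | 0, _, f => f
  | m + 1, I, f => D (I 0) (iterD D m (Fin.tail I) f)

/-- The differential operators of order at most `N` over an algebra with derivations. -/
def diffOps (D : Fin n → Derivation ℝ R R) (N : ℕ) : Submodule R (R → R) :=
  Submodule.span R (Set.range fun x : (m : Fin (N + 1)) × (Fin m → Fin n) => iterD D x.1 x.2)

variable {D : Fin n → Derivation ℝ R R} {N : ℕ}

theorem iterD_mem_diffOps {m : ℕ} (h : m ≤ N) (I : Fin m → Fin n) :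
    iterD D m I ∈ diffOps D N :=
  Submodule.subset_span ⟨⟨⟨m, Nat.lt_succ_of_le h⟩, I⟩, rfl⟩

theorem diffOps_mono {N' : ℕ} (h : N ≤ N') : diffOps D N ≤ diffOps D N' := by
  refine Submodule.span_le.2 ?_
  rintro _ ⟨⟨m, I⟩, rfl⟩
  exact iterD_mem_diffOps ((Nat.le_of_lt_succ m.2).trans h) I

/-- The span is taken over `R`, so coefficients get differentiated too: `D (r F) = r D F + (D r) F`,
where the second term has no higher order than `F`. -/
theorem deriv_mem_diffOps {F : R → R} (hF : F ∈ diffOps D N) (i : Fin n) :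
    (fun f => D i (F f)) ∈ diffOps D (N + 1) := by
  refine Submodule.span_induction (p := fun F _ => (fun f => D i (F f)) ∈ diffOps D (N + 1))
    ?_ ?_ ?_ ?_ hF
  · rintro _ ⟨⟨m, I⟩, rfl⟩
    exact iterD_mem_diffOps (m := m + 1) (Nat.succ_le_succ (Nat.le_of_lt_succ m.2))
      (Fin.cons i I : Fin (m + 1) → Fin n)
  · simp only [Pi.zero_apply, map_zero]
    exact Submodule.zero_mem _
  · intro F G _ _ hF hG
    simp only [Pi.add_apply, map_add]
    exact Submodule.add_mem _ hF hG
  · intro r F hF hDF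
    have : (fun f => D i ((r • F) f)) = r • (fun f => D i (F f)) + (D i r) • F := by
      funext f
      simp [Derivation.leibniz, mul_comm]
    rw [this]
    exact Submodule.add_mem _ (Submodule.smul_mem _ _ hDF)
      (Submodule.smul_mem _ _ (diffOps_mono (Nat.le_succ N) hF))

theorem mul_mem_diffOps (r : R) {F : R → R} (hF : F ∈ diffOps D N) :
    (fun f => r * F f) ∈ diffOps D N := Submodule.smul_mem _ r hF

theorem sum_mem_diffOps {ι : Type*} (s : Finset ι) {F : ι → R → R}
    (hF : ∀ i, F i ∈ diffOps D N) : (fun f => ∑ i ∈ s, F i f) ∈ diffOps D N := by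
  have : (fun f => ∑ i ∈ s, F i f) = ∑ i ∈ s, F i := by
    funext f
    simp
  rw [this]
  exact Submodule.sum_mem _ fun i _ => hF i

variable (Γ : Fin n → Fin n → Fin n → R) (w : R)

/-- The Christoffel and weight terms are algebraic in the tensor, so a covariant derivative agrees
with the partial derivative up to an operator of the previous order. -/
theorem covA_sub_mem_diffOps {p q : ℕ} {T : R → (Fin p → Fin n) → (Fin q → Fin n) → R}
    (hT : ∀ I J, (fun f => T f I J) ∈ diffOps D N) (I : Fin p → Fin n) (J : Fin (q + 1) → Fin n) :
    (fun f => covA D Γ w (T f) I J - D (J 0) (T f I (Fin.tail J))) ∈ diffOps D N := by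
  have h1 : (fun f => ∑ s : Fin p, ∑ m : Fin n,
      Γ (I s) (J 0) m * T f (Function.update I s m) (Fin.tail J)) ∈ diffOps D N :=
    sum_mem_diffOps _ fun s => sum_mem_diffOps _ fun m => mul_mem_diffOps _ (hT _ _)
  have h2 : (fun f => ∑ t : Fin q, ∑ m : Fin n,
      Γ m (J 0) (J t.succ) * T f I (Function.update (Fin.tail J) t m)) ∈ diffOps D N :=
    sum_mem_diffOps _ fun s => sum_mem_diffOps _ fun m => mul_mem_diffOps _ (hT _ _)
  have h3 : (fun f => w * (∑ m : Fin n, Γ m (J 0) m) * T f I (Fin.tail J)) ∈ diffOps D N :=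
    mul_mem_diffOps _ (hT _ _)
  have h := Submodule.sub_mem _ (Submodule.sub_mem _ h1 h2) h3
  convert h using 1
  funext f
  simp only [covA, Pi.sub_apply]
  ring

theorem covA_mem_diffOps {p q : ℕ} {T : R → (Fin p → Fin n) → (Fin q → Fin n) → R}
    (hT : ∀ I J, (fun f => T f I J) ∈ diffOps D N) (I : Fin p → Fin n) (J : Fin (q + 1) → Fin n) :
    (fun f => covA D Γ w (T f) I J) ∈ diffOps D (N + 1) := by
  have := Submodule.add_mem _ (diffOps_mono (Nat.le_succ N) (covA_sub_mem_diffOps Γ w hT I J))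
    (deriv_mem_diffOps (hT I (Fin.tail J)) (J 0))
  convert this using 1
  funext f
  simp

/-- Among the summands only `P^{ijk} ∇_i ∇_j ∇_k` has order three, and replacing its covariant
derivatives by partial ones, one after the other, costs terms of order at most two. This determines
the principal symbol. -/
theorem quantA_sub_mem_diffOps (κ : QuantCoeffs R) (P : (Fin 3 → Fin n) → R) :
    (fun f => quantA κ D Γ P f - ∑ I, P I * iterD D 3 I f) ∈ diffOps D 2 := by
  have t0 : ∀ (I : Fin 0 → Fin n) (J : Fin 0 → Fin n),
      (fun f => (fun (f : R) (_ : Fin 0 → Fin n) (_ : Fin 0 → Fin n) => f) f I J) ∈ diffOps D 0 :=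
    fun I J => iterD_mem_diffOps le_rfl ![]
  have t1 := covA_mem_diffOps Γ κ.lam t0
  have t2 := covA_mem_diffOps Γ κ.lam t1
  have s1 := covA_sub_mem_diffOps Γ κ.lam t0
  have s2 := covA_sub_mem_diffOps Γ κ.lam t1
  have s3 := covA_sub_mem_diffOps Γ κ.lam t2
  have u3 : ∀ i j k, (fun f => covA D Γ κ.lam (covA D Γ κ.lam (covA D Γ κ.lam
      (p := 0) (q := 0) fun _ _ => f)) ![] ![i, j, k] - D i (D j (D k f))) ∈ diffOps D 2 := by
    intro i j k
    have h := Submodule.add_mem _ (s3 ![] ![i, j, k]) (Submodule.add_mem _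
      (deriv_mem_diffOps (s2 ![] ![j, k]) i)
      (deriv_mem_diffOps (deriv_mem_diffOps (s1 ![] ![k]) j) i))
    convert h using 1
    funext f
    have e1 : Fin.tail ![i, j, k] = ![j, k] := rfl
    have e2 : Fin.tail ![j, k] = ![k] := rfl
    simp only [Pi.add_apply, map_sub, e1, e2, Matrix.cons_val_zero]
    ring
  have main : (fun f => ∑ i, ∑ j, ∑ k, (P ![i, j, k] * (covA D Γ κ.lam (covA D Γ κ.lam
      (covA D Γ κ.lam (p := 0) (q := 0) fun _ _ => f)) ![] ![i, j, k] - D i (D j (D k f)))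
      + κ.α * covA D Γ κ.δ (p := 3) (q := 0) (fun I _ => P I) ![i, j, k] ![k] *
        covA D Γ κ.lam (covA D Γ κ.lam (p := 0) (q := 0) fun _ _ => f) ![] ![i, j]
      + (κ.β₁ * covA D Γ κ.δ (covA D Γ κ.δ (p := 3) (q := 0) (fun I _ => P I))
          ![i, j, k] ![i, j] + κ.β₂ * P ![i, j, k] * ricciA D Γ i j) *
          covA D Γ κ.lam (p := 0) (q := 0) (fun _ _ => f) ![] ![k]
      + (κ.η₁ * covA D Γ κ.δ (covA D Γ κ.δ (covA D Γ κ.δ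
          (p := 3) (q := 0) (fun I _ => P I))) ![i, j, k] ![i, j, k]
        + κ.η₂ * ricciA D Γ i j * covA D Γ κ.δ (p := 3) (q := 0) (fun I _ => P I) ![i, j, k] ![k]
        + κ.η₃ * covA D Γ 0 (p := 0) (q := 2)
          (fun _ J => ricciA D Γ (J 0) (J 1)) ![] ![i, j, k] * P ![i, j, k]) * f))
      ∈ diffOps D 2 := by
    refine sum_mem_diffOps _ fun i => sum_mem_diffOps _ fun j => sum_mem_diffOps _ fun k => ?_
    exact Submodule.add_mem _ (Submodule.add_mem _ (Submodule.add_mem _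
      (mul_mem_diffOps _ (u3 i j k)) (mul_mem_diffOps _ (t2 _ _)))
      (mul_mem_diffOps _ (diffOps_mono (by norm_num) (t1 _ _))))
      (mul_mem_diffOps _ (diffOps_mono (by norm_num) (t0 ![] ![])))
  convert main using 1
  funext f
  rw [sum_multiIndex_three]
  simp only [quantA, ← Finset.sum_sub_distrib]
  refine Finset.sum_congr rfl fun i _ => Finset.sum_congr rfl fun j _ =>
    Finset.sum_congr rfl fun k _ => ?_
  have e3 : iterD D 3 ![i, j, k] f = D i (D j (D k f)) := rfl
  rw [e3]
  simp only [Matrix.cons_val_zero, Matrix.cons_val_one]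
  ring

theorem exists_coeff_of_mem_diffOps {F : R → R} (hF : F ∈ diffOps D N) :
    ∃ a : (m : ℕ) → (Fin m → Fin n) → R,
      ∀ f, F f = ∑ m ∈ Finset.range (N + 1), ∑ I, a m I * iterD D m I f := by
  obtain ⟨c, hc⟩ := (Submodule.mem_span_range_iff_exists_fun R).1 hF
  refine ⟨fun m I => if h : m < N + 1 then c ⟨⟨m, h⟩, I⟩ else 0, fun f => ?_⟩
  rw [← hc, Finset.sum_range, Finset.sum_apply, Fintype.sum_sigma]
  refine Finset.sum_congr rfl fun m _ => Finset.sum_congr rfl fun I _ => ?_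
  simp [m.2]

end DiffOps

/-! ### Comparison with iterated Fréchet derivatives. -/

section Local

variable {n : ℕ} {U : TopologicalSpace.Opens (Coord n)}

theorem iterD_apply (f : smoothOn U) (m : ℕ) (I : Fin m → Fin n) {x : Coord n} (hx : x ∈ U) :
    (iterD (partialD U) m I f).1 x = iteratedFDeriv ℝ m f.1 x (fun s => stdVec (I s)) := by
  induction m generalizing x with
  | zero => simp [iterD]
  | succ m ih =>
    rw [iteratedFDeriv_succ_apply_left]
    change (partialD U (I 0) (iterD (partialD U) m (Fin.tail I) f)).1 x = _
    rw [← partialD_apply_of_eqOn (I 0) _ (fun z hz => (ih (Fin.tail I) hz).symm) hx]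
    have hd : DifferentiableAt ℝ (iteratedFDeriv ℝ m f.1) x :=
      (ContDiffOn.contDiffAt f.2 (U.2.mem_nhds hx)).differentiableAt_iteratedFDeriv
        (WithTop.coe_lt_coe.2 (WithTop.coe_lt_top m))
    have h2 := (hd.hasFDerivAt.continuousMultilinear_apply_const
      (fun s => stdVec (Fin.tail I s))).fderiv
    simp only [pderiv]
    rw [h2]
    rfl

end Local

end ProjQuant

end

noncomputable section

namespace ProjQuant

/-! ## The quantization map of a connection -/

theorem transformed_zero {n : ℕ} {M : Type*} [TopologicalSpace M] (w : ℝ)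
    (c c' : OpenPartialHomeomorph M (Coord n))
    (f : (Fin 0 → Fin n) → Coord n → ℝ) (I : Fin 0 → Fin n) (x : Coord n) :
    transformed w c c' f I x = |(jacobian c c' x).det| ^ (-w) * f I x := by
  rw [transformed, Fintype.sum_unique (fun K : Fin 0 → Fin n => _)]
  simp only [Finset.univ_eq_empty, Finset.prod_empty, one_mul]
  rw [Subsingleton.elim (default : Fin 0 → Fin n) I]

section QuantizationMap

variable {n : ℕ} {M : Type*} [TopologicalSpace M] [ChartedSpace (Coord n) M]

/-- The range of a chart as an open set. -/
def chartDomain (c : SmoothChart n M) : TopologicalSpace.Opens (Coord n) :=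
  ⟨c.1.target, c.1.open_target⟩

/-- The component of a symbol as a smooth function on the range of the chart. -/
def compA {k : ℕ} {δ : ℝ} (P : Pol n M k δ) (c : SmoothChart n M) (I : Fin k → Fin n) :
    smoothOn (chartDomain c) := ⟨P.1 c I, P.2.1 c I⟩

theorem compA_add {k : ℕ} {δ : ℝ} (P P' : Pol n M k δ) (c : SmoothChart n M) (I : Fin k → Fin n) :
    compA (P + P') c I = compA P c I + compA P' c I := rfl

theorem compA_smul {k : ℕ} {δ : ℝ} (r : ℝ) (P : Pol n M k δ) (c : SmoothChart n M)
    (I : Fin k → Fin n) : compA (r • P) c I = r • compA P c I := rfl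

theorem Pol.ext_target {k : ℕ} {δ : ℝ} {P P' : Pol n M k δ}
    (h : ∀ c I, ∀ x ∈ c.1.target, P.1 c I x = P'.1 c I x) : P = P' := by
  apply Subtype.ext
  funext c I x
  by_cases hx : x ∈ c.1.target
  · exact h c I x hx
  · rw [P.2.2.1 c I x hx, P'.2.2.1 c I x hx]

theorem Density.ext_target {w : ℝ} {φ φ' : Density n M w}
    (h : ∀ c, ∀ x ∈ c.1.target, densityComp φ c x = densityComp φ' c x) : φ = φ' := by
  refine Pol.ext_target fun c I x hx => ?_
  rw [Subsingleton.elim I ![]]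
  exact h c x hx

variable [IsManifold (𝓡 n) ∞ M]

theorem IsGivenByFormula.unique {lam mu δ : ℝ} {cov cov' : AffineConnection n M}
    {Q Q' : Pol n M 3 δ →ₗ[ℝ] DiffOp n M lam mu 3} (hQ : IsGivenByFormula cov Q)
    (hQ' : IsGivenByFormula cov' Q')
    (h : ∀ (P : Pol n M 3 δ) (φ : Density n M lam) (c : SmoothChart n M), ∀ x ∈ c.1.target,
      quantFormula lam δ (christoffel cov c) (P.1 c) (densityComp φ c) x
        = quantFormula lam δ (christoffel cov' c) (P.1 c) (densityComp φ c) x) : Q = Q' := by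
  refine LinearMap.ext fun P => Subtype.ext (LinearMap.ext fun φ => Density.ext_target ?_)
  intro c x hx
  rw [hQ P φ c x hx, hQ' P φ c x hx, h P φ c x hx]

variable [T2Space M] (cov : AffineConnection n M)
  (hcov : CovariantDerivative.ContMDiffCovariantDerivative cov ∞)

/-- The Christoffel symbols as smooth functions on the range of the chart. -/
def christoffelA (c : SmoothChart n M) (k i j : Fin n) : smoothOn (chartDomain c) :=
  ⟨christoffel cov c k i j, contDiffOn_christoffel cov hcov c k i j⟩

/-- The quantization formula in a chart. -/
def quantComp {lam δ : ℝ} (P : Pol n M 3 δ) (φ : Density n M lam) (c : SmoothChart n M) :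
    smoothOn (chartDomain c) :=
  quantA ((quantCoeffs n lam δ).map (algebraMap ℝ _)) (partialD _) (christoffelA cov hcov c)
    (compA P c) (compA φ c ![])

theorem quantComp_apply {lam δ : ℝ} (P : Pol n M 3 δ) (φ : Density n M lam)
    (c : SmoothChart n M) {x : Coord n} (hx : x ∈ c.1.target) :
    (quantComp cov hcov P φ c).1 x
      = quantFormula lam δ (christoffel cov c) (P.1 c) (densityComp φ c) x :=
  (quantFormula_eq_quantA lam δ (U := chartDomain c) (fun _ _ _ _ _ => rfl) (fun _ _ _ => rfl)
    (fun _ _ => rfl) hx).symm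

section

variable {cov hcov} {lam δ : ℝ}

theorem quantComp_add_right (P : Pol n M 3 δ) (φ φ' : Density n M lam) (c : SmoothChart n M) :
    quantComp cov hcov P (φ + φ') c = quantComp cov hcov P φ c + quantComp cov hcov P φ' c := by
  simp only [quantComp, compA_add, quantA_add_right]

theorem quantComp_smul_right (r : ℝ) (P : Pol n M 3 δ) (φ : Density n M lam)
    (c : SmoothChart n M) : quantComp cov hcov P (r • φ) c = r • quantComp cov hcov P φ c := by
  simp only [quantComp, compA_smul, quantA_smul_right]

theorem quantComp_add_left (P P' : Pol n M 3 δ) (φ : Density n M lam) (c : SmoothChart n M) :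
    quantComp cov hcov (P + P') φ c = quantComp cov hcov P φ c + quantComp cov hcov P' φ c := by
  have h : compA (P + P') c = fun I => compA P c I + compA P' c I := rfl
  simp only [quantComp, h, quantA_add_left]

theorem quantComp_smul_left (r : ℝ) (P : Pol n M 3 δ) (φ : Density n M lam)
    (c : SmoothChart n M) : quantComp cov hcov (r • P) φ c = r • quantComp cov hcov P φ c := by
  have h : compA (r • P) c = fun I => r • compA P c I := rfl
  simp only [quantComp, h, quantA_smul_left]

end

/-- The density obtained by quantizing a symbol and applying the operator to a density. -/
def quantDensity {lam mu δ : ℝ} (hδ : δ = mu - lam) (P : Pol n M 3 δ) (φ : Density n M lam) :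
    Density n M mu :=
  ⟨fun c _ => Set.indicator c.1.target (quantComp cov hcov P φ c).1, by
    refine ⟨fun c I => ?_, fun c I x hx => Set.indicator_of_notMem hx _, fun c I σ => rfl,
      fun c c' p hp I => ?_⟩
    · exact (quantComp cov hcov P φ c).2.congr fun x hx => Set.indicator_of_mem hx _
    · have hx : c.1 p ∈ transitionDomain c c' := mem_transition hp.1 hp.2
      have ht : transition c c' (c.1 p) = c'.1 p := by rw [transition, c.1.left_inv hp.1]
      dsimp only
      rw [transformed_zero, Set.indicator_of_mem (c'.1.map_source hp.2),
        Set.indicator_of_mem (c.1.map_source hp.1),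
        quantComp_apply cov hcov P φ c' (c'.1.map_source hp.2),
        quantComp_apply cov hcov P φ c (c.1.map_source hp.1), ← ht,
        show mu = lam + δ by rw [hδ]; ring]
      refine quantFormula_transition lam δ c c' (contDiffOn_christoffel cov hcov c)
        (contDiffOn_christoffel cov hcov c') (christoffelRel cov c c') (P.2.1 c) ?_
        (φ.2.1 c ![]) ?_ hx
      all_goals
        first
        | intro I z hz
        | intro z hz
        obtain ⟨hz1, hz2⟩ := mem_transitionDomain.1 hz
        have hq := c.1.map_target hz1
      · have := P.2.2.2.2 c c' (c.1.symm z) ⟨hq, hz2⟩ I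
        rwa [c.1.right_inv hz1] at this
      · have := φ.2.2.2.2 c c' (c.1.symm z) ⟨hq, hz2⟩ ![]
        rwa [transformed_zero, c.1.right_inv hz1] at this⟩

theorem densityComp_quantDensity {lam mu δ : ℝ} (hδ : δ = mu - lam) (P : Pol n M 3 δ)
    (φ : Density n M lam) (c : SmoothChart n M) {x : Coord n} (hx : x ∈ c.1.target) :
    densityComp (quantDensity cov hcov hδ P φ) c x = (quantComp cov hcov P φ c).1 x :=
  Set.indicator_of_mem hx _

/-- The quantization of a symbol. -/
def quantOp {lam mu δ : ℝ} (hδ : δ = mu - lam) (P : Pol n M 3 δ) :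
    Density n M lam →ₗ[ℝ] Density n M mu where
  toFun := quantDensity cov hcov hδ P
  map_add' φ φ' := by
    refine Density.ext_target fun c x hx => ?_
    refine Eq.trans ?_ (congrArg₂ (· + ·) (densityComp_quantDensity cov hcov hδ P φ c hx)
      (densityComp_quantDensity cov hcov hδ P φ' c hx)).symm
    rw [densityComp_quantDensity _ _ _ _ _ _ hx]
    exact congrArg (fun f : smoothOn (chartDomain c) => f.1 x) (quantComp_add_right P φ φ' c)
  map_smul' r φ := by
    refine Density.ext_target fun c x hx => ?_
    refine Eq.trans ?_ (congrArg (r * ·) (densityComp_quantDensity cov hcov hδ P φ c hx)).symm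
    rw [densityComp_quantDensity _ _ _ _ _ _ hx]
    exact congrArg (fun f : smoothOn (chartDomain c) => f.1 x) (quantComp_smul_right r P φ c)

/-- The coefficients of degree at most two come from the operator left after removing `P^{ijk} ∂_i
∂_j ∂_k`, and those of degree three are the components of `P` themselves. This makes the symbol
condition immediate. -/
theorem exists_hasLocalForm_quantOp {lam mu δ : ℝ} (hδ : δ = mu - lam) (P : Pol n M 3 δ)
    (c : SmoothChart n M) : ∃ a, HasLocalForm 3 (quantOp cov hcov hδ P : Density n M lam →ₗ[ℝ] _) c a ∧
      ∀ I, ∀ x ∈ c.1.target, a 3 I x = P.1 c I x := by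
  obtain ⟨b, hb⟩ := exists_coeff_of_mem_diffOps (quantA_sub_mem_diffOps (D := partialD (chartDomain c))
    (christoffelA cov hcov c) ((quantCoeffs n lam δ).map (algebraMap ℝ _)) (compA P c))
  let a : (m : ℕ) → (Fin m → Fin n) → smoothOn (chartDomain c) := fun m =>
    if h : m = 3 then h ▸ compA P c else b m
  have a3 : a 3 = compA P c := rfl
  have ab : ∀ m ∈ Finset.range 3, a m = b m := fun m hm => dif_neg (Finset.mem_range.1 hm).ne
  refine ⟨fun m I => (a m I).1, ⟨fun m I => (a m I).2, fun φ x hx => ?_⟩, fun I x _ => rfl⟩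
  have h1 : quantComp cov hcov P φ c = ∑ m ∈ Finset.range (3 + 1), ∑ I, a m I *
      iterD (partialD (chartDomain c)) m I (compA φ c ![]) := by
    rw [Finset.sum_range_succ, Finset.sum_congr rfl fun m hm => by rw [ab m hm], ← hb, a3]
    exact (sub_add_cancel _ _).symm
  refine (densityComp_quantDensity cov hcov hδ P φ c hx).trans ?_
  rw [h1]
  simp only [smoothOn.sum_apply, smoothOn.mul_apply]
  refine Finset.sum_congr rfl fun m _ => Finset.sum_congr rfl fun I _ => ?_
  rw [iterD_apply (U := chartDomain c) _ _ _ hx]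
  rfl

/-- The quantization map of a smooth connection. -/
def quantMap {lam mu δ : ℝ} (hδ : δ = mu - lam) : Pol n M 3 δ →ₗ[ℝ] DiffOp n M lam mu 3 where
  toFun P := ⟨quantOp cov hcov hδ P, fun c =>
    (exists_hasLocalForm_quantOp cov hcov hδ P c).imp fun _ h => h.1⟩
  map_add' P P' := by
    refine Subtype.ext (LinearMap.ext fun φ => Density.ext_target fun c x hx => ?_)
    refine Eq.trans ?_ (congrArg₂ (· + ·) (densityComp_quantDensity cov hcov hδ P φ c hx)
      (densityComp_quantDensity cov hcov hδ P' φ c hx)).symm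
    refine (densityComp_quantDensity cov hcov hδ (P + P') φ c hx).trans ?_
    exact congrArg (fun f : smoothOn (chartDomain c) => f.1 x) (quantComp_add_left P P' φ c)
  map_smul' r P := by
    refine Subtype.ext (LinearMap.ext fun φ => Density.ext_target fun c x hx => ?_)
    refine Eq.trans ?_ (congrArg (r * ·) (densityComp_quantDensity cov hcov hδ P φ c hx)).symm
    refine (densityComp_quantDensity cov hcov hδ (r • P) φ c hx).trans ?_
    exact congrArg (fun f : smoothOn (chartDomain c) => f.1 x) (quantComp_smul_left r P φ c)

theorem isGivenByFormula_quantMap {lam mu δ : ℝ} (hδ : δ = mu - lam) :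
    IsGivenByFormula cov (quantMap (lam := lam) cov hcov hδ) := fun P φ c _ hx =>
  (densityComp_quantDensity cov hcov hδ P φ c hx).trans (quantComp_apply cov hcov P φ c hx)

theorem preservesSymbol_quantMap {lam mu δ : ℝ} (hδ : δ = mu - lam) :
    PreservesSymbol (quantMap (lam := lam) cov hcov hδ) :=
  fun P c => exists_hasLocalForm_quantOp cov hcov hδ P c

end QuantizationMap

/-! ## Projective invariance -/

section Invariance

variable {n : ℕ}

theorem QuantCoeffs.Balanced.quantA_projChange {R : Type*} [CommRing R] [Algebra ℝ R]
    {κ : QuantCoeffs R} (hκ : κ.Balanced n) (D : Fin n → Derivation ℝ R R)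
    (hlam : ∀ i, D i κ.lam = 0) (hδ : ∀ i, D i κ.δ = 0) {Γ : Fin n → Fin n → Fin n → R}
    (hΓ : ∀ k i j, Γ k i j = Γ k j i) (θ : Fin n → R) {P : (Fin 3 → Fin n) → R}
    (hP : ∀ (I : Fin 3 → Fin n) (σ : Equiv.Perm (Fin 3)), P (I ∘ σ) = P I) (f : R) :
    quantA κ D (projChange Γ θ) P f = quantA κ D Γ P f := by
  have hp := symm3_of_perm hP
  rw [quantA_eq_quantE κ hp, quantA_eq_quantE κ hp, quantE_projChange κ hκ hlam hδ hΓ hp]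

/-- The quantization formula depends only on the projective class of the connection. -/
theorem quantFormula_projChange (hn : 1 < n) {lam δ : ℝ} (h₃ : δ ≠ (n + 3) / (n + 1))
    (h₄ : δ ≠ (n + 4) / (n + 1)) (h₅ : δ ≠ (n + 5) / (n + 1))
    {U : TopologicalSpace.Opens (Coord n)} {Γ Γ' : Fin n → Fin n → Fin n → Coord n → ℝ}
    (hΓ : ∀ k i j, ContDiffOn ℝ ∞ (Γ k i j) U) (hΓ' : ∀ k i j, ContDiffOn ℝ ∞ (Γ' k i j) U)
    (hsymm : ∀ k i j, ∀ x ∈ U, Γ k i j x = Γ k j i x) {θ : Fin n → Coord n → ℝ}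
    (hθ : ∀ k i j, ∀ x ∈ U,
      Γ' k i j x = projChange (fun k i j => Γ k i j x) (fun i => θ i x) k i j)
    {P : (Fin 3 → Fin n) → Coord n → ℝ} (hP : ∀ I, ContDiffOn ℝ ∞ (P I) U)
    (hsP : ∀ I, ∀ σ : Equiv.Perm (Fin 3), P (I ∘ σ) = P I) {φ : Coord n → ℝ}
    (hφ : ContDiffOn ℝ ∞ φ U) {x : Coord n} (hx : x ∈ U) :
    quantFormula lam δ Γ' P φ x = quantFormula lam δ Γ P φ x := by
  -- The 1-form is not assumed smooth. It is recovered from the smooth Christoffel symbols by the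
  -- trace `Γ'^m_{im} - Γ^m_{im} = (n + 1) θ_i`.
  have hs : ∀ i, ContDiffOn ℝ ∞ (θ i) U := by
    intro i
    have hc : ContDiffOn ℝ ∞ (fun x => ((n : ℝ) + 1)⁻¹ * ∑ m, (Γ' m i m x - Γ m i m x)) U :=
      contDiffOn_const.mul (ContDiffOn.sum fun m _ => (hΓ' m i m).sub (hΓ m i m))
    refine hc.congr fun z hz => ?_
    have : ∀ m, Γ' m i m z - Γ m i m z = (if m = i then θ m z else 0) + θ i z := by
      intro m
      rw [hθ m i m z hz, projChange]
      simp
      ring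
    simp only [this, Finset.sum_add_distrib, Finset.sum_ite_eq', Finset.mem_univ, if_true,
      Finset.sum_const, Finset.card_univ, Fintype.card_fin, nsmul_eq_mul]
    have hn' : (n : ℝ) + 1 ≠ 0 := by positivity
    field_simp
    ring
  let γ : Fin n → Fin n → Fin n → smoothOn U := fun k i j =>
    smoothOn.extend U (Γ k i j) (hΓ k i j) 0
  let t : Fin n → smoothOn U := fun i => ⟨θ i, hs i⟩
  have e1 := quantFormula_eq_quantA lam δ (U := U) (Γ := Γ) (γ := γ)
    (fun k i j z hz => (smoothOn.extend_mem (hΓ k i j) 0 hz).symm) (P := P)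
    (ρ := fun I => ⟨P I, hP I⟩) (fun _ _ _ => rfl) (φ := φ) (f := ⟨φ, hφ⟩) (fun _ _ => rfl) hx
  have e2 := quantFormula_eq_quantA lam δ (U := U) (Γ := Γ') (γ := projChange γ t)
    (fun k i j z hz => by
      rw [hθ k i j z hz]
      simp only [projChange, smoothOn.add_apply, γ, smoothOn.extend_mem _ _ hz]
      split_ifs <;> rfl) (P := P)
    (ρ := fun I => ⟨P I, hP I⟩) (fun _ _ _ => rfl) (φ := φ) (f := ⟨φ, hφ⟩) (fun _ _ => rfl) hx
  rw [e1, e2]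
  refine congrArg (fun f : smoothOn U => f.1 x) ?_
  refine ((quantCoeffs_balanced hn h₃ h₄ h₅).map (algebraMap ℝ _)).quantA_projChange _
    (fun i => (partialD U i).map_algebraMap _) (fun i => (partialD U i).map_algebraMap _)
    (fun k i j => smoothOn.ext (fun z hz => ?_) fun z hz => ?_) t (fun I σ => ?_) _
  · simp only [γ, smoothOn.extend_mem _ _ hz, hsymm k i j z hz]
  · simp only [γ, smoothOn.extend_notMem _ _ hz]
  · exact Subtype.ext (hsP I σ)

end Invariance

end ProjQuant

end

noncomputable section

namespace ProjQuant

/-- Quantization maps of projectively equivalent torsion-free connections coincide. -/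
theorem IsGivenByFormula.eq_of_projEquiv {n : ℕ} {M : Type*} [TopologicalSpace M]
    [ChartedSpace (Coord n) M] [IsManifold (𝓡 n) ∞ M] [T2Space M] (hn : 1 < n) {lam mu δ : ℝ}
    (h₃ : δ ≠ (n + 3) / (n + 1)) (h₄ : δ ≠ (n + 4) / (n + 1)) (h₅ : δ ≠ (n + 5) / (n + 1))
    {cov cov' : AffineConnection n M}
    (hcov : CovariantDerivative.ContMDiffCovariantDerivative cov ∞)
    (hcov' : CovariantDerivative.ContMDiffCovariantDerivative cov' ∞)
    (ht : cov.torsion = 0) (h : ProjEquiv cov cov')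
    {Q Q' : Pol n M 3 δ →ₗ[ℝ] DiffOp n M lam mu 3}
    (hQ : IsGivenByFormula cov Q) (hQ' : IsGivenByFormula cov' Q') : Q = Q' := by
  refine hQ.unique hQ' fun P φ c x hx => ?_
  obtain ⟨θ, hθ⟩ := christoffel_of_projEquiv h c
  exact (quantFormula_projChange hn h₃ h₄ h₅ (U := chartDomain c)
    (contDiffOn_christoffel cov hcov c) (contDiffOn_christoffel cov' hcov' c)
    (fun k i j x hx => christoffel_symm ht c k i j hx) hθ (P.2.1 c) (P.2.2.2.1 c)
    (φ.2.1 c ![]) hx).symm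

/-! ## Symbols in global coordinates -/

section GlobalCoordinates

variable {n k : ℕ} {M : Type*} [TopologicalSpace M] [ChartedSpace (Coord n) M]
  {c : SmoothChart n M} (hc : c.1.source = Set.univ)

include hc in
theorem Pol.ext_global {δ : ℝ} {P P' : Pol n M k δ}
    (h : ∀ I, ∀ x ∈ c.1.target, P.1 c I x = P'.1 c I x) : P = P' := by
  refine Pol.ext_target fun c' I x hx => ?_
  have hp : c'.1.symm x ∈ c.1.source := hc ▸ Set.mem_univ _
  have hq := c'.1.map_target hx
  have e := P.2.2.2.2 c c' _ ⟨hp, hq⟩ I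
  have e' := P'.2.2.2.2 c c' _ ⟨hp, hq⟩ I
  rw [c'.1.right_inv hx] at e e'
  rw [e, e', transformed, transformed]
  simp only [h _ _ (c.1.map_source hp)]

theorem lieDeriv_apply (X : Fin n → Coord n → ℝ) (hX : ∀ l, ContDiff ℝ ∞ (X l)) {δ : ℝ}
    (P : Pol n M k δ) (I : Fin k → Fin n) {x : Coord n} (hx : x ∈ c.1.target) :
    (lieDeriv c hc X hX P).1 c I x = lieComp δ X (P.1 c) I x :=
  ofCoords_apply _ _ _ _ _ _ _ hx

/-- A smooth vector field in components, restricted to an open set. -/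
def fieldA (U : TopologicalSpace.Opens (Coord n)) {X : Fin n → Coord n → ℝ}
    (hX : ∀ l, ContDiff ℝ ∞ (X l)) (l : Fin n) : smoothOn U := ⟨X l, (hX l).contDiffOn⟩

theorem lieComp_eq_lieA {U : TopologicalSpace.Opens (Coord n)} {X : Fin n → Coord n → ℝ}
    (hX : ∀ l, ContDiff ℝ ∞ (X l)) (δ : ℝ) (f : (Fin k → Fin n) → smoothOn U)
    (I : Fin k → Fin n) {x : Coord n} (hx : x ∈ U) :
    lieComp δ X (fun I => (f I).1) I x
      = (lieA (partialD U) (fieldA U hX) (algebraMap ℝ _ δ) f I).1 x := by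
  have h : ∀ i l, pderiv i (X l) x = (partialD U i (fieldA U hX l)).1 x :=
    fun i l => (partialD_apply i (fieldA U hX l) hx).symm
  have h' : ∀ i I, pderiv i (f I).1 x = (partialD U i (f I)).1 x :=
    fun i I => (partialD_apply i (f I) hx).symm
  simp only [lieComp, lieA, smoothOn.add_apply, smoothOn.sub_apply, smoothOn.sum_apply,
    smoothOn.mul_apply, smoothOn.algebraMap_apply, h, h']
  rfl

theorem compA_lieDeriv (X : Fin n → Coord n → ℝ) (hX : ∀ l, ContDiff ℝ ∞ (X l)) {δ : ℝ}
    (P : Pol n M k δ) (I : Fin k → Fin n) {x : Coord n} (hx : x ∈ c.1.target) :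
    (compA (lieDeriv c hc X hX P) c I).1 x
      = (lieA (partialD (chartDomain c)) (fieldA _ hX) (algebraMap ℝ _ δ) (compA P c) I).1 x :=
  (lieDeriv_apply hc X hX P I hx).trans
    (lieComp_eq_lieA (U := chartDomain c) hX δ (compA P c) I hx)

/-- The second derivatives of the fields of `sl_{n+1}`. -/
theorem pderiv_pderiv_of_mem_slFields {X : Fin n → Coord n → ℝ} (hX : X ∈ slFields n) :
    ∃ r : Fin n → ℝ, ∀ a b l x, pderiv a (pderiv b (X l)) x
      = (if l = a then r b else 0) + (if l = b then r a else 0) := by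
  have hz : ∀ (r : ℝ) a (x : Coord n), pderiv a (fun _ => r) x = 0 := fun r a x => by
    simp [pderiv]
  have hx : ∀ i : Fin n, Differentiable ℝ (fun x : Coord n => x i) :=
    fun i => (EuclideanSpace.proj (𝕜 := ℝ) i).differentiable
  have hadd : ∀ (f g : Coord n → ℝ) a, Differentiable ℝ f → Differentiable ℝ g →
      pderiv a (fun x => f x + g x) = fun x => pderiv a f x + pderiv a g x := by
    intro f g a hf hg
    funext x
    simp only [pderiv]
    rw [fderiv_fun_add (hf x) (hg x)]
    rfl
  have hmul : ∀ (f g : Coord n → ℝ) a, Differentiable ℝ f → Differentiable ℝ g →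
      pderiv a (fun x => f x * g x) = fun x => f x * pderiv a g x + g x * pderiv a f x := by
    intro f g a hf hg
    funext x
    simp only [pderiv]
    rw [fderiv_fun_mul (hf x) (hg x)]
    rfl
  have hd : ∀ {X : Fin n → Coord n → ℝ} (_ : X ∈ slFields n) b l,
      Differentiable ℝ (X l) ∧ Differentiable ℝ (pderiv b (X l)) := by
    intro X hX b l
    have h := contDiff_of_mem_slFields hX l
    refine ⟨h.differentiable (by simp), ?_⟩
    have h2 := contDiffOn_pderiv isOpen_univ h.contDiffOn b
    exact (contDiffOn_univ.1 h2).differentiable (by simp)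
  have hcoord : ∀ b l : Fin n, pderiv b (fun x : Coord n => x l)
      = fun _ => if b = l then 1 else 0 := fun b l => funext fun x => pderiv_coord b l x
  induction hX using Submodule.span_induction with
  | mem X h =>
    rcases h with (⟨j, rfl⟩ | ⟨i, j, rfl⟩) | ⟨i, rfl⟩
    · refine ⟨0, fun a b l x => ?_⟩
      have : pderiv b (fun _ : Coord n => if l = j then (1 : ℝ) else 0) = fun _ => 0 :=
        funext fun y => hz _ b y
      rw [this, hz]
      simp
    · refine ⟨0, fun a b l x => ?_⟩
      by_cases hl : l = j
      · simp only [hl, if_true, hcoord, hz]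
        simp
      · have : pderiv b (fun _ : Coord n => (0 : ℝ)) = fun _ => 0 := funext fun y => hz _ b y
        simp only [hl, if_false, this, hz]
        simp
    -- Only the quadratic generators have nonzero second derivatives: `∂_a ∂_b (x^i x^l) = δ_{ib}
    -- δ_{la} + δ_{ia} δ_{lb}`, so `c` is the `i`-th basis covector.
    · refine ⟨fun b => if b = i then 1 else 0, fun a b l x => ?_⟩
      have hs : ∀ (b l : Fin n) (j : Fin n), pderiv a (fun x : Coord n => x j * if b = l then 1 else 0) x
          = (if a = j then 1 else 0) * if b = l then 1 else 0 := by
        intro b l j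
        rw [hmul _ _ a (hx j) (differentiable_const _), hcoord]
        simp only [hz]
        ring
      rw [hmul _ _ b (hx i) (hx l)]
      simp only [hcoord]
      rw [hadd (fun x => x i * _) (fun x => x l * _) a ((hx i).mul (differentiable_const _))
        ((hx l).mul (differentiable_const _))]
      simp only [hs]
      by_cases h1 : l = a <;> by_cases h2 : l = b <;> by_cases h3 : a = i <;>
        by_cases h4 : b = i <;> simp_all [eq_comm]
  | zero =>
    refine ⟨0, fun a b l x => ?_⟩
    have : pderiv b ((0 : Fin n → Coord n → ℝ) l) = fun _ => 0 := funext fun y => hz 0 b y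
    rw [this, hz]
    simp
  | add X Y hX hY h h' =>
    obtain ⟨r, hr⟩ := h
    obtain ⟨r', hr'⟩ := h'
    refine ⟨r + r', fun a b l x => ?_⟩
    have e1 : pderiv b ((X + Y) l) = fun x => pderiv b (X l) x + pderiv b (Y l) x :=
      hadd _ _ b (hd hX b l).1 (hd hY b l).1
    rw [e1, hadd _ _ a (hd hX b l).2 (hd hY b l).2]
    simp only [hr, hr', Pi.add_apply]
    split_ifs <;> ring
  | smul t X hX h =>
    obtain ⟨r, hr⟩ := h
    refine ⟨t • r, fun a b l x => ?_⟩
    have e1 : pderiv b ((t • X) l) = fun x => t * pderiv b (X l) x := by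
      change pderiv b (fun x => t * X l x) = _
      rw [hmul _ _ b (differentiable_const t) (hd hX b l).1]
      funext x
      rw [hz]
      ring
    rw [e1, hmul _ _ a (differentiable_const t) (hd hX b l).2]
    simp only [hz, hr, Pi.smul_apply, smul_eq_mul]
    split_ifs <;> ring

/-- The constants `r b` are cut off to zero outside `U`, since second derivatives taken with
`partialD` vanish there. -/
theorem isProjField_fieldA {U : TopologicalSpace.Opens (Coord n)} {X : Fin n → Coord n → ℝ}
    (hX : ∀ l, ContDiff ℝ ∞ (X l)) {r : Fin n → ℝ}
    (hr : ∀ a b l x, pderiv a (pderiv b (X l)) x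
      = (if l = a then r b else 0) + (if l = b then r a else 0)) :
    IsProjField (partialD U) (fieldA U hX)
      (fun b => smoothOn.extend U (fun _ => r b) contDiffOn_const 0) := by
  intro a b l
  refine smoothOn.ext (fun x hx => ?_) fun x hx => ?_
  · rw [← partialD_apply_of_eqOn a (partialD U b (fieldA U hX l))
      (fun z hz => (partialD_apply b (fieldA U hX l) hz).symm) hx]
    refine (hr a b l x).trans ?_
    rw [smoothOn.add_apply]
    split_ifs <;> simp [smoothOn.extend_mem _ _ hx]
  · rw [partialD_notMem _ _ hx, smoothOn.add_apply]
    split_ifs <;> simp [smoothOn.extend_notMem _ _ hx]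

theorem partialD_extend_const {U : TopologicalSpace.Opens (Coord n)} (i : Fin n) (r : ℝ) :
    partialD U i (smoothOn.extend U (fun _ => r) contDiffOn_const 0) = 0 := by
  refine smoothOn.ext (fun x hx => ?_) fun x hx => partialD_notMem _ _ hx
  rw [partialD_extend _ _ _ hx]
  simp [pderiv]

/-- The quantization map of a connection of the flat projective class is given by the flat
formula. -/
theorem quantFormula_of_isProjFlatIn [IsManifold (𝓡 n) ∞ M] [T2Space M] (hn : 1 < n)
    {lam δ : ℝ} (h₃ : δ ≠ (n + 3) / (n + 1)) (h₄ : δ ≠ (n + 4) / (n + 1))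
    (h₅ : δ ≠ (n + 5) / (n + 1)) {cov : AffineConnection n M}
    (hcov : CovariantDerivative.ContMDiffCovariantDerivative cov ∞) (hflat : IsProjFlatIn c cov)
    (P : Pol n M 3 δ) (φ : Density n M lam) {x : Coord n} (hx : x ∈ c.1.target) :
    quantFormula lam δ (christoffel cov c) (P.1 c) (densityComp φ c) x
      = quantFormula lam δ 0 (P.1 c) (densityComp φ c) x := by
  obtain ⟨cov₀, h0, h⟩ := hflat
  obtain ⟨θ, hθ⟩ := christoffel_of_projEquiv h c
  -- The reference connection enters only through its Christoffel symbols in `c`, which vanish on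
  -- the chart range, so the zero array serves as the first connection.
  refine quantFormula_projChange hn h₃ h₄ h₅ (U := chartDomain c) (θ := θ)
    (fun _ _ _ => contDiffOn_const) (contDiffOn_christoffel cov hcov c) (fun _ _ _ _ _ => rfl)
    (fun k i j z hz => ?_) (P.2.1 c) (P.2.2.2.1 c) (φ.2.1 c ![]) hx
  rw [hθ k i j z hz]
  simp only [projChange, h0 k i j z hz]
  rfl

/-- The Lie derivative of a symmetric tensor field is symmetric. -/
theorem lieA_perm {U : TopologicalSpace.Opens (Coord n)} {X : Fin n → Coord n → ℝ}
    (hX : ∀ l, ContDiff ℝ ∞ (X l)) (δ : ℝ) {p : (Fin k → Fin n) → smoothOn U}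
    (hp : ∀ I (σ : Equiv.Perm (Fin k)), p (I ∘ σ) = p I) (I : Fin k → Fin n)
    (σ : Equiv.Perm (Fin k)) :
    lieA (partialD U) (fieldA U hX) (algebraMap ℝ _ δ) p (I ∘ σ)
      = lieA (partialD U) (fieldA U hX) (algebraMap ℝ _ δ) p I := by
  refine smoothOn.ext (fun z hz => ?_) fun z hz => ?_
  · rw [← lieComp_eq_lieA hX δ p _ hz, ← lieComp_eq_lieA hX δ p _ hz]
    exact congrFun (lieComp_perm δ X (fun I => (p I).1) σ
      (fun I => congrArg Subtype.val (hp I σ)) I) z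
  · simp only [lieA, smoothOn.add_apply, smoothOn.sub_apply, smoothOn.sum_apply,
      smoothOn.mul_apply, partialD_notMem _ _ hz]
    simp

theorem quantA_zero_equivariant (hn : 1 < n) {lam mu δ : ℝ} (hδ : δ = mu - lam)
    (h₃ : δ ≠ (n + 3) / (n + 1)) (h₄ : δ ≠ (n + 4) / (n + 1)) (h₅ : δ ≠ (n + 5) / (n + 1))
    {U : TopologicalSpace.Opens (Coord n)} {X : Fin n → Coord n → ℝ} (hX : X ∈ slFields n)
    {p : (Fin 3 → Fin n) → smoothOn U}
    (hp : ∀ (I : Fin 3 → Fin n) (σ : Equiv.Perm (Fin 3)), p (I ∘ σ) = p I) (f : smoothOn U) :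
    quantA ((quantCoeffs n lam δ).map (algebraMap ℝ _)) (partialD U) 0
        (lieA (partialD U) (fieldA U (contDiff_of_mem_slFields hX)) (algebraMap ℝ _ δ) p) f
      = lieS (partialD U) (fieldA U (contDiff_of_mem_slFields hX)) (algebraMap ℝ _ mu)
          (quantA ((quantCoeffs n lam δ).map (algebraMap ℝ _)) (partialD U) 0 p f)
        - quantA ((quantCoeffs n lam δ).map (algebraMap ℝ _)) (partialD U) 0 p
          (lieS (partialD U) (fieldA U (contDiff_of_mem_slFields hX)) (algebraMap ℝ _ lam) f) := by
  have hs := contDiff_of_mem_slFields hX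
  obtain ⟨r, hr⟩ := pderiv_pderiv_of_mem_slFields hX
  have hp' : Symm3 fun i j k => p ![i, j, k] := symm3_of_perm hp
  have main := quantE_zero_equivariant ((quantCoeffs n lam δ).map (algebraMap ℝ (smoothOn U)))
    ((quantCoeffs_balanced hn h₃ h₄ h₅).map (algebraMap ℝ _))
    (fun i j g => partialD_comm i j g) (isProjField_fieldA (U := U) hs hr)
    (fun i j => partialD_extend_const i (r j))
    (fun i => (partialD U i).map_algebraMap _) (fun i => (partialD U i).map_algebraMap _)
    (fun i => (partialD U i).map_algebraMap _) (fun i => (partialD U i).map_algebraMap _)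
    (fun i => (partialD U i).map_algebraMap _) hp' f
  have hmu : algebraMap ℝ (smoothOn U) mu = algebraMap ℝ _ δ + algebraMap ℝ _ lam := by
    rw [← map_add, hδ]
    congr 1
    ring
  have e0 : (fun i j k => lieA (partialD U) (fieldA U hs) (algebraMap ℝ _ δ) p ![i, j, k])
      = lieV₃ (partialD U) (fieldA U hs) (algebraMap ℝ _ δ) fun i j k => p ![i, j, k] := by
    funext i j k
    rw [lieA_three]
  rw [quantA_eq_quantE _ hp', quantA_eq_quantE _ hp',
    quantA_eq_quantE _ (symm3_of_perm fun I σ => lieA_perm hs δ hp I σ), e0, hmu]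
  exact main

theorem quantFormula_zero_eq_quantA (lam δ : ℝ) {U : TopologicalSpace.Opens (Coord n)}
    {P : (Fin 3 → Fin n) → Coord n → ℝ} {φ : Coord n → ℝ} {ρ : (Fin 3 → Fin n) → smoothOn U}
    {f : smoothOn U} (hP : ∀ I, Set.EqOn (P I) (ρ I).1 U) (hφ : Set.EqOn φ f.1 U) {x : Coord n}
    (hx : x ∈ U) : quantFormula lam δ 0 P φ x
      = (quantA ((quantCoeffs n lam δ).map (algebraMap ℝ _)) (partialD U) 0 ρ f).1 x := by
  have h0 : ∀ k i j : Fin n, Set.EqOn ((0 : Fin n → Fin n → Fin n → Coord n → ℝ) k i j)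
      ((0 : Fin n → Fin n → Fin n → smoothOn U) k i j).1 U := fun _ _ _ _ _ => rfl
  exact quantFormula_eq_quantA lam δ h0 hP hφ hx

/-- Components in the global chart determine a density, so it suffices to compare the three terms
there, where each is given by the flat algebraic formula. -/
theorem isSlEquivariant_of_flat (hn : 1 < n)
    {lam mu δ : ℝ} (hδ : δ = mu - lam) (h₃ : δ ≠ (n + 3) / (n + 1)) (h₄ : δ ≠ (n + 4) / (n + 1))
    (h₅ : δ ≠ (n + 5) / (n + 1)) {Q : Pol n M 3 δ →ₗ[ℝ] DiffOp n M lam mu 3}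
    (hQ : ∀ (P : Pol n M 3 δ) (φ : Density n M lam), ∀ x ∈ c.1.target,
      densityComp ((Q P).1 φ) c x = quantFormula lam δ 0 (P.1 c) (densityComp φ c) x) :
    IsSlEquivariant c hc Q := by
  intro X hX P φ
  have hs := contDiff_of_mem_slFields hX
  have key : ∀ (P : Pol n M 3 δ) (φ : Density n M lam)
      (ρ : (Fin 3 → Fin n) → smoothOn (chartDomain c)) (f : smoothOn (chartDomain c)),
      (∀ I, Set.EqOn (P.1 c I) (ρ I).1 (chartDomain c)) →
      Set.EqOn (densityComp φ c) f.1 (chartDomain c) → ∀ x ∈ chartDomain c,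
      densityComp ((Q P).1 φ) c x = (quantA ((quantCoeffs n lam δ).map (algebraMap ℝ _))
        (partialD (chartDomain c)) 0 ρ f).1 x := fun P φ ρ f hρ hf x hx =>
    (hQ P φ x hx).trans (quantFormula_zero_eq_quantA lam δ hρ hf hx)
  refine Pol.ext_global hc fun I x hx => ?_
  rw [Subsingleton.elim I ![]]
  have e1 := key (lieDeriv c hc X hs P) φ
    (lieA (partialD _) (fieldA _ hs) (algebraMap ℝ _ δ) (compA P c)) (compA φ c ![])
    (fun I z hz => compA_lieDeriv hc X hs P I hz) (fun _ _ => rfl) x hx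
  have e2 := key P (lieDeriv c hc X hs φ) (compA P c)
    (lieS (partialD _) (fieldA _ hs) (algebraMap ℝ _ lam) (compA φ c ![])) (fun _ _ _ => rfl)
    (fun z hz => (compA_lieDeriv hc X hs φ ![] hz).trans (by rw [lieA_zero])) x hx
  have hq := key P φ (compA P c) (compA φ c ![]) (fun _ _ _ => rfl) (fun _ _ => rfl)
  have hpc : ∀ (I : Fin 3 → Fin n) (σ : Equiv.Perm (Fin 3)), compA P c (I ∘ σ) = compA P c I :=
    fun I σ => Subtype.ext (P.2.2.2.1 c I σ)
  have e3 : densityComp (lieDeriv c hc X hs ((Q P).1 φ)) c x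
      = (lieS (partialD _) (fieldA _ hs) (algebraMap ℝ _ mu)
        (quantA ((quantCoeffs n lam δ).map (algebraMap ℝ _)) (partialD (chartDomain c)) 0
          (compA P c) (compA φ c ![]))).1 x := by
    -- The component of the quantized density and the algebraic expression agree only on the chart
    -- range. That suffices, because the range is open and the Lie derivative at a point depends
    -- only on values near it.
    generalize quantA _ _ _ (compA P c) (compA φ c ![]) = q at hq
    refine (lieDeriv_apply hc X hs _ ![] hx).trans ?_
    have h := lieComp_eq_lieA (U := chartDomain c) hs mu (fun _ : Fin 0 → Fin n => q) ![] hx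
    rw [lieA_zero] at h
    rw [← h]
    have hq' : ∀ z ∈ chartDomain c, ((Q P).1 φ).1 c ![] z = q.1 z := hq
    simp only [lieComp, hq' x hx, fun l => pderiv_congr_of_isOpen (chartDomain c).2 hq' hx l]
    simp
  change densityComp ((Q (lieDeriv c hc X hs P)).1 φ) c x
    = densityComp (lieDeriv c hc X hs ((Q P).1 φ)) c x
      - densityComp ((Q P).1 (lieDeriv c hc X hs φ)) c x
  rw [e1, e2, e3, quantA_zero_equivariant hn hδ h₃ h₄ h₅ hX hpc, smoothOn.sub_apply]

end GlobalCoordinates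

end ProjQuant

end

noncomputable section

namespace ProjQuant

/-! ## The Casimir operator of `sl_{n+1}` on tensor fields -/

section Casimir

variable {n k : ℕ} {R : Type*} [CommRing R] [Algebra ℝ R]

/-- The vector field `u_a ∂_b`. -/
def linField (u : Fin n → R) (a b l : Fin n) : R := if l = b then u a else 0

/-- The vector field `u_j ∑ u_l ∂_l`. -/
def quadField (u : Fin n → R) (j l : Fin n) : R := u j * u l

/-- The vector field `∂_j`. -/
def unitField (R : Type*) [CommRing R] {n : ℕ} (j l : Fin n) : R := if l = j then 1 else 0

/-- The Euler operator `∑ u_a ∂_a`. -/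
def eulerOp (D : Fin n → Derivation ℝ R R) (u : Fin n → R) (f : R) : R := ∑ a, u a * D a f

variable {D : Fin n → Derivation ℝ R R} {u : Fin n → R} {w : R}

theorem lieA_unitField (j : Fin n) (f : (Fin k → Fin n) → R) (I : Fin k → Fin n) :
    lieA D (unitField R j) w f I = D j (f I) := by
  have h : ∀ l m : Fin n, D l (unitField R j m) = 0 := by
    intro l m
    unfold unitField
    split_ifs <;> simp
  simp only [lieA, h]
  simp [unitField]

variable (hu : ∀ a b, D a (u b) = if a = b then 1 else 0)

include hu

theorem lieA_linField (a b : Fin n) (f : (Fin k → Fin n) → R) (I : Fin k → Fin n) :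
    lieA D (linField u a b) w f I = u a * D b (f I)
      - ∑ s, (if I s = b then f (Function.update I s a) else 0)
      + w * (if a = b then f I else 0) := by
  have h : ∀ l m : Fin n, D l (linField u a b m) = if m = b then (if l = a then 1 else 0) else 0 := by
    intro l m
    unfold linField
    split_ifs <;> simp_all
  simp only [lieA, h]
  congr 1
  · congr 1
    · simp [linField]
    · refine Finset.sum_congr rfl fun s _ => ?_
      split_ifs <;> simp
  · simp only [Finset.sum_ite_eq', Finset.mem_univ, if_true, eq_comm (a := b)]
    split_ifs <;> simp

theorem lieA_eulerField (f : (Fin k → Fin n) → R) (I : Fin k → Fin n) :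
    lieA D u w f I = eulerOp D u (f I) + (w * n - k) * f I := by
  simp only [lieA, hu, eulerOp]
  simp
  ring

theorem lieA_quadField (j : Fin n) (f : (Fin k → Fin n) → R) (I : Fin k → Fin n) :
    lieA D (quadField u j) w f I = u j * eulerOp D u (f I)
      - ∑ s, u (I s) * f (Function.update I s j) + (w * (n + 1) - k) * (u j * f I) := by
  have h : ∀ l m : Fin n, D l (quadField u j m) =
      (if l = m then u j else 0) + (if l = j then u m else 0) := by
    intro l m
    simp only [quadField, Derivation.leibniz, hu, smul_eq_mul, mul_ite, mul_one, mul_zero]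
  have h1 : ∑ l, D l (quadField u j l) = (n + 1) * u j := by
    simp only [h, Finset.sum_add_distrib]
    simp
    ring
  have h2 : ∀ s, ∑ l, D l (quadField u j (I s)) * f (Function.update I s l)
      = u j * f I + u (I s) * f (Function.update I s j) := by
    intro s
    simp only [h, add_mul, ite_mul, zero_mul, Finset.sum_add_distrib]
    simp
  simp only [lieA, h1, h2, Finset.sum_add_distrib]
  simp only [quadField, eulerOp, Finset.mul_sum, mul_assoc]
  simp
  ring

/-- The second order part of the square of the Euler operator. -/
theorem eulerOp_eulerOp (f : R) :
    eulerOp D u (eulerOp D u f) = ∑ a, ∑ b, u a * (u b * D a (D b f)) + eulerOp D u f := by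
  have h : ∀ a, D a (eulerOp D u f) = ∑ b, u b * D a (D b f) + D a f := by
    intro a
    simp only [eulerOp, map_sum, Derivation.leibniz, smul_eq_mul, hu, Finset.sum_add_distrib]
    simp
  conv_lhs => rw [eulerOp]
  simp only [h, mul_add, Finset.mul_sum, Finset.sum_add_distrib]
  rfl

/-- The quadratic Casimir element of `gl_n`, acting on tensor fields through the derivative part,
the index permutation part and the weight. On symmetric tensors the purely algebraic part is a
scalar; the cross terms leave a divergence that `casimir` cancels against the quadratic fields. -/
theorem sum_lieA_linField (hw : ∀ i, D i w = 0) {f : (Fin k → Fin n) → R}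
    (hf : ∀ I (σ : Equiv.Perm (Fin k)), f (I ∘ σ) = f I) (I : Fin k → Fin n) :
    ∑ a, ∑ b, lieA D (linField u a b) w (lieA D (linField u b a) w f) I
      = ∑ a, ∑ b, u a * (u b * D b (D a (f I))) + (n + 2 * w) * eulerOp D u (f I)
        - 2 * ∑ s, ∑ j, u (I s) * D j (f (Function.update I s j))
        + (k * (n + k - 1) - 2 * w * k + w ^ 2 * n) * f I := by
  let m (a b : Fin n) (f : (Fin k → Fin n) → R) (I : Fin k → Fin n) : R :=
    ∑ s, (if I s = b then f (Function.update I s a) else 0)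
  have hL : ∀ a b (f : (Fin k → Fin n) → R), lieA D (linField u a b) w f
      = fun I => u a * D b (f I) - m a b f I + w * (if a = b then f I else 0) := fun a b f =>
    funext fun I => lieA_linField hu a b f I
  have e0 : ∀ a b, lieA D (linField u a b) w (lieA D (linField u b a) w f) I
      = u a * (u b * D b (D a (f I))) + u a * D a (f I)
        - u a * D b (m b a f I) - m a b (fun I => u b * D a (f I)) I + m a b (m b a f) I
        + (if a = b then 2 * w * (u a * D a (f I)) - 2 * w * m a a f I + w ^ 2 * f I else 0) := by
    intro a b
    rw [hL, hL]
    beta_reduce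
    have h1 : m a b (fun I => u b * D a (f I) - m b a f I + w * (if b = a then f I else 0)) I
        = m a b (fun I => u b * D a (f I)) I - m a b (m b a f) I
          + w * (if b = a then m a b f I else 0) := by
      simp only [m]
      rw [← Finset.sum_sub_distrib]
      by_cases h : b = a
      · simp only [h, if_true, Finset.mul_sum, ← Finset.sum_add_distrib]
        refine Finset.sum_congr rfl fun s _ => ?_
        split_ifs <;> simp
      · simp only [h, if_false, mul_zero, add_zero]
        refine Finset.sum_congr rfl fun s _ => ?_
        split_ifs <;> simp
    rw [h1]
    by_cases h : a = b
    · subst h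
      simp only [if_true, map_add, map_sub, Derivation.leibniz, smul_eq_mul, hw, hu]
      ring
    · have h' : ¬ b = a := fun e => h e.symm
      simp only [h, h', if_false, map_add, map_sub, Derivation.leibniz, smul_eq_mul, hu, if_true,
        map_zero, mul_zero]
      ring
  have e1 : ∑ a, ∑ b, u a * D b (m b a f I)
      = ∑ s, ∑ j, u (I s) * D j (f (Function.update I s j)) := by
    have : ∀ a b, u a * D b (m b a f I)
        = ∑ s, if I s = a then u a * D b (f (Function.update I s b)) else 0 := by
      intro a b
      simp only [m, map_sum, Finset.mul_sum]
      refine Finset.sum_congr rfl fun s _ => ?_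
      split_ifs <;> simp
    simp only [this]
    rw [Finset.sum_comm' (t' := Finset.univ) (s' := fun _ => Finset.univ) (by simp)]
    rw [Finset.sum_congr rfl fun b _ => Finset.sum_comm, Finset.sum_comm]
    simp
  have e2 : ∑ a, ∑ b, m a b (fun I => u b * D a (f I)) I
      = ∑ s, ∑ j, u (I s) * D j (f (Function.update I s j)) := by
    simp only [m]
    rw [Finset.sum_congr rfl fun a _ => Finset.sum_comm, Finset.sum_comm]
    simp
  -- For a fixed slot `s`, acting twice on `s` gives `n f`, while acting on `s` and on another slot
  -- `t` exchanges two indices of a symmetric tensor and gives `f`. There are `k` choices of `s` and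
  -- `k - 1` of `t`.
  have e3 : ∑ a, ∑ b, m a b (m b a f) I = k * (n + k - 1) * f I := by
    have h3 : ∀ s : Fin k, ∑ a, m (I s) a f (Function.update I s a) = (n + k - 1) * f I := by
      intro s
      simp only [m]
      rw [Finset.sum_comm]
      have ht : ∀ t : Fin k, ∑ a, (if Function.update I s a t = a then
          f (Function.update (Function.update I s a) t (I s)) else 0)
          = if t = s then n * f I else f I := by
        intro t
        by_cases h : t = s
        · subst h
          simp
        · simp only [h, if_false, Function.update_of_ne h]
          rw [Finset.sum_ite_eq]
          simp only [Finset.mem_univ, if_true]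
          rw [← hf I (Equiv.swap t s)]
          congr 1
          funext r
          by_cases h1 : r = t
          · subst h1
            simp
          · by_cases h2 : r = s
            · subst h2
              simp [h1]
            · simp [h1, h2, Equiv.swap_apply_of_ne_of_ne h1 h2]
      simp only [ht]
      rw [Finset.sum_ite]
      simp only [Finset.filter_eq', Finset.mem_univ, if_true,
        Finset.filter_ne', Finset.sum_const, nsmul_eq_mul, Finset.card_erase_of_mem,
        Finset.card_univ, Fintype.card_fin]
      rw [Nat.cast_sub (Nat.one_le_of_lt s.2), Finset.card_singleton]
      push_cast
      ring
    have h4 : ∑ a, ∑ b, m a b (m b a f) I = ∑ s, ∑ a, m (I s) a f (Function.update I s a) := by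
      change ∑ a, ∑ b, ∑ s, (if I s = b then m b a f (Function.update I s a) else 0) = _
      rw [Finset.sum_congr rfl fun a _ => Finset.sum_comm, Finset.sum_comm]
      simp
    rw [h4, Finset.sum_congr rfl fun s _ => h3 s]
    simp
    ring
  have e4 : ∑ a, m a a f I = k * f I := by
    simp only [m]
    rw [Finset.sum_comm]
    simp
  have e5 : ∑ a, ∑ _b : Fin n, u a * D a (f I) = n * eulerOp D u (f I) := by
    simp only [Finset.sum_const, Finset.card_univ, Fintype.card_fin, nsmul_eq_mul, eulerOp,
      Finset.mul_sum]
  simp only [e0, Finset.sum_add_distrib, Finset.sum_sub_distrib, e1, e2, e3, e5]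
  simp only [Finset.sum_ite_eq, Finset.mem_univ, if_true, Finset.sum_add_distrib,
    Finset.sum_sub_distrib, ← Finset.mul_sum, e4, Finset.sum_const, Finset.card_univ,
    Fintype.card_fin, nsmul_eq_mul]
  rw [← eulerOp]
  ring

/-- The Casimir operator acts on symmetric tensor fields by a scalar. -/
theorem casimir (hD : ∀ i j f, D i (D j f) = D j (D i f)) (hw : ∀ i, D i w = 0)
    {f : (Fin k → Fin n) → R}
    (hf : ∀ I (σ : Equiv.Perm (Fin k)), f (I ∘ σ) = f I) (I : Fin k → Fin n) :
    ∑ a, ∑ b, lieA D (linField u a b) w (lieA D (linField u b a) w f) I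
      - 2 * ∑ j, lieA D (quadField u j) w (lieA D (unitField R j) w f) I
      + lieA D u w (lieA D u w f) I - (n + 1) * lieA D u w f I
      = (k * (n + k - 1) - 2 * w * k + w ^ 2 * n + (w * n - k) ^ 2
        - (n + 1) * (w * n - k)) * f I := by
  have h1 : lieA D u w f = fun I => eulerOp D u (f I) + (w * n - k) * f I :=
    funext fun I => lieA_eulerField hu f I
  have h2 : lieA D u w (lieA D u w f) I = eulerOp D u (eulerOp D u (f I))
      + 2 * (w * n - k) * eulerOp D u (f I) + (w * n - k) ^ 2 * f I := by
    rw [lieA_eulerField hu, h1]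
    have hc : ∀ i, D i (w * n - k) = 0 := by
      intro i
      rw [map_sub, Derivation.leibniz, hw]
      simp
    have : eulerOp D u (eulerOp D u (f I) + (w * n - k) * f I)
        = eulerOp D u (eulerOp D u (f I)) + (w * n - k) * eulerOp D u (f I) := by
      simp only [eulerOp, map_add, Derivation.leibniz _ (w * n - k), hc, smul_eq_mul, mul_add,
        Finset.sum_add_distrib, mul_zero, add_zero, Finset.mul_sum]
      congr 1
      exact Finset.sum_congr rfl fun a _ => by ring
    rw [this]
    ring
  have h3 : ∀ j, lieA D (quadField u j) w (lieA D (unitField R j) w f) I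
      = ∑ b, u j * (u b * D b (D j (f I))) - ∑ s, u (I s) * D j (f (Function.update I s j))
        + (w * (n + 1) - k) * (u j * D j (f I)) := by
    intro j
    rw [lieA_quadField hu]
    simp only [lieA_unitField]
    simp only [eulerOp, Finset.mul_sum]
  have h4 : ∑ j, lieA D (quadField u j) w (lieA D (unitField R j) w f) I
      = ∑ a, ∑ b, u a * (u b * D b (D a (f I)))
        - ∑ s, ∑ j, u (I s) * D j (f (Function.update I s j))
        + (w * (n + 1) - k) * eulerOp D u (f I) := by
    simp only [h3, Finset.sum_add_distrib, Finset.sum_sub_distrib, ← Finset.mul_sum]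
    rw [Finset.sum_comm (f := fun j s => u (I s) * D j (f (Function.update I s j)))]
    simp only [eulerOp, Finset.mul_sum]
  have h5 : ∑ a, ∑ b, u a * (u b * D b (D a (f I))) = ∑ a, ∑ b, u a * (u b * D a (D b (f I))) :=
    Finset.sum_congr rfl fun a _ => Finset.sum_congr rfl fun b _ => by rw [hD]
  -- The second order parts occur with the coefficients 1, -2 and 1, the divergence terms with -2
  -- and 2. The coefficients of the Euler operator add up to zero as well, which is why `(n + 1)`
  -- times the Euler field is subtracted.
  rw [sum_lieA_linField hu hw hf, h4, h2, lieA_eulerField hu, eulerOp_eulerOp hu, h5]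
  ring

end Casimir

/-! ## Order of vanishing -/

section Vanishing

variable {n : ℕ} {R : Type*} [CommRing R] [Algebra ℝ R]

/-- All derivatives of order less than `m` vanish under the evaluation `ev`. -/
def VanishesTo (D : Fin n → Derivation ℝ R R) (ev : R →ₐ[ℝ] ℝ) : ℕ → R → Prop
  | 0, _ => True
  | m + 1, f => ev f = 0 ∧ ∀ b, VanishesTo D ev m (D b f)

variable {D : Fin n → Derivation ℝ R R} {ev : R →ₐ[ℝ] ℝ}

theorem VanishesTo.of_succ {m : ℕ} {f : R} (h : VanishesTo D ev (m + 1) f) :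
    VanishesTo D ev m f := by
  induction m generalizing f with
  | zero => trivial
  | succ m ih => exact ⟨h.1, fun b => ih (h.2 b)⟩

theorem VanishesTo.add {m : ℕ} {f g : R} (hf : VanishesTo D ev m f) (hg : VanishesTo D ev m g) :
    VanishesTo D ev m (f + g) := by
  induction m generalizing f g with
  | zero => trivial
  | succ m ih =>
    refine ⟨by rw [map_add, hf.1, hg.1, add_zero], fun b => ?_⟩
    rw [map_add]
    exact ih (hf.2 b) (hg.2 b)

theorem VanishesTo.smul {m : ℕ} {f : R} (r : ℝ) (hf : VanishesTo D ev m f) :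
    VanishesTo D ev m (r • f) := by
  induction m generalizing f with
  | zero => trivial
  | succ m ih =>
    refine ⟨by rw [map_smul, hf.1, smul_zero], fun b => ?_⟩
    rw [Derivation.map_smul]
    exact ih (hf.2 b)

theorem VanishesTo.iterD {m : ℕ} {f : R} (h : VanishesTo D ev (m + 1) f)
    (hD : ∀ i j f, D i (D j f) = D j (D i f)) (I : Fin m → Fin n) :
    ev (iterD D m I f) = 0 := by
  induction m generalizing f with
  | zero => exact h.1
  | succ m ih =>
    -- `VanishesTo` takes off the innermost derivative and `iterD` adds the outermost one;
    -- commutativity mediates.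
    have hc : ∀ (m : ℕ) (I : Fin m → Fin n) b (f : R),
        D b (ProjQuant.iterD D m I f) = ProjQuant.iterD D m I (D b f) := by
      intro m
      induction m with
      | zero => intro I b f; rfl
      | succ m ihm =>
        intro I b f
        simp only [ProjQuant.iterD]
        rw [hD, ihm]
    simp only [ProjQuant.iterD]
    rw [hc]
    exact ih (h.2 (I 0)) (Fin.tail I)

variable {u : Fin n → R} (hu : ∀ a b, D a (u b) = if a = b then 1 else 0)
  (hu0 : ∀ a, ev (u a) = 0)

include hu hu0

theorem VanishesTo.coord_mul {m : ℕ} {f : R} (hf : VanishesTo D ev m f) (a : Fin n) :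
    VanishesTo D ev (m + 1) (u a * f) := by
  induction m generalizing f with
  | zero => exact ⟨by rw [map_mul, hu0, zero_mul], fun _ => trivial⟩
  | succ m ih =>
    refine ⟨by rw [map_mul, hu0, zero_mul], fun b => ?_⟩
    rw [Derivation.leibniz, smul_eq_mul, smul_eq_mul, hu]
    refine (ih (hf.2 b)).add ?_
    split_ifs
    · rwa [mul_one]
    · have := hf.smul 0
      rwa [zero_smul, ← mul_zero f] at this

/-- Euler's identity for the lowest term of the Taylor expansion: modulo higher order, the Euler
operator multiplies a function vanishing to order `m` by `m`. The induction rests on `D_b E = (E +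
1) D_b`. -/
theorem VanishesTo.eulerOp_sub (hD : ∀ i j f, D i (D j f) = D j (D i f)) {m : ℕ} {f : R}
    (hf : VanishesTo D ev m f) : VanishesTo D ev (m + 1) (eulerOp D u f - (m : ℝ) • f) := by
  have h0 : ∀ f, ev (eulerOp D u f) = 0 := by
    intro f
    simp [eulerOp, hu0]
  induction m generalizing f with
  | zero => exact ⟨by simp [h0], fun _ => trivial⟩
  | succ m ih =>
    refine ⟨by rw [map_sub, map_smul, h0, hf.1]; simp, fun b => ?_⟩
    have h : D b (eulerOp D u f - ((m + 1 : ℕ) : ℝ) • f)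
        = eulerOp D u (D b f) - (m : ℝ) • D b f := by
      have : D b (eulerOp D u f) = eulerOp D u (D b f) + D b f := by
        simp only [eulerOp, map_sum, Derivation.leibniz, smul_eq_mul, hu, Finset.sum_add_distrib,
          hD b]
        simp
      rw [map_sub, Derivation.map_smul, this]
      push_cast
      rw [add_smul, one_smul]
      abel
    rw [h]
    exact ih (hf.2 b)

theorem VanishesTo.euler (hD : ∀ i j f, D i (D j f) = D j (D i f)) {m : ℕ} {f : R}
    (hf : VanishesTo D ev m f) : VanishesTo D ev m (eulerOp D u f) := by
  have h := (hf.eulerOp_sub hu hu0 hD).of_succ.add (hf.smul m)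
  rwa [sub_add_cancel] at h

end Vanishing

end ProjQuant

end

noncomputable section

namespace ProjQuant

/-! ## Smooth functions on an open set -/

section SmoothFunctions

variable {n : ℕ} (U : TopologicalSpace.Opens (Coord n))

/-- The subalgebra of functions on `U` which are restrictions of functions smooth on `U`. -/
def smoothFunSubalgebra : Subalgebra ℝ (U → ℝ) where
  carrier := {g | ∃ f : smoothOn U, ∀ x : U, g x = f.1 x}
  mul_mem' := by
    rintro g g' ⟨f, hf⟩ ⟨f', hf'⟩
    exact ⟨f * f', fun x => congrArg₂ (· * ·) (hf x) (hf' x)⟩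
  add_mem' := by
    rintro g g' ⟨f, hf⟩ ⟨f', hf'⟩
    exact ⟨f + f', fun x => congrArg₂ (· + ·) (hf x) (hf' x)⟩
  algebraMap_mem' r := ⟨algebraMap ℝ _ r, fun _ => rfl⟩

/-- The algebra of smooth functions defined on `U` only. -/
def smoothFun : Type := smoothFunSubalgebra U

instance : CommRing (smoothFun U) := inferInstanceAs (CommRing (smoothFunSubalgebra U))

instance : Algebra ℝ (smoothFun U) := inferInstanceAs (Algebra ℝ (smoothFunSubalgebra U))

/-- The restriction of functions to `U`. -/
def smoothRestrict : smoothOn U →ₐ[ℝ] smoothFun U where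
  toFun f := (⟨fun x => f.1 x, f, fun _ => rfl⟩ : smoothFunSubalgebra U)
  map_one' := rfl
  map_mul' _ _ := rfl
  map_zero' := rfl
  map_add' _ _ := rfl
  commutes' _ := rfl

variable {U}

theorem smoothRestrict_apply (f : smoothOn U) (x : U) : (smoothRestrict U f).1 x = f.1 x := rfl

theorem smoothRestrict_eq_iff {f f' : smoothOn U} :
    smoothRestrict U f = smoothRestrict U f' ↔ ∀ x ∈ U, f.1 x = f'.1 x :=
  ⟨fun h x hx => congrFun (congrArg Subtype.val h) ⟨x, hx⟩,
    fun h => Subtype.ext (funext fun x => h x x.2)⟩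

/-- An extension of a smooth function on `U`. -/
def smoothLift (g : smoothFun U) : smoothOn U := g.2.choose

theorem smoothRestrict_lift (g : smoothFun U) : smoothRestrict U (smoothLift g) = g :=
  Subtype.ext (funext fun x => (g.2.choose_spec x).symm)

/-- Derivatives on the open set `U` depend only on the values there, so the partial derivatives
descend to functions on `U` and any extension may be used to compute them. -/
theorem smoothRestrict_partialD {f f' : smoothOn U} (h : smoothRestrict U f = smoothRestrict U f')
    (i : Fin n) : smoothRestrict U (partialD U i f) = smoothRestrict U (partialD U i f') := by
  rw [smoothRestrict_eq_iff] at h ⊢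
  intro x hx
  rw [← partialD_apply_of_eqOn i f' h hx, partialD_apply i f hx]

variable (U) in
/-- The partial derivatives as derivations of the smooth functions on `U`. -/
def smoothD (i : Fin n) : Derivation ℝ (smoothFun U) (smoothFun U) :=
  Derivation.mk'
    { toFun := fun g => smoothRestrict U (partialD U i (smoothLift g))
      map_add' := fun g g' => by
        rw [← map_add, ← map_add]
        exact smoothRestrict_partialD (by simp only [map_add, smoothRestrict_lift]) i
      map_smul' := fun r g => by
        rw [RingHom.id_apply, ← map_smul, ← Derivation.map_smul]
        exact smoothRestrict_partialD (by simp only [map_smul, smoothRestrict_lift]) i }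
    (fun g g' => by
      have h := smoothRestrict_partialD (f := smoothLift (g * g'))
        (f' := smoothLift g * smoothLift g') (by simp only [map_mul, smoothRestrict_lift]) i
      refine h.trans ?_
      rw [Derivation.leibniz]
      simp only [smul_eq_mul, map_add, map_mul, smoothRestrict_lift]
      rfl)

theorem smoothD_restrict (i : Fin n) (f : smoothOn U) :
    smoothD U i (smoothRestrict U f) = smoothRestrict U (partialD U i f) :=
  smoothRestrict_partialD (smoothRestrict_lift _) i

theorem smoothD_comm (i j : Fin n) (g : smoothFun U) :
    smoothD U i (smoothD U j g) = smoothD U j (smoothD U i g) := by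
  rw [← smoothRestrict_lift g]
  simp only [smoothD_restrict, partialD_comm i j]

theorem iterD_smoothRestrict (f : smoothOn U) (m : ℕ) (I : Fin m → Fin n) :
    iterD (smoothD U) m I (smoothRestrict U f) = smoothRestrict U (iterD (partialD U) m I f) := by
  induction m with
  | zero => rfl
  | succ m ih => rw [iterD, ih, smoothD_restrict, iterD]

/-- Evaluation at a point. -/
def smoothEval (x : U) : smoothFun U →ₐ[ℝ] ℝ where
  toFun g := g.1 x
  map_one' := rfl
  map_mul' _ _ := rfl
  map_zero' := rfl
  map_add' _ _ := rfl
  commutes' _ := rfl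

/-- The coordinates centred at `x₀`. -/
def centredCoord (U : TopologicalSpace.Opens (Coord n)) (x₀ : Coord n) (a : Fin n) : smoothOn U :=
  ⟨fun x => x a - x₀ a,
    (((EuclideanSpace.proj (𝕜 := ℝ) a).contDiff).sub contDiff_const).contDiffOn⟩

/-- The coordinates centred at `x₀` as functions on `U`. -/
def centred (U : TopologicalSpace.Opens (Coord n)) (x₀ : Coord n) (a : Fin n) : smoothFun U :=
  smoothRestrict U (centredCoord U x₀ a)

/-- The Casimir computation needs `D_a u_b = δ_{ab}` as an identity in the algebra. In `smoothOn U`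
it fails off `U`, where `partialD` is zero; hence the passage to functions defined on `U` only. -/
theorem smoothD_centred (x₀ : Coord n) (a b : Fin n) :
    smoothD U a (centred U x₀ b) = if a = b then 1 else 0 := by
  have h : smoothD U a (centred U x₀ b)
      = smoothRestrict U (algebraMap ℝ _ (if a = b then 1 else 0)) := by
    rw [centred, smoothD_restrict, smoothRestrict_eq_iff]
    intro x hx
    rw [partialD_apply a _ hx, smoothOn.algebraMap_apply, ← pderiv_coord a b x]
    simp only [pderiv, centredCoord]
    rw [fderiv_sub_const]
  rw [h, AlgHom.commutes]
  split_ifs <;> simp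

theorem smoothEval_centred (x₀ : U) (a : Fin n) : smoothEval x₀ (centred U x₀ a) = 0 :=
  sub_self _

end SmoothFunctions

/-! ## Components of symbols in global coordinates -/

section Components

variable {n k : ℕ} {M : Type*} [TopologicalSpace M] [ChartedSpace (Coord n) M]

/-- The components of a symbol as functions on the range of the chart. -/
def comp {δ : ℝ} (c : SmoothChart n M) (I : Fin k → Fin n) :
    Pol n M k δ →ₗ[ℝ] smoothFun (chartDomain c) where
  toFun P := smoothRestrict _ (compA P c I)
  map_add' _ _ := rfl
  map_smul' _ _ := rfl

theorem comp_apply {δ : ℝ} (c : SmoothChart n M) (I : Fin k → Fin n) (P : Pol n M k δ) :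
    comp c I P = smoothRestrict _ (compA P c I) := rfl

variable {c : SmoothChart n M} (hc : c.1.source = Set.univ)

include hc in
theorem Pol.ext_comp {δ : ℝ} {P P' : Pol n M k δ} (h : ∀ I, comp c I P = comp c I P') : P = P' :=
  Pol.ext_global hc fun I => smoothRestrict_eq_iff.1 (h I)

theorem comp_perm {δ : ℝ} (P : Pol n M k δ) (I : Fin k → Fin n) (σ : Equiv.Perm (Fin k)) :
    comp c (I ∘ σ) P = comp c I P :=
  congrArg (smoothRestrict (chartDomain c))
    (Subtype.ext (P.2.2.2.1 c I σ) : compA P c (I ∘ σ) = compA P c I)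

theorem comp_lieDeriv {X : Fin n → Coord n → ℝ} (hX : ∀ l, ContDiff ℝ ∞ (X l)) {δ : ℝ}
    (P : Pol n M k δ) (I : Fin k → Fin n) :
    comp c I (lieDeriv c hc X hX P) = lieA (smoothD (chartDomain c))
      (fun l => smoothRestrict _ (fieldA _ hX l)) (algebraMap ℝ _ δ) (fun I => comp c I P) I := by
  refine (smoothRestrict_eq_iff.2 fun x hx => compA_lieDeriv hc X hX P I hx).trans ?_
  simp only [lieA, map_add, map_sub, map_sum, map_mul, AlgHom.commutes, comp_apply,
    smoothD_restrict]

/-- The Lie derivative along a field of `sl_{n+1}`. -/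
def slAct (X : slFields n) {δ : ℝ} (P : Pol n M k δ) : Pol n M k δ :=
  lieDeriv c hc X.1 (contDiff_of_mem_slFields X.2) P

theorem const_mem_slFields (r : Fin n → ℝ) : (fun l _ => r l) ∈ slFields n := by
  have h : (fun l _ => r l : Fin n → Coord n → ℝ)
      = ∑ j, r j • (fun l _ => if l = j then 1 else 0 : Fin n → Coord n → ℝ) := by
    funext l x
    simp [Finset.sum_apply]
  rw [h]
  exact Submodule.sum_mem _ fun j _ => Submodule.smul_mem _ _
    (Submodule.subset_span (Or.inl (Or.inl ⟨j, rfl⟩)))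

theorem linear_mem_slFields (i j : Fin n) :
    (fun l x => if l = j then x i else 0) ∈ slFields n :=
  Submodule.subset_span (Or.inl (Or.inr ⟨i, j, rfl⟩))

theorem quadratic_mem_slFields (i : Fin n) : (fun l x => x i * x l) ∈ slFields n :=
  Submodule.subset_span (Or.inr ⟨i, rfl⟩)

/-- The field `∂_j`. -/
def slUnit (j : Fin n) : slFields n := ⟨_, const_mem_slFields fun l => if l = j then 1 else 0⟩

/-- The field `(x^a - x₀^a) ∂_b`. -/
def slLin (x₀ : Coord n) (a b : Fin n) : slFields n :=
  ⟨fun l x => if l = b then x a - x₀ a else 0, by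
    have h : (fun l x => if l = b then x a - x₀ a else 0 : Fin n → Coord n → ℝ)
        = (fun l x => if l = b then x a else 0) - fun l _ => if l = b then x₀ a else 0 := by
      funext l x
      by_cases h : l = b <;> simp [h]
    rw [h]
    exact Submodule.sub_mem _ (linear_mem_slFields a b) (const_mem_slFields _)⟩

/-- The Euler field centred at `x₀`. -/
def slEuler (x₀ : Coord n) : slFields n :=
  ⟨fun l x => x l - x₀ l, by
    have h : (fun l x => x l - x₀ l : Fin n → Coord n → ℝ)
        = (∑ a, fun l x => if l = a then x a else 0) - fun l _ => x₀ l := by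
      funext l x
      simp [Finset.sum_apply]
    rw [h]
    exact Submodule.sub_mem _ (Submodule.sum_mem _ fun a _ => linear_mem_slFields a a)
      (const_mem_slFields _)⟩

/-- The field `(x^j - x₀^j) E` with the Euler field `E` centred at `x₀`. -/
def slQuad (x₀ : Coord n) (j : Fin n) : slFields n :=
  ⟨fun l x => (x j - x₀ j) * (x l - x₀ l), by
    have h : (fun l x => (x j - x₀ j) * (x l - x₀ l) : Fin n → Coord n → ℝ)
        = (fun l x => x j * x l) - (∑ a, x₀ a • fun l x => if l = a then x j else 0)
          - x₀ j • (slEuler x₀).1 := by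
      funext l x
      simp [slEuler, Finset.sum_apply]
      ring
    rw [h]
    exact Submodule.sub_mem _ (Submodule.sub_mem _ (quadratic_mem_slFields j)
      (Submodule.sum_mem _ fun a _ => Submodule.smul_mem _ _ (linear_mem_slFields j a)))
      (Submodule.smul_mem _ _ (slEuler x₀).2)⟩

variable {δ : ℝ} (P : Pol n M k δ) (I : Fin k → Fin n) (x₀ : Coord n)

theorem comp_slUnit (j : Fin n) : comp c I (slAct hc (slUnit j) P)
    = lieA (smoothD (chartDomain c)) (unitField _ j) (algebraMap ℝ _ δ)
      (fun I => comp c I P) I := by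
  refine (comp_lieDeriv hc _ P I).trans ?_
  congr 1
  funext l
  refine Subtype.ext (funext fun x => ?_)
  unfold unitField slUnit
  rw [smoothRestrict_apply]
  simp only [fieldA]
  split_ifs <;> rfl

theorem comp_slLin (a b : Fin n) : comp c I (slAct hc (slLin x₀ a b) P)
    = lieA (smoothD (chartDomain c)) (linField (centred _ x₀) a b) (algebraMap ℝ _ δ)
      (fun I => comp c I P) I := by
  refine (comp_lieDeriv hc _ P I).trans ?_
  congr 1
  funext l
  refine Subtype.ext (funext fun x => ?_)
  unfold linField slLin
  rw [smoothRestrict_apply]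
  simp only [fieldA]
  split_ifs <;> rfl

theorem comp_slEuler : comp c I (slAct hc (slEuler x₀) P)
    = lieA (smoothD (chartDomain c)) (centred _ x₀) (algebraMap ℝ _ δ)
      (fun I => comp c I P) I :=
  comp_lieDeriv hc _ P I

theorem comp_slQuad (j : Fin n) : comp c I (slAct hc (slQuad x₀ j) P)
    = lieA (smoothD (chartDomain c)) (quadField (centred _ x₀) j) (algebraMap ℝ _ δ)
      (fun I => comp c I P) I :=
  comp_lieDeriv hc _ P I

/-- The Casimir operator of `sl_{n+1}` acts on symbols by a scalar. -/
theorem casimir_slAct :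
    (∑ a, ∑ b, slAct hc (slLin x₀ a b) (slAct hc (slLin x₀ b a) P))
      - (2 : ℝ) • ∑ j, slAct hc (slQuad x₀ j) (slAct hc (slUnit j) P)
      + slAct hc (slEuler x₀) (slAct hc (slEuler x₀) P)
      - ((n : ℝ) + 1) • slAct hc (slEuler x₀) P
    = ((k : ℝ) * (n + k - 1) - 2 * δ * k + δ ^ 2 * n + (δ * n - k) ^ 2
        - (n + 1) * (δ * n - k)) • P := by
  refine Pol.ext_comp hc fun I => ?_
  have h := casimir (D := smoothD (chartDomain c)) (u := centred _ x₀)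
    (w := algebraMap ℝ _ δ) (smoothD_centred x₀) smoothD_comm
    (fun i => (smoothD _ i).map_algebraMap _) (f := fun I => comp c I P) (comp_perm P) I
  simp only [map_add, map_sub, map_sum, map_smul, comp_slLin, comp_slQuad, comp_slUnit,
    comp_slEuler, Algebra.smul_def, map_mul, map_pow, map_natCast, map_ofNat, map_one]
  exact h

end Components

end ProjQuant

end

noncomputable section

namespace ProjQuant

/-! ## Uniqueness of the equivariant quantization -/

theorem VanishesTo.mono {n : ℕ} {R : Type*} [CommRing R] [Algebra ℝ R]
    {D : Fin n → Derivation ℝ R R} {ev : R →ₐ[ℝ] ℝ} {m m' : ℕ} (h : m ≤ m') {f : R}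
    (hf : VanishesTo D ev m' f) : VanishesTo D ev m f := by
  induction m', h using Nat.le_induction with
  | base => exact hf
  | succ m' _ ih => exact ih hf.of_succ

section DensityAction

variable {n k : ℕ} {R : Type*} [CommRing R] [Algebra ℝ R] {D : Fin n → Derivation ℝ R R}
  {ev : R →ₐ[ℝ] ℝ} {u : Fin n → R} (hu : ∀ a b, D a (u b) = if a = b then 1 else 0)
  (hu0 : ∀ a, ev (u a) = 0) {w : ℝ} (f : (Fin 0 → Fin n) → R) (I : Fin 0 → Fin n)

include hu hu0

theorem eval_lieA_linField (a b : Fin n) :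
    ev (lieA D (linField u a b) (algebraMap ℝ R w) f I) = if a = b then w * ev (f I) else 0 := by
  rw [lieA_linField hu]
  simp only [map_add, map_sub, map_mul, hu0, AlgHom.commutes]
  split_ifs <;> simp

theorem eval_lieA_quadField (j : Fin n) :
    ev (lieA D (quadField u j) (algebraMap ℝ R w) f I) = 0 := by
  rw [lieA_quadField hu]
  simp [hu0]

theorem eval_lieA_eulerField :
    ev (lieA D u (algebraMap ℝ R w) f I) = w * n * ev (f I) := by
  rw [lieA_eulerField hu]
  simp [hu0, eulerOp]

variable (hD : ∀ i j f, D i (D j f) = D j (D i f)) {f I} (hf : VanishesTo D ev k (f I))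

include hD hf

theorem VanishesTo.lieA_eulerField_sub :
    VanishesTo D ev (k + 1) (lieA D u (algebraMap ℝ R w) f I - ((k : ℝ) + w * n) • f I) := by
  have h := hf.eulerOp_sub hu hu0 hD
  have e : lieA D u (algebraMap ℝ R w) f I - ((k : ℝ) + w * n) • f I
      = eulerOp D u (f I) - (k : ℝ) • f I := by
    rw [lieA_eulerField hu]
    simp only [Algebra.smul_def, map_add, map_mul, map_natCast, Nat.cast_zero]
    ring
  rwa [e]

theorem VanishesTo.lieA_quadField (j : Fin n) :
    VanishesTo D ev (k + 1) (lieA D (quadField u j) (algebraMap ℝ R w) f I) := by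
  have h := ((hf.euler hu hu0 hD).coord_mul hu hu0 j).add
    ((hf.coord_mul hu hu0 j).smul (w * (n + 1)))
  have e : lieA D (quadField u j) (algebraMap ℝ R w) f I
      = u j * eulerOp D u (f I) + (w * (n + 1)) • (u j * f I) := by
    rw [ProjQuant.lieA_quadField hu]
    simp [Algebra.smul_def]
  rwa [e]

/-- For densities the sum is `E (E - 1) + (n + 2 w) E + w² n` in terms of the Euler operator `E`.
After subtraction of its value at `E = k` the factor `E - k` splits off, and that factor raises the
order of vanishing. -/
theorem VanishesTo.sum_lieA_linField_sub :
    VanishesTo D ev (k + 1)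
      (∑ a, ∑ b, lieA D (linField u b a) (algebraMap ℝ R w)
          (lieA D (linField u a b) (algebraMap ℝ R w) f) I
        - (k * (k - 1) + (n + 2 * w) * k + w ^ 2 * n : ℝ) • f I) := by
  have h1 := hf.eulerOp_sub hu hu0 hD
  have h := (h1.euler hu hu0 hD).add (h1.smul (k - 1 + n + 2 * w))
  have hx : ∑ a, ∑ b, u a * (u b * D b (D a (f I))) = ∑ a, ∑ b, u a * (u b * D a (D b (f I))) :=
    Finset.sum_congr rfl fun a _ => Finset.sum_congr rfl fun b _ => by rw [hD]
  have hl : eulerOp D u (eulerOp D u (f I) - (k : ℝ) • f I)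
      = eulerOp D u (eulerOp D u (f I)) - (k : ℝ) • eulerOp D u (f I) := by
    simp only [eulerOp, map_sub, Derivation.map_smul, mul_sub, mul_smul_comm,
      Finset.sum_sub_distrib, Finset.smul_sum]
  have e : ∑ a, ∑ b, lieA D (linField u b a) (algebraMap ℝ R w)
          (lieA D (linField u a b) (algebraMap ℝ R w) f) I
        - (k * (k - 1) + (n + 2 * w) * k + w ^ 2 * n : ℝ) • f I
      = eulerOp D u (eulerOp D u (f I) - (k : ℝ) • f I)
        + ((k : ℝ) - 1 + n + 2 * w) • (eulerOp D u (f I) - (k : ℝ) • f I) := by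
    rw [Finset.sum_comm, sum_lieA_linField hu (fun i => (D i).map_algebraMap w)
      (fun J σ => congrArg f (Subsingleton.elim _ _)), hl, eulerOp_eulerOp hu, hx]
    simp only [Algebra.smul_def, map_add, map_sub, map_mul, map_pow, map_natCast, map_ofNat,
      map_one, Finset.univ_eq_empty, Finset.sum_empty, Nat.cast_zero]
    ring
  rwa [e]

end DensityAction

/-! ### Equivariant functionals at a point. -/

section Uniqueness

variable {n : ℕ} {M : Type*} [TopologicalSpace M] [ChartedSpace (Coord n) M]
  {c : SmoothChart n M} {lam mu δ : ℝ}

/-- The component of a density as a function on the range of the chart vanishes at `x₀` to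
order `m`. -/
def Density.VanishesAt (x₀ : chartDomain c) (m : ℕ) (φ : Density n M lam) : Prop :=
  VanishesTo (smoothD (chartDomain c)) (smoothEval x₀) m (comp c ![] φ)

/-- The bilinear form `(P, φ) ↦ (S P φ)(x₀)`. -/
def valueAt (x₀ : chartDomain c) (S : Pol n M 3 δ →ₗ[ℝ] DiffOp n M lam mu 3) :
    Pol n M 3 δ →ₗ[ℝ] Density n M lam →ₗ[ℝ] ℝ :=
  LinearMap.mk₂ ℝ (fun P φ => smoothEval x₀ (comp c ![] ((S P).1 φ)))
    (fun P P' φ => by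
      rw [map_add, Submodule.coe_add, LinearMap.add_apply, map_add, map_add])
    (fun r P φ => by
      rw [map_smul, Submodule.coe_smul, LinearMap.smul_apply, map_smul, map_smul])
    (fun P φ φ' => by rw [map_add, map_add, map_add])
    (fun r P φ => by rw [map_smul, map_smul, map_smul])

variable (hc : c.1.source = Set.univ) {S : Pol n M 3 δ →ₗ[ℝ] DiffOp n M lam mu 3}
  (x₀ : chartDomain c)

/-- A field vanishing at `x₀` acts on the value of a density at `x₀` only through its divergence.
That divergence is `δ_{ab}` for the linear fields, `n` for the Euler field and `0` for the quadratic
ones. -/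
theorem smoothEval_slLin (a b : Fin n) (ψ : Density n M mu) :
    smoothEval x₀ (comp c ![] (slAct hc (slLin x₀ a b) ψ))
      = if a = b then mu * smoothEval x₀ (comp c ![] ψ) else 0 := by
  rw [comp_slLin, eval_lieA_linField (smoothD_centred _) (smoothEval_centred x₀)]

theorem smoothEval_slQuad (j : Fin n) (ψ : Density n M mu) :
    smoothEval x₀ (comp c ![] (slAct hc (slQuad x₀ j) ψ)) = 0 := by
  rw [comp_slQuad, eval_lieA_quadField (smoothD_centred _) (smoothEval_centred x₀)]

theorem smoothEval_slEuler (ψ : Density n M mu) :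
    smoothEval x₀ (comp c ![] (slAct hc (slEuler x₀) ψ))
      = mu * n * smoothEval x₀ (comp c ![] ψ) := by
  rw [comp_slEuler, eval_lieA_eulerField (smoothD_centred _) (smoothEval_centred x₀)]

section Equivariant

variable {hc} (hS : IsSlEquivariant c hc S)

include hS

/-- Equivariance lets a field be moved from the symbol to the density, up to its action on the value
at `x₀`. -/
theorem IsSlEquivariant.valueAt_slAct (X : slFields n) (P : Pol n M 3 δ) (φ : Density n M lam) :
    valueAt x₀ S (slAct hc X P) φ
      = smoothEval x₀ (comp c ![] (slAct hc X ((S P).1 φ))) - valueAt x₀ S P (slAct hc X φ) := by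
  have h : (S (slAct hc X P)).1 φ = slAct hc X ((S P).1 φ) - (S P).1 (slAct hc X φ) :=
    hS X.1 X.2 P φ
  refine (congrArg (fun ψ => smoothEval x₀ (comp c ![] ψ)) h).trans ?_
  rw [map_sub, map_sub]
  rfl

theorem IsSlEquivariant.valueAt_slLin (a b : Fin n) (P : Pol n M 3 δ) (φ : Density n M lam) :
    valueAt x₀ S (slAct hc (slLin x₀ a b) P) φ
      = (if a = b then mu * valueAt x₀ S P φ else 0)
        - valueAt x₀ S P (slAct hc (slLin x₀ a b) φ) := by
  rw [hS.valueAt_slAct, smoothEval_slLin]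
  rfl

theorem IsSlEquivariant.valueAt_slQuad (j : Fin n) (P : Pol n M 3 δ) (φ : Density n M lam) :
    valueAt x₀ S (slAct hc (slQuad x₀ j) P) φ
      = - valueAt x₀ S P (slAct hc (slQuad x₀ j) φ) := by
  rw [hS.valueAt_slAct, smoothEval_slQuad, zero_sub]

theorem IsSlEquivariant.valueAt_slEuler (P : Pol n M 3 δ) (φ : Density n M lam) :
    valueAt x₀ S (slAct hc (slEuler x₀) P) φ
      = mu * n * valueAt x₀ S P φ - valueAt x₀ S P (slAct hc (slEuler x₀) φ) := by
  rw [hS.valueAt_slAct, smoothEval_slEuler]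
  rfl

end Equivariant

/-! ### The action on densities vanishing at a point -/

section Vanishing

variable {x₀ hc} {k : ℕ} {φ : Density n M lam} (hφ : Density.VanishesAt x₀ k φ)

include hφ

theorem Density.VanishesAt.slEuler_sub :
    Density.VanishesAt x₀ (k + 1)
      (slAct hc (slEuler x₀) φ - ((k : ℝ) + lam * n) • φ) := by
  unfold Density.VanishesAt
  rw [map_sub, map_smul, comp_slEuler]
  exact VanishesTo.lieA_eulerField_sub (f := fun I => comp c I φ) (smoothD_centred _)
    (smoothEval_centred x₀) smoothD_comm hφ

theorem Density.VanishesAt.slQuad (j : Fin n) :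
    Density.VanishesAt x₀ (k + 1) (slAct hc (slQuad x₀ j) φ) := by
  unfold Density.VanishesAt
  rw [comp_slQuad]
  exact VanishesTo.lieA_quadField (f := fun I => comp c I φ) (smoothD_centred _)
    (smoothEval_centred x₀) smoothD_comm hφ j

theorem Density.VanishesAt.sum_slLin_sub :
    Density.VanishesAt x₀ (k + 1)
      ((∑ a, ∑ b, slAct hc (slLin x₀ b a) (slAct hc (slLin x₀ a b) φ))
        - (k * (k - 1) + (n + 2 * lam) * k + lam ^ 2 * n : ℝ) • φ) := by
  unfold Density.VanishesAt
  rw [map_sub, map_smul, map_sum]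
  simp only [map_sum, comp_slLin]
  exact VanishesTo.sum_lieA_linField_sub (f := fun I => comp c I φ) (smoothD_centred _)
    (smoothEval_centred x₀) smoothD_comm hφ

end Vanishing


end Uniqueness

end ProjQuant

end

noncomputable section

namespace ProjQuant

/-! ### The Casimir argument and the uniqueness of the equivariant quantization. -/

section Uniqueness

variable {n : ℕ} {M : Type*} [TopologicalSpace M] [ChartedSpace (Coord n) M]
  {c : SmoothChart n M} {lam mu δ : ℝ} {hc : c.1.source = Set.univ}
  {S : Pol n M 3 δ →ₗ[ℝ] DiffOp n M lam mu 3} {x₀ : chartDomain c}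

/-- The operators in the image of an equivariant map that kill the densities vanishing to order
`k + 1` kill those vanishing to order `k`. -/
theorem IsSlEquivariant.valueAt_eq_zero_of_succ (hS : IsSlEquivariant c hc S)
    (hδ : δ = mu - lam) {k : ℕ}
    (hk : 2 * (3 - k : ℝ) * (k + 2 + (1 - δ) * (n + 1)) ≠ 0)
    (h : ∀ P φ, Density.VanishesAt x₀ (k + 1) φ → valueAt x₀ S P φ = 0)
    (P : Pol n M 3 δ) {φ : Density n M lam} (hφ : Density.VanishesAt x₀ k φ) :
    valueAt x₀ S P φ = 0 := by
  set v := valueAt x₀ S P φ with hv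
  -- By hypothesis densities vanishing to order `k + 1` do not contribute. Modulo these, `φ` is an
  -- eigenvector of the Euler field and of the sum over the linear fields, and the quadratic fields
  -- annihilate it.
  have r1 : valueAt x₀ S P (slAct hc (slEuler x₀) φ) = (k + lam * n) * v := by
    have := h P _ (hφ.slEuler_sub (hc := hc))
    rwa [map_sub, map_smul, sub_eq_zero, smul_eq_mul] at this
  have r2 : ∑ a, ∑ b, valueAt x₀ S P (slAct hc (slLin x₀ b a) (slAct hc (slLin x₀ a b) φ))
      = (k * (k - 1) + (n + 2 * lam) * k + lam ^ 2 * n) * v := by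
    have := h P _ (hφ.sum_slLin_sub (hc := hc))
    rw [map_sub, map_smul, sub_eq_zero, smul_eq_mul, map_sum] at this
    simpa only [map_sum] using this
  have r3 : ∀ P' j, valueAt x₀ S P' (slAct hc (slQuad x₀ j) φ) = 0 :=
    fun P' j => h P' _ (hφ.slQuad j)
  -- The diagonal linear fields add up to the Euler field.
  have r4 : ∑ a, valueAt x₀ S P (slAct hc (slLin x₀ a a) φ) = (k + lam * n) * v := by
    rw [← r1, ← map_sum]
    congr 1
    refine Pol.ext_comp hc fun I => ?_
    rw [map_sum]
    simp only [comp_slLin, comp_slEuler, lieA_linField (smoothD_centred _),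
      lieA_eulerField (smoothD_centred _)]
    simp [Finset.sum_add_distrib, eulerOp]
    ring
  -- Moving two fields from the symbol to the density reverses their order. The weight `μ` enters
  -- only for `a = b`, as off-diagonal fields have no divergence.
  have e1 : ∑ a, ∑ b, valueAt x₀ S (slAct hc (slLin x₀ a b) (slAct hc (slLin x₀ b a) P)) φ
      = mu ^ 2 * n * v - 2 * mu * ((k + lam * n) * v)
        + (k * (k - 1) + (n + 2 * lam) * k + lam ^ 2 * n) * v := by
    have hab : ∀ a b, valueAt x₀ S (slAct hc (slLin x₀ a b) (slAct hc (slLin x₀ b a) P)) φ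
        = (if a = b then mu ^ 2 * v - 2 * mu * valueAt x₀ S P (slAct hc (slLin x₀ a a) φ) else 0)
          + valueAt x₀ S P (slAct hc (slLin x₀ b a) (slAct hc (slLin x₀ a b) φ)) := by
      intro a b
      rw [hS.valueAt_slLin, hS.valueAt_slLin, hS.valueAt_slLin]
      by_cases hab : a = b
      · subst hab
        simp only [if_true]
        ring
      · rw [if_neg hab, if_neg hab, if_neg fun e : b = a => hab e.symm]
        ring
    simp only [hab, Finset.sum_add_distrib, r2, Finset.sum_ite_eq, Finset.mem_univ, if_true,
      Finset.sum_sub_distrib, ← Finset.mul_sum, r4, Finset.sum_const, Finset.card_univ,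
      Fintype.card_fin, nsmul_eq_mul]
    ring
  have e2 : ∀ j, valueAt x₀ S (slAct hc (slQuad x₀ j) (slAct hc (slUnit j) P)) φ = 0 := by
    intro j
    rw [hS.valueAt_slQuad, r3, neg_zero]
  have e3 : ∀ P', valueAt x₀ S P' (slAct hc (slEuler x₀) φ) = (k + lam * n) * valueAt x₀ S P' φ := by
    intro P'
    have := h P' _ (hφ.slEuler_sub (hc := hc))
    rwa [map_sub, map_smul, sub_eq_zero, smul_eq_mul] at this
  have e4 : ∀ P', valueAt x₀ S (slAct hc (slEuler x₀) P') φ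
      = (mu * n - (k + lam * n)) * valueAt x₀ S P' φ := by
    intro P'
    rw [hS.valueAt_slEuler, e3]
    ring
  -- The Casimir operator on `P` is evaluated in two ways: as its scalar on symbols of degree three,
  -- and by moving all fields to `φ`, where only the order `k` enters.
  have main := congrArg (fun P => valueAt x₀ S P φ) (casimir_slAct hc P x₀.1)
  simp only [map_add, map_sub, map_smul, map_sum, LinearMap.add_apply, LinearMap.sub_apply,
    LinearMap.smul_apply, LinearMap.sum_apply, e1, e2, e4, smul_eq_mul, ← hv,
    Finset.sum_const_zero] at main
  refine (mul_eq_zero.1 ?_).resolve_left hk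
  push_cast at main
  rw [hδ] at main ⊢
  -- For `δ = μ - λ` the second value is the Casimir scalar in degree `k`. The difference of the two
  -- scalars is the factor assumed nonzero in `hk`, so `v = 0`.
  linear_combination -main

theorem iteratedFDeriv_densityComp (φ : Density n M lam) (m : ℕ) (I : Fin m → Fin n) :
    iteratedFDeriv ℝ m (densityComp φ c) x₀ (fun s => stdVec (I s))
      = smoothEval x₀ (iterD (smoothD (chartDomain c)) m I (comp c ![] φ)) := by
  rw [comp_apply, iterD_smoothRestrict]
  exact (iterD_apply (U := chartDomain c) (compA φ c ![]) m I x₀.2).symm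

/-- The difference of two maps preserving symbols has operators of order at most two as values. -/
theorem PreservesSymbol.valueAt_add_neg_eq_zero {T Q : Pol n M 3 δ →ₗ[ℝ] DiffOp n M lam mu 3}
    (hT : PreservesSymbol T) (hQ : PreservesSymbol Q) (P : Pol n M 3 δ) {φ : Density n M lam}
    (hφ : Density.VanishesAt x₀ 3 φ) : valueAt x₀ (T + (-1 : ℝ) • Q) P φ = 0 := by
  obtain ⟨a, ha, ha3⟩ := hT P c
  obtain ⟨b, hb, hb3⟩ := hQ P c
  have hz : ∀ m ∈ Finset.range 3, ∀ I : Fin m → Fin n,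
      iteratedFDeriv ℝ m (densityComp φ c) x₀ (fun s => stdVec (I s)) = 0 := by
    intro m hm I
    rw [iteratedFDeriv_densityComp]
    exact (VanishesTo.mono (Nat.succ_le_of_lt (Finset.mem_range.1 hm)) hφ).iterD smoothD_comm I
  have h : valueAt x₀ (T + (-1 : ℝ) • Q) P φ
      = densityComp ((T P).1 φ) c x₀ + -1 * densityComp ((Q P).1 φ) c x₀ := rfl
  -- On a density vanishing to order three only third derivatives matter, and their coefficients are
  -- those of `P` in both operators.
  have hs : ∀ a : (m : ℕ) → (Fin m → Fin n) → Coord n → ℝ,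
      ∑ m ∈ Finset.range (3 + 1), ∑ I : Fin m → Fin n,
        a m I x₀ * iteratedFDeriv ℝ m (densityComp φ c) x₀ (fun s => stdVec (I s))
      = ∑ I : Fin 3 → Fin n,
        a 3 I x₀ * iteratedFDeriv ℝ 3 (densityComp φ c) x₀ (fun s => stdVec (I s)) := by
    intro a
    rw [Finset.sum_range_succ, Finset.sum_eq_zero fun m hm => Finset.sum_eq_zero fun I _ => by
      rw [hz m hm I, mul_zero], zero_add]
  rw [h, ha.2 φ x₀ x₀.2, hb.2 φ x₀ x₀.2, hs, hs]
  simp only [ha3 _ _ x₀.2, hb3 _ _ x₀.2]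
  ring

/-- An equivariant map preserving symbols is unique. -/
theorem IsSlEquivariant.unique {T Q : Pol n M 3 δ →ₗ[ℝ] DiffOp n M lam mu 3}
    (hδ : δ = mu - lam)
    (h₃ : δ ≠ (n + 3) / (n + 1)) (h₄ : δ ≠ (n + 4) / (n + 1)) (h₅ : δ ≠ (n + 5) / (n + 1))
    (hT : IsSlEquivariant c hc T) (hQ : IsSlEquivariant c hc Q)
    (hT' : PreservesSymbol T) (hQ' : PreservesSymbol Q) : T = Q := by
  -- Equivariance is linear in the map, so it passes to the difference, which is then shown to
  -- vanish.
  have hS : IsSlEquivariant c hc (T + (-1 : ℝ) • Q) := by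
    intro X hX P φ
    have e1 := hT X hX P φ
    have e2 := hQ X hX P φ
    have hl : lieDeriv c hc X (contDiff_of_mem_slFields hX) ((T P).1 φ + (-1 : ℝ) • (Q P).1 φ)
        = lieDeriv c hc X (contDiff_of_mem_slFields hX) ((T P).1 φ)
          + (-1 : ℝ) • lieDeriv c hc X (contDiff_of_mem_slFields hX) ((Q P).1 φ) := by
      refine Pol.ext_comp hc fun I => ?_
      rw [map_add, map_smul]
      simp only [comp_lieDeriv, lieA, map_add, map_smul, map_neg, mul_add,
        Finset.sum_add_distrib, neg_smul, one_smul, mul_neg, Finset.sum_neg_distrib]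
      ring
    change (T (lieDeriv c hc X (contDiff_of_mem_slFields hX) P)).1 φ
          + (-1 : ℝ) • (Q (lieDeriv c hc X (contDiff_of_mem_slFields hX) P)).1 φ
        = lieDeriv c hc X (contDiff_of_mem_slFields hX) ((T P).1 φ + (-1 : ℝ) • (Q P).1 φ)
          - ((T P).1 (lieDeriv c hc X (contDiff_of_mem_slFields hX) φ)
            + (-1 : ℝ) • (Q P).1 (lieDeriv c hc X (contDiff_of_mem_slFields hX) φ))
    rw [e1, e2, hl]
    module
  have hn : (n : ℝ) + 1 ≠ 0 := by positivity
  -- With `m = k + 3` this is the last factor `k + 2 + (1 - δ)(n + 1)` of the difference of Casimir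
  -- scalars, so `m = 5, 4, 3` belong to `k = 2, 1, 0`.
  have hne : ∀ m : ℝ, δ ≠ (n + m) / (n + 1) → m - 1 + (1 - δ) * (n + 1) ≠ 0 := by
    intro m h h0
    refine h ?_
    rw [eq_div_iff hn]
    linear_combination -h0
  have k3 : ∀ (x₀ : chartDomain c) (P : Pol n M 3 δ) (φ : Density n M lam),
      Density.VanishesAt x₀ (2 + 1) φ → valueAt x₀ (T + (-1 : ℝ) • Q) P φ = 0 :=
    fun x₀ P φ hφ => hT'.valueAt_add_neg_eq_zero hQ' P hφ
  have k2 : ∀ (x₀ : chartDomain c) (P : Pol n M 3 δ) (φ : Density n M lam),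
      Density.VanishesAt x₀ (1 + 1) φ → valueAt x₀ (T + (-1 : ℝ) • Q) P φ = 0 :=
    fun x₀ P φ hφ => hS.valueAt_eq_zero_of_succ (k := 2) hδ
      (mul_ne_zero (by norm_num) (by have := hne 5 h₅; norm_num at this ⊢; exact this))
      (k3 x₀) P hφ
  have k1 : ∀ (x₀ : chartDomain c) (P : Pol n M 3 δ) (φ : Density n M lam),
      Density.VanishesAt x₀ (0 + 1) φ → valueAt x₀ (T + (-1 : ℝ) • Q) P φ = 0 :=
    fun x₀ P φ hφ => hS.valueAt_eq_zero_of_succ (k := 1) hδ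
      (mul_ne_zero (by norm_num) (by have := hne 4 h₄; norm_num at this ⊢; exact this))
      (k2 x₀) P hφ
  -- Vanishing to order zero is no condition, so after the third step the functional kills every
  -- density.
  have k0 : ∀ (x₀ : chartDomain c) (P : Pol n M 3 δ) (φ : Density n M lam),
      valueAt x₀ (T + (-1 : ℝ) • Q) P φ = 0 :=
    fun x₀ P φ => hS.valueAt_eq_zero_of_succ (k := 0) hδ
      (mul_ne_zero (by norm_num) (by have := hne 3 h₃; norm_num at this ⊢; exact this))
      (k1 x₀) P trivial
  refine LinearMap.ext fun P => Subtype.ext (LinearMap.ext fun φ => ?_)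
  refine Pol.ext_global hc fun I x hx => ?_
  rw [Subsingleton.elim I ![]]
  have h : ((T P).1 φ).1 c ![] x + -1 * ((Q P).1 φ).1 c ![] x = 0 := k0 ⟨x, hx⟩ P φ
  linarith

end Uniqueness

end ProjQuant

end

/-! ### The theorem on projectively equivariant quantization. -/

theorem theorem2p1 (n : ℕ) (hn : 1 < n) (lam mu δ : ℝ) (hδ : δ = mu - lam)
    (h₃ : δ ≠ (n + 3) / (n + 1)) (h₄ : δ ≠ (n + 4) / (n + 1)) (h₅ : δ ≠ (n + 5) / (n + 1)) :
    -- existence of the quantization map, and (i)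
    (∀ (M : Type u) [TopologicalSpace M] [T2Space M] [ChartedSpace (Coord n) M]
        [IsManifold (𝓡 n) ∞ M],
      (∀ cov : AffineConnection n M, CovariantDerivative.ContMDiffCovariantDerivative cov ∞ →
        ∃ Q : Pol n M 3 δ →ₗ[ℝ] DiffOp n M lam mu 3,
          IsGivenByFormula cov Q ∧ PreservesSymbol Q) ∧
      (∀ cov cov' : AffineConnection n M,
        CovariantDerivative.ContMDiffCovariantDerivative cov ∞ → CovariantDerivative.ContMDiffCovariantDerivative cov' ∞ →
        cov.torsion = 0 → cov'.torsion = 0 → ProjEquiv cov cov' →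
        ∀ Q Q' : Pol n M 3 δ →ₗ[ℝ] DiffOp n M lam mu 3,
          IsGivenByFormula cov Q → IsGivenByFormula cov' Q' → Q = Q')) ∧
    -- (ii)
    (∀ (c : SmoothChart n (Coord n)) (hc : c.1.source = Set.univ)
        (cov : AffineConnection n (Coord n)),
      CovariantDerivative.ContMDiffCovariantDerivative cov ∞ → cov.torsion = 0 → IsProjFlatIn c cov →
      ∃ Q : Pol n (Coord n) 3 δ →ₗ[ℝ] DiffOp n (Coord n) lam mu 3,
        IsGivenByFormula cov Q ∧
        ∀ T : Pol n (Coord n) 3 δ →ₗ[ℝ] DiffOp n (Coord n) lam mu 3,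
          (PreservesSymbol T ∧ IsSlEquivariant c hc T) ↔ T = Q) := by
  refine ⟨fun M _ _ _ _ => ⟨fun cov hcov => ⟨quantMap cov hcov hδ,
      isGivenByFormula_quantMap cov hcov hδ, preservesSymbol_quantMap cov hcov hδ⟩,
    fun cov cov' hcov hcov' ht _ h Q Q' hQ hQ' =>
      hQ.eq_of_projEquiv hn h₃ h₄ h₅ hcov hcov' ht h hQ'⟩, fun c hc cov hcov _ hflat => ?_⟩
  have hQ := isGivenByFormula_quantMap (lam := lam) cov hcov hδ
  have hs := preservesSymbol_quantMap (lam := lam) cov hcov hδ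
  have he : IsSlEquivariant c hc (quantMap (lam := lam) cov hcov hδ) :=
    isSlEquivariant_of_flat hc hn hδ h₃ h₄ h₅ fun P φ x hx =>
      (hQ P φ c x hx).trans (quantFormula_of_isProjFlatIn hn h₃ h₄ h₅ hcov hflat P φ hx)
  refine ⟨quantMap cov hcov hδ, hQ, fun T => ⟨fun hT => ?_, ?_⟩⟩
  · exact hT.2.unique hδ h₃ h₄ h₅ he hT.1 hs
  · rintro rfl
    exact ⟨hs, he⟩
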